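/- Let $K$ be a field of characteristic $0$ and let $V = U \oplus \Pi W$ be a $p|q$-dimensional superspace over $K$ ($p, q \ge 0$), where $U$ and $W$ are purely even of dimensions $p$ and $q$ and $\Pi$ denotes parity reversion. For $G = GL(V)$, the general linear supergroup, or $G = GL(U)\times GL(W) \subset GL(V)$, its block-diagonal subgroup, let $R(G)$ be the Grothendieck ring of finite-dimensional (algebraic, $\mathbb Z/2$-graded) representations of $G$: the commutative ring generated by the classes $[M]$, with the relations $[M]=[M']+[M'']$ for every short exact sequence $0\to M'\to M\to M''\to 0$ with even equivariant maps, $[M\otimes N]=[M][N]$, and $[K]=1$. We also write $\Pi$ for the class of the one-dimensional odd trivial representation, so that multiplication by $\Pi$ is parity reversion. Let $\Lambda^k M$ be the degree $k$ part of the tensor algebra of $M$ modulo the relations $v\otimes w = -(-1)^{|v||w|}\, w\otimes v$ ($\Lambda^kM = 0$ for $k<0$). Let $\operatorname{Ber} V$ be the even one-dimensional representation on which $g=\begin{pmatrix} a&b\\ c&d\end{pmatrix}\in GL(V)$ acts as multiplication by the Berezinian $\operatorname{Ber} g=\det(a-bd^{-1}c)\,(\det d)^{-1}$. For $k\in\mathbb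 Z$ put $\Sigma^k V=\operatorname{Ber} V\otimes\Lambda^{p-k}V^*$ (zero for $k>p$) and $$\Gamma_k=[\Lambda^kV]-(-\Pi)^q\,[\Sigma^{k+q}V]\in R(GL(V)).$$ Then the sequence $(\Gamma_k)_{k\in\mathbb Z}$ is recurrent of period $q$. Precisely: 1. The restriction homomorphism $R(GL(V))\to R(GL(U)\times GL(W))$ is injective, so that $R(GL(V))$ is a subring of $R(GL(U)\times GL(W))$. 2. With $b_i=(-\Pi)^i[\Lambda^iW]\in R(GL(U)\times GL(W))$, one has $b_0=1$ and $$\sum_{i=0}^{q} b_i\,\Gamma_{k+q-i}=0\quad\text{in } R(GL(U)\times GL(W)),\qquad\text{for all } k\in\mathbb Z.$$ 3. All Hankel determinants of order $q+1$ vanish in the Grothendieck ring of $GL(V)$: $$\det\bigl(\Gamma_{k+i+j}\bigr)_{0\le i,j\le q}=0\quad\text{in } R(GL(V)),\qquad\text{for all } k\in\mathbb Z.$$ For $q=0$ this is the equality of the classes of $\Lambda^kV$ and $\det V\otimes\Lambda^{p-k}V^*$, which generalizes to arbitrary $q$ as above. -/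

import Mathlib

open scoped TensorProduct

universe u

set_option linter.unusedSectionVars false

namespace Super

/-- A finite-dimensional superspace over a field of characteristic zero: a finite-dimensional
vector space with a `ℤ/2`-grading, encoded by its parity involution, which is `v ↦ v` on even
vectors and `v ↦ -v` on odd vectors. -/
structure SuperSpace (K : Type u) [Field K] where
  carrier : Type u
  [acg : AddCommGroup carrier]
  [mod : Module K carrier]
  [fin : Module.Finite K carrier]
  parity : carrier →ₗ[K] carrier
  parity_parity : ∀ v, parity (parity v) = v

attribute [instance] SuperSpace.acg SuperSpace.mod SuperSpace.fin

instance (K : Type u) [Field K] : CoeSort (SuperSpace K) (Type u) := ⟨SuperSpace.carrier⟩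

/-- A supercommutative (associative, unital) `K`-superalgebra, the `ℤ/2`-grading being encoded by
the parity involution: even elements commute with everything, odd elements anticommute. -/
structure SuperCommAlg (K : Type u) [Field K] where
  carrier : Type u
  [ring : Ring carrier]
  [alg : Algebra K carrier]
  parity : carrier →ₐ[K] carrier
  parity_parity : ∀ a, parity (parity a) = a
  even_comm : ∀ a b, parity a = a → a * b = b * a
  odd_anticomm : ∀ a b, parity a = -a → parity b = -b → a * b = -(b * a)

attribute [instance] SuperCommAlg.ring SuperCommAlg.alg

instance (K : Type u) [Field K] : CoeSort (SuperCommAlg K) (Type u) := ⟨SuperCommAlg.carrier⟩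

section Points

variable {K : Type u} [Field K]

/-- The parity involution of `M ⊗ A`, for a vector space `M` with parity involution `σ`. -/
def par {M : Type u} [AddCommGroup M] [Module K M] (σ : Module.End K M) (A : SuperCommAlg K) :
    Module.End K (M ⊗[K] A) :=
  TensorProduct.map σ A.parity.toLinearMap

/-- Right multiplication by `a : A` on the right `A`-module `M ⊗ A`. -/
def rmul (M : Type u) [AddCommGroup M] [Module K M] (A : SuperCommAlg K) (a : A) :
    Module.End K (M ⊗[K] A) :=
  LinearMap.lTensor M (LinearMap.mulRight K a)

/-- The monoid of even endomorphisms of the right `A`-module `M ⊗ A`. -/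
def evenEnd {M : Type u} [AddCommGroup M] [Module K M] (σ : Module.End K M) (A : SuperCommAlg K) :
    Submonoid (Module.End K (M ⊗[K] A)) where
  carrier := {f | (∀ x, f (par σ A x) = par σ A (f x)) ∧
    ∀ a x, f (rmul M A a x) = rmul M A a (f x)}
  one_mem' := ⟨fun _ => rfl, fun _ _ => rfl⟩
  mul_mem' := by
    rintro f g ⟨h1, h2⟩ ⟨h3, h4⟩
    exact ⟨fun x => by simp [h3, h1], fun a x => by simp [h4, h2]⟩

/-- The group `GL(M)(A)` of `A`-points of the general linear supergroup: invertible even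
endomorphisms of the right `A`-module `M ⊗ A`. -/
abbrev SGL (M : SuperSpace K) (A : SuperCommAlg K) : Type u := (evenEnd M.parity A)ˣ

/-- A homomorphism of superalgebras. -/
structure SHom (A B : SuperCommAlg K) where
  toAlgHom : A →ₐ[K] B
  map_parity : ∀ a, toAlgHom (A.parity a) = B.parity (toAlgHom a)

/-- `f'` on `M ⊗ B` is the base change of `f` on `M ⊗ A` along `φ : A → B`. -/
def IsBaseChange {A B : SuperCommAlg K} (φ : SHom A B) {M : Type u} [AddCommGroup M] [Module K M]
    (f : Module.End K (M ⊗[K] A)) (f' : Module.End K (M ⊗[K] B)) : Prop :=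
  ∀ x, f' (LinearMap.lTensor M φ.toAlgHom.toLinearMap x) =
    LinearMap.lTensor M φ.toAlgHom.toLinearMap (f x)

/-- A subgroup functor of the functor of points of `GL(V)`. -/
abbrev SubgroupFunctor (V : SuperSpace K) : Type (u + 1) :=
  ∀ A : SuperCommAlg K, Subgroup (SGL V A)

/-- The whole supergroup `GL(V)`. -/
def fullGL (V : SuperSpace K) : SubgroupFunctor V := fun _ => ⊤

/-- The block-diagonal subgroup `GL(V₀) × GL(V₁) ⊆ GL(V)`: points preserving `V₀ ⊗ A` and
`V₁ ⊗ A`, i.e. commuting with the parity involution of `V`. -/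
def blockDiag (V : SuperSpace K) : SubgroupFunctor V := fun A =>
  { carrier := {g | ∀ x, g.1.1 (LinearMap.rTensor A V.parity x) =
      LinearMap.rTensor A V.parity (g.1.1 x)}
    one_mem' := fun _ => rfl
    mul_mem' := by
      intro g h hg hh x
      have := hg (h.1.1 x)
      rw [← hh x] at this
      exact this
    inv_mem' := by
      intro g hg x
      have h1 : ∀ y, g.1.1 (g⁻¹.1.1 y) = y := fun y => by
        have := congrArg (fun f : evenEnd V.parity A => f.1 y) g.mul_inv
        exact this
      have h2 : ∀ y, g⁻¹.1.1 (g.1.1 y) = y := fun y => by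
        have := congrArg (fun f : evenEnd V.parity A => f.1 y) g.inv_mul
        exact this
      have := congrArg (fun y => g⁻¹.1.1 y) (hg (g⁻¹.1.1 x))
      simp only [h1, h2] at this
      exact this.symm }

/-- A finite-dimensional representation of the supergroup `H ⊆ GL(V)`: a superspace `M` with an
action of the group `H(A)` on `M ⊗ A` by even `A`-linear maps, natural in the supercommutative
algebra `A` (i.e. a morphism of supergroups `H → GL(M)`). -/
structure Rep {V : SuperSpace K} (H : SubgroupFunctor V) where
  space : SuperSpace K
  act : ∀ A : SuperCommAlg K, H A →* evenEnd space.parity A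
  natural : ∀ (A B : SuperCommAlg K) (φ : SHom A B) (g : H A) (g' : H B),
    IsBaseChange φ g.1.1.1 g'.1.1.1 → IsBaseChange φ (act A g).1 (act B g').1

/-! ### Homogeneous components and signs -/

/-- The even component of an element. -/
def SuperCommAlg.ev (A : SuperCommAlg K) : A →ₗ[K] A :=
  (2⁻¹ : K) • (LinearMap.id + A.parity.toLinearMap)

/-- The odd component of an element. -/
def SuperCommAlg.od (A : SuperCommAlg K) : A →ₗ[K] A :=
  (2⁻¹ : K) • (LinearMap.id - A.parity.toLinearMap)

/-- Extension of a `K`-linear map `X → Y ⊗ A` to an `A`-linear map `X ⊗ A → Y ⊗ A`. -/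
def rext {X Y : Type u} [AddCommGroup X] [Module K X] [AddCommGroup Y] [Module K Y]
    (A : SuperCommAlg K) (φ : X →ₗ[K] Y ⊗[K] A) : X ⊗[K] A →ₗ[K] Y ⊗[K] A :=
  LinearMap.lTensor Y (LinearMap.mul' K A) ∘ₗ (TensorProduct.assoc K Y A A).toLinearMap ∘ₗ
    LinearMap.rTensor A φ

/-- The inclusion `X → X ⊗ A`, `x ↦ x ⊗ 1`. -/
def incl (X : Type u) [AddCommGroup X] [Module K X] (A : SuperCommAlg K) : X →ₗ[K] X ⊗[K] A :=
  (TensorProduct.mk K X A).flip 1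

section
variable {X Y Z : Type u} [AddCommGroup X] [Module K X] [AddCommGroup Y] [Module K Y]
  [AddCommGroup Z] [Module K Z] (A : SuperCommAlg K)

@[simp] lemma par_tmul (σ : Module.End K X) (m : X) (a : A) :
    par σ A (m ⊗ₜ a) = σ m ⊗ₜ A.parity a := rfl

@[simp] lemma rmul_tmul (x : X) (a b : A) : rmul X A a (x ⊗ₜ b) = x ⊗ₜ (b * a) := rfl

@[simp] lemma incl_apply (x : X) : incl X A x = x ⊗ₜ (1 : A) := rfl

@[simp] lemma rext_tmul (φ : X →ₗ[K] Y ⊗[K] A) (x : X) (a : A) :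
    rext A φ (x ⊗ₜ a) = rmul Y A a (φ x) := by
  simp only [rext, LinearMap.comp_apply, LinearMap.rTensor_tmul, LinearEquiv.coe_coe]
  induction φ x with
  | zero => simp
  | tmul y b => simp
  | add y z hy hz => simp only [TensorProduct.add_tmul, map_add, hy, hz]

lemma rmul_mul (a b : A) (x : X ⊗[K] A) : rmul X A (a * b) x = rmul X A b (rmul X A a x) := by
  induction x with
  | zero => simp
  | tmul y c => simp [mul_assoc]
  | add y z hy hz => simp only [map_add, hy, hz]

lemma rmul_one (x : X ⊗[K] A) : rmul X A 1 x = x := by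
  induction x with
  | zero => simp
  | tmul y c => simp
  | add y z hy hz => simp only [map_add, hy, hz]

lemma rext_rmul (φ : X →ₗ[K] Y ⊗[K] A) (a : A) (x : X ⊗[K] A) :
    rext A φ (rmul X A a x) = rmul Y A a (rext A φ x) := by
  induction x with
  | zero => simp
  | tmul y b => simp [rmul_mul]
  | add y z hy hz => simp only [map_add, hy, hz]

/-- An `A`-linear map is determined by its values on `x ⊗ 1`. -/
lemma ext_rlin {f g : X ⊗[K] A →ₗ[K] Y ⊗[K] A}
    (hf : ∀ a x, f (rmul X A a x) = rmul Y A a (f x))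
    (hg : ∀ a x, g (rmul X A a x) = rmul Y A a (g x))
    (h : ∀ x, f (x ⊗ₜ 1) = g (x ⊗ₜ 1)) : f = g := by
  refine TensorProduct.ext' fun x a => ?_
  have e : x ⊗ₜ[K] a = rmul X A a (x ⊗ₜ 1) := by simp
  rw [e, hf, hg, h]

lemma apply_tmul {f : X ⊗[K] A →ₗ[K] Y ⊗[K] A}
    (hf : ∀ a x, f (rmul X A a x) = rmul Y A a (f x)) (x : X) (a : A) :
    f (x ⊗ₜ a) = rmul Y A a (f (x ⊗ₜ 1)) := by
  rw [← hf]; simp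

lemma par_rmul (σ : Module.End K X) (a : A) (x : X ⊗[K] A) :
    par σ A (rmul X A a x) = rmul X A (A.parity a) (par σ A x) := by
  induction x with
  | zero => simp
  | tmul y b => simp
  | add y z hy hz => simp only [map_add, hy, hz]

lemma lTensor_rmul {B : SuperCommAlg K} (φ : SHom A B) (a : A) (x : X ⊗[K] A) :
    LinearMap.lTensor X φ.toAlgHom.toLinearMap (rmul X A a x) =
      rmul X B (φ.toAlgHom a) (LinearMap.lTensor X φ.toAlgHom.toLinearMap x) := by
  induction x with
  | zero => simp
  | tmul y b => simp
  | add y z hy hz => simp only [map_add, hy, hz]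

/-- Base change can be checked on `x ⊗ 1`. -/
lemma isBaseChange_of {B : SuperCommAlg K} (φ : SHom A B) {M : Type u} [AddCommGroup M] [Module K M]
    {f : Module.End K (M ⊗[K] A)} {f' : Module.End K (M ⊗[K] B)}
    (hf : ∀ a x, f (rmul M A a x) = rmul M A a (f x))
    (hf' : ∀ a x, f' (rmul M B a x) = rmul M B a (f' x))
    (h : ∀ x : M, f' (x ⊗ₜ 1) = LinearMap.lTensor M φ.toAlgHom.toLinearMap (f (x ⊗ₜ 1))) :
    IsBaseChange φ f f' := by
  intro x
  induction x with
  | zero => simp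
  | tmul y b =>
    rw [LinearMap.lTensor_tmul, apply_tmul B hf', apply_tmul A hf, h, lTensor_rmul]; rfl
  | add y z hy hz => simp only [map_add, hy, hz]

end

lemma SuperCommAlg.od_of_even (A : SuperCommAlg K) {a : A} (h : A.parity a = a) : A.od a = 0 := by
  simp [SuperCommAlg.od, h]

lemma SuperCommAlg.ev_of_odd (A : SuperCommAlg K) {a : A} (h : A.parity a = -a) : A.ev a = 0 := by
  simp [SuperCommAlg.ev, h]

variable [CharZero K]

lemma SuperCommAlg.induction (A : SuperCommAlg K) {P : A → Prop}
    (he : ∀ a, A.parity a = a → P a) (ho : ∀ a, A.parity a = -a → P a)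
    (hadd : ∀ a b, P a → P b → P (a + b)) (a : A) : P a := by
  have h2 : (2 : K) ≠ 0 := two_ne_zero
  have e : a = A.ev a + A.od a := by
    simp only [SuperCommAlg.ev, SuperCommAlg.od, LinearMap.smul_apply, LinearMap.add_apply,
      LinearMap.sub_apply, LinearMap.id_apply, ← smul_add, add_add_sub_cancel]
    rw [← two_smul K a, smul_smul, inv_mul_cancel₀ h2, one_smul]
  rw [e]
  refine hadd _ _ (he _ ?_) (ho _ ?_)
  · simp [SuperCommAlg.ev, A.parity_parity, add_comm]
  · simp [SuperCommAlg.od, A.parity_parity, ← smul_neg]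

lemma SuperCommAlg.ev_of_even (A : SuperCommAlg K) {a : A} (h : A.parity a = a) : A.ev a = a := by
  have h2 : (2 : K) ≠ 0 := two_ne_zero
  simp only [SuperCommAlg.ev, LinearMap.smul_apply, LinearMap.add_apply, LinearMap.id_apply,
    AlgHom.toLinearMap_apply, h]
  rw [← two_smul K a, smul_smul, inv_mul_cancel₀ h2, one_smul]

lemma SuperCommAlg.od_of_odd (A : SuperCommAlg K) {a : A} (h : A.parity a = -a) : A.od a = a := by
  have h2 : (2 : K) ≠ 0 := two_ne_zero
  simp only [SuperCommAlg.od, LinearMap.smul_apply, LinearMap.sub_apply, LinearMap.id_apply,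
    AlgHom.toLinearMap_apply, h, sub_neg_eq_add]
  rw [← two_smul K a, smul_smul, inv_mul_cancel₀ h2, one_smul]

end Points

section Constructions

variable {K : Type u} [Field K]

/-- The product `(M ⊗ A) × (N ⊗ A) → (M ⊗ N) ⊗ A`,
`(m ⊗ b, n ⊗ c) ↦ (-1)^{|b||n|} (m ⊗ n) ⊗ b c`. -/
def sprod (M : Type u) [AddCommGroup M] [Module K M] {N : Type u} [AddCommGroup N] [Module K N]
    (τ : Module.End K N) (A : SuperCommAlg K) :
    (M ⊗[K] A) ⊗[K] (N ⊗[K] A) →ₗ[K] (M ⊗[K] N) ⊗[K] A :=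
  LinearMap.lTensor (M ⊗[K] N) (LinearMap.mul' K A) ∘ₗ
    (TensorProduct.tensorTensorTensorComm K M A N A).toLinearMap ∘ₗ
      (TensorProduct.map (LinearMap.lTensor M A.ev) LinearMap.id +
        TensorProduct.map (LinearMap.lTensor M A.od) (LinearMap.rTensor A τ))

/-- The tensor product of even endomorphisms. -/
def tensorEnd {M : Type u} [AddCommGroup M] [Module K M] {N : Type u} [AddCommGroup N] [Module K N]
    (τ : Module.End K N) (A : SuperCommAlg K) (f : Module.End K (M ⊗[K] A))
    (h : Module.End K (N ⊗[K] A)) : Module.End K ((M ⊗[K] N) ⊗[K] A) :=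
  rext A (sprod M τ A ∘ₗ TensorProduct.map (f ∘ₗ incl M A) (h ∘ₗ incl N A))

section
variable {M : Type u} [AddCommGroup M] [Module K M] {N : Type u} [AddCommGroup N] [Module K N]
  (σ : Module.End K M) (τ : Module.End K N) (A : SuperCommAlg K)

lemma sprod_tmul (m : M) (n : N) (b c : A) : sprod M τ A ((m ⊗ₜ b) ⊗ₜ (n ⊗ₜ c)) =
    (m ⊗ₜ n) ⊗ₜ (A.ev b * c) + (m ⊗ₜ τ n) ⊗ₜ (A.od b * c) := by
  simp [sprod]

lemma tensorEnd_tmul (f : Module.End K (M ⊗[K] A)) (h : Module.End K (N ⊗[K] A))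
    (m : M) (n : N) (a : A) : tensorEnd τ A f h ((m ⊗ₜ n) ⊗ₜ a) =
      rmul (M ⊗[K] N) A a (sprod M τ A (f (m ⊗ₜ 1) ⊗ₜ h (n ⊗ₜ 1))) := by
  simp [tensorEnd]

lemma tensorEnd_rmul (f : Module.End K (M ⊗[K] A)) (h : Module.End K (N ⊗[K] A)) (a : A) (x) :
    tensorEnd τ A f h (rmul _ A a x) = rmul (M ⊗[K] N) A a (tensorEnd τ A f h x) :=
  rext_rmul A _ a x

lemma sprod_rmul_right (y : M ⊗[K] A) (x : N ⊗[K] A) (c : A) :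
    sprod M τ A (y ⊗ₜ rmul N A c x) = rmul (M ⊗[K] N) A c (sprod M τ A (y ⊗ₜ x)) := by
  induction y with
  | zero => simp
  | add y z hy hz => simp only [TensorProduct.add_tmul, map_add, hy, hz]
  | tmul m b =>
    induction x with
    | zero => simp
    | add y z hy hz => simp only [TensorProduct.tmul_add, map_add, hy, hz]
    | tmul n a => simp [sprod_tmul, mul_assoc]

lemma map_map_self (hσ : ∀ m, σ (σ m) = m) (hτ : ∀ n, τ (τ n) = n) (v : M ⊗[K] N) :
    TensorProduct.map σ τ (TensorProduct.map σ τ v) = v := by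
  induction v with
  | zero => simp
  | tmul y b => simp [hσ, hτ]
  | add y z hy hz => simp only [map_add, hy, hz]

lemma par_neg (y : M ⊗[K] A) : par (-σ) A y = -(par σ A y) := by
  induction y with
  | zero => simp
  | tmul y b => simp [TensorProduct.neg_tmul]
  | add y z hy hz => simp only [map_add, hy, hz, neg_add]

/-- An action is also an action for the opposite parity. -/
def shiftHom {G : Type u} [Group G] (f : G →* evenEnd σ A) : G →* evenEnd (-σ) A where
  toFun g := ⟨(f g).1, fun x => by rw [par_neg, par_neg, map_neg, (f g).2.1], (f g).2.2⟩
  map_one' := by ext1; rw [map_one]; rfl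
  map_mul' g h := by ext1; rw [map_mul]; rfl

lemma sprod_par (y : M ⊗[K] A) (x : N ⊗[K] A) :
    sprod M τ A (par σ A y ⊗ₜ par τ A x) = par (TensorProduct.map σ τ) A (sprod M τ A (y ⊗ₜ x)) := by
  induction y with
  | zero => simp
  | add y z hy hz => simp only [TensorProduct.add_tmul, map_add, hy, hz]
  | tmul m a =>
    induction x with
    | zero => simp
    | add y z hy hz => simp only [TensorProduct.tmul_add, map_add, hy, hz]
    | tmul n c =>
      have h1 : A.ev (A.parity a) = A.parity (A.ev a) := by simp [SuperCommAlg.ev]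
      have h2 : A.od (A.parity a) = A.parity (A.od a) := by simp [SuperCommAlg.od]
      simp [sprod_tmul, h1, h2]

lemma sprod_lTensor {B : SuperCommAlg K} (φ : SHom A B) (y : M ⊗[K] A) (x : N ⊗[K] A) :
    LinearMap.lTensor (M ⊗[K] N) φ.toAlgHom.toLinearMap (sprod M τ A (y ⊗ₜ x)) =
      sprod M τ B (LinearMap.lTensor M φ.toAlgHom.toLinearMap y ⊗ₜ
        LinearMap.lTensor N φ.toAlgHom.toLinearMap x) := by
  induction y with
  | zero => simp
  | add y z hy hz => simp only [TensorProduct.add_tmul, map_add, hy, hz]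
  | tmul m a =>
    induction x with
    | zero => simp
    | add y z hy hz => simp only [TensorProduct.tmul_add, map_add, hy, hz]
    | tmul n c =>
      have h1 : φ.toAlgHom (A.ev a) = B.ev (φ.toAlgHom a) := by
        simp [SuperCommAlg.ev, φ.map_parity]
      have h2 : φ.toAlgHom (A.od a) = B.od (φ.toAlgHom a) := by
        simp [SuperCommAlg.od, φ.map_parity]
      simp [sprod_tmul, h1, h2]


variable [CharZero K]

lemma sprod_rmul_left_even (y : M ⊗[K] A) (x : N ⊗[K] A) {b : A} (hb : A.parity b = b) :
    sprod M τ A (rmul M A b y ⊗ₜ x) = rmul (M ⊗[K] N) A b (sprod M τ A (y ⊗ₜ x)) := by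
  induction y with
  | zero => simp
  | add y z hy hz => simp only [TensorProduct.add_tmul, map_add, hy, hz]
  | tmul m a =>
    induction x with
    | zero => simp
    | add y z hy hz => simp only [TensorProduct.tmul_add, map_add, hy, hz]
    | tmul n c =>
      induction a using A.induction with
      | hadd a a' h h' =>
        simp only [TensorProduct.tmul_add, TensorProduct.add_tmul, map_add, h, h']
      | he a ha =>
        have h1 : A.parity (a * b) = a * b := by rw [map_mul, ha, hb]
        rw [rmul_tmul, sprod_tmul, sprod_tmul, A.ev_of_even h1, A.od_of_even h1, A.ev_of_even ha,
          A.od_of_even ha]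
        simp [mul_assoc, A.even_comm b c hb]
      | ho a ha =>
        have h1 : A.parity (a * b) = -(a * b) := by rw [map_mul, ha, hb, neg_mul]
        rw [rmul_tmul, sprod_tmul, sprod_tmul, A.ev_of_odd h1, A.od_of_odd h1, A.ev_of_odd ha,
          A.od_of_odd ha]
        simp [mul_assoc, A.even_comm b c hb]

lemma sprod_rmul_left_odd (hτ : ∀ n, τ (τ n) = n) (y : M ⊗[K] A) (x : N ⊗[K] A) {b : A} (hb : A.parity b = -b) :
    sprod M τ A (rmul M A b y ⊗ₜ x) = rmul (M ⊗[K] N) A b (sprod M τ A (y ⊗ₜ par τ A x)) := by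
  induction y with
  | zero => simp
  | add y z hy hz => simp only [TensorProduct.add_tmul, map_add, hy, hz]
  | tmul m a =>
    induction x with
    | zero => simp
    | add y z hy hz => simp only [TensorProduct.tmul_add, map_add, hy, hz]
    | tmul n c =>
      have hc : b * c = A.parity c * b := by
        induction c using A.induction with
        | hadd a a' h h' => simp only [map_add, mul_add, add_mul, h, h']
        | he c hc => rw [hc, A.even_comm c b hc]
        | ho c hc => rw [hc, neg_mul, A.odd_anticomm b c hb hc]
      induction a using A.induction with
      | hadd a a' h h' =>
        simp only [TensorProduct.tmul_add, TensorProduct.add_tmul, map_add, h, h']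
      | he a ha =>
        have h1 : A.parity (a * b) = -(a * b) := by rw [map_mul, ha, hb, mul_neg]
        rw [rmul_tmul, par_tmul, sprod_tmul, sprod_tmul, A.ev_of_odd h1, A.od_of_odd h1,
          A.ev_of_even ha, A.od_of_even ha]
        simp [mul_assoc, hc]
      | ho a ha =>
        have h1 : A.parity (a * b) = a * b := by rw [map_mul, ha, hb, neg_mul_neg]
        rw [rmul_tmul, par_tmul, sprod_tmul, sprod_tmul, A.ev_of_even h1, A.od_of_even h1,
          A.ev_of_odd ha, A.od_of_odd ha]
        simp [mul_assoc, hc, hτ]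

lemma tensorEnd_sprod (hτ : ∀ n, τ (τ n) = n) {f : Module.End K (M ⊗[K] A)} {h : Module.End K (N ⊗[K] A)}
    (hf : f ∈ evenEnd σ A) (hh : h ∈ evenEnd τ A) (y : M ⊗[K] A) (x : N ⊗[K] A) :
    tensorEnd τ A f h (sprod M τ A (y ⊗ₜ x)) = sprod M τ A (f y ⊗ₜ h x) := by
  induction y with
  | zero => simp
  | add y z hy hz => simp only [TensorProduct.add_tmul, map_add, hy, hz]
  | tmul m b =>
    have key : ∀ x, tensorEnd τ A f h (sprod M τ A ((m ⊗ₜ 1) ⊗ₜ x)) =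
        sprod M τ A (f (m ⊗ₜ 1) ⊗ₜ h x) := by
      intro x
      induction x with
      | zero => simp
      | add y z hy hz => simp only [TensorProduct.tmul_add, map_add, hy, hz]
      | tmul n c =>
        rw [apply_tmul A hh.2 n c, sprod_rmul_right, sprod_tmul,
          A.ev_of_even (map_one _), A.od_of_even (map_one _)]
        simp [tensorEnd_tmul]
    induction b using A.induction with
    | hadd a a' h h' =>
      simp only [TensorProduct.tmul_add, TensorProduct.add_tmul, map_add, h, h']
    | he b hb =>
      have e : m ⊗ₜ[K] b = rmul M A b (m ⊗ₜ 1) := by simp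
      rw [e, sprod_rmul_left_even τ A _ _ hb, tensorEnd_rmul, key, hf.2,
        sprod_rmul_left_even τ A _ _ hb]
    | ho b hb =>
      have e : m ⊗ₜ[K] b = rmul M A b (m ⊗ₜ 1) := by simp
      rw [e, sprod_rmul_left_odd τ A hτ _ _ hb, tensorEnd_rmul, key, hf.2,
        sprod_rmul_left_odd τ A hτ _ _ hb, hh.1]

lemma tensorEnd_mem (hτ : ∀ n, τ (τ n) = n) {f : Module.End K (M ⊗[K] A)} {h : Module.End K (N ⊗[K] A)}
    (hf : f ∈ evenEnd σ A) (hh : h ∈ evenEnd τ A) :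
    tensorEnd τ A f h ∈ evenEnd (TensorProduct.map σ τ) A := by
  refine ⟨fun x => ?_, fun a x => tensorEnd_rmul τ A f h a x⟩
  induction x with
  | zero => simp
  | add y z hy hz => simp only [map_add, hy, hz]
  | tmul mn a =>
    induction mn with
    | zero => simp
    | add y z hy hz => simp only [TensorProduct.add_tmul, map_add, hy, hz]
    | tmul m n =>
      have e : (m ⊗ₜ[K] n) ⊗ₜ[K] a = sprod M τ A ((m ⊗ₜ 1) ⊗ₜ (n ⊗ₜ a)) := by
        rw [sprod_tmul, A.ev_of_even (map_one _), A.od_of_even (map_one _)]; simp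
      rw [e, ← sprod_par, tensorEnd_sprod σ τ A hτ hf hh, hf.1, hh.1, sprod_par,
        tensorEnd_sprod σ τ A hτ hf hh]

/-- Two `A`-linear maps out of `(M ⊗ N) ⊗ A` agreeing on pure tensors `(m ⊗ n) ⊗ 1`. -/
lemma tensor_ext {Y : Type u} [AddCommGroup Y] [Module K Y]
    {f g : (M ⊗[K] N) ⊗[K] A →ₗ[K] Y ⊗[K] A}
    (hf : ∀ a x, f (rmul (M ⊗[K] N) A a x) = rmul Y A a (f x))
    (hg : ∀ a x, g (rmul (M ⊗[K] N) A a x) = rmul Y A a (g x))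
    (h : ∀ m n, f (sprod M τ A ((m ⊗ₜ 1) ⊗ₜ (n ⊗ₜ 1))) =
      g (sprod M τ A ((m ⊗ₜ 1) ⊗ₜ (n ⊗ₜ 1)))) : f = g := by
  refine ext_rlin A hf hg fun x => ?_
  induction x with
  | zero => simp
  | add y z hy hz => simp only [TensorProduct.add_tmul, map_add, hy, hz]
  | tmul m n =>
    have e : (m ⊗ₜ[K] n) ⊗ₜ[K] (1 : A) = sprod M τ A ((m ⊗ₜ 1) ⊗ₜ (n ⊗ₜ 1)) := by
      rw [sprod_tmul, A.ev_of_even (map_one _), A.od_of_even (map_one _)]; simp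
    rw [e, h]


/-- The tensor product of two actions of a group on `M ⊗ A` and `N ⊗ A`. -/
def tensorHom {G : Type u} [Group G] (hτ : ∀ n, τ (τ n) = n) (f : G →* evenEnd σ A)
    (h : G →* evenEnd τ A) : G →* evenEnd (TensorProduct.map σ τ) A where
  toFun g := ⟨tensorEnd τ A (f g).1 (h g).1, tensorEnd_mem σ τ A hτ (f g).2 (h g).2⟩
  map_one' := by
    ext1
    refine tensor_ext τ A (tensorEnd_rmul τ A _ _) (fun _ _ => rfl) fun m n => ?_
    change tensorEnd τ A _ _ _ = _
    rw [tensorEnd_sprod σ τ A hτ (f 1).2 (h 1).2, map_one, map_one]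
    rfl
  map_mul' a b := by
    ext1
    refine tensor_ext τ A (tensorEnd_rmul τ A _ _) (fun c x => ?_) fun m n => ?_
    · change tensorEnd τ A _ _ (tensorEnd τ A _ _ _) = _
      rw [tensorEnd_rmul, tensorEnd_rmul]; rfl
    · change tensorEnd τ A _ _ _ = tensorEnd τ A _ _ (tensorEnd τ A _ _ _)
      rw [tensorEnd_sprod σ τ A hτ (f _).2 (h _).2, tensorEnd_sprod σ τ A hτ (f _).2 (h _).2,
        tensorEnd_sprod σ τ A hτ (f _).2 (h _).2, map_mul, map_mul]
      rfl

lemma tensorEnd_baseChange {B : SuperCommAlg K} (φ : SHom A B)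
    {f : Module.End K (M ⊗[K] A)} {f' : Module.End K (M ⊗[K] B)}
    {h : Module.End K (N ⊗[K] A)} {h' : Module.End K (N ⊗[K] B)}
    (h1 : IsBaseChange φ f f') (h2 : IsBaseChange φ h h') :
    IsBaseChange φ (tensorEnd τ A f h) (tensorEnd τ B f' h') := by
  refine isBaseChange_of A φ (tensorEnd_rmul τ A _ _) (tensorEnd_rmul τ B _ _) fun x => ?_
  induction x with
  | zero => simp
  | add y z hy hz => simp only [TensorProduct.add_tmul, map_add, hy, hz]
  | tmul m n =>
    have h3 := h1 (m ⊗ₜ 1)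
    have h4 := h2 (n ⊗ₜ 1)
    rw [LinearMap.lTensor_tmul] at h3 h4
    simp only [AlgHom.toLinearMap_apply, map_one] at h3 h4
    rw [tensorEnd_tmul, tensorEnd_tmul, rmul_one, rmul_one, sprod_lTensor, h3, h4]

end

variable {V : SuperSpace K} {H : SubgroupFunctor V}

/-- The trivial representation on the main field. -/
def Rep.unit (H : SubgroupFunctor V) : Rep H where
  space := { carrier := K, parity := LinearMap.id, parity_parity := fun _ => rfl }
  act := fun _ => 1
  natural := fun _ _ _ _ _ _ _ => rfl

/-- The tautological representation on `V`. -/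
def Rep.taut (H : SubgroupFunctor V) : Rep H where
  space := V
  act := fun A => (Units.coeHom (evenEnd V.parity A)).comp (H A).subtype
  natural := fun _ _ _ _ _ h => h

/-- The parity shift `Π M`: the same module and action, with the opposite parity. -/
def Rep.shift (R : Rep H) : Rep H where
  space := { carrier := R.space, parity := -R.space.parity,
             parity_parity := fun v => by simp [R.space.parity_parity] }
  act := fun A => shiftHom R.space.parity A (R.act A)
  natural := R.natural

variable [CharZero K]

/-- The tensor product of superspaces. -/
def SuperSpace.tensor (M N : SuperSpace K) : SuperSpace K where
  carrier := M ⊗[K] N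
  parity := TensorProduct.map M.parity N.parity
  parity_parity := map_map_self M.parity N.parity M.parity_parity N.parity_parity

/-- The tensor product of representations. -/
def Rep.tensor (R S : Rep H) : Rep H where
  space := R.space.tensor S.space
  act := fun A => tensorHom R.space.parity S.space.parity A S.space.parity_parity
    (R.act A) (S.act A)
  natural := fun A B φ g g' hg => tensorEnd_baseChange S.space.parity A φ
    (R.natural A B φ g g' hg) (S.natural A B φ g g' hg)

end Constructions

section Quotients

variable {K : Type u} [Field K] {M : Type u} [AddCommGroup M] [Module K M]
  {N : Type u} [AddCommGroup N] [Module K N]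
  (σ : Module.End K M) (τ : Module.End K N) (A : SuperCommAlg K)

/-- The `A`-submodule `S ⊗ A ⊆ M ⊗ A`. -/
def baseSub (S : Submodule K M) (A : SuperCommAlg K) : Submodule K (M ⊗[K] A) :=
  Submodule.map₂ (TensorProduct.mk K M A) S ⊤

variable {A} in
lemma tmul_mem_baseSub {S : Submodule K M} {m : M} (h : m ∈ S) (a : A) :
    m ⊗ₜ a ∈ baseSub S A := Submodule.apply_mem_map₂ _ h trivial

/-- The endomorphism of `(M / S) ⊗ A` induced by an endomorphism `f` preserving `S ⊗ A`. -/
def quotEnd (S : Submodule K M) (f : Module.End K (M ⊗[K] A))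
    (h : ∀ x ∈ S, f (x ⊗ₜ 1) ∈ baseSub S A) : Module.End K ((M ⧸ S) ⊗[K] A) :=
  rext A (S.liftQ (LinearMap.rTensor A S.mkQ ∘ₗ f ∘ₗ incl M A) (by
    intro x hx
    have h0 : baseSub S A ≤ LinearMap.ker (LinearMap.rTensor A S.mkQ) := by
      refine Submodule.map₂_le.2 fun m hm a _ => ?_
      have : S.mkQ m = 0 := by simpa using hm
      rw [TensorProduct.mk_apply, LinearMap.mem_ker, LinearMap.rTensor_tmul, this,
        TensorProduct.zero_tmul]
    exact h0 (h x hx)))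

lemma rTensor_rmul (l : M →ₗ[K] N) (a : A) (x : M ⊗[K] A) :
    LinearMap.rTensor A l (rmul M A a x) = rmul N A a (LinearMap.rTensor A l x) := by
  induction x with
  | zero => simp
  | tmul y b => simp
  | add y z hy hz => simp only [map_add, hy, hz]

lemma quotEnd_mkQ (S : Submodule K M) (f : Module.End K (M ⊗[K] A))
    (h : ∀ x ∈ S, f (x ⊗ₜ 1) ∈ baseSub S A)
    (hf : ∀ a x, f (rmul M A a x) = rmul M A a (f x)) (x : M ⊗[K] A) :
    quotEnd A S f h (LinearMap.rTensor A S.mkQ x) = LinearMap.rTensor A S.mkQ (f x) := by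
  induction x with
  | zero => simp
  | add y z hy hz => simp only [map_add, hy, hz]
  | tmul m a => rw [apply_tmul A hf, rTensor_rmul, LinearMap.rTensor_tmul, quotEnd, rext_tmul]; rfl

lemma mkQ_surj (S : Submodule K M) : Function.Surjective (LinearMap.rTensor A S.mkQ) :=
  LinearMap.rTensor_surjective _ S.mkQ_surjective

/-- The action on the quotient by a stable subspace. -/
def quotHom {G : Type u} [Group G] (S : Submodule K M) (hS : S ≤ S.comap σ)
    (f : G →* evenEnd σ A) (h : ∀ g, ∀ x ∈ S, (f g).1 (x ⊗ₜ 1) ∈ baseSub S A) :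
    G →* evenEnd (S.mapQ S σ hS) A where
  toFun g := ⟨quotEnd A S (f g).1 (h g), by
    have hp : ∀ x, par (S.mapQ S σ hS) A (LinearMap.rTensor A S.mkQ x) =
        LinearMap.rTensor A S.mkQ (par σ A x) := fun x => by
      induction x with
      | zero => simp
      | add y z hy hz => simp only [map_add, hy, hz]
      | tmul m a => simp
    refine ⟨fun x => ?_, fun a x => rext_rmul A _ a x⟩
    obtain ⟨x, rfl⟩ := mkQ_surj A S x
    rw [hp, quotEnd_mkQ A S _ _ (f g).2.2, quotEnd_mkQ A S _ _ (f g).2.2, hp, (f g).2.1]⟩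
  map_one' := by
    ext1
    refine LinearMap.ext fun x => ?_
    obtain ⟨x, rfl⟩ := mkQ_surj A S x
    change quotEnd A S _ (h 1) _ = _
    rw [quotEnd_mkQ A S _ _ (f 1).2.2, map_one]; rfl
  map_mul' a b := by
    ext1
    refine LinearMap.ext fun x => ?_
    obtain ⟨x, rfl⟩ := mkQ_surj A S x
    change quotEnd A S _ (h (a * b)) _ = quotEnd A S _ (h a) (quotEnd A S _ (h b) _)
    rw [quotEnd_mkQ A S _ _ (f _).2.2, quotEnd_mkQ A S _ _ (f _).2.2,
      quotEnd_mkQ A S _ _ (f _).2.2, map_mul]; rfl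

variable {A} in
lemma quotEnd_baseChange {B : SuperCommAlg K} (φ : SHom A B) (S : Submodule K M)
    {f : Module.End K (M ⊗[K] A)} {f' : Module.End K (M ⊗[K] B)}
    (h : ∀ x ∈ S, f (x ⊗ₜ 1) ∈ baseSub S A) (h' : ∀ x ∈ S, f' (x ⊗ₜ 1) ∈ baseSub S B)
    (hf : ∀ a x, f (rmul M A a x) = rmul M A a (f x))
    (hf' : ∀ a x, f' (rmul M B a x) = rmul M B a (f' x))
    (hb : IsBaseChange φ f f') : IsBaseChange φ (quotEnd A S f h) (quotEnd B S f' h') := by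
  have hp : ∀ x, LinearMap.lTensor (M ⧸ S) φ.toAlgHom.toLinearMap (LinearMap.rTensor A S.mkQ x) =
      LinearMap.rTensor B S.mkQ (LinearMap.lTensor M φ.toAlgHom.toLinearMap x) := fun x => by
    induction x with
    | zero => simp
    | add y z hy hz => simp only [map_add, hy, hz]
    | tmul m a => simp
  intro x
  obtain ⟨x, rfl⟩ := mkQ_surj A S x
  rw [hp, quotEnd_mkQ B S _ _ hf', quotEnd_mkQ A S _ _ hf, hp, hb]

variable {V : SuperSpace K} {H : SubgroupFunctor V}

/-- A subrepresentation: a graded subspace `S` such that `S ⊗ A` is preserved for all `A`. -/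
structure Rep.Sub (R : Rep H) where
  carrier : Submodule K R.space
  parity_le : carrier ≤ carrier.comap R.space.parity
  stable : ∀ (A : SuperCommAlg K) (g : H A), ∀ x ∈ carrier,
    (R.act A g).1 (x ⊗ₜ 1) ∈ baseSub carrier A

/-- The quotient superspace. -/
def SuperSpace.quot (M : SuperSpace K) (S : Submodule K M) (hS : S ≤ S.comap M.parity) :
    SuperSpace K where
  carrier := M ⧸ S
  parity := S.mapQ S M.parity hS
  parity_parity := fun v => by
    obtain ⟨v, rfl⟩ := S.mkQ_surjective v
    simp [M.parity_parity]

/-- The quotient representation. -/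
def Rep.quot (R : Rep H) (S : R.Sub) : Rep H where
  space := R.space.quot S.carrier S.parity_le
  act := fun A => quotHom R.space.parity A S.carrier S.parity_le (R.act A) (S.stable A)
  natural := fun A B φ g g' hg => quotEnd_baseChange φ S.carrier (S.stable A g) (S.stable B g')
    (R.act A g).2.2 (R.act B g').2.2 (R.natural A B φ g g' hg)

end Quotients

section Exterior

variable {K : Type u} [Field K]

/-- The even component of a vector, for the parity involution `σ`. -/
def evPart {M : Type u} [AddCommGroup M] [Module K M] (σ : Module.End K M) : Module.End K M :=
  (2⁻¹ : K) • (1 + σ)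

/-- The odd component of a vector, for the parity involution `σ`. -/
def odPart {M : Type u} [AddCommGroup M] [Module K M] (σ : Module.End K M) : Module.End K M :=
  (2⁻¹ : K) • (1 - σ)

/-- The braiding `v ⊗ w ↦ (-1)^{|v||w|} w ⊗ v`. -/
def braid {M : Type u} [AddCommGroup M] [Module K M] (σ : Module.End K M) :
    Module.End K (M ⊗[K] M) :=
  (TensorProduct.map (evPart σ) LinearMap.id + TensorProduct.map (odPart σ) σ) ∘ₗ
    (TensorProduct.comm K M M).toLinearMap

/-- The map `t ⊗ v ⊗ w ↦ t ⊗ v ⊗ w + (-1)^{|v||w|} t ⊗ w ⊗ v` on `T ⊗ M ⊗ M`. -/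
def symm (T : Type u) [AddCommGroup T] [Module K T] {M : Type u} [AddCommGroup M] [Module K M]
    (σ : Module.End K M) : Module.End K ((T ⊗[K] M) ⊗[K] M) :=
  (TensorProduct.assoc K T M M).symm.toLinearMap ∘ₗ LinearMap.lTensor T (1 + braid σ) ∘ₗ
    (TensorProduct.assoc K T M M).toLinearMap

section
variable {M : Type u} [AddCommGroup M] [Module K M] {N : Type u} [AddCommGroup N] [Module K N]
  {T : Type u} [AddCommGroup T] [Module K T]
  (σ : Module.End K M) (τ : Module.End K N) (A : SuperCommAlg K)

lemma braid_tmul (v w : M) : braid σ (v ⊗ₜ w) = evPart σ w ⊗ₜ v + odPart σ w ⊗ₜ σ v := by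
  simp [braid]

lemma evPart_of_odd {m : M} (h : σ m = -m) : evPart σ m = 0 := by simp [evPart, h]

lemma odPart_of_even {m : M} (h : σ m = m) : odPart σ m = 0 := by simp [odPart, h]

/-- Parity-preserving maps in the second factor. -/
lemma sprod_natural {P : Type u} [AddCommGroup P] [Module K P] (ρ : Module.End K P)
    (l : N →ₗ[K] P) (hl : ∀ n, l (τ n) = ρ (l n)) (y : T ⊗[K] A) (x : N ⊗[K] A) :
    LinearMap.rTensor A (LinearMap.lTensor T l) (sprod T τ A (y ⊗ₜ x)) =
      sprod T ρ A (y ⊗ₜ LinearMap.rTensor A l x) := by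
  induction y with
  | zero => simp
  | add y z hy hz => simp only [TensorProduct.add_tmul, map_add, hy, hz]
  | tmul m a =>
    induction x with
    | zero => simp
    | add y z hy hz => simp only [TensorProduct.tmul_add, map_add, hy, hz]
    | tmul n c => simp [sprod_tmul, hl]

variable [CharZero K]

lemma evPart_of_even {m : M} (h : σ m = m) : evPart σ m = m := by
  have h2 : (2 : K) ≠ 0 := two_ne_zero
  simp only [evPart, LinearMap.smul_apply, LinearMap.add_apply, Module.End.one_apply, h]
  rw [← two_smul K m, smul_smul, inv_mul_cancel₀ h2, one_smul]

lemma odPart_of_odd {m : M} (h : σ m = -m) : odPart σ m = m := by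
  have h2 : (2 : K) ≠ 0 := two_ne_zero
  simp only [odPart, LinearMap.smul_apply, LinearMap.sub_apply, Module.End.one_apply, h,
    sub_neg_eq_add]
  rw [← two_smul K m, smul_smul, inv_mul_cancel₀ h2, one_smul]

lemma invol_induction (hσ : ∀ m, σ (σ m) = m) {P : M → Prop} (he : ∀ a, σ a = a → P a)
    (ho : ∀ a, σ a = -a → P a) (hadd : ∀ a b, P a → P b → P (a + b)) (a : M) : P a := by
  have h2 : (2 : K) ≠ 0 := two_ne_zero
  have e : a = evPart σ a + odPart σ a := by
    simp only [evPart, odPart, LinearMap.smul_apply, LinearMap.add_apply,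
      LinearMap.sub_apply, Module.End.one_apply, ← smul_add, add_add_sub_cancel]
    rw [← two_smul K a, smul_smul, inv_mul_cancel₀ h2, one_smul]
  rw [e]
  refine hadd _ _ (he _ ?_) (ho _ ?_)
  · simp [evPart, hσ, add_comm]
  · simp [odPart, hσ, ← smul_neg]

lemma sprod_assoc (hτ : ∀ n, τ (τ n) = n) (y : T ⊗[K] A) (x : M ⊗[K] A) (z : N ⊗[K] A) :
    LinearMap.rTensor A (TensorProduct.assoc K T M N).toLinearMap
      (sprod (T ⊗[K] M) τ A (sprod T σ A (y ⊗ₜ x) ⊗ₜ z)) =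
      sprod T (TensorProduct.map σ τ) A (y ⊗ₜ sprod M τ A (x ⊗ₜ z)) := by
  induction y with
  | zero => simp
  | add y z hy hz => simp only [TensorProduct.add_tmul, map_add, hy, hz]
  | tmul t a =>
    induction x with
    | zero => simp
    | add y z hy hz => simp only [TensorProduct.add_tmul, TensorProduct.tmul_add, map_add, hy, hz]
    | tmul m b =>
      induction z with
      | zero => simp
      | add y z hy hz =>
        simp only [TensorProduct.tmul_add, map_add, hy, hz]
      | tmul n c =>
        induction a using A.induction with
        | hadd a a' h h' => simp only [TensorProduct.tmul_add, TensorProduct.add_tmul, map_add, h, h']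
        | he a ha =>
          induction b using A.induction with
          | hadd b b' h h' =>
            simp only [TensorProduct.tmul_add, TensorProduct.add_tmul, map_add, h, h']
          | he b hb =>
            have hab : A.parity (a * b) = a * b := by rw [map_mul, ha, hb]
            simp [sprod_tmul, A.ev_of_even ha, A.od_of_even ha, A.ev_of_even hb, A.od_of_even hb,
              A.ev_of_even hab, A.od_of_even hab, mul_assoc]
          | ho b hb =>
            have hab : A.parity (a * b) = -(a * b) := by rw [map_mul, ha, hb, mul_neg]
            simp [sprod_tmul, A.ev_of_even ha, A.od_of_even ha, A.ev_of_odd hb, A.od_of_odd hb,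
              A.ev_of_odd hab, A.od_of_odd hab, mul_assoc]
        | ho a ha =>
          induction b using A.induction with
          | hadd b b' h h' =>
            simp only [TensorProduct.tmul_add, TensorProduct.add_tmul, map_add, h, h']
          | he b hb =>
            have hab : A.parity (a * b) = -(a * b) := by rw [map_mul, ha, hb, neg_mul]
            simp [sprod_tmul, A.ev_of_odd ha, A.od_of_odd ha, A.ev_of_even hb, A.od_of_even hb,
              A.ev_of_odd hab, A.od_of_odd hab, mul_assoc]
          | ho b hb =>
            have hab : A.parity (a * b) = a * b := by rw [map_mul, ha, hb, neg_mul_neg]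
            simp [sprod_tmul, A.ev_of_odd ha, A.od_of_odd ha, A.ev_of_odd hb, A.od_of_odd hb,
              A.ev_of_even hab, A.od_of_even hab, mul_assoc, hτ]

lemma braid_sprod (hσ : ∀ m, σ (σ m) = m) (x z : M ⊗[K] A) :
    LinearMap.rTensor A (braid σ) (sprod M σ A (x ⊗ₜ z)) =
      sprod M σ A (evPart (par σ A) z ⊗ₜ x) + sprod M σ A (odPart (par σ A) z ⊗ₜ par σ A x) := by
  induction x with
  | zero => simp
  | add y z hy hz =>
    simp only [TensorProduct.add_tmul, TensorProduct.tmul_add, map_add, hy, hz]; abel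
  | tmul v b =>
    induction z with
    | zero => simp
    | add y z hy hz =>
      simp only [TensorProduct.add_tmul, TensorProduct.tmul_add, map_add, hy, hz]; abel
    | tmul w c =>
      have leaf : ∀ (w : M) (c b : A), (σ w = w ∨ σ w = -w) → (A.parity c = c ∨ A.parity c = -c) →
          (A.parity b = b ∨ A.parity b = -b) →
          LinearMap.rTensor A (braid σ) (sprod M σ A ((v ⊗ₜ b) ⊗ₜ (w ⊗ₜ c))) =
            sprod M σ A (evPart (par σ A) (w ⊗ₜ c) ⊗ₜ (v ⊗ₜ b)) +
              sprod M σ A (odPart (par σ A) (w ⊗ₜ c) ⊗ₜ par σ A (v ⊗ₜ b)) := by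
        intro w c b hw hc hb
        rcases hw with hw | hw <;> rcases hc with hc | hc
        · have hp : par σ A (w ⊗ₜ c) = w ⊗ₜ c := by simp [hw, hc]
          rw [evPart_of_even _ hp, odPart_of_even _ hp, sprod_tmul, sprod_tmul, A.ev_of_even hc,
            A.od_of_even hc]
          rcases hb with hb | hb
          · simp [braid_tmul, hw, A.ev_of_even hb, A.od_of_even hb, evPart_of_even σ hw,
              odPart_of_even σ hw, A.even_comm c b hc]
          · simp [braid_tmul, hw, A.ev_of_odd hb, A.od_of_odd hb, evPart_of_even σ hw,
              odPart_of_even σ hw, A.even_comm c b hc]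
        · have hp : par σ A (w ⊗ₜ c) = -(w ⊗ₜ c) := by simp [hw, hc, TensorProduct.tmul_neg]
          rw [evPart_of_odd _ hp, odPart_of_odd _ hp, par_tmul, sprod_tmul, sprod_tmul,
            A.ev_of_odd hc, A.od_of_odd hc]
          rcases hb with hb | hb
          · simp [braid_tmul, hw, hb, hσ, A.ev_of_even hb, A.od_of_even hb, evPart_of_even σ hw,
              odPart_of_even σ hw, A.even_comm b c hb]
          · simp [braid_tmul, hw, hb, hσ, A.ev_of_odd hb, A.od_of_odd hb, evPart_of_even σ hw,
              odPart_of_even σ hw, A.odd_anticomm b c hb hc]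
        · have hp : par σ A (w ⊗ₜ c) = -(w ⊗ₜ c) := by simp [hw, hc, TensorProduct.neg_tmul]
          rw [evPart_of_odd _ hp, odPart_of_odd _ hp, par_tmul, sprod_tmul, sprod_tmul,
            A.ev_of_even hc, A.od_of_even hc]
          rcases hb with hb | hb
          · simp [braid_tmul, hw, hb, A.ev_of_even hb, A.od_of_even hb, evPart_of_odd σ hw,
              odPart_of_odd σ hw, A.even_comm c b hc]
          · simp [braid_tmul, hw, hb, A.ev_of_odd hb, A.od_of_odd hb, evPart_of_odd σ hw,
              odPart_of_odd σ hw, A.even_comm c b hc, TensorProduct.tmul_neg,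
              TensorProduct.neg_tmul]
        · have hp : par σ A (w ⊗ₜ c) = w ⊗ₜ c := by
            simp [hw, hc, TensorProduct.neg_tmul, TensorProduct.tmul_neg]
          rw [evPart_of_even _ hp, odPart_of_even _ hp, sprod_tmul, sprod_tmul, A.ev_of_odd hc,
            A.od_of_odd hc]
          rcases hb with hb | hb
          · simp [braid_tmul, hw, A.ev_of_even hb, A.od_of_even hb, evPart_of_odd σ hw,
              odPart_of_odd σ hw, A.even_comm b c hb]
          · simp [braid_tmul, hw, A.ev_of_odd hb, A.od_of_odd hb, evPart_of_odd σ hw,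
              odPart_of_odd σ hw, A.odd_anticomm b c hb hc, TensorProduct.tmul_neg,
              TensorProduct.neg_tmul]
      induction w using invol_induction σ hσ with
      | hadd a a' h h' =>
        simp only [TensorProduct.tmul_add, TensorProduct.add_tmul, map_add, h, h']; abel
      | he w hw | ho w hw =>
        induction c using A.induction with
        | hadd a a' h h' =>
          simp only [TensorProduct.tmul_add, TensorProduct.add_tmul, map_add, h, h']; abel
        | he c hc | ho c hc =>
          induction b using A.induction with
          | hadd a a' h h' =>
            simp only [TensorProduct.tmul_add, TensorProduct.add_tmul, map_add, h, h']; abel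
          | he b hb | ho b hb => exact leaf w c b (by simp [hw]) (by simp [hc]) (by simp [hb])

lemma even_evPart {h : Module.End K (M ⊗[K] A)} (hh : h ∈ evenEnd σ A) (w : M) :
    h (evPart σ w ⊗ₜ 1) = evPart (par σ A) (h (w ⊗ₜ 1)) := by
  have h1 : evPart σ w ⊗ₜ[K] (1 : A) = (2⁻¹ : K) • (w ⊗ₜ 1 + par σ A (w ⊗ₜ 1)) := by
    rw [par_tmul, map_one, ← TensorProduct.add_tmul, TensorProduct.smul_tmul']; rfl
  rw [h1, map_smul, map_add, hh.1]; rfl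

lemma even_odPart {h : Module.End K (M ⊗[K] A)} (hh : h ∈ evenEnd σ A) (w : M) :
    h (odPart σ w ⊗ₜ 1) = odPart (par σ A) (h (w ⊗ₜ 1)) := by
  have h1 : odPart σ w ⊗ₜ[K] (1 : A) = (2⁻¹ : K) • (w ⊗ₜ 1 - par σ A (w ⊗ₜ 1)) := by
    rw [par_tmul, map_one, ← TensorProduct.sub_tmul, TensorProduct.smul_tmul']; rfl
  rw [h1, map_smul, map_sub, hh.1]; rfl

lemma even_parity {h : Module.End K (M ⊗[K] A)} (hh : h ∈ evenEnd σ A) (w : M) :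
    h (σ w ⊗ₜ 1) = par σ A (h (w ⊗ₜ 1)) := by
  rw [← hh.1]; simp

lemma braid_parity (n : M ⊗[K] M) : (1 + braid σ) (TensorProduct.map σ σ n) =
    TensorProduct.map σ σ ((1 + braid σ) n) := by
  induction n with
  | zero => simp
  | add y z hy hz => simp only [map_add, hy, hz]
  | tmul v w =>
    have h1 : evPart σ (σ w) = σ (evPart σ w) := by simp [evPart]
    have h2 : odPart σ (σ w) = σ (odPart σ w) := by simp [odPart]
    simp [braid_tmul, h1, h2]

lemma symm_tmul (t : T) (v w : M) : symm T σ ((t ⊗ₜ v) ⊗ₜ w) =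
    (t ⊗ₜ v) ⊗ₜ w + ((t ⊗ₜ evPart σ w) ⊗ₜ v + (t ⊗ₜ odPart σ w) ⊗ₜ σ v) := by
  simp [symm, braid_tmul, TensorProduct.tmul_add]

lemma symm_sprod (hσ : ∀ m, σ (σ m) = m) (y : T ⊗[K] A) (x z : M ⊗[K] A) :
    LinearMap.rTensor A (symm T σ) (sprod (T ⊗[K] M) σ A (sprod T σ A (y ⊗ₜ x) ⊗ₜ z)) =
      sprod (T ⊗[K] M) σ A (sprod T σ A (y ⊗ₜ x) ⊗ₜ z) +
      (sprod (T ⊗[K] M) σ A (sprod T σ A (y ⊗ₜ evPart (par σ A) z) ⊗ₜ x) +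
        sprod (T ⊗[K] M) σ A (sprod T σ A (y ⊗ₜ odPart (par σ A) z) ⊗ₜ par σ A x)) := by
  have hinj : Function.Injective
      (LinearMap.rTensor A (TensorProduct.assoc K T M M).toLinearMap) := by
    have h := (LinearEquiv.rTensor A (TensorProduct.assoc K T M M)).injective
    exact h
  apply hinj
  have e : LinearMap.rTensor A (TensorProduct.assoc K T M M).toLinearMap ∘ₗ
      LinearMap.rTensor A (symm T σ) = LinearMap.rTensor A (LinearMap.lTensor T (1 + braid σ)) ∘ₗ
        LinearMap.rTensor A (TensorProduct.assoc K T M M).toLinearMap := by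
    rw [← LinearMap.rTensor_comp, ← LinearMap.rTensor_comp]
    congr 1
    ext; simp [symm]
  have e' := LinearMap.congr_fun e (sprod (T ⊗[K] M) σ A (sprod T σ A (y ⊗ₜ x) ⊗ₜ z))
  simp only [LinearMap.comp_apply] at e'
  rw [e', map_add, map_add, sprod_assoc σ σ A hσ, sprod_assoc σ σ A hσ, sprod_assoc σ σ A hσ,
    sprod_natural _ A _ _ (braid_parity σ), ← map_add, ← map_add, ← TensorProduct.tmul_add,
    ← TensorProduct.tmul_add, LinearMap.rTensor_add, LinearMap.add_apply, braid_sprod σ A hσ]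
  congr 3
  exact LinearMap.congr_fun (LinearMap.rTensor_id A (M ⊗[K] M)) _

lemma symm_equivariant (hσ : ∀ m, σ (σ m) = m) {f : Module.End K (T ⊗[K] A)}
    {h : Module.End K (M ⊗[K] A)} (hh : h ∈ evenEnd σ A) (u : (T ⊗[K] M) ⊗[K] M) :
    tensorEnd σ A (tensorEnd σ A f h) h (symm T σ u ⊗ₜ 1) =
      LinearMap.rTensor A (symm T σ) (tensorEnd σ A (tensorEnd σ A f h) h (u ⊗ₜ 1)) := by
  induction u with
  | zero => simp
  | add y z hy hz => simp only [TensorProduct.add_tmul, map_add, hy, hz]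
  | tmul tv w =>
    induction tv with
    | zero => simp
    | add y z hy hz => simp only [TensorProduct.add_tmul, map_add, hy, hz]
    | tmul t v =>
      simp only [symm_tmul, TensorProduct.add_tmul, map_add, tensorEnd_tmul, rmul_one,
        symm_sprod σ A hσ, even_evPart σ A hh, even_odPart σ A hh, even_parity σ A hh]

lemma sup_stable {S S' : Submodule K M} {f : Module.End K (M ⊗[K] A)}
    (h : ∀ x ∈ S, f (x ⊗ₜ 1) ∈ baseSub S A) (h' : ∀ x ∈ S', f (x ⊗ₜ 1) ∈ baseSub S' A) :
    ∀ x ∈ S ⊔ S', f (x ⊗ₜ 1) ∈ baseSub (S ⊔ S') A := by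
  intro x hx
  obtain ⟨y, hy, z, hz, rfl⟩ := Submodule.mem_sup.1 hx
  rw [TensorProduct.add_tmul, map_add]
  exact add_mem (Submodule.map₂_le_map₂_left le_sup_left (h y hy))
    (Submodule.map₂_le_map₂_left le_sup_right (h' z hz))

lemma range_stable {l : Module.End K M} {f : Module.End K (M ⊗[K] A)}
    (h : ∀ x, f (l x ⊗ₜ 1) = LinearMap.rTensor A l (f (x ⊗ₜ 1))) :
    ∀ x ∈ LinearMap.range l, f (x ⊗ₜ 1) ∈ baseSub (LinearMap.range l) A := by
  rintro _ ⟨x, rfl⟩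
  rw [h]
  induction f (x ⊗ₜ 1) with
  | zero => simp
  | add y z hy hz => rw [map_add]; exact add_mem hy hz
  | tmul m a => exact tmul_mem_baseSub (LinearMap.mem_range_self l m) a

lemma tensor_stable {S : Submodule K M} {f : Module.End K (M ⊗[K] A)}
    {h : Module.End K (N ⊗[K] A)} (hs : ∀ x ∈ S, f (x ⊗ₜ 1) ∈ baseSub S A) :
    ∀ x ∈ Submodule.map₂ (TensorProduct.mk K M N) S ⊤, tensorEnd τ A f h (x ⊗ₜ 1) ∈
      baseSub (Submodule.map₂ (TensorProduct.mk K M N) S ⊤) A := by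
  intro x hx
  have key : Submodule.map₂ (TensorProduct.mk K M N) S ⊤ ≤
      (baseSub (Submodule.map₂ (TensorProduct.mk K M N) S ⊤) A).comap
        (tensorEnd τ A f h ∘ₗ incl _ A) := by
    refine Submodule.map₂_le.2 fun m hm n _ => ?_
    rw [Submodule.mem_comap, LinearMap.comp_apply, incl_apply, TensorProduct.mk_apply,
      tensorEnd_tmul, rmul_one]
    have h2 : baseSub S A ≤ (baseSub (Submodule.map₂ (TensorProduct.mk K M N) S ⊤) A).comap
        (sprod M τ A ∘ₗ (TensorProduct.mk K _ _).flip (h (n ⊗ₜ 1))) := by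
      refine Submodule.map₂_le.2 fun m hm a _ => ?_
      rw [Submodule.mem_comap, LinearMap.comp_apply, LinearMap.flip_apply,
        TensorProduct.mk_apply, TensorProduct.mk_apply]
      induction h (n ⊗ₜ 1) with
      | zero => simp
      | add y z hy hz => rw [TensorProduct.tmul_add, map_add]; exact add_mem hy hz
      | tmul n b =>
        rw [sprod_tmul]
        exact add_mem (tmul_mem_baseSub (Submodule.apply_mem_map₂ _ hm Submodule.mem_top) _)
          (tmul_mem_baseSub (Submodule.apply_mem_map₂ _ hm Submodule.mem_top) _)
    exact h2 (hs m hm)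
  exact key hx

lemma tensor_parity {S : Submodule K M} (hS : S ≤ S.comap σ) :
    Submodule.map₂ (TensorProduct.mk K M N) S ⊤ ≤
      (Submodule.map₂ (TensorProduct.mk K M N) S ⊤).comap (TensorProduct.map σ τ) :=
  Submodule.map₂_le.2 fun _ hm _ _ => Submodule.apply_mem_map₂ _ (hS hm) trivial

lemma symm_parity (θ : Module.End K T) (u : (T ⊗[K] M) ⊗[K] M) :
    TensorProduct.map (TensorProduct.map θ σ) σ (symm T σ u) =
      symm T σ (TensorProduct.map (TensorProduct.map θ σ) σ u) := by
  induction u with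
  | zero => simp
  | add y z hy hz => simp only [map_add, hy, hz]
  | tmul tv w =>
    induction tv with
    | zero => simp
    | add y z hy hz => simp only [TensorProduct.add_tmul, map_add, hy, hz]
    | tmul t v =>
      have h1 : evPart σ (σ w) = σ (evPart σ w) := by simp [evPart]
      have h2 : odPart σ (σ w) = σ (odPart σ w) := by simp [odPart]
      simp [symm_tmul, h1, h2]

end

variable {V : SuperSpace K} {H : SubgroupFunctor V}

/-- The zero subrepresentation. -/
def Rep.Sub.zero (R : Rep H) : R.Sub where
  carrier := ⊥
  parity_le := bot_le
  stable := fun A g x hx => by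
    obtain rfl : x = 0 := hx
    simp

variable [CharZero K]

/-- For a subrepresentation `S ⊆ T ⊗ R`, the subrepresentation of `T ⊗ R ⊗ R` spanned by `S ⊗ R`
and by the elements `t ⊗ v ⊗ w + (-1)^{|v||w|} t ⊗ w ⊗ v`. -/
def Rep.Sub.step {T R : Rep H} (S : (T.tensor R).Sub) : ((T.tensor R).tensor R).Sub where
  carrier := Submodule.map₂ (TensorProduct.mk K (T.space ⊗[K] R.space) R.space) S.carrier ⊤ ⊔
    LinearMap.range (symm T.space R.space.parity)
  parity_le := sup_le
    ((tensor_parity (TensorProduct.map T.space.parity R.space.parity) R.space.parity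
      S.parity_le).trans (Submodule.comap_mono le_sup_left))
    (by
      rintro _ ⟨x, rfl⟩
      exact Submodule.mem_sup_right ⟨_, (symm_parity R.space.parity T.space.parity x).symm⟩)
  stable := fun A g => sup_stable A
    (tensor_stable R.space.parity A (h := (R.act A g).1) (S.stable A g))
    (range_stable A (symm_equivariant R.space.parity A R.space.parity_parity (R.act A g).2))

/-- The tensor power `R ⊗ ⋯ ⊗ R`. -/
def Rep.tpow (R : Rep H) : ℕ → Rep H
  | 0 => Rep.unit H
  | k + 1 => (Rep.tpow R k).tensor R

/-- The degree `k` component of the two-sided ideal of the tensor algebra generated by the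
elements `v ⊗ w + (-1)^{|v||w|} w ⊗ v`. -/
def Rep.extRel (R : Rep H) : ∀ k : ℕ, (R.tpow k).Sub
  | 0 => Rep.Sub.zero _
  | 1 => Rep.Sub.zero _
  | k + 2 => Rep.Sub.step (T := R.tpow k) (Rep.extRel R (k + 1))

/-- The exterior power `Λ^k R`, the degree `k` component of the tensor algebra modulo the
relations `v ⊗ w = -(-1)^{|v||w|} w ⊗ v`. -/
def Rep.ext (R : Rep H) (k : ℕ) : Rep H := (R.tpow k).quot (R.extRel k)

end Exterior

noncomputable section Duals

variable {K : Type u} [Field K] [CharZero K]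
  {M : Type u} [AddCommGroup M] [Module K M] [Module.Finite K M]

/-- The identification of `M* ⊗ A` with `Hom_A(M ⊗ A, A) = Hom_K(M, A)`,
`φ ⊗ a ↦ (m ↦ (-1)^{|a||m|} φ(m) a)`. -/
def dualEquiv (σ : Module.End K M) (hσ : ∀ m, σ (σ m) = m) (A : SuperCommAlg K) :
    Module.Dual K M ⊗[K] A ≃ₗ[K] (M →ₗ[K] A) :=
  (LinearEquiv.ofInvolutive (TensorProduct.map LinearMap.id A.ev +
    TensorProduct.map σ.dualMap A.od) (fun x => by
      induction x with
      | zero => simp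
      | add y z hy hz => simp only [map_add, hy, hz]
      | tmul φ a =>
        have hφ : σ.dualMap (σ.dualMap φ) = φ := by ext; simp [hσ]
        induction a using A.induction with
        | hadd a a' h h' => simp only [TensorProduct.tmul_add, map_add, h, h']
        | he a ha => simp [A.ev_of_even ha, A.od_of_even ha]
        | ho a ha => simp [A.ev_of_odd ha, A.od_of_odd ha, hφ])).trans
  (dualTensorHomEquiv K M A)

/-- The `A`-linear extension `M ⊗ A → A` of a linear map `M → A`. -/
def evalExt (A : SuperCommAlg K) (ψ : M →ₗ[K] A) : M ⊗[K] A →ₗ[K] A :=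
  LinearMap.mul' K A ∘ₗ LinearMap.rTensor A ψ

/-- Precomposition with `f`, as a map on `Hom_A(M ⊗ A, A) = Hom_K(M, A)`. -/
def precomp (A : SuperCommAlg K) (f : Module.End K (M ⊗[K] A)) : Module.End K (M →ₗ[K] A) where
  toFun ψ := evalExt A ψ ∘ₗ f ∘ₗ incl M A
  map_add' ψ ψ' := by simp [evalExt, LinearMap.add_comp, LinearMap.comp_add]
  map_smul' c ψ := by simp [evalExt, LinearMap.smul_comp, LinearMap.comp_smul]

/-- The (contravariant) transpose of `f`, acting on `M* ⊗ A`. -/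
def dualEnd (σ : Module.End K M) (hσ : ∀ m, σ (σ m) = m) (A : SuperCommAlg K)
    (f : Module.End K (M ⊗[K] A)) : Module.End K (Module.Dual K M ⊗[K] A) :=
  (dualEquiv σ hσ A).symm.toLinearMap ∘ₗ precomp A f ∘ₗ (dualEquiv σ hσ A).toLinearMap

section
variable (σ : Module.End K M) (hσ : ∀ m, σ (σ m) = m) (A : SuperCommAlg K)

lemma dualEquiv_tmul (φ : Module.Dual K M) (a : A) (m : M) :
    dualEquiv σ hσ A (φ ⊗ₜ a) m = φ m • A.ev a + φ (σ m) • A.od a := by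
  change dualTensorHom K M A ((TensorProduct.map (LinearMap.id : Module.Dual K M →ₗ[K] _) A.ev +
    TensorProduct.map σ.dualMap A.od : Module.End K (Module.Dual K M ⊗[K] A)) (φ ⊗ₜ a)) m = _
  simp

lemma evalExt_tmul (ψ : M →ₗ[K] A) (m : M) (a : A) : evalExt A ψ (m ⊗ₜ a) = ψ m * a := by
  simp [evalExt]

lemma precomp_apply (f : Module.End K (M ⊗[K] A)) (ψ : M →ₗ[K] A) (m : M) :
    precomp A f ψ m = evalExt A ψ (f (m ⊗ₜ 1)) := rfl

lemma dualEquiv_dualEnd (f : Module.End K (M ⊗[K] A)) (x : Module.Dual K M ⊗[K] A) :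
    dualEquiv σ hσ A (dualEnd σ hσ A f x) = precomp A f (dualEquiv σ hσ A x) := by
  simp [dualEnd]

lemma evalExt_rmul (ψ : M →ₗ[K] A) (a : A) (x : M ⊗[K] A) :
    evalExt A ψ (rmul M A a x) = evalExt A ψ x * a := by
  induction x with
  | zero => simp
  | tmul y b => simp [evalExt_tmul, mul_assoc]
  | add y z hy hz => simp only [map_add, hy, hz, add_mul]

lemma evalExt_precomp {f : Module.End K (M ⊗[K] A)}
    (hf : ∀ a x, f (rmul M A a x) = rmul M A a (f x)) (ψ : M →ₗ[K] A) (x : M ⊗[K] A) :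
    evalExt A (precomp A f ψ) x = evalExt A ψ (f x) := by
  induction x with
  | zero => simp
  | tmul y b => rw [apply_tmul A hf, evalExt_rmul, evalExt_tmul, precomp_apply]
  | add y z hy hz => simp only [map_add, hy, hz]

lemma dualEquiv_par (x : Module.Dual K M ⊗[K] A) (m : M) :
    dualEquiv σ hσ A (par σ.dualMap A x) m = A.parity (dualEquiv σ hσ A x (σ m)) := by
  induction x with
  | zero => simp
  | add y z hy hz => simp only [map_add, LinearMap.add_apply, hy, hz]
  | tmul φ a =>
    have h1 : A.ev (A.parity a) = A.parity (A.ev a) := by simp [SuperCommAlg.ev]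
    have h2 : A.od (A.parity a) = A.parity (A.od a) := by simp [SuperCommAlg.od]
    rw [par_tmul, dualEquiv_tmul, dualEquiv_tmul, h1, h2]
    simp

lemma dualEquiv_rmul_even {a : A} (ha : A.parity a = a) (x : Module.Dual K M ⊗[K] A) (m : M) :
    dualEquiv σ hσ A (rmul _ A a x) m = dualEquiv σ hσ A x m * a := by
  induction x with
  | zero => simp
  | add y z hy hz => simp only [map_add, LinearMap.add_apply, hy, hz, add_mul]
  | tmul φ b =>
    have h1 : A.ev (b * a) = A.ev b * a := by simp [SuperCommAlg.ev, ha, add_mul]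
    have h2 : A.od (b * a) = A.od b * a := by simp [SuperCommAlg.od, ha, sub_mul]
    rw [rmul_tmul, dualEquiv_tmul, dualEquiv_tmul, h1, h2]
    simp [add_mul]

lemma dualEquiv_rmul_odd {a : A} (ha : A.parity a = -a) (x : Module.Dual K M ⊗[K] A) (m : M) :
    dualEquiv σ hσ A (rmul _ A a x) m = dualEquiv σ hσ A x (σ m) * a := by
  induction x with
  | zero => simp
  | add y z hy hz => simp only [map_add, LinearMap.add_apply, hy, hz, add_mul]
  | tmul φ b =>
    have h1 : A.ev (b * a) = A.od b * a := by
      simp [SuperCommAlg.ev, SuperCommAlg.od, ha, sub_eq_add_neg, add_mul]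
    have h2 : A.od (b * a) = A.ev b * a := by
      simp [SuperCommAlg.ev, SuperCommAlg.od, ha, add_mul, sub_eq_add_neg]
    rw [rmul_tmul, dualEquiv_tmul, dualEquiv_tmul, h1, h2]
    simp [add_mul, hσ, add_comm]

lemma dualEnd_mem {f : Module.End K (M ⊗[K] A)} (hf : f ∈ evenEnd σ A) :
    dualEnd σ hσ A f ∈ evenEnd σ.dualMap A := by
  constructor
  · intro x
    apply (dualEquiv σ hσ A).injective
    ext m
    rw [dualEquiv_dualEnd, precomp_apply, dualEquiv_par, dualEquiv_dualEnd, precomp_apply,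
      even_parity σ A hf]
    induction f (m ⊗ₜ 1) with
    | zero => simp
    | add y z hy hz => simp only [map_add, hy, hz]
    | tmul n b =>
      rw [evalExt_tmul, par_tmul, evalExt_tmul, dualEquiv_par, map_mul, A.parity_parity]
  · intro a x
    apply (dualEquiv σ hσ A).injective
    induction a using A.induction with
    | hadd a a' h h' =>
      have e : ∀ (X : Type u) [AddCommGroup X] [Module K X] (y : X ⊗[K] A),
          rmul X A (a + a') y = rmul X A a y + rmul X A a' y := by
        intro X _ _ y
        induction y with
        | zero => simp
        | add y z hy hz => simp only [map_add, hy, hz]; abel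
        | tmul y b => simp [mul_add, TensorProduct.tmul_add]
      rw [e, e, map_add, map_add, map_add, h, h']
    | he a ha =>
      ext m
      rw [dualEquiv_dualEnd, precomp_apply, dualEquiv_rmul_even σ hσ A ha, dualEquiv_dualEnd,
        precomp_apply]
      induction f (m ⊗ₜ 1) with
      | zero => simp
      | add y z hy hz => simp only [map_add, hy, hz, add_mul]
      | tmul n b =>
        rw [evalExt_tmul, evalExt_tmul, dualEquiv_rmul_even σ hσ A ha, mul_assoc, mul_assoc,
          A.even_comm a b ha]
    | ho a ha =>
      ext m
      rw [dualEquiv_dualEnd, precomp_apply, dualEquiv_rmul_odd σ hσ A ha, dualEquiv_dualEnd,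
        precomp_apply, even_parity σ A hf]
      induction f (m ⊗ₜ 1) with
      | zero => simp
      | add y z hy hz => simp only [map_add, hy, hz, add_mul]
      | tmul n b =>
        have hc : a * b = A.parity b * a := by
          induction b using A.induction with
          | hadd b b' h h' => simp only [map_add, mul_add, add_mul, h, h']
          | he c hc => rw [hc, A.even_comm c a hc]
          | ho c hc => rw [hc, neg_mul, A.odd_anticomm a c ha hc]
        rw [evalExt_tmul, par_tmul, evalExt_tmul, dualEquiv_rmul_odd σ hσ A ha, mul_assoc,
          mul_assoc, hc]

lemma dualEnd_one : dualEnd σ hσ A 1 = 1 := by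
  refine LinearMap.ext fun x => (dualEquiv σ hσ A).injective (LinearMap.ext fun m => ?_)
  rw [dualEquiv_dualEnd, precomp_apply, Module.End.one_apply, Module.End.one_apply, evalExt_tmul,
    mul_one]

lemma dualEnd_mul {f : Module.End K (M ⊗[K] A)}
    (hf : ∀ a x, f (rmul M A a x) = rmul M A a (f x)) (g : Module.End K (M ⊗[K] A)) :
    dualEnd σ hσ A (f * g) = dualEnd σ hσ A g * dualEnd σ hσ A f := by
  refine LinearMap.ext fun x => (dualEquiv σ hσ A).injective (LinearMap.ext fun m => ?_)
  rw [dualEquiv_dualEnd, Module.End.mul_apply, dualEquiv_dualEnd, dualEquiv_dualEnd,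
    precomp_apply, precomp_apply, evalExt_precomp A hf, Module.End.mul_apply]

/-- The contragredient action on `M* ⊗ A`. -/
def dualHom {G : Type u} [Group G] (f : G →* evenEnd σ A) : G →* evenEnd σ.dualMap A where
  toFun g := ⟨dualEnd σ hσ A (f g⁻¹).1, dualEnd_mem σ hσ A (f g⁻¹).2⟩
  map_one' := Subtype.ext (by
    simp only [inv_one, map_one]
    exact dualEnd_one σ hσ A)
  map_mul' a b := Subtype.ext (by
    simp only [mul_inv_rev, map_mul]
    exact dualEnd_mul σ hσ A (f b⁻¹).2.2 _)

lemma dualEnd_baseChange {B : SuperCommAlg K} (φ : SHom A B)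
    {f : Module.End K (M ⊗[K] A)} {f' : Module.End K (M ⊗[K] B)} (h : IsBaseChange φ f f') :
    IsBaseChange φ (dualEnd σ hσ A f) (dualEnd σ hσ B f') := by
  have key : ∀ x m, dualEquiv σ hσ B (LinearMap.lTensor _ φ.toAlgHom.toLinearMap x) m =
      φ.toAlgHom (dualEquiv σ hσ A x m) := by
    intro x m
    induction x with
    | zero => simp
    | add y z hy hz => simp only [map_add, LinearMap.add_apply, hy, hz]
    | tmul n a =>
      have h1 : φ.toAlgHom (A.ev a) = B.ev (φ.toAlgHom a) := by
        simp [SuperCommAlg.ev, φ.map_parity]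
      have h2 : φ.toAlgHom (A.od a) = B.od (φ.toAlgHom a) := by
        simp [SuperCommAlg.od, φ.map_parity]
      rw [LinearMap.lTensor_tmul, dualEquiv_tmul, dualEquiv_tmul]
      simp [h1, h2]
  intro x
  apply (dualEquiv σ hσ B).injective
  ext m
  have h0 := h (m ⊗ₜ 1)
  rw [LinearMap.lTensor_tmul] at h0
  simp only [AlgHom.toLinearMap_apply, map_one] at h0
  rw [dualEquiv_dualEnd, key, dualEquiv_dualEnd, precomp_apply, precomp_apply, h0]
  induction f (m ⊗ₜ 1) with
  | zero => simp
  | add y z hy hz => simp only [map_add, hy, hz]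
  | tmul n b =>
    rw [LinearMap.lTensor_tmul, evalExt_tmul, evalExt_tmul, key, map_mul]; rfl

end

variable {V : SuperSpace K} {H : SubgroupFunctor V}

/-- The dual superspace. -/
def SuperSpace.dual (M : SuperSpace K) : SuperSpace K where
  carrier := Module.Dual K M
  parity := LinearMap.dualMap M.parity
  parity_parity := fun φ => by ext; simp [M.parity_parity]

lemma isBaseChange_inv {A B : SuperCommAlg K} (φ : SHom A B) {g : SGL V A} {g' : SGL V B}
    (h : IsBaseChange φ g.1.1 g'.1.1) : IsBaseChange φ (g⁻¹).1.1 (g'⁻¹).1.1 := by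
  have h1 : ∀ y, g.1.1 (g⁻¹.1.1 y) = y := fun y =>
    congrArg (fun f : evenEnd V.parity A => f.1 y) g.mul_inv
  have h2 : ∀ y, g'⁻¹.1.1 (g'.1.1 y) = y := fun y =>
    congrArg (fun f : evenEnd V.parity B => f.1 y) g'.inv_mul
  intro x
  have := h (g⁻¹.1.1 x)
  rw [h1] at this
  rw [← this, h2]

/-- The dual representation. -/
def Rep.dual (R : Rep H) : Rep H where
  space := R.space.dual
  act := fun A => dualHom R.space.parity R.space.parity_parity A (R.act A)
  natural := fun A B φ g g' hg => dualEnd_baseChange R.space.parity R.space.parity_parity A φ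
    (R.natural A B φ g⁻¹ g'⁻¹ (isBaseChange_inv φ hg))

end Duals

noncomputable section Berezinian

variable {K : Type u} [Field K]

/-- The subalgebra of even elements. -/
def SuperCommAlg.even (A : SuperCommAlg K) : Subalgebra K A :=
  AlgHom.equalizer A.parity (AlgHom.id K A)

/-- Even elements form a commutative ring. -/
instance (A : SuperCommAlg K) : CommRing A.even :=
  { (inferInstance : Ring A.even) with
    mul_comm := fun a b => Subtype.ext (A.even_comm a.1 b.1 a.2) }

/-- The even component, as an element of the even subalgebra. -/
def SuperCommAlg.evProj (A : SuperCommAlg K) (a : A) : A.even :=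
  ⟨A.ev a, by
    change A.parity _ = _
    simp [SuperCommAlg.ev, A.parity_parity, add_comm]⟩

section
variable (A : SuperCommAlg K) {m n l : Type} [Fintype m] [Fintype n] [Fintype l]
  [DecidableEq m] [DecidableEq n] [DecidableEq l]

/-- The determinant of a square matrix with even entries (computed in the commutative ring of
even elements). -/
def edet (X : Matrix n n A) : A := ((X.map A.evProj).det : A.even)

/-- The inverse of an invertible square matrix with even entries. -/
def einv (X : Matrix n n A) : Matrix n n A := ((X.map A.evProj)⁻¹).map Subtype.val

/-- The Berezinian `det(a - b d⁻¹ c) (det d)⁻¹` of a supermatrix with even diagonal blocks `a`,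
`d` and odd off-diagonal blocks `b`, `c`, with `d` invertible. -/
def ber (a : Matrix m m A) (b : Matrix m n A) (c : Matrix n m A) (d : Matrix n n A) : A :=
  edet A (a - b * einv A d * c) * edet A (einv A d)

/-- All entries are even. -/
def IsEv (X : Matrix m n A) : Prop := ∀ i j, A.parity (X i j) = X i j

/-- All entries are odd. -/
def IsOd (X : Matrix m n A) : Prop := ∀ i j, A.parity (X i j) = -X i j

variable {A}

lemma IsEv.mul {X : Matrix m n A} {Y : Matrix n l A} (hX : IsEv A X) (hY : IsEv A Y) :
    IsEv A (X * Y) := fun i j => by simp [Matrix.mul_apply, hX _ _, hY _ _]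

lemma IsOd.mul {X : Matrix m n A} {Y : Matrix n l A} (hX : IsOd A X) (hY : IsOd A Y) :
    IsEv A (X * Y) := fun i j => by simp [Matrix.mul_apply, hX _ _, hY _ _]

lemma IsEv.mul_od {X : Matrix m n A} {Y : Matrix n l A} (hX : IsEv A X) (hY : IsOd A Y) :
    IsOd A (X * Y) := fun i j => by simp [Matrix.mul_apply, hX _ _, hY _ _]

lemma IsOd.mul_ev {X : Matrix m n A} {Y : Matrix n l A} (hX : IsOd A X) (hY : IsEv A Y) :
    IsOd A (X * Y) := fun i j => by simp [Matrix.mul_apply, hX _ _, hY _ _]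

lemma IsEv.add {X Y : Matrix m n A} (hX : IsEv A X) (hY : IsEv A Y) : IsEv A (X + Y) :=
  fun i j => by simp [hX _ _, hY _ _]

lemma IsEv.sub {X Y : Matrix m n A} (hX : IsEv A X) (hY : IsEv A Y) : IsEv A (X - Y) :=
  fun i j => by simp [hX _ _, hY _ _]

lemma IsOd.add {X Y : Matrix m n A} (hX : IsOd A X) (hY : IsOd A Y) : IsOd A (X + Y) :=
  fun i j => by simp [hX _ _, hY _ _, add_comm]

lemma IsOd.neg {X : Matrix m n A} (hX : IsOd A X) : IsOd A (-X) :=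
  fun i j => by simp [hX _ _]

lemma isEv_one : IsEv A (1 : Matrix n n A) := fun i j => by
  rcases eq_or_ne i j with rfl | h
  · simp
  · simp [Matrix.one_apply_ne h]

lemma isEv_map (X : Matrix m n A.even) : IsEv A (X.map Subtype.val) := fun i j => (X i j).2

lemma map_val_mul (X : Matrix m n A.even) (Y : Matrix n l A.even) :
    (X * Y).map Subtype.val = X.map Subtype.val * Y.map Subtype.val :=
  Matrix.map_mul (f := A.even.val)

lemma map_val_one : (1 : Matrix n n A.even).map Subtype.val = (1 : Matrix n n A) :=
  Matrix.map_one _ rfl rfl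

variable [CharZero K]

lemma evProj_val (a : A.even) : A.evProj a.1 = a := Subtype.ext (A.ev_of_even a.2)

lemma map_evProj (X : Matrix m n A.even) : (X.map Subtype.val).map A.evProj = X := by
  ext i j; exact congrArg Subtype.val (evProj_val _)

lemma IsEv.map_val {X : Matrix m n A} (hX : IsEv A X) : (X.map A.evProj).map Subtype.val = X := by
  ext i j; exact A.ev_of_even (hX i j)

lemma edet_map (X : Matrix n n A.even) : edet A (X.map Subtype.val) = X.det := by
  rw [edet, map_evProj]

lemma edet_mul {X Y : Matrix n n A} (hX : IsEv A X) (hY : IsEv A Y) :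
    edet A (X * Y) = edet A X * edet A Y := by
  rw [← hX.map_val, ← hY.map_val, ← map_val_mul, edet_map, edet_map, edet_map, Matrix.det_mul]
  rfl

lemma edet_one : edet A (1 : Matrix n n A) = 1 := by
  rw [← map_val_one, edet_map, Matrix.det_one]; rfl

lemma edet_comm {X : Matrix n n A} (a : A) : edet A X * a = a * edet A X :=
  A.even_comm _ _ ((X.map A.evProj).det.2)

lemma einv_eq {d e : Matrix n n A} (hd : IsEv A d) (he : IsEv A e) (h : d * e = 1) :
    einv A d = e := by
  have : d.map A.evProj * e.map A.evProj = 1 := by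
    rw [← map_evProj (d.map A.evProj * e.map A.evProj), map_val_mul, hd.map_val, he.map_val, h,
      ← map_val_one, map_evProj]
  rw [einv, Matrix.inv_eq_right_inv this, he.map_val]

/-- A two-sided even inverse. -/
structure EvInv (d e : Matrix n n A) : Prop where
  hd : IsEv A d
  he : IsEv A e
  right : d * e = 1
  left : e * d = 1

lemma evInv_of_isUnit {d : Matrix n n A} (hd : IsEv A d) (h : IsUnit (d.map A.evProj).det) :
    EvInv d (einv A d) := by
  refine ⟨hd, isEv_map _, ?_, ?_⟩
  · calc d * einv A d = (d.map A.evProj).map Subtype.val * einv A d := by rw [hd.map_val]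
      _ = 1 := by rw [einv, ← map_val_mul, Matrix.mul_nonsing_inv _ h, map_val_one]
  · calc einv A d * d = einv A d * (d.map A.evProj).map Subtype.val := by rw [hd.map_val]
      _ = 1 := by rw [einv, ← map_val_mul, Matrix.nonsing_inv_mul _ h, map_val_one]

lemma od_sq {x : A} (hx : A.parity x = -x) : x * x = 0 := by
  have h2 : (2 : K) ≠ 0 := two_ne_zero
  have h := A.odd_anticomm x x hx hx
  have : (2 : K) • (x * x) = 0 := by rw [two_smul]; nth_rw 1 [h]; simp
  exact (smul_eq_zero.1 this).resolve_left h2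

lemma od_mul_sq {x y : A} (hx : A.parity x = -x) (hy : A.parity y = -y) :
    (x * y) * (x * y) = 0 := by
  rw [mul_assoc, ← mul_assoc y, A.odd_anticomm y x hy hx, neg_mul, mul_neg, mul_assoc x,
    ← mul_assoc, od_sq hx, zero_mul, neg_zero]

lemma isUnit_one_add {x : Matrix m n A} {y : Matrix n m A} (hx : IsOd A x) (hy : IsOd A y) :
    IsUnit ((1 + x * y).map A.evProj).det := by
  have hN : ∀ i j, IsNilpotent (((x * y).map A.evProj) i j) := by
    intro i j
    have e : ((x * y).map A.evProj) i j = ∑ k, A.evProj (x i k * y k j) := by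
      apply Subtype.ext
      rw [AddSubmonoidClass.coe_finsetSum]
      simp only [Matrix.map_apply, Matrix.mul_apply, SuperCommAlg.evProj]
      exact map_sum A.ev _ _
    rw [e]
    refine isNilpotent_sum fun k _ => ⟨2, ?_⟩
    have h1 : A.parity (x i k * y k j) = x i k * y k j := by rw [map_mul, hx, hy, neg_mul_neg]
    apply Subtype.ext
    rw [pow_two]
    change A.ev _ * A.ev _ = 0
    rw [A.ev_of_even h1, od_mul_sq (hx i k) (hy k j)]
  have hm : (1 + x * y).map A.evProj = 1 + (x * y).map A.evProj := by
    conv_lhs => rw [← map_val_one, ← (hx.mul hy).map_val, ← Matrix.map_add _ (fun _ _ => rfl)]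
    rw [map_evProj]
  rw [hm]
  let Q := Ideal.Quotient.mk (nilradical A.even)
  have h0 : (Q.mapMatrix (1 + (x * y).map A.evProj)) = 1 := by
    rw [map_add, map_one]
    have : Q.mapMatrix ((x * y).map A.evProj) = 0 := by
      ext i j
      exact Ideal.Quotient.eq_zero_iff_mem.2 (hN i j)
    rw [this, add_zero]
  have h1 : Q (1 + (x * y).map A.evProj).det = 1 := by
    rw [RingHom.map_det, h0, Matrix.det_one]
  have h2 : IsNilpotent ((1 + (x * y).map A.evProj).det - 1) := by
    have : Q ((1 + (x * y).map A.evProj).det - 1) = 0 := by rw [map_sub, h1, map_one, sub_self]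
    exact Ideal.Quotient.eq_zero_iff_mem.1 this
  have h3 := h2.isUnit_add_one
  rwa [sub_add_cancel] at h3

lemma evInv_one_add {x : Matrix m n A} {y : Matrix n m A} (hx : IsOd A x) (hy : IsOd A y) :
    EvInv (1 + x * y) (einv A (1 + x * y)) :=
  evInv_of_isUnit (isEv_one.add (hx.mul hy)) (isUnit_one_add hx hy)

lemma EvInv.mul {d e d' e' : Matrix n n A} (h : EvInv d e) (h' : EvInv d' e') :
    EvInv (d * d') (e' * e) := by
  refine ⟨h.hd.mul h'.hd, h'.he.mul h.he, ?_, ?_⟩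
  · rw [Matrix.mul_assoc, ← Matrix.mul_assoc d', h'.right, Matrix.one_mul, h.right]
  · rw [Matrix.mul_assoc, ← Matrix.mul_assoc e, h.left, Matrix.one_mul, h'.left]

lemma EvInv.edet {d e : Matrix n n A} (h : EvInv d e) : edet A d * edet A e = 1 := by
  rw [← edet_mul h.hd h.he, h.right, edet_one]

lemma ber_eq {d e : Matrix n n A} (h : EvInv d e) (a : Matrix m m A) (b : Matrix m n A)
    (c : Matrix n m A) : ber A a b c d = edet A (a - b * e * c) * edet A e := by
  rw [ber, einv_eq h.hd h.he h.right]

lemma edet_single {x : Matrix m n A} (hx : IsOd A x) (j : n) (i : m) {η : A}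
    (hη : A.parity η = -η) :
    edet A (1 + x * Matrix.single j i η) * edet A (1 + Matrix.single j i η * x) = 1 := by
  have hs : IsOd A (Matrix.single j i η) := fun k k' => by
    by_cases h : j = k ∧ i = k' <;> simp [Matrix.single, h, hη]
  have ho : ∀ k k', A.parity (x k k' * η) = x k k' * η := fun k k' => by
    rw [map_mul, hx, hη, neg_mul_neg]
  have ho' : ∀ k k', A.parity (η * x k k') = η * x k k' := fun k k' => by
    rw [map_mul, hx, hη, neg_mul_neg]
  have hod : A.parity (x i j) = -x i j := hx i j
  have e1 : 1 + x * Matrix.single j i η =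
      (1 + Matrix.replicateCol Unit (fun k => A.evProj (x k j * η)) *
        Matrix.replicateRow Unit (Pi.single i (1 : A.even))).map Subtype.val := by
    ext k k'
    have : (x * Matrix.single j i η) k k' = if i = k' then x k j * η else 0 := by
      split_ifs with h
      · subst h; simp
      · simp [Ne.symm h]
    rw [Matrix.add_apply, this]
    simp only [Matrix.map_apply, Matrix.add_apply, Matrix.mul_apply, Matrix.replicateCol_apply,
      Matrix.replicateRow_apply, Finset.univ_unique, Finset.sum_singleton, Pi.single_apply]
    by_cases h : i = k'
    · subst h
      by_cases h' : k = i
      · subst h'; simp [SuperCommAlg.evProj, A.ev_of_even (ho _ _)]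
      · simp [h', SuperCommAlg.evProj, A.ev_of_even (ho _ _)]
    · by_cases h' : k = k'
      · subst h'; simp [h, Ne.symm h]
      · simp [h, h', Ne.symm h]
  have e2 : 1 + Matrix.single j i η * x =
      (1 + Matrix.replicateCol Unit (Pi.single j (1 : A.even)) *
        Matrix.replicateRow Unit (fun k => A.evProj (η * x i k))).map Subtype.val := by
    ext k k'
    have : (Matrix.single j i η * x) k k' = if j = k then η * x i k' else 0 := by
      split_ifs with h
      · subst h; simp
      · simp [Ne.symm h]
    rw [Matrix.add_apply, this]
    simp only [Matrix.map_apply, Matrix.add_apply, Matrix.mul_apply, Matrix.replicateCol_apply,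
      Matrix.replicateRow_apply, Finset.univ_unique, Finset.sum_singleton, Pi.single_apply]
    by_cases h : j = k
    · subst h
      by_cases h' : k' = j
      · subst h'; simp [SuperCommAlg.evProj, A.ev_of_even (ho' _ _)]
      · simp [Ne.symm h', SuperCommAlg.evProj, A.ev_of_even (ho' _ _)]
    · by_cases h' : k = k'
      · subst h'; simp [h, Ne.symm h]
      · simp [h, h', Ne.symm h]
  rw [e1, e2, edet_map, edet_map, Matrix.det_one_add_replicateCol_mul_replicateRow,
    Matrix.det_one_add_replicateCol_mul_replicateRow]
  simp only [single_one_dotProduct, dotProduct_single_one]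
  have v1 : (A.evProj (x i j * η) : A) = x i j * η := A.ev_of_even (ho i j)
  have v2 : (A.evProj (η * x i j) : A) = η * x i j := A.ev_of_even (ho' i j)
  change (1 + (A.evProj (x i j * η) : A)) * (1 + (A.evProj (η * x i j) : A)) = 1
  rw [v1, v2, A.odd_anticomm η (x i j) hη hod, mul_add, mul_one, add_mul, one_mul, mul_neg,
    od_mul_sq hod hη]
  abel

/-- The key identity `det(1 - x (1 + y x)⁻¹ y) = det(1 + y x)` for odd `x` and single-entry `y`. -/
lemma edet_key {x : Matrix m n A} (hx : IsOd A x) {y : Matrix n m A} (hy : IsOd A y)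
    (h : edet A (1 + x * y) * edet A (1 + y * x) = 1) {w : Matrix n n A}
    (hw : EvInv (1 + y * x) w) : edet A (1 - x * w * y) * edet A w = 1 := by
  have h1 : (1 - x * w * y) * (1 + x * y) = 1 := by
    have : x * (w * (1 + y * x)) * y = x * y := by rw [hw.left, Matrix.mul_one]
    rw [Matrix.mul_add, Matrix.mul_one, Matrix.mul_add, Matrix.add_mul] at this
    rw [Matrix.mul_add, Matrix.mul_one, Matrix.sub_mul, Matrix.one_mul]
    simp only [Matrix.mul_assoc] at this ⊢
    rw [sub_add_sub_comm, add_sub_assoc, this]; abel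
  have h2 : edet A (1 - x * w * y) * edet A (1 + x * y) = 1 := by
    rw [← edet_mul (isEv_one.sub ((hx.mul_ev hw.he).mul hy)) (isEv_one.add (hx.mul hy)), h1,
      edet_one]
  have h3 := hw.edet
  calc edet A (1 - x * w * y) * edet A w
      = edet A (1 - x * w * y) * (edet A (1 + x * y) * edet A (1 + y * x)) * edet A w := by
        rw [h, mul_one]
    _ = (edet A (1 - x * w * y) * edet A (1 + x * y)) * (edet A (1 + y * x) * edet A w) := by
        simp only [mul_assoc]
    _ = 1 := by rw [h2, h3, one_mul]

/-- `Ber` is invariant under left multiplication by lower unitriangular matrices. -/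
def LInv (y : Matrix n m A) : Prop :=
  ∀ (a : Matrix m m A) (b : Matrix m n A) (c : Matrix n m A) (d : Matrix n n A), IsEv A a →
    IsOd A b → IsOd A c → (∃ e, EvInv d e) → ber A a b (c + y * a) (d + y * b) = ber A a b c d

lemma exists_inv {y : Matrix n m A} {b : Matrix m n A} {d : Matrix n n A} (hy : IsOd A y)
    (hb : IsOd A b) (h : ∃ e, EvInv d e) : ∃ e, EvInv (d + y * b) e := by
  obtain ⟨e, he⟩ := h
  have h1 := (evInv_one_add hy (hb.mul_ev he.he)).mul he
  have h2 : (1 + y * (b * e)) * d = d + y * b := by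
    rw [Matrix.add_mul, Matrix.one_mul, Matrix.mul_assoc, Matrix.mul_assoc, he.left,
      Matrix.mul_one]
  rw [h2] at h1
  exact ⟨_, h1⟩

lemma lInv_of {y : Matrix n m A} (hy : IsOd A y)
    (h : ∀ x : Matrix m n A, IsOd A x → edet A (1 + x * y) * edet A (1 + y * x) = 1) :
    LInv y := by
  intro a b c d ha hb hc ⟨e, he⟩
  have hx : IsOd A (b * e) := hb.mul_ev he.he
  have hw := evInv_one_add hy hx
  have h1 := hw.mul he
  have h2 : (1 + y * (b * e)) * d = d + y * b := by
    rw [Matrix.add_mul, Matrix.one_mul, Matrix.mul_assoc, Matrix.mul_assoc, he.left,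
      Matrix.mul_one]
  rw [h2] at h1
  have hk := edet_key hx hy (h _ hx) hw
  have hs : IsEv A (a - b * e * c) := ha.sub (hx.mul hc)
  rw [ber_eq h1, ber_eq he]
  generalize hx' : b * e = x at *
  generalize einv A (1 + y * x) = w at *
  have e3 : a - b * (e * w) * (c + y * a) = (1 - x * w * y) * (a - x * c) := by
    have hl : w * (1 + y * x) = 1 := hw.left
    have e4 : x * (w * (1 + y * x)) * c = x * c := by rw [hl, Matrix.mul_one]
    rw [Matrix.mul_add, Matrix.mul_one, Matrix.mul_add, Matrix.add_mul] at e4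
    rw [← Matrix.mul_assoc b, hx', Matrix.mul_add, Matrix.sub_mul, Matrix.one_mul, Matrix.mul_sub]
    simp only [Matrix.mul_assoc] at e4 ⊢
    generalize x * (w * (y * (x * c))) = P at e4 ⊢
    rw [← e4]; abel
  rw [e3, edet_mul (isEv_one.sub ((hx.mul_ev hw.he).mul hy)) hs, edet_mul he.he hw.he]
  calc _ = (edet A (1 - x * w * y) * edet A w) * (edet A (a - x * c) * edet A e) := by
        rw [mul_assoc _ (edet A w), edet_comm (X := w) (edet A (a - x * c) * edet A e)]
        simp only [mul_assoc]
    _ = _ := by rw [hk, one_mul]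

lemma lInv_add {y y' : Matrix n m A} (hy' : IsOd A y') (h : LInv y) (h' : LInv y') :
    LInv (y + y') := by
  intro a b c d ha hb hc hd
  rw [Matrix.add_mul, Matrix.add_mul, add_comm (y * a), add_comm (y * b), ← add_assoc,
    ← add_assoc, h a b _ _ ha hb (hc.add (hy'.mul_ev ha)) (exists_inv hy' hb hd),
    h' a b c d ha hb hc hd]

lemma lInv (y : Matrix n m A) (hy : IsOd A y) : LInv y := by
  have key : IsOd A y ∧ LInv y := by
    rw [Matrix.matrix_eq_sum_single y]
    have h0 : IsOd A (0 : Matrix n m A) ∧ LInv (0 : Matrix n m A) :=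
      ⟨fun i j => by simp, fun a b c d _ _ _ _ => by simp⟩
    refine Finset.sum_induction _ (fun z => IsOd A z ∧ LInv z)
      (fun u v hu hv => ⟨hu.1.add hv.1, lInv_add hv.1 hu.2 hv.2⟩) h0 fun j _ => ?_
    refine Finset.sum_induction _ (fun z => IsOd A z ∧ LInv z)
      (fun u v hu hv => ⟨hu.1.add hv.1, lInv_add hv.1 hu.2 hv.2⟩) h0 fun i _ => ?_
    have hs : IsOd A (Matrix.single j i (y j i)) := fun k k' => by
      by_cases h : j = k ∧ i = k'
      · obtain ⟨rfl, rfl⟩ := h; simp [hy j i]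
      · simp [Matrix.single, h]
    exact ⟨hs, lInv_of hs fun x hx => edet_single hx j i (hy j i)⟩
  exact key.2

/-- Multiplicativity of the Berezinian. -/
theorem ber_mul {a a' : Matrix m m A} {b b' : Matrix m n A} {c c' : Matrix n m A}
    {d d' e e' : Matrix n n A} (ha : IsEv A a) (hb : IsOd A b) (hc : IsOd A c) (he : EvInv d e)
    (ha' : IsEv A a') (hb' : IsOd A b') (hc' : IsOd A c') (he' : EvInv d' e') :
    ber A (a * a' + b * c') (a * b' + b * d') (c * a' + d * c') (c * b' + d * d') =
      ber A a b c d * ber A a' b' c' d' := by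
  have hz : IsOd A (e * c) := he.he.mul_od hc
  obtain ⟨v, hv⟩ := exists_inv hz hb' ⟨e', he'⟩
  rw [← lInv _ hz a' b' c' d' ha' hb' hc' ⟨e', he'⟩, ber_eq hv, ber_eq he]
  have h1 : c * b' + d * d' = d * (d' + e * c * b') := by
    rw [Matrix.mul_add, ← Matrix.mul_assoc, ← Matrix.mul_assoc, he.right, Matrix.one_mul, add_comm]
  have h2 : c * a' + d * c' = d * (c' + e * c * a') := by
    rw [Matrix.mul_add, ← Matrix.mul_assoc, ← Matrix.mul_assoc, he.right, Matrix.one_mul, add_comm]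
  rw [h1, h2, ber_eq (he.mul hv)]
  have h3 : a * a' + b * c' - (a * b' + b * d') * (v * e) * (d * (c' + e * c * a')) =
      (a - b * e * c) * (a' - b' * v * (c' + e * c * a')) := by
    have h4 : (v * e) * (d * (c' + e * c * a')) = v * (c' + e * c * a') := by
      rw [Matrix.mul_assoc, ← Matrix.mul_assoc e, he.left, Matrix.one_mul]
    have h5 : b * ((d' + e * c * b') * v) * (c' + e * c * a') = b * (c' + e * c * a') := by
      rw [hv.right, Matrix.mul_one]
    have h6 : b * (c' + e * c * a') = b * c' + b * (e * (c * a')) := by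
      rw [Matrix.mul_add]; simp only [Matrix.mul_assoc]
    rw [Matrix.mul_assoc, h4]
    rw [h6] at h5
    generalize c' + e * c * a' = u at *
    rw [Matrix.add_mul, Matrix.mul_add, Matrix.add_mul] at h5
    rw [Matrix.sub_mul, Matrix.mul_sub, Matrix.mul_sub, Matrix.add_mul]
    simp only [Matrix.mul_assoc] at h5 ⊢
    have h7 : b * c' = b * (d' * (v * u)) + b * (e * (c * (b' * (v * u)))) -
        b * (e * (c * a')) := eq_sub_of_add_eq h5.symm
    rw [h7]; abel
  have hs : IsEv A (a - b * e * c) := ha.sub ((hb.mul_ev he.he).mul hc)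
  have ht : IsEv A (a' - b' * v * (c' + e * c * a')) :=
    ha'.sub ((hb'.mul_ev hv.he).mul (hc'.add (hz.mul_ev ha')))
  rw [h3, edet_mul hs ht, edet_mul hv.he he.he, mul_assoc _ (edet A e),
    edet_comm (X := e) (edet A (a' - b' * v * (c' + e * c * a')) * edet A v)]
  simp only [mul_assoc]

lemma ber_one : ber A (1 : Matrix m m A) (0 : Matrix m n A) (0 : Matrix n m A) 1 = 1 := by
  rw [ber_eq ⟨isEv_one, isEv_one, Matrix.one_mul 1, Matrix.one_mul 1⟩]
  simp [edet_one]

lemma ber_even (a : Matrix m m A) (b : Matrix m n A) (c : Matrix n m A) (d : Matrix n n A) :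
    A.parity (ber A a b c d) = ber A a b c d := by
  rw [ber, edet, edet, map_mul]
  exact congrArg₂ (· * ·) (Subtype.property (p := fun x => A.parity x = x) _)
    (Subtype.property (p := fun x => A.parity x = x) _)

lemma edet_baseChange {B : SuperCommAlg K} (φ : SHom A B) {X : Matrix n n A} (hX : IsEv A X) :
    edet B (X.map φ.toAlgHom) = φ.toAlgHom (edet A X) := by
  let ψ : A.even →+* B.even := (φ.toAlgHom.toRingHom.comp A.even.val.toRingHom).codRestrict
    B.even.toSubring (fun a => by
      change B.parity (φ.toAlgHom a.1) = φ.toAlgHom a.1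
      rw [← φ.map_parity]; exact congrArg _ a.2)
  have h1 : X.map φ.toAlgHom = (ψ.mapMatrix (X.map A.evProj)).map Subtype.val := by
    conv_lhs => rw [← hX.map_val]
    rfl
  rw [h1, edet_map, ← RingHom.map_det]
  rfl

lemma IsEv.baseChange {B : SuperCommAlg K} (φ : SHom A B) {X : Matrix m n A} (hX : IsEv A X) :
    IsEv B (X.map φ.toAlgHom) := fun i j => by
  rw [Matrix.map_apply, ← φ.map_parity, hX]

lemma ber_baseChange {B : SuperCommAlg K} (φ : SHom A B) {a : Matrix m m A} {b : Matrix m n A}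
    {c : Matrix n m A} {d e : Matrix n n A} (ha : IsEv A a) (hb : IsOd A b) (hc : IsOd A c)
    (h : EvInv d e) : ber B (a.map φ.toAlgHom) (b.map φ.toAlgHom) (c.map φ.toAlgHom)
      (d.map φ.toAlgHom) = φ.toAlgHom (ber A a b c d) := by
  have h' : EvInv (d.map φ.toAlgHom) (e.map φ.toAlgHom) := by
    refine ⟨h.hd.baseChange φ, h.he.baseChange φ, ?_, ?_⟩
    · rw [← Matrix.map_mul, h.right, Matrix.map_one _ (map_zero _) (map_one _)]
    · rw [← Matrix.map_mul, h.left, Matrix.map_one _ (map_zero _) (map_one _)]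
  rw [ber_eq h, ber_eq h', map_mul, ← edet_baseChange φ h.he,
    ← edet_baseChange φ (ha.sub ((hb.mul_ev h.he).mul hc)), Matrix.map_sub _ (map_sub _),
    Matrix.map_mul, Matrix.map_mul]

end

/-! ### The Berezinian of a point of `GL(V)` and the representation `Ber V` -/

/-- A homogeneous basis with `p` even and `q` odd vectors, exhibiting `dim V = p|q`. -/
structure HomBasis (V : SuperSpace K) (p q : ℕ) where
  basis : Module.Basis (Fin p ⊕ Fin q) K V
  even : ∀ i, V.parity (basis (.inl i)) = basis (.inl i)
  odd : ∀ j, V.parity (basis (.inr j)) = -basis (.inr j)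

/-- The coefficient in `A` of the `i`-th basis vector. -/
def coordA {V : Type u} [AddCommGroup V] [Module K V] {ι : Type} (b : Module.Basis ι K V)
    (A : SuperCommAlg K) (i : ι) : V ⊗[K] A →ₗ[K] A :=
  (TensorProduct.lid K A).toLinearMap ∘ₗ LinearMap.rTensor A (b.coord i)

/-- The matrix of an endomorphism of the right `A`-module `V ⊗ A`: `f(e_j) = ∑ e_i f_ij`. -/
def mat {V : Type u} [AddCommGroup V] [Module K V] {ι : Type} (b : Module.Basis ι K V)
    (A : SuperCommAlg K) (f : Module.End K (V ⊗[K] A)) : Matrix ι ι A :=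
  Matrix.of fun i j => coordA b A i (f (b j ⊗ₜ 1))

/-- The Berezinian of an endomorphism of `V ⊗ A` in a homogeneous basis. -/
def berEnd {V : SuperSpace K} {p q : ℕ} (e : HomBasis V p q) (A : SuperCommAlg K)
    (f : Module.End K (V ⊗[K] A)) : A :=
  ber A (mat e.basis A f).toBlocks₁₁ (mat e.basis A f).toBlocks₁₂ (mat e.basis A f).toBlocks₂₁
    (mat e.basis A f).toBlocks₂₂

section
variable {V : SuperSpace K} {p q : ℕ} (e : HomBasis V p q) (A : SuperCommAlg K)

lemma coordA_rmul {V : Type u} [AddCommGroup V] [Module K V] {ι : Type} (b : Module.Basis ι K V)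
    (i : ι) (a : A) (x : V ⊗[K] A) : coordA b A i (rmul V A a x) = coordA b A i x * a := by
  induction x with
  | zero => simp
  | tmul y c => simp [coordA]
  | add y z hy hz => simp only [map_add, hy, hz, add_mul]

lemma mat_mul {V : Type u} [AddCommGroup V] [Module K V] {ι : Type} [Fintype ι]
    (b : Module.Basis ι K V) {f : Module.End K (V ⊗[K] A)}
    (hf : ∀ a x, f (rmul V A a x) = rmul V A a (f x)) (h : Module.End K (V ⊗[K] A)) :
    mat b A (f * h) = mat b A f * mat b A h := by
  ext i j
  rw [Matrix.mul_apply]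
  change coordA b A i (f (h (b j ⊗ₜ 1))) = ∑ k, coordA b A i (f (b k ⊗ₜ 1)) *
    coordA b A k (h (b j ⊗ₜ 1))
  induction h (b j ⊗ₜ 1) with
  | zero => simp
  | add y z hy hz => simp only [map_add, hy, hz, mul_add, Finset.sum_add_distrib]
  | tmul v a =>
    have e1 : v ⊗ₜ[K] a = ∑ k, b.repr v k • rmul V A a (b k ⊗ₜ 1) := by
      conv_lhs => rw [← b.sum_repr v]
      rw [TensorProduct.sum_tmul]
      refine Finset.sum_congr rfl fun k _ => ?_
      rw [rmul_tmul, one_mul, TensorProduct.smul_tmul']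
    conv_lhs => rw [e1]
    rw [map_sum, map_sum]
    refine Finset.sum_congr rfl fun k _ => ?_
    rw [map_smul, map_smul, hf, coordA_rmul]
    simp [coordA]

lemma mat_one {V : Type u} [AddCommGroup V] [Module K V] {ι : Type} [DecidableEq ι]
    (b : Module.Basis ι K V) : mat b A 1 = 1 := by
  ext i j
  rcases eq_or_ne i j with rfl | h
  · simp [mat, coordA]
  · simp [mat, coordA, Matrix.one_apply_ne h, Finsupp.single_eq_of_ne h]

lemma coordA_par_even (i : Fin p) (x : V ⊗[K] A) :
    coordA e.basis A (.inl i) (par V.parity A x) = A.parity (coordA e.basis A (.inl i) x) := by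
  have h : ∀ v, e.basis.coord (.inl i) (V.parity v) = e.basis.coord (.inl i) v := by
    intro v
    have : e.basis.coord (.inl i) ∘ₗ V.parity = e.basis.coord (.inl i) := by
      refine e.basis.ext fun k => ?_
      rcases k with k | k
      · simp [e.even]
      · simp [e.odd]
    exact LinearMap.congr_fun this v
  induction x with
  | zero => simp
  | add y z hy hz => simp only [map_add, hy, hz]
  | tmul v a =>
    have := h v
    simp only [Module.Basis.coord_apply] at this
    simp [coordA, this]

lemma coordA_par_odd (i : Fin q) (x : V ⊗[K] A) :
    coordA e.basis A (.inr i) (par V.parity A x) = -A.parity (coordA e.basis A (.inr i) x) := by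
  have h : ∀ v, e.basis.coord (.inr i) (V.parity v) = -e.basis.coord (.inr i) v := by
    intro v
    have : e.basis.coord (.inr i) ∘ₗ V.parity = -e.basis.coord (.inr i) := by
      refine e.basis.ext fun k => ?_
      rcases k with k | k
      · simp [e.even]
      · simp [e.odd]
    exact LinearMap.congr_fun this v
  induction x with
  | zero => simp
  | add y z hy hz => simp only [map_add, hy, hz, neg_add]
  | tmul v a =>
    have := h v
    simp only [Module.Basis.coord_apply] at this
    simp [coordA, this]

variable {A}

lemma mat_parity {f : Module.End K (V ⊗[K] A)} (hf : f ∈ evenEnd V.parity A) :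
    IsEv A (mat e.basis A f).toBlocks₁₁ ∧ IsOd A (mat e.basis A f).toBlocks₁₂ ∧
      IsOd A (mat e.basis A f).toBlocks₂₁ ∧ IsEv A (mat e.basis A f).toBlocks₂₂ := by
  have h1 : ∀ i, f (par V.parity A (e.basis (.inl i) ⊗ₜ 1)) = f (e.basis (.inl i) ⊗ₜ 1) := by
    intro i; simp [e.even]
  have h2 : ∀ i, f (par V.parity A (e.basis (.inr i) ⊗ₜ 1)) = -f (e.basis (.inr i) ⊗ₜ 1) := by
    intro i; simp [e.odd, TensorProduct.neg_tmul]
  refine ⟨fun i j => ?_, fun i j => ?_, fun i j => ?_, fun i j => ?_⟩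
  · change A.parity (coordA e.basis A (.inl i) (f (e.basis (.inl j) ⊗ₜ 1))) = _
    rw [← coordA_par_even, ← hf.1, h1]; rfl
  · change A.parity (coordA e.basis A (.inl i) (f (e.basis (.inr j) ⊗ₜ 1))) = _
    rw [← coordA_par_even, ← hf.1, h2, map_neg]; rfl
  · change A.parity (coordA e.basis A (.inr i) (f (e.basis (.inl j) ⊗ₜ 1))) = _
    rw [← neg_eq_iff_eq_neg.2 (coordA_par_odd e A i _), ← hf.1, h1]; rfl
  · change A.parity (coordA e.basis A (.inr i) (f (e.basis (.inr j) ⊗ₜ 1))) = _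
    rw [← neg_eq_iff_eq_neg.2 (coordA_par_odd e A i _), ← hf.1, h2, map_neg, neg_neg]; rfl

lemma toBlocks_mul {R : Type u} [Ring R] {m n : Type} [Fintype m] [Fintype n]
    (X Y : Matrix (m ⊕ n) (m ⊕ n) R) :
    (X * Y).toBlocks₁₁ = X.toBlocks₁₁ * Y.toBlocks₁₁ + X.toBlocks₁₂ * Y.toBlocks₂₁ ∧
    (X * Y).toBlocks₁₂ = X.toBlocks₁₁ * Y.toBlocks₁₂ + X.toBlocks₁₂ * Y.toBlocks₂₂ ∧
    (X * Y).toBlocks₂₁ = X.toBlocks₂₁ * Y.toBlocks₁₁ + X.toBlocks₂₂ * Y.toBlocks₂₁ ∧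
    (X * Y).toBlocks₂₂ = X.toBlocks₂₁ * Y.toBlocks₁₂ + X.toBlocks₂₂ * Y.toBlocks₂₂ := by
  refine ⟨?_, ?_, ?_, ?_⟩ <;> ext i j <;>
    simp [Matrix.mul_apply, Matrix.toBlocks₁₁, Matrix.toBlocks₁₂, Matrix.toBlocks₂₁,
      Matrix.toBlocks₂₂]

variable [CharZero K]

/-- The odd-odd block of an invertible even endomorphism is invertible. -/
lemma exists_evInv (g : SGL V A) : ∃ i, EvInv (mat e.basis A g.1.1).toBlocks₂₂ i := by
  have hg := mat_parity e g.1.2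
  have hg' := mat_parity e g⁻¹.1.2
  have h1 : mat e.basis A g.1.1 * mat e.basis A g⁻¹.1.1 = 1 := by
    rw [← mat_mul A e.basis g.1.2.2, ← mat_one A e.basis]
    exact congrArg (fun f : evenEnd V.parity A => mat e.basis A f.1) g.mul_inv
  have h2 := (toBlocks_mul (mat e.basis A g.1.1) (mat e.basis A g⁻¹.1.1)).2.2.2
  have h3 : (1 : Matrix (Fin p ⊕ Fin q) (Fin p ⊕ Fin q) A).toBlocks₂₂ = 1 := by
    ext i j
    simp [Matrix.toBlocks₂₂, Matrix.one_apply]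
  rw [h1, h3] at h2
  generalize (mat e.basis A g.1.1).toBlocks₂₁ = c at *
  generalize (mat e.basis A g.1.1).toBlocks₂₂ = d at *
  generalize (mat e.basis A g⁻¹.1.1).toBlocks₁₂ = b' at *
  generalize (mat e.basis A g⁻¹.1.1).toBlocks₂₂ = d' at *
  have h4 := evInv_one_add hg.2.2.1 hg'.2.1.neg
  have h5 : d * d' = 1 + c * -b' := by rw [h2, Matrix.mul_neg]; abel
  have h6 : d * (d' * einv A (1 + c * -b')) = 1 := by
    rw [← Matrix.mul_assoc, h5, h4.right]
  refine ⟨_, evInv_of_isUnit hg.2.2.2 ?_⟩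
  have h7 : d.map A.evProj * (d' * einv A (1 + c * -b')).map A.evProj = 1 := by
    rw [← map_evProj (d.map A.evProj * _), map_val_mul, hg.2.2.2.map_val,
      (hg'.2.2.2.mul h4.he).map_val, h6, ← map_val_one, map_evProj]
  exact Matrix.isUnit_det_of_right_inverse h7

lemma berEnd_mul (g h : SGL V A) :
    berEnd e A (g.1.1 * h.1.1) = berEnd e A g.1.1 * berEnd e A h.1.1 := by
  obtain ⟨i, hi⟩ := exists_evInv e g
  obtain ⟨j, hj⟩ := exists_evInv e h
  obtain ⟨g1, g2, g3, -⟩ := mat_parity e g.1.2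
  obtain ⟨h1, h2, h3, -⟩ := mat_parity e h.1.2
  obtain ⟨b1, b2, b3, b4⟩ := toBlocks_mul (mat e.basis A g.1.1) (mat e.basis A h.1.1)
  rw [berEnd, mat_mul A e.basis g.1.2.2, b1, b2, b3, b4, ber_mul g1 g2 g3 hi h1 h2 h3 hj]
  rfl

lemma berEnd_one : berEnd e A 1 = 1 := by
  have h := mat_one A e.basis
  rw [berEnd, h]
  rw [← Matrix.fromBlocks_one, Matrix.toBlocks_fromBlocks₁₁, Matrix.toBlocks_fromBlocks₁₂,
    Matrix.toBlocks_fromBlocks₂₁, Matrix.toBlocks_fromBlocks₂₂, ber_one]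

lemma berEnd_baseChange {B : SuperCommAlg K} (φ : SHom A B) (g : SGL V A) (g' : SGL V B)
    (h : IsBaseChange φ g.1.1 g'.1.1) :
    berEnd e B g'.1.1 = φ.toAlgHom (berEnd e A g.1.1) := by
  obtain ⟨i, hi⟩ := exists_evInv e g
  obtain ⟨g1, g2, g3, -⟩ := mat_parity e g.1.2
  have hm : mat e.basis B g'.1.1 = (mat e.basis A g.1.1).map φ.toAlgHom := by
    ext i j
    have h0 := h (e.basis j ⊗ₜ 1)
    rw [LinearMap.lTensor_tmul] at h0
    simp only [AlgHom.toLinearMap_apply, map_one] at h0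
    change coordA e.basis B i (g'.1.1 (e.basis j ⊗ₜ 1)) =
      φ.toAlgHom (coordA e.basis A i (g.1.1 (e.basis j ⊗ₜ 1)))
    rw [h0]
    induction g.1.1 (e.basis j ⊗ₜ 1) with
    | zero => simp
    | add y z hy hz => simp only [map_add, hy, hz]
    | tmul v a => simp [coordA]
  rw [berEnd, berEnd, ← ber_baseChange φ g1 g2 g3 hi, hm]
  rfl

/-- Multiplication by an even element on `K ⊗ A`. -/
def scalarEnd (a : A) (ha : A.parity a = a) : evenEnd (LinearMap.id : Module.End K K) A :=
  ⟨LinearMap.lTensor K (LinearMap.mulLeft K a), by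
    refine ⟨fun x => ?_, fun b x => ?_⟩ <;> induction x with
    | zero => simp
    | add y z hy hz => simp only [map_add, hy, hz]
    | tmul v c => simp [ha, mul_assoc]⟩

lemma scalarEnd_apply (a : A) (ha : A.parity a = a) (x : K ⊗[K] A) :
    (scalarEnd a ha).1 x = LinearMap.lTensor K (LinearMap.mulLeft K a) x := rfl

lemma berEnd_even (f : Module.End K (V ⊗[K] A)) : A.parity (berEnd e A f) = berEnd e A f :=
  ber_even _ _ _ _

/-- `g` acts on `K ⊗ A` as multiplication by the Berezinian of `g`. -/
def berHom (A : SuperCommAlg K) : SGL V A →* evenEnd (LinearMap.id : Module.End K K) A where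
  toFun g := scalarEnd (berEnd e A g.1.1) (berEnd_even e _)
  map_one' := Subtype.ext <| LinearMap.ext fun x => by
    have h : berEnd e A (1 : SGL V A).1.1 = 1 := berEnd_one e
    rw [scalarEnd_apply, h, LinearMap.mulLeft_one, LinearMap.lTensor_id]; rfl
  map_mul' g h := Subtype.ext <| LinearMap.ext fun x => by
    have h1 : berEnd e A (g * h).1.1 = _ := berEnd_mul e g h
    rw [scalarEnd_apply, h1, LinearMap.mulLeft_mul, LinearMap.lTensor_comp]; rfl

lemma scalarEnd_baseChange {B : SuperCommAlg K} (φ : SHom A B) (a : A) (ha : A.parity a = a)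
    (b : B) (hb : B.parity b = b) (h : b = φ.toAlgHom a) :
    IsBaseChange φ (scalarEnd a ha).1 (scalarEnd b hb).1 := fun x => by
  rw [scalarEnd_apply, scalarEnd_apply, h]
  induction x with
  | zero => simp
  | add y z hy hz => simp only [map_add, hy, hz]
  | tmul v a => simp

/-- The representation `Ber V`: one-dimensional, even, with `g` acting as multiplication by the
Berezinian of `g`. -/
def Rep.ber (e : HomBasis V p q) (H : SubgroupFunctor V) : Rep H where
  space := { carrier := K, parity := LinearMap.id, parity_parity := fun _ => rfl }
  act := fun A => (berHom e A).comp (H A).subtype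
  natural := fun _ _ φ g g' hg =>
    scalarEnd_baseChange φ _ (berEnd_even e _) _ (berEnd_even e _)
      (berEnd_baseChange e φ g.1 g'.1 hg)

end

end Berezinian

noncomputable section Grothendieck

variable {K : Type u} [Field K] {V : SuperSpace K} {H H' : SubgroupFunctor V}

/-- Homomorphisms of representations: even linear maps commuting with the action. -/
structure Rep.Hom (M N : Rep H) where
  toLin : M.space →ₗ[K] N.space
  map_parity : ∀ v, toLin (M.space.parity v) = N.space.parity (toLin v)
  equivariant : ∀ (A : SuperCommAlg K) (g : H A) (x : M.space ⊗[K] A),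
    LinearMap.rTensor A toLin ((M.act A g).1 x) = (N.act A g).1 (LinearMap.rTensor A toLin x)

/-- There is a short exact sequence `0 → M' → M → M'' → 0`. -/
def Rep.ShortExact (M' M M'' : Rep H) : Prop :=
  ∃ (f : M'.Hom M) (g : M.Hom M''), Function.Injective f.toLin ∧ Function.Surjective g.toLin ∧
    Function.Exact f.toLin g.toLin

/-- Restriction of a representation to a smaller subgroup. -/
def Rep.restrict (h : ∀ A, H A ≤ H' A) (R : Rep H') : Rep H where
  space := R.space
  act := fun A => (R.act A).comp (Subgroup.inclusion (h A))
  natural := fun A B φ g g' hg =>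
    R.natural A B φ (Subgroup.inclusion (h A) g) (Subgroup.inclusion (h B) g') hg

lemma Rep.ShortExact.restrict (h : ∀ A, H A ≤ H' A) {M' M M'' : Rep H'}
    (hs : Rep.ShortExact M' M M'') :
    Rep.ShortExact (M'.restrict h) (M.restrict h) (M''.restrict h) := by
  obtain ⟨f, g, h1, h2, h3⟩ := hs
  exact ⟨⟨f.toLin, f.map_parity, fun A x y => f.equivariant A (Subgroup.inclusion (h A) x) y⟩,
    ⟨g.toLin, g.map_parity, fun A x y => g.equivariant A (Subgroup.inclusion (h A) x) y⟩, h1, h2, h3⟩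

variable [CharZero K]

lemma evPart_range_le {M : Type u} [AddCommGroup M] [Module K M] (σ : Module.End K M) :
    LinearMap.range (evPart σ) ≤ (LinearMap.range (evPart σ)).comap σ := by
  rintro _ ⟨v, rfl⟩
  exact ⟨σ v, by simp [evPart]⟩

lemma blockDiag_stable {A : SuperCommAlg K} {g : SGL V A} (hg : g ∈ blockDiag V A) :
    ∀ x ∈ LinearMap.range (evPart V.parity),
      g.1.1 (x ⊗ₜ 1) ∈ baseSub (LinearMap.range (evPart V.parity)) A :=
  range_stable A fun x => by
    have e : ∀ y : V ⊗[K] A, LinearMap.rTensor A (evPart V.parity) y =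
        (2⁻¹ : K) • (y + LinearMap.rTensor A V.parity y) := by
      intro y
      have : LinearMap.rTensor A (evPart V.parity) =
          (2⁻¹ : K) • (LinearMap.id + LinearMap.rTensor A V.parity) := by
        rw [evPart, LinearMap.rTensor_smul, LinearMap.rTensor_add]
        congr 2
        exact LinearMap.rTensor_id A V
      rw [this]; rfl
    have h1 : evPart V.parity x ⊗ₜ[K] (1 : A) = LinearMap.rTensor A (evPart V.parity) (x ⊗ₜ 1) :=
      rfl
    rw [h1, e, e, map_smul, map_add, hg]

/-- The subspace of even vectors `V₀ ⊆ V`, as a subrepresentation for the block-diagonal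
subgroup. -/
def evenSub (V : SuperSpace K) : (Rep.taut (blockDiag V)).Sub where
  carrier := LinearMap.range (evPart V.parity)
  parity_le := evPart_range_le V.parity
  stable := fun _ g => blockDiag_stable g.2

/-- The purely even representation `W` of `GL(V₀) × GL(V₁)` with `V = V₀ ⊕ Π W`: the odd part
`V₁ = V / V₀` with reversed parity. -/
def oddPartW (V : SuperSpace K) : Rep (blockDiag V) :=
  ((Rep.taut (blockDiag V)).quot (evenSub V)).shift

/-- The relations of the Grothendieck ring: `[M] = [M'] + [M'']` for short exact sequences
`0 → M' → M → M'' → 0`, `[M ⊗ N] = [M] [N]`, and `[K] = 1`. -/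
def K0Rel (H : SubgroupFunctor V) : Ideal (MvPolynomial (Rep H) ℤ) :=
  Ideal.span ({r | ∃ M' M M'' : Rep H, Rep.ShortExact M' M M'' ∧
      r = MvPolynomial.X M - MvPolynomial.X M' - MvPolynomial.X M''} ∪
    {r | ∃ M N : Rep H, r = MvPolynomial.X (M.tensor N) - MvPolynomial.X M * MvPolynomial.X N} ∪
    {MvPolynomial.X (Rep.unit H) - 1})

/-- The Grothendieck ring of the finite-dimensional representations of the supergroup `H`: the
commutative ring generated by the classes `[M]`, with the relations given by short exact sequences,
tensor products and the trivial representation. -/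
abbrev K0 (H : SubgroupFunctor V) : Type (u + 1) := MvPolynomial (Rep H) ℤ ⧸ K0Rel H

/-- The class of a representation. -/
def Rep.cls (M : Rep H) : K0 H := Ideal.Quotient.mk (K0Rel H) (MvPolynomial.X M)

/-- Restriction of representations, as a homomorphism of Grothendieck rings. -/
def K0.restrict (h : ∀ A, H A ≤ H' A) : K0 H' →+* K0 H :=
  Ideal.Quotient.lift (K0Rel H')
    ((Ideal.Quotient.mk (K0Rel H)).comp (MvPolynomial.rename (Rep.restrict h)).toRingHom) (by
      have key : K0Rel H' ≤ RingHom.ker ((Ideal.Quotient.mk (K0Rel H)).comp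
          (MvPolynomial.rename (R := ℤ) (Rep.restrict h)).toRingHom) := by
        refine Ideal.span_le.2 ?_
        rintro _ ((⟨M', M, M'', hs, rfl⟩ | ⟨M, N, rfl⟩) | rfl)
        · refine Ideal.Quotient.eq_zero_iff_mem.2 (Ideal.subset_span (.inl (.inl
            ⟨M'.restrict h, M.restrict h, M''.restrict h, hs.restrict h, ?_⟩)))
          simp
        · refine Ideal.Quotient.eq_zero_iff_mem.2 (Ideal.subset_span (.inl (.inr
            ⟨M.restrict h, N.restrict h, ?_⟩)))
          simp only [AlgHom.toRingHom_eq_coe, RingHom.coe_coe, map_sub, map_mul,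
            MvPolynomial.rename_X]
          rfl
        · refine Ideal.Quotient.eq_zero_iff_mem.2 (Ideal.subset_span (.inr ?_))
          simp only [AlgHom.toRingHom_eq_coe, RingHom.coe_coe, map_sub, map_one,
            MvPolynomial.rename_X]
          rfl
      exact fun a ha => key ha)

/-- The restriction homomorphism from the Grothendieck ring of `GL(V)` to that of
`GL(V₀) × GL(V₁)`. -/
def resBlock (V : SuperSpace K) : K0 (fullGL V) →+* K0 (blockDiag V) :=
  K0.restrict fun _ => le_top

/-- The class `Π` of the one-dimensional odd trivial representation; multiplication by it is the
parity shift. -/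
def Pi (H : SubgroupFunctor V) : K0 H := (Rep.unit H).shift.cls

/-- The class of `Λ^k R`, for `k : ℤ` (zero for `k < 0`). -/
def extCls (R : Rep H) (k : ℤ) : K0 H := if 0 ≤ k then (R.ext k.toNat).cls else 0

/-- The class of `Σ^k V = Ber V ⊗ Λ^{p-k} V*`, for `k : ℤ` (zero for `k > p`). -/
def sigmaCls {p q : ℕ} (e : HomBasis V p q) (H : SubgroupFunctor V) (k : ℤ) : K0 H :=
  if k ≤ p then ((Rep.ber e H).tensor ((Rep.taut H).dual.ext (p - k).toNat)).cls else 0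

/-- `Γ_k = Λ^k V - (-Π)^q Σ^{k+q} V` in the Grothendieck ring of `GL(V)`. -/
def Gam {p q : ℕ} (e : HomBasis V p q) (k : ℤ) : K0 (fullGL V) :=
  extCls (Rep.taut (fullGL V)) k - (-Pi (fullGL V)) ^ q * sigmaCls e (fullGL V) (k + q)

/-- The coefficients `b_i = (-Π)^i Λ^i W` of the recurrence. -/
def coeffB (V : SuperSpace K) (i : ℕ) : K0 (blockDiag V) :=
  (-Pi (blockDiag V)) ^ i * extCls (oddPartW V) i

end Grothendieck

end Super

/-! Everything is reduced to characters. A representation of `H`, where `H` is `GL(V)` or its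
block-diagonal subgroup, has two functions on the `K`-points of the diagonal torus: the trace and
the supertrace, given by `ε = 0` and `ε = 1` in `Rep.char`. Both are additive on exact sequences and
multiplicative on tensor products, so they descend to `K0 H`. The main theorem is that together they
determine a class (`K0.eq_of_char`).

The proof is an induction on dimension (`Rep.cls_eq_of_char`) that needs neither simple modules nor
Jordan–Hölder. If `M` and `N` have equal characters, they have vectors `w₁`, `w₂` of the same weight
and parity, of maximal height. Let `w = (w₁, w₂)` in `M ⊕ N`, and let `D` be the set of vectors
whose translates are killed by every linear form that lives in top height and vanishes on `w`. Then
`D` is a subrepresentation (`Rep.topSub`), it contains `w`, and its part of the weight of `w` is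
only the line `K w`. The projections `f : D → M` and `g : D → N` give `[M] - [N] = [M / im f] + [ker
g] - [N / im g] - [ker f]`. Since `w` is not in `ker f + ker g`, the total dimension on the right is
smaller (`Rep.finrank_correspondence`).

The hard point is that `w` belongs to `D`, that is, `φ (g w) = 0` for all points `g` over all
superalgebras and all top forms `φ` with `φ w = 0` (`Rep.co_gact_eq_zero`). For `g = upper * torus *
lower` this is clear: the lower factor fixes `w`, the torus scales it, the upper factor does not
change top components. The Schur complement reduces a general `g` to a block-diagonal one, which has
entries in a commutative algebra. There `g` is joined to the identity by a segment, which lies in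
the big cell over a power series ring.

Restriction to the block-diagonal subgroup keeps the torus, hence the characters, so it is injective
(`resBlock_injective`). The recurrence becomes an identity of generating functions. Let `x_i`, `y_j`
be the torus coordinates and `π = (-1) ^ ε` the character of `Π`. The characters of `Λ^k V` are the
coefficients of the expansion at `z = 0` of `∏ (1 + x_i z) / ∏ (1 - π y_j z)`, and those of `(-Π)^q
Σ^{k+q} V` come from its expansion at infinity. The denominator is `∑ b_i z^i`; multiplying by it
turns both expansions into the polynomial `∏ (1 + x_i z)`, so the difference is annihilated
(`eGen_mul_extSeries`, `sum_recurrence`). The Hankel determinants vanish because the recurrence is a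
vector in the kernel with one entry equal to `1`. -/

namespace Super

/-! ### Commutative algebras as superalgebras, and the coproduct of supercommutative superalgebras.
-/

section Algebras

variable {K : Type u} [Field K] [CharZero K]

/-- A commutative algebra, as a purely even superalgebra. -/
def SuperCommAlg.ofComm (B : Type u) [CommRing B] [Algebra K B] : SuperCommAlg K where
  carrier := B
  parity := AlgHom.id K B
  parity_parity _ := rfl
  even_comm a b _ := mul_comm a b
  odd_anticomm a b ha _ := by
    have h2 : (2 : K) ≠ 0 := two_ne_zero
    have h : a = -a := ha
    have h0 : (2 : K) • a = 0 := by rw [two_smul]; nth_rw 1 [h]; simp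
    rw [(smul_eq_zero.1 h0).resolve_left h2]; simp

lemma SuperCommAlg.ev_add_od (A : SuperCommAlg K) (a : A) : A.ev a + A.od a = a := by
  induction a using A.induction with
  | hadd a b ha hb => rw [map_add, map_add, add_add_add_comm, ha, hb]
  | he a h => rw [A.ev_of_even h, A.od_of_even h, add_zero]
  | ho a h => rw [A.ev_of_odd h, A.od_of_odd h, zero_add]

lemma SuperCommAlg.ev_sub_od (A : SuperCommAlg K) (a : A) : A.ev a - A.od a = A.parity a := by
  induction a using A.induction with
  | hadd a b ha hb => rw [map_add, map_add, map_add, ← ha, ← hb]; abel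
  | he a h => rw [A.ev_of_even h, A.od_of_even h, sub_zero, h]
  | ho a h => rw [A.ev_of_odd h, A.od_of_odd h, zero_sub, h]

lemma SuperCommAlg.mul_odd (A : SuperCommAlg K) (a : A) {c : A} (hc : A.parity c = -c) :
    a * c = c * A.parity a := by
  induction a using A.induction with
  | hadd a b ha hb => rw [map_add, add_mul, mul_add, ha, hb]
  | he a h => rw [h, A.even_comm a c h]
  | ho a h => rw [h, A.odd_anticomm a c h hc, mul_neg]

lemma SuperCommAlg.mul_even (A : SuperCommAlg K) (a : A) {c : A} (hc : A.parity c = c) :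
    a * c = c * a := (A.even_comm c a hc).symm

/-- The underlying space of the tensor product of superalgebras. -/
def STensor (A B : SuperCommAlg K) : Type u := A ⊗[K] B

section
variable (A B : SuperCommAlg K)

noncomputable instance : AddCommGroup (STensor A B) :=
  inferInstanceAs (AddCommGroup (A ⊗[K] B))

noncomputable instance : Module K (STensor A B) := inferInstanceAs (Module K (A ⊗[K] B))

variable {A B} in
/-- Pure tensors in the tensor product of superalgebras. -/
def STensor.mk (a : A) (b : B) : STensor A B := a ⊗ₜ[K] b

lemma STensor.add_mk (a a' : A) (b : B) :
    STensor.mk (a + a') b = STensor.mk a b + STensor.mk a' b := TensorProduct.add_tmul _ _ _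

lemma STensor.mk_add (a : A) (b b' : B) :
    STensor.mk a (b + b') = STensor.mk a b + STensor.mk a b' := TensorProduct.tmul_add _ _ _

lemma STensor.zero_mk (b : B) : STensor.mk (0 : A) b = 0 := TensorProduct.zero_tmul _ _

lemma STensor.neg_mk (a : A) (b : B) :
    STensor.mk (-a) b = -STensor.mk a b := TensorProduct.neg_tmul _ _

lemma STensor.mk_neg (a : A) (b : B) :
    STensor.mk a (-b) = -STensor.mk a b := TensorProduct.tmul_neg _ _

lemma STensor.smul_mk (c : K) (a : A) (b : B) :
    STensor.mk (c • a) b = c • STensor.mk a b := (TensorProduct.smul_tmul' c a b).symm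

variable {A B} in
lemma STensor.induction {P : STensor A B → Prop} (h0 : P 0) (hm : ∀ a b, P (STensor.mk a b))
    (ha : ∀ x y, P x → P y → P (x + y)) (x : STensor A B) : P x :=
  TensorProduct.induction_on (motive := P) x h0 hm ha

/-- The product `(a ⊗ b) (a' ⊗ b') = (-1)^{|b||a'|} a a' ⊗ b b'`. -/
noncomputable def STensor.mulMap : STensor A B →ₗ[K] STensor A B →ₗ[K] STensor A B :=
  TensorProduct.curry (TensorProduct.map (LinearMap.mul' K A) (LinearMap.mul' K B) ∘ₗ
    (TensorProduct.tensorTensorTensorComm K A B A B).toLinearMap ∘ₗ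
      (TensorProduct.map LinearMap.id (LinearMap.rTensor B A.ev) +
        TensorProduct.map (LinearMap.lTensor A B.parity.toLinearMap) (LinearMap.rTensor B A.od)))

noncomputable instance : Mul (STensor A B) := ⟨fun x y => STensor.mulMap A B x y⟩

lemma STensor.mk_mul_mk (a a' : A) (b b' : B) : STensor.mk a b * STensor.mk a' b' =
    STensor.mk (a * A.ev a') (b * b') + STensor.mk (a * A.od a') (B.parity b * b') := by
  change (TensorProduct.map (LinearMap.mul' K A) (LinearMap.mul' K B) ∘ₗ
    (TensorProduct.tensorTensorTensorComm K A B A B).toLinearMap ∘ₗ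
      (TensorProduct.map LinearMap.id (LinearMap.rTensor B A.ev) +
        TensorProduct.map (LinearMap.lTensor A B.parity.toLinearMap) (LinearMap.rTensor B A.od)))
    ((a ⊗ₜ b) ⊗ₜ (a' ⊗ₜ b')) = (a * A.ev a') ⊗ₜ (b * b') + (a * A.od a') ⊗ₜ (B.parity b * b')
  simp

variable {A B} in
lemma STensor.mk_mul_mk_even (a : A) {a' : A} (h : A.parity a' = a') (b b' : B) :
    STensor.mk a b * STensor.mk a' b' = STensor.mk (a * a') (b * b') := by
  rw [STensor.mk_mul_mk, A.ev_of_even h, A.od_of_even h, mul_zero, STensor.zero_mk,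
    add_zero]

variable {A B} in
lemma STensor.mk_mul_mk_odd (a : A) {a' : A} (h : A.parity a' = -a') (b b' : B) :
    STensor.mk a b * STensor.mk a' b' = STensor.mk (a * a') (B.parity b * b') := by
  rw [STensor.mk_mul_mk, A.ev_of_odd h, A.od_of_odd h, mul_zero, STensor.zero_mk,
    zero_add]

lemma STensor.mul_add' (x y z : STensor A B) : x * (y + z) = x * y + x * z :=
  map_add (STensor.mulMap A B x) y z

lemma STensor.add_mul' (x y z : STensor A B) : (x + y) * z = x * z + y * z :=
  LinearMap.map_add₂ (STensor.mulMap A B) x y z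

lemma STensor.zero_mul' (x : STensor A B) : 0 * x = 0 :=
  LinearMap.map_zero₂ (STensor.mulMap A B) x

lemma STensor.mul_zero' (x : STensor A B) : x * 0 = 0 :=
  map_zero (STensor.mulMap A B x)

/-- The sign of a product depends only on the parity of the left component of the second factor, so
it suffices to make `a'` and `a''` homogeneous and count how often the parity of `B` is applied to
`b` and `b'`. -/
lemma STensor.mul_assoc' (x y z : STensor A B) : x * y * z = x * (y * z) := by
  induction x using STensor.induction with
  | h0 => simp only [STensor.zero_mul']
  | ha x x' h h' => simp only [STensor.add_mul', h, h']
  | hm a b =>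
  induction y using STensor.induction with
  | h0 => simp only [STensor.zero_mul', STensor.mul_zero']
  | ha x x' h h' => simp only [STensor.add_mul', STensor.mul_add', h, h']
  | hm a' b' =>
  induction z using STensor.induction with
  | h0 => simp only [STensor.mul_zero']
  | ha x x' h h' => simp only [STensor.mul_add', h, h']
  | hm a'' b'' =>
  induction a' using A.induction with
  | hadd c d h h' => simp only [STensor.add_mk, STensor.mul_add', STensor.add_mul', h, h']
  | he a' h =>
    induction a'' using A.induction with
    | hadd c d h h' => simp only [STensor.add_mk, STensor.mul_add', h, h']
    | he a'' h' =>
      have e : A.parity (a' * a'') = a' * a'' := by rw [map_mul, h, h']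
      rw [STensor.mk_mul_mk_even _ h, STensor.mk_mul_mk_even _ h', STensor.mk_mul_mk_even _ h',
        STensor.mk_mul_mk_even _ e, mul_assoc, mul_assoc]
    | ho a'' h' =>
      have e : A.parity (a' * a'') = -(a' * a'') := by rw [map_mul, h, h', mul_neg]
      rw [STensor.mk_mul_mk_even _ h, STensor.mk_mul_mk_odd _ h', STensor.mk_mul_mk_odd _ h',
        STensor.mk_mul_mk_odd _ e, mul_assoc, map_mul, mul_assoc]
  | ho a' h =>
    induction a'' using A.induction with
    | hadd c d h h' => simp only [STensor.add_mk, STensor.mul_add', h, h']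
    | he a'' h' =>
      have e : A.parity (a' * a'') = -(a' * a'') := by rw [map_mul, h, h', neg_mul]
      rw [STensor.mk_mul_mk_odd _ h, STensor.mk_mul_mk_even _ h', STensor.mk_mul_mk_even _ h',
        STensor.mk_mul_mk_odd _ e, mul_assoc, mul_assoc]
    | ho a'' h' =>
      have e : A.parity (a' * a'') = a' * a'' := by rw [map_mul, h, h', neg_mul_neg]
      rw [STensor.mk_mul_mk_odd _ h, STensor.mk_mul_mk_odd _ h', STensor.mk_mul_mk_odd _ h',
        STensor.mk_mul_mk_even _ e, mul_assoc, map_mul, B.parity_parity, mul_assoc]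

noncomputable instance : One (STensor A B) := ⟨STensor.mk 1 1⟩

lemma STensor.one_def : (1 : STensor A B) = STensor.mk 1 1 := rfl

lemma STensor.one_mul' (x : STensor A B) : 1 * x = x := by
  induction x using STensor.induction with
  | h0 => simp only [STensor.mul_zero']
  | ha x x' h h' => simp only [STensor.mul_add', h, h']
  | hm a b =>
    rw [STensor.one_def, STensor.mk_mul_mk, map_one, ← STensor.add_mk, ← mul_add, A.ev_add_od,
      one_mul, one_mul]

lemma STensor.mul_one' (x : STensor A B) : x * 1 = x := by
  induction x using STensor.induction with
  | h0 => simp only [STensor.zero_mul']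
  | ha x x' h h' => simp only [STensor.add_mul', h, h']
  | hm a b => rw [STensor.one_def, STensor.mk_mul_mk_even _ (map_one _), mul_one, mul_one]

noncomputable instance : Ring (STensor A B) :=
  { (inferInstance : AddCommGroup (STensor A B)), (inferInstance : Mul (STensor A B)),
    (inferInstance : One (STensor A B)) with
    left_distrib := STensor.mul_add' A B
    right_distrib := STensor.add_mul' A B
    zero_mul := STensor.zero_mul' A B
    mul_zero := STensor.mul_zero' A B
    mul_assoc := STensor.mul_assoc' A B
    one_mul := STensor.one_mul' A B
    mul_one := STensor.mul_one' A B }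

noncomputable instance : Algebra K (STensor A B) :=
  Algebra.ofModule (fun r x y => LinearMap.map_smul₂ (STensor.mulMap A B) r x y)
    (fun r x y => map_smul (STensor.mulMap A B x) r y)

/-- The parity of the tensor product of superalgebras. -/
noncomputable def STensor.parity : STensor A B →ₐ[K] STensor A B :=
  AlgHom.ofLinearMap (TensorProduct.map A.parity.toLinearMap B.parity.toLinearMap :
      (A ⊗[K] B) →ₗ[K] (A ⊗[K] B))
    (by
      change TensorProduct.map A.parity.toLinearMap B.parity.toLinearMap (1 ⊗ₜ 1) = _
      rw [TensorProduct.map_tmul, AlgHom.toLinearMap_apply, AlgHom.toLinearMap_apply, map_one,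
        map_one]; rfl)
    (by
      set P : STensor A B →ₗ[K] STensor A B :=
        TensorProduct.map A.parity.toLinearMap B.parity.toLinearMap
      have hP : ∀ a b, P (STensor.mk a b) = STensor.mk (A.parity a) (B.parity b) := fun _ _ => rfl
      change ∀ x y, P (x * y) = P x * P y
      intro x y
      induction x using STensor.induction with
      | h0 => simp
      | ha x x' h h' => simp only [add_mul, map_add, h, h']
      | hm a b =>
      induction y using STensor.induction with
      | h0 => simp
      | ha x x' h h' => simp only [mul_add, map_add, h, h']
      | hm a' b' =>
        have h1 : A.ev (A.parity a') = A.parity (A.ev a') := by simp [SuperCommAlg.ev]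
        have h2 : A.od (A.parity a') = A.parity (A.od a') := by simp [SuperCommAlg.od]
        simp only [STensor.mk_mul_mk, map_add, hP, h1, h2, map_mul])

lemma STensor.parity_mk (a : A) (b : B) :
    STensor.parity A B (STensor.mk a b) = STensor.mk (A.parity a) (B.parity b) := rfl

/-- The even and odd components of `y` are `(y ± P y) / 2`, so this is the rule `x y = y₀ x + y₁
P(x)` without denominators. It is bilinear, hence can be tested on pure tensors, whereas the two
axioms of supercommutativity concern homogeneous elements, which need not be pure tensors. -/
lemma STensor.scomm (x y : STensor A B) :
    2 • (x * y) = (y + STensor.parity A B y) * x +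
      (y - STensor.parity A B y) * STensor.parity A B x := by
  induction x using STensor.induction with
  | h0 => simp
  | ha x x' h h' => simp only [add_mul, mul_add, map_add, smul_add, h, h']; abel
  | hm a b =>
  induction y using STensor.induction with
  | h0 => simp
  | ha x x' h h' =>
    rw [mul_add, smul_add, h, h', map_add]; simp only [add_mul, sub_mul]; abel
  | hm a' b' =>
    have k1 : ∀ b'' : B, STensor.mk a' b'' * STensor.mk a b = STensor.mk (a' * A.ev a) (b'' * b) +
      STensor.mk (a' * A.od a) (B.parity b'' * b) := fun b'' => STensor.mk_mul_mk A B _ _ _ _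
    have f1 : A.ev (A.parity a) = A.ev a := by
      simp [SuperCommAlg.ev, A.parity_parity, add_comm]
    have f2 : A.od (A.parity a) = -A.od a := by
      simp [SuperCommAlg.od, A.parity_parity, ← smul_neg]
    have k2 : ∀ b'' : B, STensor.mk a' b'' * STensor.mk (A.parity a) (B.parity b) =
        STensor.mk (a' * A.ev a) (b'' * B.parity b) -
        STensor.mk (a' * A.od a) (B.parity b'' * B.parity b) := fun b'' => by
      rw [STensor.mk_mul_mk A B, f1, f2, mul_neg, STensor.neg_mk, sub_eq_add_neg]
    induction a' using A.induction with
    | hadd c d h h' =>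
      have h1 := h (fun _ => STensor.mk_mul_mk A B _ _ _ _) (fun b'' => by
        rw [STensor.mk_mul_mk A B, f1, f2, mul_neg, STensor.neg_mk, sub_eq_add_neg])
      have h2 := h' (fun _ => STensor.mk_mul_mk A B _ _ _ _) (fun b'' => by
        rw [STensor.mk_mul_mk A B, f1, f2, mul_neg, STensor.neg_mk, sub_eq_add_neg])
      rw [STensor.add_mk, mul_add, smul_add, h1, h2, map_add]; simp only [add_mul, sub_mul]; abel
    | he a' ha =>
      induction b' using B.induction with
      | hadd c d h h' =>
        rw [STensor.mk_add, mul_add, smul_add, h, h', map_add]; simp only [add_mul, sub_mul]; abel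
      | he b' hb =>
        rw [STensor.parity_mk, ha, hb, sub_self, zero_mul, add_zero, add_mul, k1, hb,
          STensor.mk_mul_mk_even _ ha, ← STensor.add_mk, ← mul_add, A.ev_add_od, A.mul_even a ha,
          B.mul_even b hb, two_smul]
      | ho b' hb =>
        rw [STensor.parity_mk, ha, hb, STensor.mk_neg, add_neg_cancel, zero_mul, zero_add,
          sub_neg_eq_add, STensor.parity_mk, add_mul, k2, hb, neg_mul, STensor.mk_neg,
          STensor.mk_mul_mk_even _ ha, sub_neg_eq_add, ← STensor.add_mk, ← mul_add, A.ev_add_od,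
          A.mul_even a ha, B.mul_odd b hb, two_smul]
    | ho a' ha =>
      induction b' using B.induction with
      | hadd c d h h' =>
        rw [STensor.mk_add, mul_add, smul_add, h, h', map_add]; simp only [add_mul, sub_mul]; abel
      | he b' hb =>
        have e : a' * A.parity a = a' * A.ev a - a' * A.od a := by rw [← mul_sub, A.ev_sub_od]
        rw [STensor.parity_mk, ha, hb, STensor.neg_mk, add_neg_cancel, zero_mul, zero_add,
          sub_neg_eq_add, STensor.parity_mk, add_mul, k2, hb,
          STensor.mk_mul_mk_odd _ ha, A.mul_odd a ha, B.mul_even _ hb, two_smul, e, sub_eq_add_neg,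
          STensor.add_mk, STensor.neg_mk]
        abel
      | ho b' hb =>
        have e : a' * A.parity a = a' * A.ev a - a' * A.od a := by rw [← mul_sub, A.ev_sub_od]
        rw [STensor.parity_mk, ha, hb, STensor.neg_mk, STensor.mk_neg, neg_neg, sub_self, zero_mul,
          add_zero, add_mul, k1, hb, STensor.mk_mul_mk_odd _ ha, A.mul_odd a ha, B.mul_odd _ hb,
          B.parity_parity, two_smul, e, sub_eq_add_neg, STensor.add_mk, STensor.neg_mk, neg_mul,
          STensor.mk_neg]

/-- The tensor product of supercommutative superalgebras. -/
noncomputable def SuperCommAlg.tensor : SuperCommAlg K where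
  carrier := STensor A B
  parity := STensor.parity A B
  parity_parity x := map_map_self A.parity.toLinearMap B.parity.toLinearMap A.parity_parity
    B.parity_parity x
  even_comm x y hx := by
    have h := STensor.scomm A B y x
    rw [hx, sub_self, zero_mul, add_zero, add_mul, ← two_smul ℕ] at h
    have h2 : (2 : K) ≠ 0 := two_ne_zero
    have h3 : (2 : K) • (y * x) = (2 : K) • (x * y) := by
      rw [← Nat.cast_two, Nat.cast_smul_eq_nsmul, Nat.cast_smul_eq_nsmul, h]
    exact (smul_right_injective _ h2 h3).symm
  odd_anticomm x y hx hy := by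
    have h := STensor.scomm A B x y
    rw [hx, hy, add_neg_cancel, zero_mul, zero_add, sub_neg_eq_add, add_mul, ← two_smul ℕ] at h
    have h2 : (2 : K) ≠ 0 := two_ne_zero
    have h3 : (2 : K) • (x * y) = (2 : K) • (y * -x) := by
      rw [← Nat.cast_two, Nat.cast_smul_eq_nsmul, Nat.cast_smul_eq_nsmul, h]
    rw [← mul_neg]; exact smul_right_injective _ h2 h3

/-- The inclusion of the first factor. -/
noncomputable def SHom.inl : SHom A (A.tensor B) where
  toAlgHom := AlgHom.ofLinearMap (R := K) (A := A) (B := STensor A B)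
    ((TensorProduct.mk K A B).flip 1) rfl (fun a a' => by
      change STensor.mk (a * a') (1 : B) = STensor.mk a 1 * STensor.mk a' 1
      rw [STensor.mk_mul_mk, map_one, mul_one, ← STensor.add_mk, ← mul_add, A.ev_add_od])
  map_parity a := by
    change STensor.mk (A.parity a) (1 : B) = STensor.mk (A.parity a) (B.parity 1)
    rw [map_one]

/-- The inclusion of the second factor. -/
noncomputable def SHom.inr : SHom B (A.tensor B) where
  toAlgHom := AlgHom.ofLinearMap (R := K) (A := B) (B := STensor A B)
    (TensorProduct.mk K A B 1) rfl (fun b b' => by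
      change STensor.mk (1 : A) (b * b') = STensor.mk 1 b * STensor.mk 1 b'
      rw [STensor.mk_mul_mk_even _ (map_one _), mul_one])
  map_parity b := by
    change STensor.mk (1 : A) (B.parity b) = STensor.mk (A.parity 1) (B.parity b)
    rw [map_one]

lemma SHom.inl_mul_inr (a : A) (b : B) :
    (SHom.inl A B).toAlgHom a * (SHom.inr A B).toAlgHom b = (STensor.mk a b : STensor A B) :=
  (STensor.mk_mul_mk_even (A := A) (B := B) a (map_one _) 1 b).trans (by rw [mul_one, one_mul])

variable {A B}

/-- The universal property of the tensor product of superalgebras. -/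
noncomputable def SHom.lift {C : SuperCommAlg K} (f : SHom A C) (g : SHom B C) :
    SHom (A.tensor B) C where
  toAlgHom := AlgHom.ofLinearMap (R := K) (A := STensor A B) (B := C)
    (LinearMap.mul' K C ∘ₗ TensorProduct.map f.toAlgHom.toLinearMap g.toAlgHom.toLinearMap)
    (by
      change f.toAlgHom 1 * g.toAlgHom 1 = 1
      rw [map_one, map_one, mul_one])
    (by
      set P : STensor A B →ₗ[K] C := LinearMap.mul' K C ∘ₗ
        TensorProduct.map f.toAlgHom.toLinearMap g.toAlgHom.toLinearMap
      have hP : ∀ a b, P (STensor.mk a b) = f.toAlgHom a * g.toAlgHom b := fun _ _ => rfl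
      change ∀ x y, P (x * y) = P x * P y
      intro x y
      induction x using STensor.induction with
      | h0 => simp
      | ha x x' h h' => simp only [add_mul, map_add, h, h']
      | hm a b =>
      induction y using STensor.induction with
      | h0 => simp
      | ha x x' h h' => simp only [mul_add, map_add, h, h']
      | hm a' b' =>
        induction a' using A.induction with
        | hadd c d h h' => simp only [STensor.add_mk, mul_add, map_add, h, h']
        | he a' ha =>
          have h1 : C.parity (f.toAlgHom a') = f.toAlgHom a' := by rw [← f.map_parity, ha]
          rw [STensor.mk_mul_mk_even _ ha, hP, hP, hP, map_mul, map_mul, mul_assoc, mul_assoc,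
            ← mul_assoc (f.toAlgHom a'), ← C.mul_even _ h1, mul_assoc]
        | ho a' ha =>
          have h1 : C.parity (f.toAlgHom a') = -f.toAlgHom a' := by rw [← f.map_parity, ha, map_neg]
          rw [STensor.mk_mul_mk_odd _ ha, hP, hP, hP, map_mul, map_mul, mul_assoc, mul_assoc,
            g.map_parity, ← mul_assoc (f.toAlgHom a'), ← C.mul_odd _ h1, mul_assoc])
  map_parity x := by
    set P : STensor A B →ₗ[K] C := LinearMap.mul' K C ∘ₗ
      TensorProduct.map f.toAlgHom.toLinearMap g.toAlgHom.toLinearMap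
    have hP : ∀ a b, P (STensor.mk a b) = f.toAlgHom a * g.toAlgHom b := fun _ _ => rfl
    change P (STensor.parity A B x) = C.parity (P x)
    induction x using STensor.induction with
    | h0 => simp
    | ha x x' h h' => simp only [map_add, h, h']
    | hm a b => rw [STensor.parity_mk, hP, hP, f.map_parity, g.map_parity, map_mul]

lemma SHom.lift_mk {C : SuperCommAlg K} (f : SHom A C) (g : SHom B C) (a : A) (b : B) :
    (SHom.lift f g).toAlgHom (STensor.mk a b : STensor A B) = f.toAlgHom a * g.toAlgHom b := rfl

/-- The identity homomorphism. -/
def SHom.id (A : SuperCommAlg K) : SHom A A := ⟨AlgHom.id K A, fun _ => rfl⟩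

/-- Homomorphisms from a commutative algebra to even elements. -/
def SHom.ofComm {B : Type u} [CommRing B] [Algebra K B] (f : B →ₐ[K] A)
    (hf : ∀ b, A.parity (f b) = f b) : SHom (SuperCommAlg.ofComm (K := K) B) A :=
  ⟨f, fun b => (hf b).symm⟩

end

end Algebras


/-! ### Points of `GL(V)` as invertible supermatrices. -/

noncomputable section Points

variable {K : Type u} [Field K] {V : SuperSpace K} {p q : ℕ}

/-- The sign of a basis vector: `1` for even vectors, `-1` for odd vectors. -/
def sgn (K : Type u) [Field K] {p q : ℕ} : Fin p ⊕ Fin q → K :=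
  Sum.elim (fun _ => 1) (fun _ => -1)

lemma sgn_mul_self (i : Fin p ⊕ Fin q) : sgn K i * sgn K i = 1 := by
  rcases i with i | i <;> simp [sgn]

/-- Supermatrices: the diagonal blocks are even and the off-diagonal blocks are odd. -/
def IsSuper (A : SuperCommAlg K) (X : Matrix (Fin p ⊕ Fin q) (Fin p ⊕ Fin q) A) : Prop :=
  ∀ i j, A.parity (X i j) = (sgn K i * sgn K j) • X i j

variable (e : HomBasis V p q) (A : SuperCommAlg K)

lemma HomBasis.parity_basis (i : Fin p ⊕ Fin q) :
    V.parity (e.basis i) = sgn K i • e.basis i := by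
  rcases i with i | i
  · simp [sgn, e.even]
  · simp [sgn, e.odd]

/-- The endomorphism of `V ⊗ A` with a given matrix. -/
def toEnd (X : Matrix (Fin p ⊕ Fin q) (Fin p ⊕ Fin q) A) : Module.End K (V ⊗[K] A) :=
  rext A (e.basis.constr K fun j => ∑ i, e.basis i ⊗ₜ[K] X i j)

lemma toEnd_basis (X : Matrix (Fin p ⊕ Fin q) (Fin p ⊕ Fin q) A) (j : Fin p ⊕ Fin q) :
    toEnd e A X (e.basis j ⊗ₜ 1) = ∑ i, e.basis i ⊗ₜ[K] X i j := by
  rw [toEnd, rext_tmul, rmul_one, Module.Basis.constr_basis]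

lemma toEnd_rmul (X : Matrix (Fin p ⊕ Fin q) (Fin p ⊕ Fin q) A) (a : A) (x : V ⊗[K] A) :
    toEnd e A X (rmul V A a x) = rmul V A a (toEnd e A X x) := rext_rmul A _ a x

lemma coordA_basis_tmul (i j : Fin p ⊕ Fin q) (a : A) :
    coordA e.basis A i (e.basis j ⊗ₜ a) = if j = i then a else 0 := by
  simp [coordA, Finsupp.single_apply]

lemma mat_toEnd (X : Matrix (Fin p ⊕ Fin q) (Fin p ⊕ Fin q) A) :
    mat e.basis A (toEnd e A X) = X := by
  ext i j
  change coordA e.basis A i (toEnd e A X (e.basis j ⊗ₜ 1)) = X i j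
  rw [toEnd_basis, map_sum]
  simp [coordA_basis_tmul]

lemma sum_coordA (x : V ⊗[K] A) : x = ∑ i, e.basis i ⊗ₜ[K] coordA e.basis A i x := by
  induction x with
  | zero => simp
  | add x y hx hy =>
    conv_lhs => rw [hx, hy]
    simp only [map_add, TensorProduct.tmul_add, Finset.sum_add_distrib]
  | tmul v a =>
    conv_lhs => rw [← e.basis.sum_repr v, TensorProduct.sum_tmul]
    refine Finset.sum_congr rfl fun i _ => ?_
    simp [coordA, TensorProduct.smul_tmul]

variable {A} in
lemma apply_basis (f : Module.End K (V ⊗[K] A)) (j : Fin p ⊕ Fin q) :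
    f (e.basis j ⊗ₜ 1) = ∑ i, e.basis i ⊗ₜ[K] mat e.basis A f i j :=
  sum_coordA e A (f (e.basis j ⊗ₜ 1))

variable {A} in
lemma end_ext {Y : Type u} [AddCommGroup Y] [Module K Y] {f g : V ⊗[K] A →ₗ[K] Y ⊗[K] A}
    (hf : ∀ a x, f (rmul V A a x) = rmul Y A a (f x))
    (hg : ∀ a x, g (rmul V A a x) = rmul Y A a (g x))
    (h : ∀ j, f (e.basis j ⊗ₜ 1) = g (e.basis j ⊗ₜ 1)) : f = g := by
  refine ext_rlin A hf hg fun x => ?_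
  have : f ∘ₗ incl V A = g ∘ₗ incl V A := e.basis.ext h
  exact LinearMap.congr_fun this x

variable {A} in
lemma eq_of_mat_eq {f g : Module.End K (V ⊗[K] A)}
    (hf : ∀ a x, f (rmul V A a x) = rmul V A a (f x))
    (hg : ∀ a x, g (rmul V A a x) = rmul V A a (g x))
    (h : mat e.basis A f = mat e.basis A g) : f = g :=
  end_ext e hf hg fun j => by rw [apply_basis, apply_basis, h]

lemma toEnd_mem {X : Matrix (Fin p ⊕ Fin q) (Fin p ⊕ Fin q) A} (hX : IsSuper A X) :
    toEnd e A X ∈ evenEnd V.parity A := by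
  refine ⟨fun x => ?_, toEnd_rmul e A X⟩
  rw [sum_coordA e A x]
  simp only [map_sum]
  refine Finset.sum_congr rfl fun j _ => ?_
  generalize coordA e.basis A j x = a
  have e1 : e.basis j ⊗ₜ[K] a = rmul V A a (e.basis j ⊗ₜ 1) := by simp
  rw [par_tmul, e.parity_basis, e1, toEnd_rmul, par_rmul, toEnd_basis, TensorProduct.smul_tmul]
  have e2 : e.basis j ⊗ₜ[K] (sgn K j • A.parity a) =
      rmul V A (sgn K j • A.parity a) (e.basis j ⊗ₜ 1) := by simp
  rw [e2, toEnd_rmul, toEnd_basis]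
  simp only [map_sum]
  refine Finset.sum_congr rfl fun i _ => ?_
  rw [par_tmul, e.parity_basis, hX, rmul_tmul, rmul_tmul, TensorProduct.smul_tmul, smul_mul_assoc,
    mul_smul_comm, smul_smul, ← mul_assoc, sgn_mul_self, one_mul]

lemma toEnd_mul (X Y : Matrix (Fin p ⊕ Fin q) (Fin p ⊕ Fin q) A) :
    toEnd e A (X * Y) = toEnd e A X * toEnd e A Y := by
  refine eq_of_mat_eq e (toEnd_rmul e A _) (fun a x => ?_) ?_
  · simp only [Module.End.mul_apply, toEnd_rmul]
  · rw [mat_mul A e.basis (toEnd_rmul e A X), mat_toEnd, mat_toEnd, mat_toEnd]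

lemma toEnd_one : toEnd e A 1 = 1 :=
  eq_of_mat_eq e (toEnd_rmul e A _) (fun _ _ => rfl) (by rw [mat_toEnd, mat_one])

/-- An invertible supermatrix is the matrix of a point of `GL(V)`. -/
lemma exists_point {X Y : Matrix (Fin p ⊕ Fin q) (Fin p ⊕ Fin q) A} (hX : IsSuper A X)
    (hY : IsSuper A Y) (h : X * Y = 1) (h' : Y * X = 1) :
    ∃ g : SGL V A, mat e.basis A g.1.1 = X :=
  ⟨⟨⟨toEnd e A X, toEnd_mem e A hX⟩, ⟨toEnd e A Y, toEnd_mem e A hY⟩,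
    Subtype.ext (by change toEnd e A X * toEnd e A Y = 1; rw [← toEnd_mul, h, toEnd_one]),
    Subtype.ext (by change toEnd e A Y * toEnd e A X = 1; rw [← toEnd_mul, h', toEnd_one])⟩,
    mat_toEnd e A X⟩

variable {A}

/-- The matrix of a point. -/
abbrev pmat (g : SGL V A) : Matrix (Fin p ⊕ Fin q) (Fin p ⊕ Fin q) A := mat e.basis A g.1.1

lemma point_ext {g h : SGL V A} (hm : pmat e g = pmat e h) : g = h :=
  Units.ext (Subtype.ext (eq_of_mat_eq e g.1.2.2 h.1.2.2 hm))

lemma pmat_mul (g h : SGL V A) : pmat e (g * h) = pmat e g * pmat e h :=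
  mat_mul A e.basis g.1.2.2 h.1.1

lemma pmat_one : pmat e (1 : SGL V A) = 1 := mat_one A e.basis

lemma pmat_mul_inv (g : SGL V A) : pmat e g * pmat e g⁻¹ = 1 := by
  rw [← pmat_mul, mul_inv_cancel, pmat_one]

lemma pmat_inv_mul (g : SGL V A) : pmat e g⁻¹ * pmat e g = 1 := by
  rw [← pmat_mul, inv_mul_cancel, pmat_one]

lemma pmat_isSuper (g : SGL V A) : IsSuper A (pmat e g) := by
  obtain ⟨h1, h2, h3, h4⟩ := mat_parity e g.1.2
  rintro (i | i) (j | j)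
  · simpa [sgn, Matrix.toBlocks₁₁] using h1 i j
  · simpa [sgn, Matrix.toBlocks₁₂] using h2 i j
  · simpa [sgn, Matrix.toBlocks₂₁] using h3 i j
  · simpa [sgn, Matrix.toBlocks₂₂] using h4 i j

/-- With this, naturality of a representation can be applied after a comparison of matrix entries.
-/
lemma isBaseChange_iff {B : SuperCommAlg K} (φ : SHom A B) (g : SGL V A) (g' : SGL V B) :
    IsBaseChange φ g.1.1 g'.1.1 ↔ pmat e g' = (pmat e g).map φ.toAlgHom := by
  have key : ∀ j, LinearMap.lTensor V φ.toAlgHom.toLinearMap (g.1.1 (e.basis j ⊗ₜ 1)) =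
      ∑ i, e.basis i ⊗ₜ[K] φ.toAlgHom (pmat e g i j) := fun j => by
    rw [apply_basis e, map_sum]
    rfl
  constructor
  · intro h
    ext i j
    have h0 := h (e.basis j ⊗ₜ 1)
    rw [LinearMap.lTensor_tmul, AlgHom.toLinearMap_apply, map_one, key] at h0
    change coordA e.basis B i (g'.1.1 (e.basis j ⊗ₜ 1)) = φ.toAlgHom (pmat e g i j)
    rw [h0, map_sum]
    simp [coordA_basis_tmul]
  · intro h
    refine isBaseChange_of A φ g.1.2.2 g'.1.2.2 fun x => ?_
    have : g'.1.1 ∘ₗ incl V B =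
        LinearMap.lTensor V φ.toAlgHom.toLinearMap ∘ₗ g.1.1 ∘ₗ incl V A := by
      refine e.basis.ext fun j => ?_
      change g'.1.1 (e.basis j ⊗ₜ 1) =
        LinearMap.lTensor V φ.toAlgHom.toLinearMap (g.1.1 (e.basis j ⊗ₜ 1))
      rw [key, apply_basis e]
      change ∑ i, e.basis i ⊗ₜ[K] pmat e g' i j = _
      rw [h]; rfl
    exact LinearMap.congr_fun this x

lemma IsSuper.map {B : SuperCommAlg K} (φ : SHom A B)
    {X : Matrix (Fin p ⊕ Fin q) (Fin p ⊕ Fin q) A} (hX : IsSuper A X) :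
    IsSuper B (X.map φ.toAlgHom) := fun i j => by
  rw [Matrix.map_apply, ← φ.map_parity, hX, map_smul]

lemma exists_baseChange {B : SuperCommAlg K} (φ : SHom A B) (g : SGL V A) :
    ∃ g' : SGL V B, pmat e g' = (pmat e g).map φ.toAlgHom :=
  exists_point e B ((pmat_isSuper e g).map φ) ((pmat_isSuper e g⁻¹).map φ)
    (by rw [← Matrix.map_mul, pmat_mul_inv, Matrix.map_one _ (map_zero _) (map_one _)])
    (by rw [← Matrix.map_mul, pmat_inv_mul, Matrix.map_one _ (map_zero _) (map_one _)])

lemma pmat_parity_comm (g : SGL V A) :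
    g ∈ blockDiag V A ↔ ∀ i j, sgn K i • pmat e g i j = sgn K j • pmat e g i j := by
  have key : ∀ j, LinearMap.rTensor A V.parity (g.1.1 (e.basis j ⊗ₜ 1)) =
      ∑ i, e.basis i ⊗ₜ[K] (sgn K i • pmat e g i j) := fun j => by
    rw [apply_basis e, map_sum]
    refine Finset.sum_congr rfl fun i _ => ?_
    rw [LinearMap.rTensor_tmul, e.parity_basis, TensorProduct.smul_tmul]
  have key' : ∀ j, g.1.1 (LinearMap.rTensor A V.parity (e.basis j ⊗ₜ 1)) =
      ∑ i, e.basis i ⊗ₜ[K] (sgn K j • pmat e g i j) := fun j => by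
    rw [LinearMap.rTensor_tmul, e.parity_basis, ← TensorProduct.smul_tmul', map_smul,
      apply_basis e, Finset.smul_sum]
    refine Finset.sum_congr rfl fun i _ => ?_
    rw [TensorProduct.tmul_smul]
  constructor
  · intro h i j
    have h1 := congrArg (coordA e.basis A i) (h (e.basis j ⊗ₜ 1))
    rw [key, key', map_sum, map_sum] at h1
    simpa [coordA_basis_tmul] using h1.symm
  · intro h x
    have : g.1.1 ∘ₗ LinearMap.rTensor A V.parity = LinearMap.rTensor A V.parity ∘ₗ g.1.1 := by
      refine end_ext e (fun a x => ?_) (fun a x => ?_) fun j => ?_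
      · simp only [LinearMap.comp_apply, rTensor_rmul, g.1.2.2]
      · simp only [LinearMap.comp_apply, rTensor_rmul, g.1.2.2]
      · rw [LinearMap.comp_apply, LinearMap.comp_apply, key, key']
        exact Finset.sum_congr rfl fun i _ => by rw [h i j]
    exact LinearMap.congr_fun this x

variable [CharZero K]

lemma mem_blockDiag_iff (g : SGL V A) :
    g ∈ blockDiag V A ↔ (∀ i j, pmat e g (.inl i) (.inr j) = 0) ∧
      ∀ i j, pmat e g (.inr i) (.inl j) = 0 := by
  rw [pmat_parity_comm e]
  have h2 : (2 : K) ≠ 0 := two_ne_zero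
  constructor
  · intro h
    constructor
    · intro i j
      have := h (.inl i) (.inr j)
      simp only [sgn, Sum.elim_inl, Sum.elim_inr, one_smul, neg_smul] at this
      have h3 : (2 : K) • pmat e g (.inl i) (.inr j) = 0 := by
        rw [two_smul]; nth_rw 1 [this]; simp
      exact (smul_eq_zero.1 h3).resolve_left h2
    · intro i j
      have := h (.inr i) (.inl j)
      simp only [sgn, Sum.elim_inl, Sum.elim_inr, one_smul, neg_smul] at this
      have h3 : (2 : K) • pmat e g (.inr i) (.inl j) = 0 := by
        rw [two_smul]; nth_rw 1 [← this]; simp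
      exact (smul_eq_zero.1 h3).resolve_left h2
  · rintro ⟨h, h'⟩ (i | i) (j | j)
    · rfl
    · rw [h, smul_zero, smul_zero]
    · rw [h', smul_zero, smul_zero]
    · rfl

end Points


/-! ### Unipotent matrices and the block Gauss decomposition. -/

noncomputable section Gauss

variable {K : Type u} [Field K] {V : SuperSpace K} {p q : ℕ}

/-- `X` differs from the identity only in the entries `(i, j)` with `h i < h j`. -/
def IsUni {R : Type u} [Ring R] {ι : Type} [DecidableEq ι] (h : ι → ℤ) (X : Matrix ι ι R) : Prop :=
  ∀ i j, ¬ h i < h j → X i j = (1 : Matrix ι ι R) i j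

/-- Row `i` of `X * Y = 1` expresses row `i` of `Y` through rows of strictly greater height, which
suggests induction on the distance of `h i` from an upper bound of `h`. -/
lemma IsUni.inv {R : Type u} [Ring R] {ι : Type} [Fintype ι] [DecidableEq ι] {h : ι → ℤ}
    {X Y : Matrix ι ι R} (hX : IsUni h X) (hXY : X * Y = 1) : IsUni h Y := by
  obtain ⟨B, hB⟩ : ∃ B : ℤ, ∀ i, h i ≤ B := by
    obtain ⟨B, hB⟩ := (Set.finite_range h).bddAbove
    exact ⟨B, fun i => hB ⟨i, rfl⟩⟩
  have key : ∀ n : ℕ, ∀ i, B - h i = n → ∀ j, ¬ h i < h j → Y i j = (1 : Matrix ι ι R) i j := by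
    intro n
    induction n using Nat.strong_induction_on with
    | _ n ih =>
      intro i hi j hij
      have h1 : (X * Y) i j = X i i * Y i j + 0 := by
        rw [Matrix.mul_apply, ← Finset.add_sum_erase _ _ (Finset.mem_univ i)]
        congr 1
        refine Finset.sum_eq_zero fun k hk => ?_
        have hki := Finset.ne_of_mem_erase hk
        by_cases hik : h i < h k
        · have h2 := hB k
          rw [ih (B - h k).toNat (by omega) k (by omega) j (by omega),
            Matrix.one_apply_ne (by rintro rfl; omega), mul_zero]
        · rw [hX i k hik, Matrix.one_apply_ne hki.symm, zero_mul]
      rw [hXY, hX i i (lt_irrefl _), Matrix.one_apply_eq, one_mul, add_zero] at h1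
      exact h1.symm
  exact fun i j hij => key (B - h i).toNat i (by have := hB i; omega) j hij

/-- The height of a basis vector: even vectors come first. -/
def hgt {p q : ℕ} : Fin p ⊕ Fin q → ℤ := Sum.elim (fun i => (i : ℤ)) (fun j => (p + j : ℤ))

/-- The properties of the functors `GL(V)` and `GL(V₀) × GL(V₁)` used in highest weight theory. -/
structure Reductive (e : HomBasis V p q) (H : SubgroupFunctor V) : Prop where
  block_le : ∀ A, blockDiag V A ≤ H A
  -- Membership depends only on which off-diagonal entries vanish; thus base changes of a point, and
  -- the contractions of a unipotent point used later, stay in the subgroup.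
  mem_of_support : ∀ {A B : SuperCommAlg K} {g : SGL V A}, g ∈ H A → ∀ {g' : SGL V B},
    (∀ i j, i ≠ j → pmat e g i j = 0 → pmat e g' i j = 0) → g' ∈ H B
  gauss : ∀ {A : SuperCommAlg K} {g : SGL V A}, g ∈ H A → ∃ n ∈ H A, ∃ g₀ ∈ blockDiag V A,
    ∃ n' ∈ H A, g = n * g₀ * n' ∧ IsUni hgt (pmat e n) ∧ IsUni (-hgt) (pmat e n')

variable [CharZero K] (e : HomBasis V p q)

lemma reductive_blockDiag : Reductive e (blockDiag V) where
  block_le _ := le_rfl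
  mem_of_support {A B g} hg g' h := by
    rw [mem_blockDiag_iff e] at hg ⊢
    exact ⟨fun i j => h _ _ (by simp) (hg.1 i j), fun i j => h _ _ (by simp) (hg.2 i j)⟩
  gauss {A g} hg := ⟨1, one_mem _, g, hg, 1, one_mem _, by simp, fun i j _ => by rw [pmat_one],
    fun i j _ => by rw [pmat_one]⟩

lemma isSuper_upper {A : SuperCommAlg K} {b : Matrix (Fin p) (Fin q) A} (hb : IsOd A b) :
    IsSuper A (Matrix.fromBlocks 1 b 0 1) := by
  rintro (i | i) (j | j)
  · simpa [sgn] using isEv_one i j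
  · simpa [sgn] using hb i j
  · simp
  · simpa [sgn] using isEv_one i j

lemma isSuper_lower {A : SuperCommAlg K} {c : Matrix (Fin q) (Fin p) A} (hc : IsOd A c) :
    IsSuper A (Matrix.fromBlocks 1 0 c 1) := by
  rintro (i | i) (j | j)
  · simpa [sgn] using isEv_one i j
  · simp
  · simpa [sgn] using hc i j
  · simpa [sgn] using isEv_one i j

lemma exists_upper {A : SuperCommAlg K} {b : Matrix (Fin p) (Fin q) A} (hb : IsOd A b) :
    ∃ g : SGL V A, pmat e g = Matrix.fromBlocks 1 b 0 1 ∧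
      pmat e g⁻¹ = Matrix.fromBlocks 1 (-b) 0 1 := by
  have h1 : Matrix.fromBlocks 1 b 0 1 * Matrix.fromBlocks 1 (-b) 0 1 =
      (1 : Matrix (Fin p ⊕ Fin q) (Fin p ⊕ Fin q) A) := by
    simp [Matrix.fromBlocks_multiply]
  have h2 : Matrix.fromBlocks 1 (-b) 0 1 * Matrix.fromBlocks 1 b 0 1 =
      (1 : Matrix (Fin p ⊕ Fin q) (Fin p ⊕ Fin q) A) := by
    simp [Matrix.fromBlocks_multiply]
  obtain ⟨g, hg⟩ := exists_point e A (isSuper_upper hb) (isSuper_upper hb.neg) h1 h2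
  refine ⟨g, hg, ?_⟩
  calc pmat e g⁻¹ = pmat e g⁻¹ * (Matrix.fromBlocks 1 b 0 1 * Matrix.fromBlocks 1 (-b) 0 1) := by
        rw [h1, mul_one]
    _ = _ := by rw [← hg, ← mul_assoc, pmat_inv_mul, one_mul]

lemma exists_lower {A : SuperCommAlg K} {c : Matrix (Fin q) (Fin p) A} (hc : IsOd A c) :
    ∃ g : SGL V A, pmat e g = Matrix.fromBlocks 1 0 c 1 ∧
      pmat e g⁻¹ = Matrix.fromBlocks 1 0 (-c) 1 := by
  have h1 : Matrix.fromBlocks 1 0 c 1 * Matrix.fromBlocks 1 0 (-c) 1 =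
      (1 : Matrix (Fin p ⊕ Fin q) (Fin p ⊕ Fin q) A) := by
    simp [Matrix.fromBlocks_multiply]
  have h2 : Matrix.fromBlocks 1 0 (-c) 1 * Matrix.fromBlocks 1 0 c 1 =
      (1 : Matrix (Fin p ⊕ Fin q) (Fin p ⊕ Fin q) A) := by
    simp [Matrix.fromBlocks_multiply]
  obtain ⟨g, hg⟩ := exists_point e A (isSuper_lower hc) (isSuper_lower hc.neg) h1 h2
  refine ⟨g, hg, ?_⟩
  calc pmat e g⁻¹ = pmat e g⁻¹ * (Matrix.fromBlocks 1 0 c 1 * Matrix.fromBlocks 1 0 (-c) 1) := by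
        rw [h1, mul_one]
    _ = _ := by rw [← hg, ← mul_assoc, pmat_inv_mul, one_mul]

/-- Schur complement: with blocks `a b c d`, the point is the product of an upper factor with corner
`b d⁻¹`, of the block-diagonal factor with blocks `a - b d⁻¹ c` and `d`, and of a lower factor with
corner `d⁻¹ c`. Only invertibility of `d` is needed, which is automatic for points of the supergroup
by `exists_evInv`. -/
lemma reductive_fullGL : Reductive e (fullGL V) where
  block_le _ := le_top
  mem_of_support _ _ _ := trivial
  gauss {A g} _ := by
    obtain ⟨h1, h2, h3, h4⟩ := mat_parity e g.1.2
    obtain ⟨w, hw⟩ := exists_evInv e g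
    have hX : pmat e g = _ := (Matrix.fromBlocks_toBlocks (mat e.basis A g.1.1)).symm
    generalize (mat e.basis A g.1.1).toBlocks₁₁ = a at *
    generalize (mat e.basis A g.1.1).toBlocks₁₂ = b at *
    generalize (mat e.basis A g.1.1).toBlocks₂₁ = c at *
    generalize (mat e.basis A g.1.1).toBlocks₂₂ = d at *
    obtain ⟨n, hn, hn'⟩ := exists_upper e (h2.mul_ev hw.he)
    obtain ⟨m, hm, hm'⟩ := exists_lower e (hw.he.mul_od h3)
    refine ⟨n, trivial, n⁻¹ * g * m⁻¹, ?_, m, trivial, by group, ?_, ?_⟩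
    · have : pmat e (n⁻¹ * g * m⁻¹) = Matrix.fromBlocks (a - b * w * c) 0 0 d := by
        rw [pmat_mul, pmat_mul, hn', hm', hX, Matrix.fromBlocks_multiply,
          Matrix.fromBlocks_multiply]
        have e1 : b * w * d = b := by rw [Matrix.mul_assoc, hw.left, Matrix.mul_one]
        have e2 : d * (w * c) = c := by rw [← Matrix.mul_assoc, hw.right, Matrix.one_mul]
        simp [e1, e2, sub_eq_add_neg]
      rw [mem_blockDiag_iff e, this]
      exact ⟨fun _ _ => rfl, fun _ _ => rfl⟩
    · rw [hn]
      rintro (i | i) (j | j) h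
      · simp [Matrix.one_apply]
      · have hi := i.2
        simp only [hgt, Sum.elim_inl, Sum.elim_inr] at h; omega
      · simp
      · simp [Matrix.one_apply]
    · rw [hm]
      rintro (i | i) (j | j) h
      · simp [Matrix.one_apply]
      · simp
      · have hj := j.2
        simp only [hgt, Pi.neg_apply, Sum.elim_inl, Sum.elim_inr] at h; omega
      · simp [Matrix.one_apply]

end Gauss


/-! ### Matrix coefficients: extending linear forms to `M ⊗ A`. -/

noncomputable section Coefficients

variable {K : Type u} [Field K] (A : SuperCommAlg K) {M : Type u} [AddCommGroup M] [Module K M]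
  {N : Type u} [AddCommGroup N] [Module K N]

/-- The extension `M ⊗ A → A` of a linear form on `M`. -/
def co (φ : M →ₗ[K] K) : M ⊗[K] A →ₗ[K] A :=
  (TensorProduct.lid K A).toLinearMap ∘ₗ LinearMap.rTensor A φ

/-- The extension `M ⊗ A → M` of a linear form on `A`. -/
def ct (M : Type u) [AddCommGroup M] [Module K M] {A : SuperCommAlg K} (θ : A →ₗ[K] K) :
    M ⊗[K] A →ₗ[K] M :=
  (TensorProduct.rid K M).toLinearMap ∘ₗ LinearMap.lTensor M θ

@[simp] lemma co_tmul (φ : M →ₗ[K] K) (m : M) (a : A) : co A φ (m ⊗ₜ a) = φ m • a := by simp [co]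

@[simp] lemma ct_tmul {A : SuperCommAlg K} (θ : A →ₗ[K] K) (m : M) (a : A) :
    ct M θ (m ⊗ₜ a) = θ a • m := by simp [ct]

lemma co_rmul (φ : M →ₗ[K] K) (a : A) (x : M ⊗[K] A) : co A φ (rmul M A a x) = co A φ x * a := by
  induction x with
  | zero => simp
  | tmul y c => simp
  | add y z hy hz => simp only [map_add, hy, hz, add_mul]

lemma co_rTensor (φ : N →ₗ[K] K) (l : M →ₗ[K] N) (x : M ⊗[K] A) :
    co A φ (LinearMap.rTensor A l x) = co A (φ ∘ₗ l) x := by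
  induction x with
  | zero => simp
  | tmul y c => simp
  | add y z hy hz => simp only [map_add, hy, hz]

lemma ct_rTensor {A : SuperCommAlg K} (θ : A →ₗ[K] K) (l : M →ₗ[K] N) (x : M ⊗[K] A) :
    ct N θ (LinearMap.rTensor A l x) = l (ct M θ x) := by
  induction x with
  | zero => simp
  | tmul y c => simp
  | add y z hy hz => simp only [map_add, hy, hz]

lemma co_lTensor {A B : SuperCommAlg K} (f : SHom A B) (φ : M →ₗ[K] K) (x : M ⊗[K] A) :
    co B φ (LinearMap.lTensor M f.toAlgHom.toLinearMap x) = f.toAlgHom (co A φ x) := by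
  induction x with
  | zero => simp
  | tmul y c => simp
  | add y z hy hz => simp only [map_add, hy, hz]

lemma eq_zero_of_co [Module.Finite K M] {x : M ⊗[K] A} (h : ∀ φ : M →ₗ[K] K, co A φ x = 0) :
    x = 0 := by
  let b := Module.finBasis K M
  have key : ∀ x : M ⊗[K] A, x = ∑ i, b i ⊗ₜ[K] co A (b.coord i) x := by
    intro x
    induction x with
    | zero => simp
    | add x y hx hy =>
      conv_lhs => rw [hx, hy]
      simp only [map_add, TensorProduct.tmul_add, Finset.sum_add_distrib]
    | tmul v a =>
      conv_lhs => rw [← b.sum_repr v, TensorProduct.sum_tmul]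
      exact Finset.sum_congr rfl fun i _ => by simp [TensorProduct.smul_tmul]
  rw [key x]
  simp [h]

lemma ext_co [Module.Finite K M] {x y : M ⊗[K] A} (h : ∀ φ : M →ₗ[K] K, co A φ x = co A φ y) :
    x = y := by
  rw [← sub_eq_zero]
  exact eq_zero_of_co A fun φ => by rw [map_sub, h, sub_self]

/-- If `r` is a projection onto `S`, then `φ - φ ∘ r` vanishes on `S` for every form `φ`, so all
coefficients of `x` and of its projection agree. Stability of a subspace thereby becomes the
vanishing of matrix coefficients. -/
lemma mem_baseSub_of_co [Module.Finite K M] {S : Submodule K M} {x : M ⊗[K] A}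
    (h : ∀ φ : M →ₗ[K] K, (∀ m ∈ S, φ m = 0) → co A φ x = 0) : x ∈ baseSub S A := by
  obtain ⟨r, hr⟩ := LinearMap.exists_leftInverse_of_injective S.subtype S.ker_subtype
  have hr' : ∀ m ∈ S, S.subtype (r m) = m := fun m hm =>
    congrArg S.subtype (LinearMap.congr_fun hr ⟨m, hm⟩)
  have e : x = LinearMap.rTensor A (S.subtype ∘ₗ r) x := by
    refine ext_co A fun φ => ?_
    rw [co_rTensor]
    have := h (φ - φ ∘ₗ S.subtype ∘ₗ r) fun m hm => by
      simp only [LinearMap.sub_apply, LinearMap.comp_apply, hr' m hm, sub_self]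
    have h2 : co A (φ - φ ∘ₗ S.subtype ∘ₗ r) x = co A φ x - co A (φ ∘ₗ S.subtype ∘ₗ r) x := by
      simp [co, LinearMap.rTensor_sub]
    rw [h2] at this
    exact sub_eq_zero.1 this
  rw [e]
  induction x with
  | zero => simp
  | tmul y c => exact tmul_mem_baseSub (r y).2 c
  | add y z hy hz =>
    rw [map_add]
    have : ∀ y : M ⊗[K] A, LinearMap.rTensor A (S.subtype ∘ₗ r) y ∈ baseSub S A := fun y => by
      induction y with
      | zero => simp
      | tmul y c => exact tmul_mem_baseSub (r y).2 c
      | add y z hy hz => rw [map_add]; exact add_mem hy hz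
    exact add_mem (this y) (this z)

end Coefficients

/-! ### The diagonal torus: its characters, its generic point, its points over `K`. -/

noncomputable section Torus

variable {K : Type u} [Field K] {p q : ℕ}

/-- The coordinate algebra of the diagonal torus. -/
abbrev Laurent (K : Type u) [Field K] (p q : ℕ) : Type u :=
  AddMonoidAlgebra K (Fin p ⊕ Fin q → ℤ)

/-- The value of the characters of the torus at a point. -/
def chi {R : Type u} [CommRing R] (t : Fin p ⊕ Fin q → Rˣ) :
    Multiplicative (Fin p ⊕ Fin q → ℤ) →* R :=
  (Units.coeHom R).comp
    { toFun := fun l => ∏ i, t i ^ (l.toAdd i)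
      map_one' := by simp
      map_mul' := fun l m => by simp [zpow_add, Finset.prod_mul_distrib] }

lemma chi_apply {R : Type u} [CommRing R] (t : Fin p ⊕ Fin q → Rˣ) (l : Fin p ⊕ Fin q → ℤ) :
    chi t (Multiplicative.ofAdd l) = ((∏ i, t i ^ l i : Rˣ) : R) := rfl

lemma chi_single {R : Type u} [CommRing R] (t : Fin p ⊕ Fin q → Rˣ) (i : Fin p ⊕ Fin q) :
    chi t (Multiplicative.ofAdd (Pi.single i 1)) = t i := by
  rw [chi_apply, Finset.prod_eq_single i]
  · simp
  · intro j _ h; simp [h]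
  · simp

lemma chi_mul {R : Type u} [CommRing R] (s t : Fin p ⊕ Fin q → Rˣ) (l) :
    chi (s * t) l = chi s l * chi t l := by
  change ((∏ i, (s i * t i) ^ (l.toAdd i) : Rˣ) : R) =
    ((∏ i, s i ^ (l.toAdd i) : Rˣ) : R) * ((∏ i, t i ^ (l.toAdd i) : Rˣ) : R)
  rw [← Units.val_mul, ← Finset.prod_mul_distrib]
  simp [mul_zpow]

lemma chi_one {R : Type u} [CommRing R] (l) :
    chi (1 : Fin p ⊕ Fin q → Rˣ) l = 1 := by
  change ((∏ i, (1 : Rˣ) ^ (l.toAdd i) : Rˣ) : R) = 1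
  simp

/-- Evaluation of Laurent polynomials at a point of the torus. -/
def evalTorus {R : Type u} [CommRing R] [Algebra K R] (t : Fin p ⊕ Fin q → Rˣ) :
    Laurent K p q →ₐ[K] R := AddMonoidAlgebra.lift K R _ (chi t)

lemma evalTorus_single {R : Type u} [CommRing R] [Algebra K R] (t : Fin p ⊕ Fin q → Rˣ)
    (l : Fin p ⊕ Fin q → ℤ) :
    evalTorus (K := K) t (AddMonoidAlgebra.single l 1) = chi t (Multiplicative.ofAdd l) := by
  rw [evalTorus, AddMonoidAlgebra.lift_single, one_smul]

/-- The coordinates of the generic point of the torus. -/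
def genUnit (i : Fin p ⊕ Fin q) : (Laurent K p q)ˣ where
  val := AddMonoidAlgebra.single (Pi.single i 1) 1
  inv := AddMonoidAlgebra.single (-Pi.single i 1) 1
  val_inv := by rw [AddMonoidAlgebra.single_mul_single, add_neg_cancel, mul_one]; rfl
  inv_val := by rw [AddMonoidAlgebra.single_mul_single, neg_add_cancel, mul_one]; rfl

variable [CharZero K]

/-- Test on the point with coordinate `2` in one slot and `1` elsewhere: in characteristic zero `2`
has infinite order. No assumption that `K` is algebraically closed is needed. -/
lemma chi_injective {l m : Fin p ⊕ Fin q → ℤ}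
    (h : ∀ t : Fin p ⊕ Fin q → Kˣ, chi t (Multiplicative.ofAdd l) = chi t (Multiplicative.ofAdd m)) :
    l = m := by
  funext i
  have key : ∀ l : Fin p ⊕ Fin q → ℤ, chi (Function.update 1 i (Units.mk0 (2 : K) two_ne_zero))
      (Multiplicative.ofAdd l) = (2 : K) ^ l i := by
    intro l
    rw [chi_apply, Finset.prod_eq_single i]
    · simp
    · intro j _ h; simp [h]
    · simp
  have h1 := h (Function.update 1 i (Units.mk0 (2 : K) two_ne_zero))
  rw [key, key] at h1
  have h2 : (2 : ℚ) ^ l i = 2 ^ m i := by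
    have : (((2 : ℚ) ^ l i : ℚ) : K) = ((2 ^ m i : ℚ) : K) := by push_cast; exact h1
    exact_mod_cast this
  exact zpow_right_injective₀ (by norm_num) (by norm_num) h2

variable (K) in
-- Dedekind's independence of characters, applied after composing the vectors `v l` with an
-- arbitrary linear form.
lemma chi_independent {W : Type u} [AddCommGroup W] [Module K W]
    (F : Finset (Fin p ⊕ Fin q → ℤ)) (v : (Fin p ⊕ Fin q → ℤ) → W)
    (h : ∀ t : Fin p ⊕ Fin q → Kˣ, ∑ l ∈ F, chi t (Multiplicative.ofAdd l) • v l = 0) :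
    ∀ l ∈ F, v l = 0 := by
  let X : (Fin p ⊕ Fin q → ℤ) → ((Fin p ⊕ Fin q → Kˣ) →* K) := fun l =>
    { toFun := fun t => chi t (Multiplicative.ofAdd l)
      map_one' := chi_one _
      map_mul' := fun s t => chi_mul s t _ }
  have hX : Function.Injective X := fun l m hlm =>
    chi_injective fun t => DFunLike.congr_fun hlm t
  have hli := (linearIndependent_monoidHom (Fin p ⊕ Fin q → Kˣ) K).comp X hX
  intro l hl
  rw [← Module.forall_dual_apply_eq_zero_iff K]
  intro φ
  refine linearIndependent_iff'.1 hli F (fun l => φ (v l)) ?_ l hl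
  funext t
  have := congrArg φ (h t)
  rw [map_sum, map_zero] at this
  rw [Finset.sum_apply]
  simp only [Pi.zero_apply]
  rw [← this]
  refine Finset.sum_congr rfl fun m _ => ?_
  rw [map_smul, smul_eq_mul, mul_comm]
  rfl

variable {V : SuperSpace K} (e : HomBasis V p q)

lemma exists_diag {A : SuperCommAlg K} {R : Type u} [CommRing R] [Algebra K R] (j : R →ₐ[K] A)
    (hj : ∀ r, A.parity (j r) = j r) (t : Fin p ⊕ Fin q → Rˣ) :
    ∃ g ∈ blockDiag V A, pmat e g = Matrix.diagonal fun i => j (t i) := by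
  have hs : ∀ t : Fin p ⊕ Fin q → R, IsSuper A (Matrix.diagonal fun i => j (t i)) := by
    intro t i k
    by_cases h : i = k
    · subst h; rw [Matrix.diagonal_apply_eq, hj, sgn_mul_self, one_smul]
    · rw [Matrix.diagonal_apply_ne _ h, map_zero, smul_zero]
  obtain ⟨g, hg⟩ := exists_point e A (hs fun i => t i) (hs fun i => (t i)⁻¹.1)
    (by rw [Matrix.diagonal_mul_diagonal, ← Matrix.diagonal_one]
        congr 1; funext i; rw [← map_mul, Units.mul_inv, map_one])
    (by rw [Matrix.diagonal_mul_diagonal, ← Matrix.diagonal_one]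
        congr 1; funext i; rw [← map_mul, Units.inv_mul, map_one])
  exact ⟨g, (mem_blockDiag_iff e g).2
    ⟨fun i k => (congrFun (congrFun hg (.inl i)) (.inr k)).trans (by simp),
      fun i k => (congrFun (congrFun hg (.inr i)) (.inl k)).trans (by simp)⟩, hg⟩

/-- The ground field, as a superalgebra. -/
abbrev KAlg (K : Type u) [Field K] [CharZero K] : SuperCommAlg K := SuperCommAlg.ofComm K

/-- The coordinate algebra of the torus, as a superalgebra. -/
abbrev LAlg (K : Type u) [Field K] [CharZero K] (p q : ℕ) : SuperCommAlg K :=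
  SuperCommAlg.ofComm (Laurent K p q)

/-- Laurent monomials. -/
def lmono (l : Fin p ⊕ Fin q → ℤ) : LAlg K p q :=
  (AddMonoidAlgebra.single l 1 : Laurent K p q)

/-- The generic point of the torus. -/
def genTorus : SGL V (LAlg K p q) :=
  (exists_diag e (A := LAlg K p q) (AlgHom.id K (Laurent K p q))
    (fun _ => rfl) genUnit).choose

lemma genTorus_mem : genTorus e ∈ blockDiag V _ :=
  (exists_diag e (A := LAlg K p q) (AlgHom.id K (Laurent K p q))
    (fun _ => rfl) genUnit).choose_spec.1

lemma pmat_genTorus : pmat e (genTorus e) =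
    Matrix.diagonal fun i => lmono (Pi.single i 1) :=
  (exists_diag e (A := LAlg K p q) (AlgHom.id K (Laurent K p q))
    (fun _ => rfl) genUnit).choose_spec.2

/-- The point of the torus over the ground field with given coordinates. -/
def torusPt (t : Fin p ⊕ Fin q → Kˣ) : SGL V (KAlg K) :=
  (exists_diag e (A := KAlg K) (AlgHom.id K K) (fun _ => rfl) t).choose

lemma torusPt_mem (t : Fin p ⊕ Fin q → Kˣ) : torusPt e t ∈ blockDiag V _ :=
  (exists_diag e (A := KAlg K) (AlgHom.id K K) (fun _ => rfl) t).choose_spec.1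

lemma pmat_torusPt (t : Fin p ⊕ Fin q → Kˣ) :
    pmat e (torusPt e t) =
      Matrix.diagonal fun i => (show KAlg K from (t i : K)) :=
  (exists_diag e (A := KAlg K) (AlgHom.id K K) (fun _ => rfl) t).choose_spec.2

lemma torusPt_mul (s t : Fin p ⊕ Fin q → Kˣ) :
    torusPt e (s * t) = torusPt e s * torusPt e t := by
  refine point_ext e ?_
  rw [pmat_mul, pmat_torusPt, pmat_torusPt, pmat_torusPt, Matrix.diagonal_mul_diagonal]
  rfl

lemma torusPt_one : torusPt e 1 = 1 := by
  refine point_ext e ?_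
  rw [pmat_torusPt, pmat_one, ← Matrix.diagonal_one]
  rfl

end Torus


/-! ### Weight space decomposition. -/

noncomputable section Weights

variable {K : Type u} [Field K] {V : SuperSpace K} {p q : ℕ} {e : HomBasis V p q}
  {H : SubgroupFunctor V}

/-- The action of a point `g ∈ H(A)`. -/
def Rep.gact (M : Rep H) {A : SuperCommAlg K} {g : SGL V A} (hg : g ∈ H A) :
    Module.End K (M.space ⊗[K] A) := (M.act A ⟨g, hg⟩).1

section
variable (M : Rep H) {A : SuperCommAlg K} {g h : SGL V A}

lemma Rep.gact_one : M.gact (one_mem (H A)) = 1 :=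
  congrArg Subtype.val (map_one (M.act A))

lemma Rep.gact_mul (hg : g ∈ H A) (hh : h ∈ H A) :
    M.gact (mul_mem hg hh) = M.gact hg * M.gact hh :=
  congrArg Subtype.val (map_mul (M.act A) (⟨g, hg⟩ : H A) (⟨h, hh⟩ : H A))

lemma Rep.gact_rmul (hg : g ∈ H A) (a : A) (x : M.space ⊗[K] A) :
    M.gact hg (rmul M.space A a x) = rmul M.space A a (M.gact hg x) := (M.act A ⟨g, hg⟩).2.2 a x

lemma Rep.gact_par (hg : g ∈ H A) (x : M.space ⊗[K] A) :
    M.gact hg (par M.space.parity A x) = par M.space.parity A (M.gact hg x) :=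
  (M.act A ⟨g, hg⟩).2.1 x

lemma Rep.gact_tmul (hg : g ∈ H A) (m : M.space) (a : A) :
    M.gact hg (m ⊗ₜ a) = rmul M.space A a (M.gact hg (m ⊗ₜ 1)) :=
  apply_tmul A (M.gact_rmul hg) m a

variable (e) in
lemma Rep.gact_natural {B : SuperCommAlg K} (φ : SHom A B) {g' : SGL V B} (hg : g ∈ H A)
    (hg' : g' ∈ H B) (h : pmat e g' = (pmat e g).map φ.toAlgHom) (m : M.space) :
    M.gact hg' (m ⊗ₜ 1) =
      LinearMap.lTensor M.space φ.toAlgHom.toLinearMap (M.gact hg (m ⊗ₜ 1)) := by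
  have := M.natural A B φ ⟨g, hg⟩ ⟨g', hg'⟩ ((isBaseChange_iff e φ g g').2 h) (m ⊗ₜ 1)
  rw [LinearMap.lTensor_tmul, AlgHom.toLinearMap_apply, map_one] at this
  exact this

lemma Rep.Hom.map_gact {M N : Rep H} (f : M.Hom N) (hg : g ∈ H A) (m : M.space) :
    LinearMap.rTensor A f.toLin (M.gact hg (m ⊗ₜ 1)) = N.gact hg (f.toLin m ⊗ₜ 1) :=
  f.equivariant A ⟨g, hg⟩ (m ⊗ₜ 1)

end

variable [CharZero K]

/-- The identity linear form on the ground field. -/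
def idForm (K : Type u) [Field K] [CharZero K] : (KAlg K) →ₗ[K] K :=
  (LinearMap.id : K →ₗ[K] K)

/-- The endomorphism of `M` given by a point over the ground field. -/
def Rep.opK (M : Rep H) {g : SGL V (KAlg K)} (hg : g ∈ H _) :
    Module.End K M.space := ct M.space (idForm K) ∘ₗ M.gact hg ∘ₗ incl _ _

lemma ct_idForm_tmul {M : Type u} [AddCommGroup M] [Module K M]
    (x : M ⊗[K] (KAlg K)) : ct M (idForm K) x ⊗ₜ 1 = x := by
  induction x with
  | zero => simp
  | tmul y c =>
    rw [ct_tmul, TensorProduct.smul_tmul]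
    congr 1
    exact mul_one (c : K)
  | add y z hy hz => rw [map_add, TensorProduct.add_tmul, hy, hz]

lemma Rep.opK_tmul (M : Rep H) {g : SGL V (KAlg K)} (hg : g ∈ H _)
    (m : M.space) : M.opK hg m ⊗ₜ 1 = M.gact hg (m ⊗ₜ 1) := ct_idForm_tmul _

variable (K) in
lemma tmul_one_injective {M : Type u} [AddCommGroup M] [Module K M] {x y : M}
    (h : x ⊗ₜ[K] (1 : KAlg K) = y ⊗ₜ 1) : x = y := by
  have := congrArg (ct M (idForm K)) h
  rw [ct_tmul, ct_tmul] at this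
  have h1 : idForm K 1 = 1 := rfl
  rwa [h1, one_smul, one_smul] at this

lemma Rep.opK_mul (M : Rep H) {g h : SGL V (KAlg K)} (hg : g ∈ H _)
    (hh : h ∈ H _) : M.opK (mul_mem hg hh) = M.opK hg * M.opK hh := by
  ext m
  apply tmul_one_injective K
  rw [Module.End.mul_apply, M.opK_tmul, M.opK_tmul, M.opK_tmul, M.gact_mul hg hh]
  rfl

lemma Rep.opK_one (M : Rep H) :
    M.opK (one_mem (H (KAlg K))) = 1 := by
  ext m
  apply tmul_one_injective K
  rw [M.opK_tmul, M.gact_one]; rfl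

/-- The coefficient of a Laurent monomial. -/
def wcoeff (l : Fin p ⊕ Fin q → ℤ) : (LAlg K p q) →ₗ[K] K :=
  (Finsupp.lapply l ∘ₗ (AddMonoidAlgebra.coeffLinearEquiv K).toLinearMap : Laurent K p q →ₗ[K] K)

/-- The expansion is asserted for every finite set containing `F`, so that the expansions of
finitely many vectors can be written over one common set of exponents. -/
lemma exists_expansion {M : Type u} [AddCommGroup M] [Module K M]
    (x : M ⊗[K] (LAlg K p q)) :
    ∃ F : Finset (Fin p ⊕ Fin q → ℤ), (∀ l ∉ F, ct M (wcoeff (K := K) l) x = 0) ∧ ∀ F', F ⊆ F' →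
      x = ∑ l ∈ F', ct M (wcoeff (K := K) l) x ⊗ₜ[K] lmono l := by
  classical
  induction x with
  | zero => exact ⟨∅, by simp, by simp⟩
  | add x y hx hy =>
    obtain ⟨F, h1, h2⟩ := hx
    obtain ⟨G, h3, h4⟩ := hy
    refine ⟨F ∪ G, fun l hl => ?_, fun F' hF' => ?_⟩
    · rw [Finset.mem_union, not_or] at hl
      rw [map_add, h1 l hl.1, h3 l hl.2, add_zero]
    · conv_lhs => rw [h2 F' (Finset.union_subset_left hF'), h4 F' (Finset.union_subset_right hF')]
      rw [← Finset.sum_add_distrib]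
      exact Finset.sum_congr rfl fun l _ => by rw [map_add, TensorProduct.add_tmul]
  | tmul m b =>
    let b' : Laurent K p q := b
    have hc : ∀ l, wcoeff l b = b'.coeff l := fun _ => rfl
    have h0 : ∀ l ∉ b'.coeff.support, wcoeff l b = 0 := fun l hl => by
      rw [hc]; simpa using hl
    refine ⟨b'.coeff.support, fun l hl => by rw [ct_tmul, h0 l hl, zero_smul],
      fun F' hF' => ?_⟩
    have hb : b' = ∑ l ∈ F', wcoeff l b • (AddMonoidAlgebra.single l 1 : Laurent K p q) := by
      rw [← Finset.sum_subset hF' fun l _ hl => by rw [h0 l hl, zero_smul]]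
      conv_lhs => rw [← AddMonoidAlgebra.sum_coeff_single b']
      refine Finset.sum_congr rfl fun l _ => ?_
      rw [hc, AddMonoidAlgebra.smul_single, smul_eq_mul, mul_one]
    have hb' : b = ∑ l ∈ F', wcoeff l b •
      lmono l := hb
    conv_lhs => rw [hb', TensorProduct.tmul_sum]
    exact Finset.sum_congr rfl fun l _ => by rw [ct_tmul, TensorProduct.smul_tmul]

variable (hH : Reductive e H) (M : Rep H)

/-- The projection of a representation to a weight space. -/
def Rep.wproj (l : Fin p ⊕ Fin q → ℤ) : Module.End K M.space :=
  ct M.space (wcoeff (K := K) l) ∘ₗ M.gact (hH.block_le _ (genTorus_mem e)) ∘ₗ incl _ _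

/-- The action of the generic torus point is the coaction of the Laurent polynomial algebra, and its
components along the monomials are the weight projections. Finitely many occur, because a finite
basis of `M` involves finitely many monomials. -/
lemma Rep.exists_weights : ∃ F : Finset (Fin p ⊕ Fin q → ℤ), (∀ l ∉ F, M.wproj hH l = 0) ∧
    ∀ m, M.gact (hH.block_le _ (genTorus_mem e)) (m ⊗ₜ 1) = ∑ l ∈ F, M.wproj hH l m ⊗ₜ[K] lmono l := by
  classical
  let b := Module.finBasis K M.space
  choose F h1 h2 using fun i =>
    exists_expansion (M.gact (hH.block_le _ (genTorus_mem e)) (b i ⊗ₜ 1))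
  refine ⟨Finset.univ.biUnion F, fun l hl => b.ext fun i => ?_, fun m => ?_⟩
  · exact h1 i l fun h => hl (Finset.mem_biUnion.2 ⟨i, Finset.mem_univ _, h⟩)
  · have : M.gact (hH.block_le _ (genTorus_mem e)) ∘ₗ incl M.space _ =
        ∑ l ∈ Finset.univ.biUnion F, (TensorProduct.mk K M.space
          (LAlg K p q)).flip (lmono l) ∘ₗ
            M.wproj hH l := by
      refine b.ext fun i => ?_
      rw [LinearMap.sum_apply]
      exact h2 i _ (Finset.subset_biUnion_of_mem F (Finset.mem_univ i))
    have := LinearMap.congr_fun this m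
    rw [LinearMap.sum_apply] at this
    exact this

/-- A finite set containing the weights of a representation. -/
def Rep.wts : Finset (Fin p ⊕ Fin q → ℤ) := (M.exists_weights hH).choose

lemma Rep.wproj_eq_zero {l : Fin p ⊕ Fin q → ℤ} (h : l ∉ M.wts hH) : M.wproj hH l = 0 :=
  (M.exists_weights hH).choose_spec.1 l h

/-- The action of points of the torus. -/
lemma Rep.gact_diag {A : SuperCommAlg K} {R : Type u} [CommRing R] [Algebra K R] (j : R →ₐ[K] A)
    (hj : ∀ r, A.parity (j r) = j r) (t : Fin p ⊕ Fin q → Rˣ) {g : SGL V A} (hg : g ∈ H A)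
    (h : pmat e g = Matrix.diagonal fun i => j (t i)) (m : M.space) :
    M.gact hg (m ⊗ₜ 1) =
      ∑ l ∈ M.wts hH, M.wproj hH l m ⊗ₜ[K] j (chi t (Multiplicative.ofAdd l)) := by
  -- Every diagonal point is a specialization of the generic one, along the evaluation of Laurent
  -- polynomials at its coordinates.
  let φ : SHom (LAlg K p q) A :=
    SHom.ofComm (j.comp (evalTorus t)) fun b => hj _
  have h1 : pmat e g = (pmat e (genTorus e)).map φ.toAlgHom := by
    rw [h, pmat_genTorus]
    refine Eq.trans ?_ (Matrix.diagonal_map (map_zero φ.toAlgHom)).symm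
    congr 1
    funext i
    change j (t i) = j (evalTorus t (AddMonoidAlgebra.single (Pi.single i 1) 1))
    rw [evalTorus_single, chi_single]
  rw [M.gact_natural e φ (hH.block_le _ (genTorus_mem e)) hg h1,
    (M.exists_weights hH).choose_spec.2 m, map_sum]
  refine Finset.sum_congr rfl fun l _ => ?_
  rw [LinearMap.lTensor_tmul]
  congr 1
  change j (evalTorus t (AddMonoidAlgebra.single l 1)) = _
  rw [evalTorus_single]

/-- The action of a point of the torus over the ground field. -/
def Rep.opT (t : Fin p ⊕ Fin q → Kˣ) : Module.End K M.space :=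
  M.opK (hH.block_le _ (torusPt_mem e t))

lemma Rep.opT_eq (t : Fin p ⊕ Fin q → Kˣ) :
    M.opT hH t = ∑ l ∈ M.wts hH, chi t (Multiplicative.ofAdd l) • M.wproj hH l := by
  ext m
  apply tmul_one_injective K
  rw [Rep.opT, M.opK_tmul, M.gact_diag hH (A := KAlg K) (AlgHom.id K K)
    (fun _ => rfl) t _ (pmat_torusPt e t), LinearMap.sum_apply, TensorProduct.sum_tmul]
  refine Finset.sum_congr rfl fun l _ => ?_
  rw [LinearMap.smul_apply, TensorProduct.smul_tmul]
  congr 1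
  exact (mul_one (chi t (Multiplicative.ofAdd l) : K)).symm

lemma Rep.opT_mul (s t : Fin p ⊕ Fin q → Kˣ) :
    M.opT hH (s * t) = M.opT hH s * M.opT hH t := by
  rw [Rep.opT, Rep.opT, Rep.opT, ← M.opK_mul]
  congr 1
  exact torusPt_mul e s t

lemma Rep.opT_one : M.opT hH 1 = 1 := by
  rw [← M.opK_one, Rep.opT]
  congr 1
  exact torusPt_one e

lemma Rep.sum_wproj : ∑ l ∈ M.wts hH, M.wproj hH l = 1 := by
  rw [← M.opT_one hH, M.opT_eq hH]
  exact Finset.sum_congr rfl fun l _ => by rw [chi_one, one_smul]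

variable (K) in
/-- Combinations of characters are equal only if their coefficients are. -/
lemma eq_of_chi {W : Type u} [AddCommGroup W] [Module K W]
    (F : Finset (Fin p ⊕ Fin q → ℤ)) {v w : (Fin p ⊕ Fin q → ℤ) → W}
    (hv : ∀ l ∉ F, v l = 0) (hw : ∀ l ∉ F, w l = 0)
    (h : ∀ t : Fin p ⊕ Fin q → Kˣ, ∑ l ∈ F, chi t (Multiplicative.ofAdd l) • v l =
      ∑ l ∈ F, chi t (Multiplicative.ofAdd l) • w l) (l) : v l = w l := by
  by_cases hl : l ∈ F
  · rw [← sub_eq_zero]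
    refine chi_independent K F (fun l => v l - w l) (fun t => ?_) l hl
    simp only [smul_sub, Finset.sum_sub_distrib, h, sub_self]
  · rw [hv l hl, hw l hl]

/-- Expand both sides of `opT t * opT s = opT (t * s)` in characters of `s` and compare
coefficients. -/
lemma Rep.opT_wproj (t : Fin p ⊕ Fin q → Kˣ) (l : Fin p ⊕ Fin q → ℤ) :
    M.opT hH t * M.wproj hH l = chi t (Multiplicative.ofAdd l) • M.wproj hH l := by
  refine eq_of_chi K (M.wts hH) (v := fun l => M.opT hH t * M.wproj hH l)
    (w := fun l => chi t (Multiplicative.ofAdd l) • M.wproj hH l) (fun l hl => ?_)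
    (fun l hl => ?_) (fun s => ?_) l
  · simp only [M.wproj_eq_zero hH hl, mul_zero]
  · simp only [M.wproj_eq_zero hH hl, smul_zero]
  · calc _ = M.opT hH t * M.opT hH s := by
          rw [M.opT_eq hH s, Finset.mul_sum]
          exact Finset.sum_congr rfl fun l _ => by rw [mul_smul_comm]
      _ = M.opT hH (t * s) := (M.opT_mul hH t s).symm
      _ = _ := by
          rw [M.opT_eq hH]
          exact Finset.sum_congr rfl fun l _ => by rw [chi_mul, smul_smul, mul_comm]

/-- Orthogonality of the projections: expand `opT s * wproj m = chi s m • wproj m` in characters of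
`s`. -/
lemma Rep.wproj_mul (l m : Fin p ⊕ Fin q → ℤ) :
    M.wproj hH l * M.wproj hH m = if l = m then M.wproj hH m else 0 := by
  refine eq_of_chi K (M.wts hH) (v := fun l => M.wproj hH l * M.wproj hH m)
    (w := fun l => if l = m then M.wproj hH m else 0) (fun l hl => ?_)
    (fun l hl => ?_) (fun s => ?_) l
  · simp only [M.wproj_eq_zero hH hl, zero_mul]
  · by_cases h : l = m
    · subst h; simp only [M.wproj_eq_zero hH hl, if_true]
    · simp only [if_neg h]
  · have h1 : ∑ l ∈ M.wts hH, chi s (Multiplicative.ofAdd l) • (M.wproj hH l * M.wproj hH m) =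
        M.opT hH s * M.wproj hH m := by
      rw [M.opT_eq hH s, Finset.sum_mul]
      exact Finset.sum_congr rfl fun l _ => by rw [smul_mul_assoc]
    rw [h1, M.opT_wproj]
    by_cases hm : m ∈ M.wts hH
    · rw [Finset.sum_eq_single m]
      · simp
      · intro l _ h; simp [h]
      · intro h; exact absurd hm h
    · rw [M.wproj_eq_zero hH hm]; simp

lemma Rep.wproj_wproj_self (l : Fin p ⊕ Fin q → ℤ) (x : M.space) :
    M.wproj hH l (M.wproj hH l x) = M.wproj hH l x := by
  have := LinearMap.congr_fun (M.wproj_mul hH l l) x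
  rwa [if_pos rfl] at this

lemma Rep.wproj_wproj_ne {l m : Fin p ⊕ Fin q → ℤ} (h : l ≠ m) (x : M.space) :
    M.wproj hH l (M.wproj hH m x) = 0 := by
  have := LinearMap.congr_fun (M.wproj_mul hH l m) x
  rwa [if_neg h] at this

lemma Rep.wproj_parity (l : Fin p ⊕ Fin q → ℤ) (x : M.space) :
    M.wproj hH l (M.space.parity x) = M.space.parity (M.wproj hH l x) := by
  have h1 : M.space.parity x ⊗ₜ[K] (1 : LAlg K p q) =
      par M.space.parity _ (x ⊗ₜ 1) := by simp
  change ct M.space (wcoeff (K := K) l) (M.gact _ (M.space.parity x ⊗ₜ 1)) =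
    M.space.parity (ct M.space (wcoeff (K := K) l) (M.gact _ (x ⊗ₜ 1)))
  rw [h1, M.gact_par, ← ct_rTensor]
  congr 1

lemma Rep.Hom.map_wproj {M N : Rep H} (f : M.Hom N) (l : Fin p ⊕ Fin q → ℤ) (x : M.space) :
    f.toLin (M.wproj hH l x) = N.wproj hH l (f.toLin x) := by
  change f.toLin (ct M.space (wcoeff (K := K) l) (M.gact _ (x ⊗ₜ 1))) = _
  rw [← ct_rTensor, f.map_gact]; rfl

/-- Torus points act on a weight vector by the corresponding character. -/
lemma Rep.gact_weight {A : SuperCommAlg K} {R : Type u} [CommRing R] [Algebra K R] (j : R →ₐ[K] A)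
    (hj : ∀ r, A.parity (j r) = j r) (t : Fin p ⊕ Fin q → Rˣ) {g : SGL V A} (hg : g ∈ H A)
    (h : pmat e g = Matrix.diagonal fun i => j (t i)) {l : Fin p ⊕ Fin q → ℤ} {m : M.space}
    (hm : M.wproj hH l m = m) :
    M.gact hg (m ⊗ₜ 1) = m ⊗ₜ[K] j (chi t (Multiplicative.ofAdd l)) := by
  rw [M.gact_diag hH j hj t hg h]
  have h0 : ∀ k, k ≠ l → M.wproj hH k m = 0 := fun k hk => by
    rw [← hm, M.wproj_wproj_ne hH hk]
  by_cases hl : l ∈ M.wts hH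
  · rw [Finset.sum_eq_single l (fun k _ hk => by rw [h0 k hk, TensorProduct.zero_tmul])
      (fun h => absurd hl h), hm]
  · have h1 : m = 0 := by rw [← hm, M.wproj_eq_zero hH hl]; rfl
    subst h1; simp

end Weights


/-! ### Contraction of unipotent points by a cocharacter. -/

noncomputable section Unipotent

variable {K : Type u} [Field K] [CharZero K] {V : SuperSpace K} {p q : ℕ} {e : HomBasis V p q}
  {H : SubgroupFunctor V}

/-- The ring of polynomials in one variable, as a superalgebra. -/
abbrev PAlg (K : Type u) [Field K] [CharZero K] : SuperCommAlg K :=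
  SuperCommAlg.ofComm (Polynomial K)

/-- Powers of the variable. -/
def pvar (n : ℕ) : PAlg K := (Polynomial.X ^ n : Polynomial K)

lemma mk_mul_mk_comm (A : SuperCommAlg K) {B : Type u} [CommRing B] [Algebra K B] (a a' : A)
    (b b' : SuperCommAlg.ofComm (K := K) B) :
    STensor.mk a b * STensor.mk a' b' = STensor.mk (a * a') (b * b') := by
  rw [STensor.mk_mul_mk]
  change STensor.mk (a * A.ev a') (b * b') + STensor.mk (a * A.od a') (b * b') = _
  rw [← STensor.add_mk, ← mul_add, A.ev_add_od]

/-- The path from the identity to a unipotent matrix `X`, with entries `s^(h j - h i) X i j`. -/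
def upath (h : Fin p ⊕ Fin q → ℤ) {A : SuperCommAlg K}
    (X : Matrix (Fin p ⊕ Fin q) (Fin p ⊕ Fin q) A) :
    Matrix (Fin p ⊕ Fin q) (Fin p ⊕ Fin q) (A.tensor (PAlg K)) :=
  Matrix.of fun i j => (STensor.mk (X i j) (pvar (h j - h i).toNat) : STensor A (PAlg K))

lemma upath_apply (h : Fin p ⊕ Fin q → ℤ) {A : SuperCommAlg K}
    (X : Matrix (Fin p ⊕ Fin q) (Fin p ⊕ Fin q) A) (i j) : upath h X i j =
      (STensor.mk (X i j) (pvar (h j - h i).toNat) : STensor A (PAlg K)) := rfl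

lemma IsUni.eq_or {R : Type u} [Ring R] {h : Fin p ⊕ Fin q → ℤ}
    {X : Matrix (Fin p ⊕ Fin q) (Fin p ⊕ Fin q) R} (hX : IsUni h X) (i j) :
    h i ≤ h j ∨ X i j = 0 := by
  by_cases hij : h i < h j
  · exact .inl hij.le
  · by_cases h' : i = j
    · subst h'; exact .inl le_rfl
    · right; rw [hX i j hij, Matrix.one_apply_ne h']

/-- The exponents `h k - h i` and `h j - h k` add up to `h j - h i`. The truncation `toNat` does no
harm, since entries with a negative exponent vanish for unipotent matrices. -/
lemma upath_mul {h : Fin p ⊕ Fin q → ℤ} {A : SuperCommAlg K}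
    {X Y : Matrix (Fin p ⊕ Fin q) (Fin p ⊕ Fin q) A} (hX : IsUni h X) (hY : IsUni h Y) :
    upath h X * upath h Y = upath h (X * Y) := by
  ext i j
  have hs : ∀ (s : Finset (Fin p ⊕ Fin q)) (f : Fin p ⊕ Fin q → A) (b : PAlg K),
      STensor.mk (∑ k ∈ s, f k) b = ∑ k ∈ s, STensor.mk (f k) b := fun s f b =>
    TensorProduct.sum_tmul s f b
  rw [Matrix.mul_apply, upath_apply, Matrix.mul_apply]
  refine Eq.trans ?_ (hs _ _ _).symm
  refine Finset.sum_congr rfl fun k _ => ?_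
  refine (mk_mul_mk_comm (A := A) (B := Polynomial K) (X i k) (Y k j) (pvar (h k - h i).toNat)
    (pvar (h j - h k).toNat)).trans ?_
  rcases hX.eq_or i k with h1 | h1
  · rcases hY.eq_or k j with h2 | h2
    · congr 1
      refine (pow_add (Polynomial.X : Polynomial K) _ _).symm.trans ?_
      change (Polynomial.X ^ _ : Polynomial K) = Polynomial.X ^ _
      congr 1
      omega
    · rw [h2, mul_zero, STensor.zero_mk, STensor.zero_mk]
  · rw [h1, zero_mul, STensor.zero_mk, STensor.zero_mk]

lemma upath_one (h : Fin p ⊕ Fin q → ℤ) (A : SuperCommAlg K) :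
    upath h (1 : Matrix (Fin p ⊕ Fin q) (Fin p ⊕ Fin q) A) = 1 := by
  ext i j
  rw [upath_apply]
  by_cases hij : i = j
  · subst hij
    rw [Matrix.one_apply_eq, Matrix.one_apply_eq, sub_self]
    rfl
  · rw [Matrix.one_apply_ne hij, Matrix.one_apply_ne hij, STensor.zero_mk]; rfl

lemma upath_isSuper (h : Fin p ⊕ Fin q → ℤ) {A : SuperCommAlg K}
    {X : Matrix (Fin p ⊕ Fin q) (Fin p ⊕ Fin q) A} (hX : IsSuper A X) :
    IsSuper (A.tensor (PAlg K)) (upath h X) := fun i j => by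
  rw [upath_apply]
  change STensor.mk (A.parity (X i j)) (pvar (h j - h i).toNat) = _
  rw [hX, STensor.smul_mk]
  rfl

/-- Evaluation of the polynomial variable. -/
def evalAt (A : SuperCommAlg K) (s : K) : SHom (A.tensor (PAlg K)) A :=
  SHom.lift (SHom.id A) (SHom.ofComm ((Algebra.ofId K A).comp (Polynomial.aeval s))
    fun b => by
      change A.parity (algebraMap K A _) = algebraMap K A _
      rw [AlgHom.commutes])

lemma evalAt_mk (A : SuperCommAlg K) (s : K) (a : A) (b : Polynomial K) :
    (evalAt A s).toAlgHom (STensor.mk a (show PAlg K from b) : STensor A (PAlg K)) =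
      b.eval s • a := by
  rw [evalAt, SHom.lift_mk]
  change a * algebraMap K A (Polynomial.aeval s b) = _
  rw [Polynomial.coe_aeval_eq_eval, ← Algebra.commutes, ← Algebra.smul_def]

lemma evalAt_upath (h : Fin p ⊕ Fin q → ℤ) {A : SuperCommAlg K} (s : K)
    (X : Matrix (Fin p ⊕ Fin q) (Fin p ⊕ Fin q) A) (i j) :
    (upath h X).map (evalAt A s).toAlgHom i j = s ^ (h j - h i).toNat • X i j := by
  rw [Matrix.map_apply, upath_apply]
  refine (evalAt_mk A s (X i j) (Polynomial.X ^ (h j - h i).toNat)).trans ?_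
  rw [Polynomial.eval_pow, Polynomial.eval_X]

/-- A linear form on `A`, extended to `A ⊗ K[X]`. -/
def polyForm {A : SuperCommAlg K} (θ : A →ₗ[K] K) : STensor A (PAlg K) →ₗ[K] Polynomial K :=
  (TensorProduct.lid K (Polynomial K)).toLinearMap ∘ₗ LinearMap.rTensor (Polynomial K) θ

/-- A coefficient along a path over `A ⊗ K[X]` is an honest polynomial whose values are the
coefficients at the points of the path. Hence an identity known for all nonzero parameters extends
to the parameter `0`. -/
lemma eval_polyForm {A : SuperCommAlg K} (θ : A →ₗ[K] K) (s : K) (x : STensor A (PAlg K)) :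
    (polyForm θ x).eval s = θ ((evalAt A s).toAlgHom x) := by
  induction x using STensor.induction with
  | h0 => 
    rw [map_zero, Polynomial.eval_zero]
    exact ((congrArg θ (map_zero (evalAt A s).toAlgHom)).trans (map_zero θ)).symm
  | ha x y hx hy =>
    rw [map_add, Polynomial.eval_add, hx, hy, ← map_add]
    exact congrArg θ (map_add (evalAt A s).toAlgHom x y).symm
  | hm a b =>
    refine Eq.trans ?_ (congrArg θ (evalAt_mk A s a b)).symm
    have : polyForm θ (STensor.mk a b) = θ a • (show Polynomial K from b) := by
      change (TensorProduct.lid K (Polynomial K)) (LinearMap.rTensor (Polynomial K) θ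
        (a ⊗ₜ[K] (show Polynomial K from b))) = _
      rw [LinearMap.rTensor_tmul, TensorProduct.lid_tmul]
    rw [this, map_smul, Polynomial.eval_smul, smul_eq_mul, smul_eq_mul, mul_comm]

/-- The value of a weight on the cocharacter `h`. -/
def ht (h l : Fin p ⊕ Fin q → ℤ) : ℤ := ∑ i, h i * l i

lemma chi_cochar (h l : Fin p ⊕ Fin q → ℤ) (s : Kˣ) :
    chi (fun i => s ^ h i) (Multiplicative.ofAdd l) = (s : K) ^ ht h l := by
  rw [chi_apply, ht, ← Units.val_zpow_eq_zpow_val]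
  congr 1
  have : ∀ F : Finset (Fin p ⊕ Fin q), ∏ i ∈ F, (s ^ h i) ^ l i = s ^ ∑ i ∈ F, h i * l i := by
    intro F
    induction F using Finset.induction_on with
    | empty => simp
    | insert i F hi ih => rw [Finset.prod_insert hi, Finset.sum_insert hi, ih, zpow_add, zpow_mul]
  exact this _

variable (hH : Reductive e H) (M : Rep H)

lemma Rep.co_gact_diag {A : SuperCommAlg K} (t : Fin p ⊕ Fin q → Kˣ) {g : SGL V A} (hg : g ∈ H A)
    (h : pmat e g = Matrix.diagonal fun i => Algebra.ofId K A (t i)) (φ : M.space →ₗ[K] K)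
    (l : Fin p ⊕ Fin q → ℤ) (x : M.space ⊗[K] A) :
    co A (φ ∘ₗ M.wproj hH l) (M.gact hg x) =
      chi t (Multiplicative.ofAdd l) • co A (φ ∘ₗ M.wproj hH l) x := by
  induction x with
  | zero => simp
  | add x y hx hy => simp only [map_add, smul_add, hx, hy]
  | tmul m a =>
    rw [M.gact_tmul, co_rmul, M.gact_diag hH (Algebra.ofId K A) (fun r => AlgHom.commutes _ _) t hg h,
      map_sum]
    have h0 : ∀ k, k ≠ l → co A (φ ∘ₗ M.wproj hH l) (M.wproj hH k m ⊗ₜ[K]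
        Algebra.ofId K A (chi t (Multiplicative.ofAdd k))) = 0 := fun k hk => by
      rw [co_tmul, LinearMap.comp_apply, M.wproj_wproj_ne hH hk.symm, map_zero, zero_smul]
    by_cases hl : l ∈ M.wts hH
    · rw [Finset.sum_eq_single l (fun k _ hk => h0 k hk) (fun h => absurd hl h), co_tmul, co_tmul,
        LinearMap.comp_apply, M.wproj_wproj_self, LinearMap.comp_apply, Algebra.ofId_apply,
        Algebra.algebraMap_eq_smul_one, smul_smul, smul_mul_assoc, one_mul, smul_smul, mul_comm]
    · rw [Finset.sum_eq_zero fun k hk => h0 k (by rintro rfl; exact hl hk), co_tmul,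
        LinearMap.comp_apply, M.wproj_eq_zero hH hl]
      simp

/-- Unipotent points raise (or lower) heights of weights. -/
lemma Rep.co_gact_uni {h : Fin p ⊕ Fin q → ℤ} {A : SuperCommAlg K} {n : SGL V A} (hn : n ∈ H A)
    (hu : IsUni h (pmat e n)) {l k : Fin p ⊕ Fin q → ℤ}
    (hlk : ht h k ≤ ht h l) {m : M.space} (hm : M.wproj hH k m = m) (φ : M.space →ₗ[K] K) :
    co A (φ ∘ₗ M.wproj hH l) (M.gact hn (m ⊗ₜ 1)) = φ (M.wproj hH l m) • 1 := by
  have hu' : IsUni h (pmat e n⁻¹) := hu.inv (pmat_mul_inv e n)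
  -- The path `S s` with entries `s ^ (h j - h i) * n i j`: it equals `n` at `s = 1` and the
  -- identity at `s = 0`, and it is a torus conjugate of `n` for `s ≠ 0`.
  obtain ⟨N, hN⟩ := exists_point e (A.tensor (PAlg K)) (upath_isSuper h (pmat_isSuper e n))
    (upath_isSuper h (pmat_isSuper e n⁻¹)) (by rw [upath_mul hu hu', pmat_mul_inv, upath_one])
    (by rw [upath_mul hu' hu, pmat_inv_mul, upath_one])
  have hN' : pmat e N = upath h (pmat e n) := hN
  have hNH : N ∈ H _ := hH.mem_of_support hn fun i j _ h0 => by
    rw [hN', upath_apply, h0, STensor.zero_mk]; rfl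
  choose S hS using fun s => exists_baseChange e (evalAt A s) N
  have hS' : ∀ s i j, pmat e (S s) i j = s ^ (h j - h i).toNat • pmat e n i j := fun s i j => by
    rw [hS, hN', evalAt_upath]
  have hSH : ∀ s, S s ∈ H A := fun s => hH.mem_of_support hn fun i j _ h0 => by
    rw [hS', h0, smul_zero]
  rw [← sub_eq_zero, ← Module.forall_dual_apply_eq_zero_iff K]
  intro θ
  rw [map_sub, sub_eq_zero]
  set ψ := φ ∘ₗ M.wproj hH l with hψ
  set P : Polynomial K := polyForm θ (co (A.tensor (PAlg K)) ψ (M.gact hNH (m ⊗ₜ 1)))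
  have hP : ∀ s, P.eval s = θ (co A ψ (M.gact (hSH s) (m ⊗ₜ 1))) := fun s => by
    rw [M.gact_natural e (evalAt A s) hNH (hSH s) (hS s), co_lTensor]
    exact eval_polyForm θ s _
  obtain ⟨d, hd⟩ : ∃ d : ℕ, ht h l = ht h k + d := ⟨(ht h l - ht h k).toNat, by omega⟩
  have key : ∀ s : K, s ≠ 0 → s ^ d * P.eval s = θ (co A ψ (M.gact hn (m ⊗ₜ 1))) := by
    intro s hs
    obtain ⟨τ, hτ, hτ'⟩ := exists_diag e (A := A) (Algebra.ofId K A) (fun r => AlgHom.commutes _ _)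
      (fun i => Units.mk0 s hs ^ h i)
    have hτH := hH.block_le A hτ
    -- Here `τ` is the value at `s` of the cocharacter `h`. It acts on the weight `l` by `s ^ ht h
    -- l` and on `m` by `s ^ ht h k`, which relates the coefficient of `S s` to that of `n`.
    have e1 : τ * S s = n * τ := by
      refine point_ext e ?_
      rw [pmat_mul, pmat_mul, hτ']
      ext i j
      rw [Matrix.diagonal_mul, Matrix.mul_diagonal, hS', Algebra.ofId_apply, Algebra.ofId_apply,
        ← Algebra.smul_def, ← Algebra.commutes, ← Algebra.smul_def, smul_smul]
      rcases hu.eq_or i j with h1 | h1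
      · congr 1
        rw [Units.val_zpow_eq_zpow_val, Units.val_zpow_eq_zpow_val, Units.val_mk0, ← zpow_natCast,
          ← zpow_add₀ hs]
        congr 1
        omega
      · rw [h1, smul_zero, smul_zero]
    have e2 : M.gact hτH (M.gact (hSH s) (m ⊗ₜ 1)) = M.gact hn (M.gact hτH (m ⊗ₜ 1)) := by
      rw [← Module.End.mul_apply, ← Module.End.mul_apply, ← M.gact_mul, ← M.gact_mul]
      congr 2
    have e3 := congrArg (co A ψ) e2
    rw [M.co_gact_diag hH _ hτH hτ', M.gact_weight hH (Algebra.ofId K A)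
      (fun r => AlgHom.commutes _ _) _ hτH hτ' hm, M.gact_tmul hn m (Algebra.ofId K A _), co_rmul, chi_cochar, chi_cochar,
      Units.val_mk0, Algebra.ofId_apply, ← Algebra.commutes, ← Algebra.smul_def] at e3
    have e4 := congrArg θ e3
    rw [map_smul, map_smul, ← hP, hd, zpow_add₀ hs, zpow_natCast, smul_eq_mul, smul_eq_mul,
      mul_assoc] at e4
    exact mul_left_cancel₀ (zpow_ne_zero _ hs) e4
  -- Both sides agree at all nonzero elements of an infinite field. Since `d` is non-negative, the
  -- value at `0` now determines the coefficient of `n`.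
  have hpoly : Polynomial.X ^ d * P = Polynomial.C (θ (co A ψ (M.gact hn (m ⊗ₜ 1)))) := by
    refine Polynomial.eq_of_infinite_eval_eq _ _ ?_
    refine Set.Infinite.mono (s := {0}ᶜ) ?_ (Set.finite_singleton (0 : K)).infinite_compl
    intro s hs
    simpa using key s hs
  have h0 := congrArg (Polynomial.eval 0) hpoly
  rw [Polynomial.eval_mul, Polynomial.eval_pow, Polynomial.eval_X, Polynomial.eval_C] at h0
  rw [← h0]
  -- If `d = 0`, the constant is the coefficient of the identity `S 0`. If `d > 0`, it is zero; so
  -- is the other side, as `l` and `k` are then different weights.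
  rcases Nat.eq_zero_or_pos d with h1 | h1
  · rw [h1, pow_zero, one_mul, hP]
    have e1 : S 0 = 1 := by
      refine point_ext e ?_
      ext i j
      rw [hS', pmat_one]
      by_cases hij : h i < h j
      · rw [zero_pow (by omega), zero_smul, Matrix.one_apply_ne]
        rintro rfl; exact lt_irrefl _ hij
      · have : (h j - h i).toNat = 0 := by omega
        rw [this, pow_zero, one_smul, hu i j hij]
    have e2 : M.gact (hSH 0) = 1 := by
      rw [← M.gact_one (A := A)]
      congr 1
    rw [e2, Module.End.one_apply, co_tmul]
    rfl
  · have hne : l ≠ k := by rintro rfl; omega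
    rw [zero_pow h1.ne', zero_mul, ← hm, M.wproj_wproj_ne hH hne, map_zero, zero_smul, map_zero]

end Unipotent


/-! ### Triangular factorization of matrices congruent to the identity. -/

noncomputable section Triangular

/-- Induction on the size, eliminating with the last diagonal entry. That pivot maps to `1`, hence
is a unit, and the Schur complement again maps to the identity because the off-diagonal column maps
to zero. -/
lemma exists_udl {R R₀ : Type u} [CommRing R] [CommRing R₀] (π : R →+* R₀)
    (hπ : ∀ x, π x = 1 → IsUnit x) (n : ℕ) (X : Matrix (Fin n) (Fin n) R) (hX : X.map π = 1) :
    ∃ (U : Matrix (Fin n) (Fin n) R) (D : Fin n → R) (L : Matrix (Fin n) (Fin n) R),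
      X = U * Matrix.diagonal D * L ∧ IsUni (fun i : Fin n => (i : ℤ)) U ∧
        IsUni (-fun i : Fin n => (i : ℤ)) L := by
  induction n with
  | zero => exact ⟨1, 1, 1, Subsingleton.elim _ _, fun i => i.elim0, fun i => i.elim0⟩
  | succ n ih =>
    let s : Fin n ⊕ Fin 1 ≃ Fin (n + 1) := finSumFinEquiv
    have hs1 : ∀ i, ((s (.inl i) : Fin (n + 1)) : ℤ) = i := fun i => by simp [s]
    have hs2 : ∀ i, ((s (.inr i) : Fin (n + 1)) : ℤ) = n := fun i => by simp [s]
    obtain ⟨a, b, c, d, hY⟩ : ∃ a b c d, X.submatrix s s = Matrix.fromBlocks a b c d :=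
      ⟨_, _, _, _, (Matrix.fromBlocks_toBlocks (X.submatrix s s)).symm⟩
    have hent : ∀ i j, π (X.submatrix s s i j) = (1 : Matrix (Fin n ⊕ Fin 1) _ R₀) i j := by
      intro i j
      have := congrFun (congrFun hX (s i)) (s j)
      rw [Matrix.map_apply] at this
      rw [Matrix.submatrix_apply, this]
      simp [Matrix.one_apply]
    rw [hY] at hent
    have ha : a.map π = 1 := by
      ext i j
      have := hent (.inl i) (.inl j)
      simpa [Matrix.one_apply] using this
    have hb : ∀ i j, π (b i j) = 0 := fun i j => by simpa using hent (.inl i) (.inr j)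
    have hd : π (d 0 0) = 1 := by simpa using hent (.inr 0) (.inr 0)
    obtain ⟨δ, hδ⟩ := hπ _ hd
    set d' : Matrix (Fin 1) (Fin 1) R := Matrix.of fun _ _ => (δ⁻¹ : Rˣ).1 with hd'
    have hdd : d * d' = 1 := by
      ext i j
      fin_cases i; fin_cases j
      simp [Matrix.mul_apply, hd', ← hδ]
    have hdd' : d' * d = 1 := by
      ext i j
      fin_cases i; fin_cases j
      simp [Matrix.mul_apply, hd', ← hδ]
    have hA : (a - b * d' * c).map π = 1 := by
      have : (b * d' * c).map π = 0 := by
        ext i j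
        rw [Matrix.map_apply, Matrix.mul_assoc, Matrix.mul_apply, map_sum]
        exact Finset.sum_eq_zero fun k _ => by rw [map_mul, hb, zero_mul]
      rw [Matrix.map_sub _ (map_sub π), this, ha, sub_zero]
    obtain ⟨U, D, L, hUDL, hU, hL⟩ := ih _ hA
    refine ⟨(Matrix.fromBlocks U (b * d') 0 1).submatrix s.symm s.symm,
      Sum.elim D (fun _ => δ) ∘ s.symm,
      (Matrix.fromBlocks L 0 (d' * c) 1).submatrix s.symm s.symm, ?_, ?_, ?_⟩
    -- The block identity is `[a b; c d] = [U, b d'; 0, 1] [D, 0; 0, d] [L, 0; d' c, 1]`, where `d'`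
    -- is the inverse of `d`.
    · have hD : Matrix.diagonal (Sum.elim D (fun _ : Fin 1 => (δ : R))) =
          Matrix.fromBlocks (Matrix.diagonal D) 0 0 d := by
        rw [← Matrix.fromBlocks_diagonal]
        congr 1
        ext i j
        fin_cases i; fin_cases j
        simpa using hδ
      have hXs : X = (X.submatrix s s).submatrix s.symm s.symm := by simp
      rw [hXs, hY, ← Matrix.submatrix_diagonal_equiv, Matrix.submatrix_mul_equiv,
        Matrix.submatrix_mul_equiv, hD, Matrix.fromBlocks_multiply, Matrix.fromBlocks_multiply]
      congr 2
      · have : U * Matrix.diagonal D * L + b * d' * d * (d' * c) = a := by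
          rw [← hUDL, Matrix.mul_assoc b d' d, hdd', Matrix.mul_one, ← Matrix.mul_assoc,
            sub_add_cancel]
        simpa using this.symm
      · simp [Matrix.mul_assoc, hdd']
      · simp [← Matrix.mul_assoc, hdd]
      · simp
    · intro i j hij
      beta_reduce at hij
      obtain ⟨i, rfl⟩ := s.surjective i
      obtain ⟨j, rfl⟩ := s.surjective j
      rw [Matrix.submatrix_apply, s.symm_apply_apply, s.symm_apply_apply]
      rcases i with i | i <;> rcases j with j | j
      · rw [hs1, hs1] at hij
        simpa [Matrix.one_apply] using hU i j hij
      · rw [hs1, hs2] at hij; omega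
      · simp
      · simp [Matrix.one_apply]
    · intro i j hij
      obtain ⟨i, rfl⟩ := s.surjective i
      obtain ⟨j, rfl⟩ := s.surjective j
      simp only [Pi.neg_apply] at hij
      rw [Matrix.submatrix_apply, s.symm_apply_apply, s.symm_apply_apply]
      rcases i with i | i <;> rcases j with j | j
      · rw [hs1, hs1] at hij
        simpa [Matrix.one_apply] using hL i j hij
      · simp
      · rw [hs1, hs2] at hij; omega
      · simp [Matrix.one_apply]

end Triangular


/-! ### Vectors of top height and the big cell. -/

noncomputable section Highest

variable {K : Type u} [Field K] [CharZero K] {V : SuperSpace K} {p q : ℕ} {e : HomBasis V p q}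
  {H : SubgroupFunctor V}

variable (e) in
lemma exists_block {A : SuperCommAlg K} {R : Type u} [CommRing R] [Algebra K R] (j : R →ₐ[K] A)
    (hj : ∀ r, A.parity (j r) = j r) {a : Matrix (Fin p) (Fin p) R} {d : Matrix (Fin q) (Fin q) R}
    (ha : IsUnit a.det) (hd : IsUnit d.det) :
    ∃ g ∈ blockDiag V A, pmat e g = Matrix.fromBlocks (a.map j) 0 0 (d.map j) := by
  have hs : ∀ (a : Matrix (Fin p) (Fin p) R) (d : Matrix (Fin q) (Fin q) R),
      IsSuper A (Matrix.fromBlocks (a.map j) 0 0 (d.map j)) := by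
    rintro a d (i | i) (k | k)
    · simp [sgn, hj]
    · simp
    · simp
    · simp [sgn, hj]
  have hm : ∀ {n : ℕ} (a b : Matrix (Fin n) (Fin n) R), a * b = 1 → a.map j * b.map j = 1 := by
    intro n a b h
    rw [← Matrix.map_mul, h, Matrix.map_one _ (map_zero _) (map_one _)]
  obtain ⟨g, hg⟩ := exists_point e A (hs a d) (hs a⁻¹ d⁻¹)
    (by rw [Matrix.fromBlocks_multiply, hm _ _ (Matrix.mul_nonsing_inv a ha),
          hm _ _ (Matrix.mul_nonsing_inv d hd)]; simp)
    (by rw [Matrix.fromBlocks_multiply, hm _ _ (Matrix.nonsing_inv_mul a ha),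
          hm _ _ (Matrix.nonsing_inv_mul d hd)]; simp)
  exact ⟨g, (mem_blockDiag_iff e g).2
    ⟨fun i k => congrFun (congrFun hg (.inl i)) (.inr k),
      fun i k => congrFun (congrFun hg (.inr i)) (.inl k)⟩, hg⟩

lemma isUni_fromBlocks_hgt {R : Type u} [CommRing R] {A : SuperCommAlg K} [Algebra K R]
    (j : R →ₐ[K] A) {U : Matrix (Fin p) (Fin p) R} {U' : Matrix (Fin q) (Fin q) R}
    (hU : IsUni (fun i : Fin p => (i : ℤ)) U) (hU' : IsUni (fun i : Fin q => (i : ℤ)) U') :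
    IsUni hgt (Matrix.fromBlocks (U.map j) 0 0 (U'.map j)) := by
  rintro (i | i) (k | k) h
  · have h1 := hU i k (by simpa [hgt] using h)
    simp [h1, Matrix.one_apply, apply_ite j]
  · simp
  · simp
  · have h1 := hU' i k (by simpa [hgt] using h)
    simp [h1, Matrix.one_apply, apply_ite j]

lemma isUni_fromBlocks_neg_hgt {R : Type u} [CommRing R] {A : SuperCommAlg K} [Algebra K R]
    (j : R →ₐ[K] A) {U : Matrix (Fin p) (Fin p) R} {U' : Matrix (Fin q) (Fin q) R}
    (hU : IsUni (-fun i : Fin p => (i : ℤ)) U) (hU' : IsUni (-fun i : Fin q => (i : ℤ)) U') :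
    IsUni (-hgt) (Matrix.fromBlocks (U.map j) 0 0 (U'.map j)) := by
  rintro (i | i) (k | k) h
  · have h1 := hU i k (by simpa [hgt] using h)
    simp [h1, Matrix.one_apply, apply_ite j]
  · simp
  · simp
  · have h1 := hU' i k (by simpa [hgt] using h)
    simp [h1, Matrix.one_apply, apply_ite j]

variable (hH : Reductive e H) (M : Rep H)

/-- Linear forms supported on the weight spaces of height `c`. -/
def Rep.IsTop (c : ℤ) (φ : M.space →ₗ[K] K) : Prop :=
  ∀ l, ht hgt l ≠ c → φ ∘ₗ M.wproj hH l = 0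

lemma Rep.form_eq_sum (φ : M.space →ₗ[K] K) : φ = ∑ l ∈ M.wts hH, φ ∘ₗ M.wproj hH l := by
  ext m
  rw [LinearMap.sum_apply]
  conv_lhs => rw [← Module.End.one_apply (R := K) m, ← M.sum_wproj hH, LinearMap.sum_apply, map_sum]
  rfl

lemma Rep.co_eq_sum (A : SuperCommAlg K) (φ : M.space →ₗ[K] K) (x : M.space ⊗[K] A) :
    co A φ x = ∑ l ∈ M.wts hH, co A (φ ∘ₗ M.wproj hH l) x := by
  induction x with
  | zero => simp
  | add x y hx hy => rw [map_add, hx, hy, ← Finset.sum_add_distrib]; simp only [map_add]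
  | tmul m a =>
    conv_lhs => rw [co_tmul, M.form_eq_sum hH φ, LinearMap.sum_apply, Finset.sum_smul]
    simp only [co_tmul]

lemma ht_neg (h l : Fin p ⊕ Fin q → ℤ) : ht (-h) l = -ht h l := by
  simp [ht, Finset.sum_neg_distrib]

section
variable {M} {c : ℤ} (hc : ∀ l, c < ht hgt l → M.wproj hH l = 0)
include hc

/-- Points unipotent for `-hgt` change a vector only by terms of greater height, and no weights lie
above `c`. -/
lemma Rep.gact_raise {A : SuperCommAlg K} {n : SGL V A} (hn : n ∈ H A)
    (hu : IsUni (-hgt) (pmat e n)) {k : Fin p ⊕ Fin q → ℤ} (hk : ht hgt k = c) {w : M.space}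
    (hw : M.wproj hH k w = w) : M.gact hn (w ⊗ₜ 1) = w ⊗ₜ 1 := by
  refine ext_co A fun φ => ?_
  rw [M.co_eq_sum hH, M.co_eq_sum hH A φ (w ⊗ₜ 1)]
  refine Finset.sum_congr rfl fun l _ => ?_
  by_cases hl : ht hgt l ≤ c
  · rw [M.co_gact_uni hH hn hu (by rw [ht_neg, ht_neg]; omega) hw, co_tmul]; rfl
  · rw [hc l (not_le.1 hl)]; simp [co]

/-- Points unipotent for `hgt` add only terms of smaller height, which a form supported in the top
height `c` does not see. -/
lemma Rep.co_gact_lower {A : SuperCommAlg K} {n : SGL V A} (hn : n ∈ H A)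
    (hu : IsUni hgt (pmat e n)) {φ : M.space →ₗ[K] K} (hφ : M.IsTop hH c φ)
    (x : M.space ⊗[K] A) : co A φ (M.gact hn x) = co A φ x := by
  induction x with
  | zero => simp
  | add x y hx hy => simp only [map_add, hx, hy]
  | tmul m a =>
    rw [M.gact_tmul hn, co_rmul]
    have key : co A φ (M.gact hn (m ⊗ₜ 1)) = φ m • 1 := by
      have hm : m = ∑ k ∈ M.wts hH, M.wproj hH k m := by
        conv_lhs => rw [← Module.End.one_apply (R := K) m, ← M.sum_wproj hH, LinearMap.sum_apply]
      rw [hm, TensorProduct.sum_tmul, map_sum, map_sum, map_sum, Finset.sum_smul]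
      refine Finset.sum_congr rfl fun k _ => ?_
      by_cases hk : ht hgt k ≤ c
      · have h1 : φ (M.wproj hH k m) • (1 : A) = co A φ (M.wproj hH k m ⊗ₜ 1) := by rw [co_tmul]
        rw [h1, M.co_eq_sum hH, M.co_eq_sum hH A φ (_ ⊗ₜ 1)]
        refine Finset.sum_congr rfl fun l _ => ?_
        by_cases hl : ht hgt l = c
        · rw [M.co_gact_uni hH hn hu (by omega) (M.wproj_wproj_self hH k m), co_tmul]; rfl
        · rw [hφ l hl]; simp [co]
      · rw [hc k (not_le.1 hk)]; simp
    rw [key, co_tmul, smul_mul_assoc, one_mul]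

variable {k : Fin p ⊕ Fin q → ℤ} (hk : ht hgt k = c) {w : M.space} (hw : M.wproj hH k w = w)
  {φ : M.space →ₗ[K] K} (hφ : M.IsTop hH c φ) (hφw : φ w = 0)
include hk hw hφ hφw

/-- The vanishing statement on the big cell. -/
lemma Rep.co_gact_cell {R R₀ : Type u} [CommRing R] [Algebra K R] [CommRing R₀] (π : R →+* R₀)
    (hπ : ∀ x, π x = 1 → IsUnit x) {a : Matrix (Fin p) (Fin p) R} {d : Matrix (Fin q) (Fin q) R}
    (ha : a.map π = 1) (hd : d.map π = 1) {g : SGL V (SuperCommAlg.ofComm (K := K) R)}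
    (hg : g ∈ H _) (h : pmat e g = Matrix.fromBlocks a 0 0 d) :
    co _ φ (M.gact hg (w ⊗ₜ 1)) = 0 := by
  have hdet : ∀ {n : ℕ} (X : Matrix (Fin n) (Fin n) R), X.map π = 1 → IsUnit X.det := by
    intro n X hX
    refine hπ _ ?_
    rw [RingHom.map_det, RingHom.mapMatrix_apply, hX, Matrix.det_one]
  -- The determinants of all three factors divide the unit `X.det`, so each factor gives a point of
  -- the group.
  have hunits : ∀ {n : ℕ} {X U L : Matrix (Fin n) (Fin n) R} {D : Fin n → R}, X.map π = 1 →
      X = U * Matrix.diagonal D * L → IsUnit U.det ∧ IsUnit L.det ∧ ∀ i, IsUnit (D i) := by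
    intro n X U L D hX hUDL
    have := hdet X hX
    rw [hUDL, Matrix.det_mul, Matrix.det_mul, IsUnit.mul_iff, IsUnit.mul_iff,
      Matrix.det_diagonal] at this
    exact ⟨this.1.1, this.2, fun i =>
      isUnit_of_dvd_unit (Finset.dvd_prod_of_mem D (Finset.mem_univ i)) this.1.2⟩
  obtain ⟨U, D, L, h1, hU, hL⟩ := exists_udl π hπ p a ha
  obtain ⟨U', D', L', h1', hU', hL'⟩ := exists_udl π hπ q d hd
  obtain ⟨u1, l1, d1⟩ := hunits ha h1
  obtain ⟨u2, l2, d2⟩ := hunits hd h1'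
  let j : R →ₐ[K] (SuperCommAlg.ofComm (K := K) R) := AlgHom.id K R
  obtain ⟨u, hu, hu'⟩ := exists_block e (A := SuperCommAlg.ofComm (K := K) R) j (fun _ => rfl) u1 u2
  obtain ⟨l, hl, hl'⟩ := exists_block e (A := SuperCommAlg.ofComm (K := K) R) j (fun _ => rfl) l1 l2
  obtain ⟨t, ht, ht'⟩ := exists_diag e (A := SuperCommAlg.ofComm (K := K) R) j (fun _ => rfl)
    (Sum.elim (fun i => (d1 i).unit) (fun i => (d2 i).unit))
  have huH := hH.block_le _ hu
  have hlH := hH.block_le _ hl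
  have htH := hH.block_le _ ht
  have hmat : Matrix.fromBlocks a 0 0 d = Matrix.fromBlocks U 0 0 U' *
      Matrix.fromBlocks (Matrix.diagonal D) 0 0 (Matrix.diagonal D') *
        Matrix.fromBlocks L 0 0 L' := by
    rw [Matrix.fromBlocks_multiply, Matrix.fromBlocks_multiply]
    simp [h1, h1']
  have e1 : g = u * t * l := by
    refine point_ext e ?_
    have e2 : pmat e t = Matrix.fromBlocks (Matrix.diagonal D) 0 0 (Matrix.diagonal D') := by
      refine ht'.trans ?_
      rw [Matrix.fromBlocks_diagonal]
      congr 1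
      funext i
      rcases i with i | i <;> rfl
    rw [pmat_mul, pmat_mul, hu', hl', h, e2]
    exact hmat
  have e2 : M.gact hg = M.gact huH * M.gact htH * M.gact hlH := by
    rw [← M.gact_mul, ← M.gact_mul]
    congr 1
  -- The lower factor fixes `w`, the upper one does not affect `φ`, and the torus multiplies `w` by
  -- a scalar of the algebra, so `φ w = 0` finishes.
  rw [e2, Module.End.mul_apply, Module.End.mul_apply,
    Rep.gact_raise hH hc hlH (by rw [hl']; exact isUni_fromBlocks_neg_hgt j hL hL') hk hw,
    Rep.co_gact_lower hH hc huH (by rw [hu']; exact isUni_fromBlocks_hgt j hU hU') hφ,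
    M.gact_weight hH j (fun _ => rfl) _ htH ht' hw, co_tmul, hφw, zero_smul]

end

end Highest


/-! ### From the big cell to all points of the group. -/

noncomputable section HighestBlock

variable {K : Type u} [Field K] [CharZero K] {V : SuperSpace K} {p q : ℕ} {e : HomBasis V p q}
  {H : SubgroupFunctor V}

/-- The segment from the identity matrix to `a`. -/
def segment {R : Type u} [CommRing R] {n : ℕ} (a : Matrix (Fin n) (Fin n) R) :
    Matrix (Fin n) (Fin n) (Polynomial R) :=
  Matrix.of fun i j => Polynomial.C ((1 : Matrix (Fin n) (Fin n) R) i j) +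
    Polynomial.X * Polynomial.C (a i j - (1 : Matrix (Fin n) (Fin n) R) i j)

lemma segment_map_eval {R S : Type u} [CommRing R] [CommRing S] {n : ℕ}
    (a : Matrix (Fin n) (Fin n) R) (f : Polynomial R →+* S) (g : R →+* S)
    (hC : ∀ r, f (Polynomial.C r) = g r) (hX : f Polynomial.X = 1) :
    (segment a).map f = a.map g := by
  ext i j
  simp [segment, hC, hX]

lemma segment_map_zero {R S : Type u} [CommRing R] [CommRing S] {n : ℕ}
    (a : Matrix (Fin n) (Fin n) R) (f : Polynomial R →+* S) (hX : f Polynomial.X = 0) :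
    (segment a).map f = 1 := by
  ext i j
  by_cases h : i = j
  · subst h; simp [segment, hX]
  · simp [segment, hX, Matrix.one_apply_ne h]

/-- The diagonal blocks of a point and of its inverse have even entries, so they are mutually
inverse matrices over the commutative ring `A.even`. Block-diagonal points thus come from
commutative algebras. -/
lemma exists_even_blocks (e : HomBasis V p q) {A : SuperCommAlg K} {g : SGL V A}
    (hg : g ∈ blockDiag V A) :
    ∃ (a : Matrix (Fin p) (Fin p) A.even) (d : Matrix (Fin q) (Fin q) A.even),
      IsUnit a.det ∧ IsUnit d.det ∧
        pmat e g = Matrix.fromBlocks (a.map Subtype.val) 0 0 (d.map Subtype.val) := by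
  have key : ∀ {g : SGL V A}, g ∈ blockDiag V A → pmat e g =
      Matrix.fromBlocks (((pmat e g).toBlocks₁₁.map A.evProj).map Subtype.val) 0 0
        (((pmat e g).toBlocks₂₂.map A.evProj).map Subtype.val) := by
    intro g hg
    obtain ⟨h1, -, -, h4⟩ := mat_parity e g.1.2
    rw [h1.map_val, h4.map_val]
    obtain ⟨h2, h3⟩ := (mem_blockDiag_iff e g).1 hg
    conv_lhs => rw [← Matrix.fromBlocks_toBlocks (pmat e g)]
    congr 1
    · ext i j; exact h2 i j
    · ext i j; exact h3 i j
  have hmul := pmat_mul_inv e g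
  rw [key hg, key (inv_mem hg), Matrix.fromBlocks_multiply, ← Matrix.fromBlocks_one,
    Matrix.fromBlocks_inj] at hmul
  simp only [Matrix.mul_zero, Matrix.zero_mul, add_zero, zero_add] at hmul
  rw [← map_val_mul, ← map_val_mul] at hmul
  have hinj : ∀ {n : ℕ} {x : Matrix (Fin n) (Fin n) A.even}, x.map Subtype.val = (1 : Matrix _ _ A) →
      x = 1 := by
    intro n x hx
    rw [← map_evProj x, hx, ← map_val_one, map_evProj]
  exact ⟨_, _, Matrix.isUnit_det_of_right_inverse (hinj hmul.1),
    Matrix.isUnit_det_of_right_inverse (hinj hmul.2.2.2), key hg⟩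

variable {hH : Reductive e H} {M : Rep H} {c : ℤ} (hc : ∀ l, c < ht hgt l → M.wproj hH l = 0)
  {k : Fin p ⊕ Fin q → ℤ} (hk : ht hgt k = c) {w : M.space} (hw : M.wproj hH k w = w)
  {φ : M.space →ₗ[K] K} (hφ : M.IsTop hH c φ) (hφw : φ w = 0)
include hc hk hw hφ hφw

/-- The vanishing statement for points over commutative algebras. -/
lemma Rep.co_gact_comm {R : Type u} [CommRing R] [Algebra K R] {a : Matrix (Fin p) (Fin p) R}
    {d : Matrix (Fin q) (Fin q) R} (ha : IsUnit a.det) (hd : IsUnit d.det)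
    {g : SGL V (SuperCommAlg.ofComm (K := K) R)} (hg : g ∈ H _)
    (hgm : pmat e g = Matrix.fromBlocks a 0 0 d) :
    co _ φ (M.gact hg (w ⊗ₜ 1)) = 0 := by
  -- The segments `1 + X (a - 1)` and `1 + X (d - 1)` join the identity to `a` and `d`. Inverting
  -- their determinants gives a point over `C`, which is then viewed at `X = 1` and in the formal
  -- neighbourhood of `X = 0`.
  let f : Polynomial R := (segment a).det * (segment d).det
  let C := Localization.Away f
  let ι : Polynomial R →ₐ[K] C := Algebra.algHom K (Polynomial R) C
  have hfC : IsUnit (ι f) := IsLocalization.Away.algebraMap_isUnit f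
  have hdet : ∀ {S : Type u} [CommRing S] {n : ℕ} (X : Matrix (Fin n) (Fin n) (Polynomial R))
      (F : Polynomial R →+* S), (X.map F).det = F X.det := fun X F => by
    rw [RingHom.map_det]; rfl
  rw [map_mul, IsUnit.mul_iff] at hfC
  let ev1 : Polynomial R →ₐ[K] R := (Polynomial.aeval (1 : R)).restrictScalars K
  have hev1 : ∀ {n : ℕ} (x : Matrix (Fin n) (Fin n) R), (segment x).map ev1 = x := fun x => by
    refine (segment_map_eval x (ev1 : Polynomial R →+* R) (RingHom.id R) (fun r => ?_) ?_).trans ?_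
    · simp [ev1]
    · simp [ev1]
    · ext; simp
  have hev : IsUnit (ev1 f) := by
    have h1 : ∀ {n : ℕ} (x : Matrix (Fin n) (Fin n) R), ev1 (segment x).det = x.det := fun x => by
      have := hdet (segment x) (ev1 : Polynomial R →+* R)
      exact this.symm.trans (congrArg Matrix.det (hev1 x))
    rw [map_mul, h1, h1]
    exact ha.mul hd
  -- Specialization at `X = 1` extends to `C`, because `f` takes there the unit value `a.det *
  -- d.det`.
  let E : C →ₐ[K] R := IsLocalization.liftAlgHom (M := Submonoid.powers f) (f := ev1) (by
    rintro ⟨_, n, rfl⟩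
    rw [map_pow]
    exact hev.pow n)
  have hE : ∀ x, E (ι x) = ev1 x := fun x => IsLocalization.lift_eq _ x
  let ps : Polynomial R →ₐ[K] PowerSeries R :=
    (Polynomial.coeToPowerSeries.algHom R).restrictScalars K
  have hps : ∀ x, ps x = (x : PowerSeries R) := fun x => by
    simp [ps, Polynomial.coeToPowerSeries.algHom_apply]
  -- At `X = 0` both segments are the identity, so `f` has constant term `1`.
  have hpsf : IsUnit (ps f) := by
    have h1 : ∀ {n : ℕ} (x : Matrix (Fin n) (Fin n) R),
        Polynomial.constantCoeff (segment x).det = 1 := fun x => by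
      rw [← hdet, segment_map_zero x _ (by simp), Matrix.det_one]
    have h2 : Polynomial.constantCoeff f = 1 := by rw [map_mul, h1, h1, one_mul]
    rw [PowerSeries.isUnit_iff_constantCoeff, hps, Polynomial.constantCoeff_coe]
    change IsUnit (Polynomial.constantCoeff f)
    rw [h2]
    exact isUnit_one
  let P : C →ₐ[K] PowerSeries R := IsLocalization.liftAlgHom (M := Submonoid.powers f) (f := ps) (by
    rintro ⟨_, n, rfl⟩
    rw [map_pow]
    exact hpsf.pow n)
  have hP : ∀ x, P (ι x) = ps x := fun x => IsLocalization.lift_eq _ x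
  -- Polynomials embed in power series, so a fraction that vanishes in `R⟦X⟧` has zero numerator. A
  -- vanishing statement over `C` may therefore be checked over `R⟦X⟧`, for any commutative ring
  -- `R`.
  have hPinj : ∀ x, P x = 0 → x = 0 := by
    intro x hx
    obtain ⟨y, n, hn⟩ := IsLocalization.exists_mk'_eq (Submonoid.powers f) x
    have h1 : x * ι n = ι y := by rw [← hn]; exact IsLocalization.mk'_spec _ _ _
    have h2 : ps y = 0 := by rw [← hP, ← h1, map_mul, hx, zero_mul]
    rw [hps, Polynomial.coe_eq_zero_iff] at h2
    rw [← hn, h2, IsLocalization.mk'_zero]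
  obtain ⟨γ, hγ, hγm⟩ := exists_block e (A := SuperCommAlg.ofComm (K := K) C) (AlgHom.id K C)
    (fun _ => rfl) (a := (segment a).map ι) (d := (segment d).map ι)
    (by have := hdet (segment a) (ι : Polynomial R →+* C); exact this ▸ hfC.1)
    (by have := hdet (segment d) (ι : Polynomial R →+* C); exact this ▸ hfC.2)
  have hγH := hH.block_le _ hγ
  have hγm' : ∀ {S : SuperCommAlg K} (F : SHom (SuperCommAlg.ofComm (K := K) C) S),
      (pmat e γ).map F.toAlgHom = Matrix.fromBlocks ((segment a).map fun x => F.toAlgHom (ι x)) 0 0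
        ((segment d).map fun x => F.toAlgHom (ι x)) := by
    intro S F
    rw [hγm, Matrix.fromBlocks_map]
    congr 1
    · ext i j; exact map_zero F.toAlgHom
    · ext i j; exact map_zero F.toAlgHom
  -- Over `R⟦X⟧` both blocks reduce to the identity modulo `X`, and series with constant term `1`
  -- are units, so the big cell statement applies.
  have hzero : co _ φ (M.gact hγH (w ⊗ₜ 1)) = 0 := by
    let F : SHom (SuperCommAlg.ofComm (K := K) C) (SuperCommAlg.ofComm (K := K) (PowerSeries R)) :=
      SHom.ofComm P fun _ => rfl
    obtain ⟨δ, hδ⟩ := exists_baseChange e F γ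
    have hδm := hδ.trans (hγm' F)
    have hδH : δ ∈ H _ := hH.block_le _ ((mem_blockDiag_iff e δ).2
      ⟨fun i j => congrFun (congrFun hδm (.inl i)) (.inr j),
        fun i j => congrFun (congrFun hδm (.inr i)) (.inl j)⟩)
    have hs : ∀ {n : ℕ} (x : Matrix (Fin n) (Fin n) R),
        ((segment x).map fun y => P (ι y)).map PowerSeries.constantCoeff = 1 := by
      intro n x
      rw [← segment_map_zero x (Polynomial.constantCoeff (R := R)) (by simp)]
      ext i j
      simp [hP, hps]
    have h1 := Rep.co_gact_cell hH hc hk hw hφ hφw (PowerSeries.constantCoeff (R := R))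
      (fun x hx => PowerSeries.isUnit_iff_constantCoeff.2 (hx ▸ isUnit_one)) (hs a) (hs d) hδH hδm
    rw [M.gact_natural e F hγH hδH hδ, co_lTensor] at h1
    exact hPinj _ h1
  let G : SHom (SuperCommAlg.ofComm (K := K) C) (SuperCommAlg.ofComm (K := K) R) :=
    SHom.ofComm E fun _ => rfl
  have hG : pmat e g = (pmat e γ).map G.toAlgHom := by
    rw [hγm', hgm]
    have h2 : ∀ {n : ℕ} (x : Matrix (Fin n) (Fin n) R),
        x = (segment x).map fun y => E (ι y) := fun x => by
      conv_lhs => rw [← hev1 x]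
      ext i j
      simp [hE]
    have h3 : Matrix.fromBlocks a 0 0 d = Matrix.fromBlocks ((segment a).map fun y => E (ι y)) 0 0
        ((segment d).map fun y => E (ι y)) := by rw [← h2 a, ← h2 d]
    exact h3
  rw [M.gact_natural e G hγH hg hG, co_lTensor, hzero, map_zero]

lemma Rep.co_gact_block {A : SuperCommAlg K} {g : SGL V A} (hg : g ∈ blockDiag V A)
    (hgH : g ∈ H A) : co A φ (M.gact hgH (w ⊗ₜ 1)) = 0 := by
  obtain ⟨a, d, ha, hd, hgm⟩ := exists_even_blocks e hg
  obtain ⟨γ, hγ, hγm⟩ := exists_block e (A := SuperCommAlg.ofComm (K := K) A.even)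
    (AlgHom.id K A.even) (fun _ => rfl) ha hd
  let F : SHom (SuperCommAlg.ofComm (K := K) A.even) A := SHom.ofComm A.even.val fun b => b.2
  have hF : pmat e g = (pmat e γ).map F.toAlgHom := by
    rw [hγm, Matrix.fromBlocks_map, hgm]
    congr 1
  rw [M.gact_natural e F (hH.block_le _ hγ) hgH hF, co_lTensor,
    Rep.co_gact_comm hc hk hw hφ hφw ha hd _ hγm, map_zero]

/-- Top forms vanishing on a highest weight vector vanish on all its translates. -/
lemma Rep.co_gact_eq_zero {A : SuperCommAlg K} {g : SGL V A} (hg : g ∈ H A) :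
    co A φ (M.gact hg (w ⊗ₜ 1)) = 0 := by
  obtain ⟨n, hn, g₀, hg₀, n', hn', rfl, hu, hu'⟩ := hH.gauss hg
  have hb := hH.block_le _ hg₀
  have e2 : M.gact hg = M.gact hn * M.gact hb * M.gact hn' := by
    rw [← M.gact_mul, ← M.gact_mul]
  -- In the Gauss decomposition `n'` fixes `w` and `n` does not change the value of `φ`, which
  -- leaves the block-diagonal factor.
  rw [e2, Module.End.mul_apply, Module.End.mul_apply, Rep.gact_raise hH hc hn' hu' hk hw,
    Rep.co_gact_lower hH hc hn hu hφ, Rep.co_gact_block hc hk hw hφ hφw hg₀ hb]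

end HighestBlock


/-! ### The subrepresentation attached to a vector of top height. -/

noncomputable section Generated

variable {K : Type u} [Field K] [CharZero K] {V : SuperSpace K} {p q : ℕ} {e : HomBasis V p q}
  {H : SubgroupFunctor V}

/-- Over `A ⊗ B`, act on a `B`-valued vector by a point coming from `A`, apply `φ`, then pair the
factor `A` with `θ`: the result is the value on that vector of a single linear form on `M`. Thus
such forms can be evaluated on the translate by a `B`-point through a product of two points over `A
⊗ B`. -/
lemma co_gact_inr (M : Rep H) {A B : SuperCommAlg K} {h : SGL V A} (hh : h ∈ H A)
    {h' : SGL V (A.tensor B)} (hh' : h' ∈ H _) (e : HomBasis V p q)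
    (hm : pmat e h' = (pmat e h).map (SHom.inl A B).toAlgHom) (φ : M.space →ₗ[K] K)
    (θ : A →ₗ[K] K) (y : M.space ⊗[K] B) :
    (TensorProduct.lid K B) (LinearMap.rTensor B θ (show A ⊗[K] B from co (A.tensor B) φ
      (M.gact hh' (LinearMap.lTensor M.space (SHom.inr A B).toAlgHom.toLinearMap y)))) =
      co B (θ ∘ₗ co A φ ∘ₗ M.gact hh ∘ₗ incl _ _) y := by
  induction y with
  | zero => 
    rw [map_zero, map_zero, map_zero, map_zero]
    exact (congrArg (TensorProduct.lid K B) (map_zero (LinearMap.rTensor B θ))).trans (map_zero _)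
  | add x y hx hy =>
    rw [map_add, map_add, map_add, map_add, ← hx, ← hy]
    exact (congrArg (TensorProduct.lid K B) (map_add (LinearMap.rTensor B θ) _ _)).trans (map_add _ _ _)
  | tmul m b =>
    rw [LinearMap.lTensor_tmul, M.gact_tmul hh', co_rmul, M.gact_natural e (SHom.inl A B) hh hh' hm,
      co_lTensor, co_tmul]
    have := SHom.inl_mul_inr A B (co A φ (M.gact hh (m ⊗ₜ 1))) b
    refine (congrArg (fun z : A ⊗[K] B => TensorProduct.lid K B (LinearMap.rTensor B θ z)) this).trans ?_
    change TensorProduct.lid K B (LinearMap.rTensor B θ (_ ⊗ₜ[K] b)) = _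
    rw [LinearMap.rTensor_tmul, TensorProduct.lid_tmul]
    rfl

variable (hH : Reductive e H) (M : Rep H)

/-- The defining linear forms of the subrepresentation generated by a highest weight vector. -/
def Rep.topForms (c : ℤ) (w : M.space) : Set (Module.Dual K M.space) :=
  {ψ | ∃ (A : SuperCommAlg K) (g : SGL V A) (hg : g ∈ H A) (φ : M.space →ₗ[K] K) (θ : A →ₗ[K] K),
    M.IsTop hH c φ ∧ φ w = 0 ∧ ψ = θ ∘ₗ co A φ ∘ₗ M.gact hg ∘ₗ incl _ _}

/-- The space of vectors killed by the forms `topForms`. -/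
def Rep.topSpace (c : ℤ) (w : M.space) : Submodule K M.space :=
  (Submodule.span K (M.topForms hH c w)).dualCoannihilator

lemma Rep.mem_topSpace {c : ℤ} {w m : M.space} : m ∈ M.topSpace hH c w ↔
    ∀ (A : SuperCommAlg K) (g : SGL V A) (hg : g ∈ H A) (φ : M.space →ₗ[K] K), M.IsTop hH c φ →
      φ w = 0 → co A φ (M.gact hg (m ⊗ₜ 1)) = 0 := by
  rw [Rep.topSpace, Submodule.mem_dualCoannihilator]
  constructor
  · intro h A g hg φ h1 h2
    rw [← Module.forall_dual_apply_eq_zero_iff K]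
    intro θ
    exact h _ (Submodule.subset_span ⟨A, g, hg, φ, θ, h1, h2, rfl⟩)
  · intro h ψ hψ
    induction hψ using Submodule.span_induction with
    | mem ψ hψ =>
      obtain ⟨A, g, hg, φ, θ, h1, h2, rfl⟩ := hψ
      change θ (co A φ (M.gact hg (m ⊗ₜ 1))) = 0
      rw [h A g hg φ h1 h2, map_zero]
    | zero => rfl
    | add x y _ _ hx hy => rw [LinearMap.add_apply, hx, hy, add_zero]
    | smul a x _ hx => rw [LinearMap.smul_apply, hx, smul_zero]

lemma co_par {M : Type u} [AddCommGroup M] [Module K M] (A : SuperCommAlg K) (σ : Module.End K M)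
    (φ : M →ₗ[K] K) (x : M ⊗[K] A) : co A φ (par σ A x) = A.parity (co A (φ ∘ₗ σ) x) := by
  induction x with
  | zero => simp
  | add y z hy hz => simp only [map_add, hy, hz]
  | tmul m a => simp

/-- The subrepresentation generated by a homogeneous highest weight vector, enlarged by lower
weights. -/
def Rep.topSub (c : ℤ) (w : M.space) (s : K) (hs : M.space.parity w = s • w) : M.Sub where
  carrier := M.topSpace hH c w
  parity_le m hm := by
    rw [Submodule.mem_comap, M.mem_topSpace hH]
    intro A g hg φ h1 h2
    -- The parity moves onto the form: `φ ∘ parity` is again supported in height `c`, and it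
    -- vanishes on `w` because `w` is homogeneous.
    have e1 : M.space.parity m ⊗ₜ[K] (1 : A) = par M.space.parity A (m ⊗ₜ 1) := by simp
    rw [e1, M.gact_par, co_par, (M.mem_topSpace hH).1 hm A g hg, map_zero]
    · intro l hl
      ext x
      rw [LinearMap.comp_apply, LinearMap.comp_apply, ← M.wproj_parity]
      exact LinearMap.congr_fun (h1 l hl) _
    · rw [LinearMap.comp_apply, hs, map_smul, h2, smul_zero]
  stable B g x hx := by
    refine mem_baseSub_of_co B fun ψ hψ => ?_
    have hspan : ψ ∈ Submodule.span K (M.topForms hH c w) := by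
      -- In finite dimension, a form vanishing on the common kernel is a combination of the defining
      -- forms, so it suffices to treat these.
      rw [← Subspace.dualCoannihilator_dualAnnihilator_eq (W := Submodule.span K _),
        Submodule.mem_dualAnnihilator]
      exact hψ
    clear hψ
    induction hspan using Submodule.span_induction with
    | mem ψ hψ =>
      obtain ⟨A, h, hh, φ, θ, h1, h2, rfl⟩ := hψ
      obtain ⟨h', hh'⟩ := exists_baseChange e (SHom.inl A B) h
      obtain ⟨g', hg'⟩ := exists_baseChange e (SHom.inr A B) g.1
      have hH1 : h' ∈ H _ := hH.mem_of_support hh fun i j _ h0 => by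
        rw [hh', Matrix.map_apply, h0, map_zero]
      have hH2 : g' ∈ H _ := hH.mem_of_support g.2 fun i j _ h0 => by
        rw [hg', Matrix.map_apply, h0, map_zero]
      -- The condition defining the subspace runs over all superalgebras; it is used for the product
      -- of the two points over `A ⊗ B`.
      have key := (M.mem_topSpace hH).1 hx _ _ (mul_mem hH1 hH2) φ h1 h2
      rw [M.gact_mul hH1 hH2, Module.End.mul_apply,
        M.gact_natural e (SHom.inr A B) g.2 hH2 hg'] at key
      rw [← co_gact_inr M hh hH1 e hh' φ θ]
      refine (congrArg (fun z : A ⊗[K] B => TensorProduct.lid K B (LinearMap.rTensor B θ z)) key).trans ?_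
      exact (congrArg (TensorProduct.lid K B) (map_zero (LinearMap.rTensor B θ))).trans (map_zero _)
    | zero => simp [co]
    | add φ ψ _ _ hφ hψ =>
      have : co B (φ + ψ) = co B φ + co B ψ := by simp [co, LinearMap.rTensor_add, LinearMap.comp_add]
      rw [this, LinearMap.add_apply, hφ, hψ, add_zero]
    | smul a φ _ hφ =>
      have : co B (a • φ) = a • co B φ := by simp [co, LinearMap.rTensor_smul, LinearMap.comp_smul]
      rw [this, LinearMap.smul_apply, hφ, smul_zero]

variable {M} {c : ℤ} {k : Fin p ⊕ Fin q → ℤ} {w : M.space}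

lemma Rep.mem_topSpace_self (hc : ∀ l, c < ht hgt l → M.wproj hH l = 0)
    (hk : ht hgt k = c) (hw : M.wproj hH k w = w) : w ∈ M.topSpace hH c w :=
  (M.mem_topSpace hH).2 fun _ _ hg _ h1 h2 => Rep.co_gact_eq_zero hc hk hw h1 h2 hg

/-- Otherwise some form kills `w` but not `m`. Composed with the projection to weight `k` it is a
top form, and the condition at the identity point gives a contradiction. This one-dimensionality
makes the dimension drop in the induction. -/
lemma Rep.mem_span_of_mem_topSpace (hk : ht hgt k = c) (hw : M.wproj hH k w = w) {m : M.space}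
    (hm : m ∈ M.topSpace hH c w) (hmk : M.wproj hH k m = m) : m ∈ Submodule.span K {w} := by
  by_contra hne
  obtain ⟨φ, h1, h2⟩ := Submodule.exists_dual_map_eq_bot_of_notMem hne inferInstance
  have hφw : φ w = 0 := by
    have : φ w ∈ (Submodule.span K {w}).map φ := ⟨w, Submodule.mem_span_singleton_self w, rfl⟩
    rw [h2] at this
    exact this
  refine h1 ?_
  have := (M.mem_topSpace hH).1 hm (KAlg K) 1 (one_mem _) (φ ∘ₗ M.wproj hH k) (fun l hl => ?_) ?_
  · rw [M.gact_one, Module.End.one_apply, co_tmul, LinearMap.comp_apply, hmk] at this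
    have h3 : φ m • (1 : K) = 0 := this
    simpa using h3
  · ext x
    rw [LinearMap.comp_apply, LinearMap.comp_apply, M.wproj_wproj_ne hH (by rintro rfl; exact hl hk),
      map_zero]
    rfl
  · rw [LinearMap.comp_apply, hw, hφw]

end Generated


/-! ### Subrepresentations, kernels, ranges and direct sums. -/

noncomputable section Constr

variable {K : Type u} [Field K]

/-- The restriction of an endomorphism of `M ⊗ A` to a retract `X` of `M`. -/
def retEnd {X M : Type u} [AddCommGroup X] [Module K X] [AddCommGroup M] [Module K M]
    (i : X →ₗ[K] M) (r : M →ₗ[K] X) {A : SuperCommAlg K} (f : Module.End K (M ⊗[K] A)) :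
    Module.End K (X ⊗[K] A) := LinearMap.rTensor A r ∘ₗ f ∘ₗ LinearMap.rTensor A i

section
variable {X M : Type u} [AddCommGroup X] [Module K X] [AddCommGroup M] [Module K M]

lemma rTensor_injective {i : X →ₗ[K] M} {r : M →ₗ[K] X} (hr : r ∘ₗ i = LinearMap.id)
    (A : SuperCommAlg K) : Function.Injective (LinearMap.rTensor A i) := by
  intro x y h
  have h2 := congrArg (LinearMap.rTensor A r) h
  rwa [← LinearMap.comp_apply, ← LinearMap.comp_apply, ← LinearMap.rTensor_comp, hr,
    LinearMap.rTensor_id] at h2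

lemma rTensor_lTensor {A B : SuperCommAlg K} (φ : SHom A B) (i : X →ₗ[K] M) (x : X ⊗[K] A) :
    LinearMap.rTensor B i (LinearMap.lTensor X φ.toAlgHom.toLinearMap x) =
      LinearMap.lTensor M φ.toAlgHom.toLinearMap (LinearMap.rTensor A i x) := by
  induction x with
  | zero => simp
  | add y z hy hz => simp only [map_add, hy, hz]
  | tmul m a => simp

lemma rTensor_par (i : X →ₗ[K] M) {τ : Module.End K X} {σ : Module.End K M}
    (h : ∀ x, i (τ x) = σ (i x)) (A : SuperCommAlg K) (x : X ⊗[K] A) :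
    LinearMap.rTensor A i (par τ A x) = par σ A (LinearMap.rTensor A i x) := by
  induction x with
  | zero => simp
  | add y z hy hz => simp only [map_add, hy, hz]
  | tmul m a => simp [h]

end

variable {V : SuperSpace K} {H : SubgroupFunctor V}

/-- The retraction is the identity on `S ⊗ A`, where the operator takes its values. The axioms for
the action on `S` then follow from those on `M`, since `S ⊗ A → M ⊗ A` is injective. -/
lemma retEnd_spec {M : Type u} [AddCommGroup M] [Module K M] {S : Submodule K M} {r : M →ₗ[K] S}
    (hr : r ∘ₗ S.subtype = LinearMap.id) {A : SuperCommAlg K} {f : Module.End K (M ⊗[K] A)}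
    (hf : ∀ a x, f (rmul M A a x) = rmul M A a (f x))
    (h : ∀ x ∈ S, f (x ⊗ₜ 1) ∈ baseSub S A) (x : S ⊗[K] A) :
    LinearMap.rTensor A S.subtype (retEnd S.subtype r f x) = f (LinearMap.rTensor A S.subtype x) := by
  induction x with
  | zero => simp
  | add y z hy hz => simp only [map_add, hy, hz]
  | tmul m a =>
    have key : baseSub S A ≤ LinearMap.ker (LinearMap.rTensor A (S.subtype ∘ₗ r) - LinearMap.id) := by
      refine Submodule.map₂_le.2 fun m hm a _ => ?_
      have h1 : S.subtype (r m) = m := congrArg S.subtype (LinearMap.congr_fun hr ⟨m, hm⟩)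
      rw [LinearMap.mem_ker, LinearMap.sub_apply, TensorProduct.mk_apply, LinearMap.rTensor_tmul,
        LinearMap.comp_apply, h1, LinearMap.id_apply, sub_self]
    have h2 := key (h m m.2)
    rw [LinearMap.mem_ker, LinearMap.sub_apply, sub_eq_zero, LinearMap.rTensor_comp] at h2
    have h3 : LinearMap.rTensor A S.subtype (m ⊗ₜ[K] a) = rmul M A a ((m : M) ⊗ₜ 1) := by simp
    rw [retEnd, LinearMap.comp_apply, LinearMap.comp_apply, h3, hf, rTensor_rmul, rTensor_rmul]
    congr 1

/-- A retraction of a vector space to a subspace. -/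
def retraction {M : Type u} [AddCommGroup M] [Module K M] (S : Submodule K M) : M →ₗ[K] S :=
  (LinearMap.exists_leftInverse_of_injective S.subtype S.ker_subtype).choose

lemma retraction_comp {M : Type u} [AddCommGroup M] [Module K M] (S : Submodule K M) :
    retraction S ∘ₗ S.subtype = LinearMap.id :=
  (LinearMap.exists_leftInverse_of_injective S.subtype S.ker_subtype).choose_spec

/-- The action on a stable subspace. -/
def subHom {M : Type u} [AddCommGroup M] [Module K M] (σ : Module.End K M) (A : SuperCommAlg K)
    {G : Type u} [Group G] (S : Submodule K M) (hS : S ≤ S.comap σ)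
    (f : G →* evenEnd σ A) (h : ∀ g, ∀ x ∈ S, (f g).1 (x ⊗ₜ 1) ∈ baseSub S A) :
    G →* evenEnd (LinearMap.restrict σ hS) A :=
  have spec : ∀ g x, LinearMap.rTensor A S.subtype (retEnd S.subtype (retraction S) (f g).1 x) =
      (f g).1 (LinearMap.rTensor A S.subtype x) := fun g =>
    retEnd_spec (retraction_comp S) (f g).2.2 (h g)
  have hp : ∀ x, LinearMap.rTensor A S.subtype (par (LinearMap.restrict σ hS) A x) =
      par σ A (LinearMap.rTensor A S.subtype x) := rTensor_par S.subtype (fun _ => rfl) A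
  { toFun := fun g => ⟨retEnd S.subtype (retraction S) (f g).1, by
      refine ⟨fun x => rTensor_injective (retraction_comp S) A ?_,
        fun a x => rTensor_injective (retraction_comp S) A ?_⟩
      · rw [spec, hp, hp, spec, (f g).2.1]
      · rw [spec, rTensor_rmul, rTensor_rmul, spec, (f g).2.2]⟩
    map_one' := Subtype.ext <| LinearMap.ext fun x => rTensor_injective (retraction_comp S) A (by
      refine (spec 1 x).trans ?_
      rw [map_one]; rfl)
    map_mul' := fun g h => Subtype.ext <| LinearMap.ext fun x =>
      rTensor_injective (retraction_comp S) A (by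
        refine (spec (g * h) x).trans ?_
        refine Eq.trans ?_ (spec g _).symm
        refine Eq.trans ?_ (congrArg (f g).1 (spec h _)).symm
        rw [map_mul]; rfl) }

lemma subEnd_baseChange {M : Type u} [AddCommGroup M] [Module K M] {A B : SuperCommAlg K}
    (φ : SHom A B) (S : Submodule K M)
    {f : Module.End K (M ⊗[K] A)} {f' : Module.End K (M ⊗[K] B)}
    (h : ∀ x ∈ S, f (x ⊗ₜ 1) ∈ baseSub S A) (h' : ∀ x ∈ S, f' (x ⊗ₜ 1) ∈ baseSub S B)
    (hf : ∀ a x, f (rmul M A a x) = rmul M A a (f x))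
    (hf' : ∀ a x, f' (rmul M B a x) = rmul M B a (f' x))
    (hb : IsBaseChange φ f f') : IsBaseChange φ (retEnd S.subtype (retraction S) f)
      (retEnd S.subtype (retraction S) f') := fun x =>
  rTensor_injective (retraction_comp S) B (by
    rw [retEnd_spec (retraction_comp S) hf' h', rTensor_lTensor, hb, rTensor_lTensor,
      retEnd_spec (retraction_comp S) hf h])

/-- A subspace of a superspace. -/
def SuperSpace.sub (M : SuperSpace K) (S : Submodule K M) (hS : S ≤ S.comap M.parity) :
    SuperSpace K where
  carrier := S
  parity := LinearMap.restrict M.parity hS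
  parity_parity := fun v => Subtype.ext (M.parity_parity v)

/-- A subrepresentation as a representation. -/
def Rep.Sub.toRep {M : Rep H} (S : M.Sub) : Rep H where
  space := M.space.sub S.carrier S.parity_le
  act := fun A => subHom M.space.parity A S.carrier S.parity_le (M.act A) (S.stable A)
  natural := fun A B φ g g' hg => subEnd_baseChange φ S.carrier (S.stable A g) (S.stable B g')
    (M.act A g).2.2 (M.act B g').2.2 (M.natural A B φ g g' hg)

lemma Rep.Sub.rTensor_act {M : Rep H} (S : M.Sub) (A : SuperCommAlg K) (g : H A)
    (x : S.carrier ⊗[K] A) :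
    LinearMap.rTensor A S.carrier.subtype ((S.toRep.act A g).1 x) =
      (M.act A g).1 (LinearMap.rTensor A S.carrier.subtype x) :=
  retEnd_spec (retraction_comp S.carrier) (M.act A g).2.2 (S.stable A g) x

/-- The inclusion of a subrepresentation. -/
def Rep.Sub.incl {M : Rep H} (S : M.Sub) : S.toRep.Hom M where
  toLin := S.carrier.subtype
  map_parity _ := rfl
  equivariant := S.rTensor_act

/-- The projection to the quotient by a subrepresentation. -/
def Rep.Sub.proj {M : Rep H} (S : M.Sub) : M.Hom (M.quot S) where
  toLin := S.carrier.mkQ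
  map_parity _ := rfl
  equivariant A g x := (quotEnd_mkQ A S.carrier _ (S.stable A g) (M.act A g).2.2 x).symm

lemma Rep.Sub.shortExact {M : Rep H} (S : M.Sub) : Rep.ShortExact S.toRep M (M.quot S) :=
  ⟨S.incl, S.proj, S.carrier.injective_subtype, S.carrier.mkQ_surjective, fun x => by
    change S.carrier.mkQ x = 0 ↔ x ∈ Set.range S.carrier.subtype
    simp⟩

/-- The kernel of a homomorphism. -/
def Rep.Hom.ker {M N : Rep H} (f : M.Hom N) : M.Sub where
  carrier := LinearMap.ker f.toLin
  parity_le v hv := by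
    rw [Submodule.mem_comap, LinearMap.mem_ker, f.map_parity, LinearMap.mem_ker.1 hv, map_zero]
  stable A g x hx := by
    refine mem_baseSub_of_co A fun φ hφ => ?_
    -- A form vanishing on the kernel factors through `f`, and `f` commutes with the action.
    have h1 : φ ∈ (LinearMap.ker f.toLin).dualAnnihilator :=
      (Submodule.mem_dualAnnihilator _).2 hφ
    rw [← LinearMap.range_dualMap_eq_dualAnnihilator_ker] at h1
    obtain ⟨ψ, rfl⟩ := h1
    change co A (ψ ∘ₗ f.toLin) _ = 0
    rw [← co_rTensor, f.equivariant, LinearMap.rTensor_tmul, LinearMap.mem_ker.1 hx,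
      TensorProduct.zero_tmul, map_zero, map_zero]

/-- The range of a homomorphism. -/
def Rep.Hom.range {M N : Rep H} (f : M.Hom N) : N.Sub where
  carrier := LinearMap.range f.toLin
  parity_le := by
    rintro _ ⟨v, rfl⟩
    exact ⟨M.space.parity v, f.map_parity v⟩
  stable A g := by
    rintro _ ⟨v, rfl⟩
    refine mem_baseSub_of_co A fun φ hφ => ?_
    have h0 : φ ∘ₗ f.toLin = 0 := LinearMap.ext fun x => hφ _ ⟨x, rfl⟩
    have h1 : f.toLin v ⊗ₜ[K] (1 : A) = LinearMap.rTensor A f.toLin (v ⊗ₜ 1) := by simp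
    rw [h1, ← f.equivariant, co_rTensor, h0]
    simp [co]

/-- A homomorphism, as a homomorphism to its range. -/
def Rep.Hom.rangeRestrict {M N : Rep H} (f : M.Hom N) : M.Hom f.range.toRep where
  toLin := f.toLin.rangeRestrict
  map_parity v := Subtype.ext (f.map_parity v)
  equivariant A g x := by
    refine rTensor_injective (retraction_comp f.range.carrier) A ?_
    refine Eq.trans ?_ (f.range.rTensor_act A g _).symm
    have h1 : ∀ y, LinearMap.rTensor A (LinearMap.range f.toLin).subtype
        (LinearMap.rTensor A f.toLin.rangeRestrict y) = LinearMap.rTensor A f.toLin y := fun y => by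
      rw [← LinearMap.comp_apply, ← LinearMap.rTensor_comp]
      rfl
    exact (h1 _).trans ((f.equivariant A g x).trans (congrArg _ (h1 x).symm))

lemma Rep.Hom.shortExact {M N : Rep H} (f : M.Hom N) :
    Rep.ShortExact f.ker.toRep M f.range.toRep :=
  ⟨f.ker.incl, f.rangeRestrict, f.ker.carrier.injective_subtype,
    LinearMap.surjective_rangeRestrict f.toLin, fun x => by
    change f.toLin.rangeRestrict x = 0 ↔ x ∈ Set.range (LinearMap.ker f.toLin).subtype
    simp [Subtype.ext_iff]⟩

/-- The composition of homomorphisms. -/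
def Rep.Hom.comp {L M N : Rep H} (f : M.Hom N) (g : L.Hom M) : L.Hom N where
  toLin := f.toLin ∘ₗ g.toLin
  map_parity v := by simp [f.map_parity, g.map_parity]
  equivariant A h x := by
    rw [LinearMap.rTensor_comp, LinearMap.comp_apply, LinearMap.comp_apply, g.equivariant,
      f.equivariant]

/-- The direct sum of endomorphisms. -/
def sumEnd {M N : Type u} [AddCommGroup M] [Module K M] [AddCommGroup N] [Module K N]
    {A : SuperCommAlg K} (f : Module.End K (M ⊗[K] A)) (h : Module.End K (N ⊗[K] A)) :
    Module.End K ((M × N) ⊗[K] A) :=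
  LinearMap.rTensor A (LinearMap.inl K M N) ∘ₗ f ∘ₗ LinearMap.rTensor A (LinearMap.fst K M N) +
    LinearMap.rTensor A (LinearMap.inr K M N) ∘ₗ h ∘ₗ LinearMap.rTensor A (LinearMap.snd K M N)

section
variable {M N : Type u} [AddCommGroup M] [Module K M] [AddCommGroup N] [Module K N]
    {A : SuperCommAlg K}

lemma prod_tensor_ext {x y : (M × N) ⊗[K] A}
    (h1 : LinearMap.rTensor A (LinearMap.fst K M N) x = LinearMap.rTensor A (LinearMap.fst K M N) y)
    (h2 : LinearMap.rTensor A (LinearMap.snd K M N) x = LinearMap.rTensor A (LinearMap.snd K M N) y) :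
    x = y := by
  have key : ∀ z : (M × N) ⊗[K] A,
      z = LinearMap.rTensor A (LinearMap.inl K M N) (LinearMap.rTensor A (LinearMap.fst K M N) z) +
        LinearMap.rTensor A (LinearMap.inr K M N) (LinearMap.rTensor A (LinearMap.snd K M N) z) := by
    intro z
    induction z with
    | zero => simp
    | add y z hy hz =>
      simp only [map_add]
      nth_rewrite 1 [hy, hz]
      abel
    | tmul m a => simp [← TensorProduct.add_tmul]
  rw [key x, h1, h2, ← key y]

lemma fst_sumEnd (f : Module.End K (M ⊗[K] A)) (h : Module.End K (N ⊗[K] A)) (x) :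
    LinearMap.rTensor A (LinearMap.fst K M N) (sumEnd f h x) =
      f (LinearMap.rTensor A (LinearMap.fst K M N) x) := by
  have h1 : ∀ y, LinearMap.rTensor A (LinearMap.fst K M N) (LinearMap.rTensor A (LinearMap.inl K M N) y)
      = y := fun y => by
    rw [← LinearMap.comp_apply, ← LinearMap.rTensor_comp, LinearMap.fst_comp_inl,
      LinearMap.rTensor_id]; rfl
  have h2 : ∀ y, LinearMap.rTensor A (LinearMap.fst K M N) (LinearMap.rTensor A (LinearMap.inr K M N) y)
      = 0 := fun y => by
    rw [← LinearMap.comp_apply, ← LinearMap.rTensor_comp, LinearMap.fst_comp_inr,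
      LinearMap.rTensor_zero]; rfl
  simp only [sumEnd, LinearMap.add_apply, map_add, LinearMap.comp_apply, h1, h2, add_zero]

lemma snd_sumEnd (f : Module.End K (M ⊗[K] A)) (h : Module.End K (N ⊗[K] A)) (x) :
    LinearMap.rTensor A (LinearMap.snd K M N) (sumEnd f h x) =
      h (LinearMap.rTensor A (LinearMap.snd K M N) x) := by
  have h1 : ∀ y, LinearMap.rTensor A (LinearMap.snd K M N) (LinearMap.rTensor A (LinearMap.inr K M N) y)
      = y := fun y => by
    rw [← LinearMap.comp_apply, ← LinearMap.rTensor_comp, LinearMap.snd_comp_inr,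
      LinearMap.rTensor_id]; rfl
  have h2 : ∀ y, LinearMap.rTensor A (LinearMap.snd K M N) (LinearMap.rTensor A (LinearMap.inl K M N) y)
      = 0 := fun y => by
    rw [← LinearMap.comp_apply, ← LinearMap.rTensor_comp, LinearMap.snd_comp_inl,
      LinearMap.rTensor_zero]; rfl
  simp only [sumEnd, LinearMap.add_apply, map_add, LinearMap.comp_apply, h1, h2, zero_add]

lemma sumEnd_one : sumEnd (1 : Module.End K (M ⊗[K] A)) (1 : Module.End K (N ⊗[K] A)) = 1 :=
  LinearMap.ext fun x => prod_tensor_ext (fst_sumEnd _ _ x) (snd_sumEnd _ _ x)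

lemma sumEnd_mul (f f' : Module.End K (M ⊗[K] A)) (h h' : Module.End K (N ⊗[K] A)) :
    sumEnd (f * f') (h * h') = sumEnd f h * sumEnd f' h' :=
  LinearMap.ext fun x => prod_tensor_ext
    (by rw [fst_sumEnd, Module.End.mul_apply, Module.End.mul_apply, fst_sumEnd, fst_sumEnd])
    (by rw [snd_sumEnd, Module.End.mul_apply, Module.End.mul_apply, snd_sumEnd, snd_sumEnd])

lemma sumEnd_mem {σ : Module.End K M} {τ : Module.End K N} {f : Module.End K (M ⊗[K] A)}
    {h : Module.End K (N ⊗[K] A)} (hf : f ∈ evenEnd σ A) (hh : h ∈ evenEnd τ A) :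
    sumEnd f h ∈ evenEnd (σ.prodMap τ) A := by
  have hp1 : ∀ x, LinearMap.rTensor A (LinearMap.fst K M N) (par (σ.prodMap τ) A x) =
      par σ A (LinearMap.rTensor A (LinearMap.fst K M N) x) := by
    have h0 : ∀ x : M × N, LinearMap.fst K M N (σ.prodMap τ x) = σ (LinearMap.fst K M N x) :=
      fun _ => rfl
    exact rTensor_par (X := M × N) (LinearMap.fst K M N) h0 A
  have hp2 : ∀ x, LinearMap.rTensor A (LinearMap.snd K M N) (par (σ.prodMap τ) A x) =
      par τ A (LinearMap.rTensor A (LinearMap.snd K M N) x) := by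
    have h0 : ∀ x : M × N, LinearMap.snd K M N (σ.prodMap τ x) = τ (LinearMap.snd K M N x) :=
      fun _ => rfl
    exact rTensor_par (X := M × N) (LinearMap.snd K M N) h0 A
  refine ⟨fun x => prod_tensor_ext ?_ ?_, fun a x => prod_tensor_ext ?_ ?_⟩
  · rw [fst_sumEnd, hp1, hp1, fst_sumEnd, hf.1]
  · rw [snd_sumEnd, hp2, hp2, snd_sumEnd, hh.1]
  · rw [fst_sumEnd, rTensor_rmul, rTensor_rmul, fst_sumEnd, hf.2]
  · rw [snd_sumEnd, rTensor_rmul, rTensor_rmul, snd_sumEnd, hh.2]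

variable (A) in
/-- The direct sum of actions. -/
def sumHom {σ : Module.End K M} {τ : Module.End K N} {G : Type u} [Group G]
    (f : G →* evenEnd σ A) (h : G →* evenEnd τ A) : G →* evenEnd (σ.prodMap τ) A where
  toFun g := ⟨sumEnd (f g).1 (h g).1, sumEnd_mem (f g).2 (h g).2⟩
  map_one' := Subtype.ext <| by
    rw [map_one, map_one]
    exact sumEnd_one
  map_mul' a b := Subtype.ext <| by
    rw [map_mul, map_mul]
    exact sumEnd_mul _ _ _ _

lemma sumEnd_baseChange {B : SuperCommAlg K} (φ : SHom A B) {f : Module.End K (M ⊗[K] A)}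
    {f' : Module.End K (M ⊗[K] B)} {h : Module.End K (N ⊗[K] A)} {h' : Module.End K (N ⊗[K] B)}
    (hf : IsBaseChange φ f f') (hh : IsBaseChange φ h h') :
    IsBaseChange φ (sumEnd f h) (sumEnd f' h') := fun x => prod_tensor_ext
  (by rw [fst_sumEnd, rTensor_lTensor, rTensor_lTensor, hf, fst_sumEnd])
  (by rw [snd_sumEnd, rTensor_lTensor, rTensor_lTensor, hh, snd_sumEnd])

end

/-- The direct sum of superspaces. -/
def SuperSpace.prod (M N : SuperSpace K) : SuperSpace K where
  carrier := M × N
  parity := M.parity.prodMap N.parity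
  parity_parity := fun v => Prod.ext (M.parity_parity v.1) (N.parity_parity v.2)

/-- The direct sum of representations. -/
def Rep.prod (M N : Rep H) : Rep H where
  space := M.space.prod N.space
  act := fun A => sumHom A (M.act A) (N.act A)
  natural := fun A B φ g g' hg =>
    sumEnd_baseChange φ (M.natural A B φ g g' hg) (N.natural A B φ g g' hg)

/-- The first projection of a direct sum. -/
def Rep.fst (M N : Rep H) : (M.prod N).Hom M where
  toLin := LinearMap.fst K M.space N.space
  map_parity _ := rfl
  equivariant _ _ x := fst_sumEnd _ _ x

/-- The second projection of a direct sum. -/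
def Rep.snd (M N : Rep H) : (M.prod N).Hom N where
  toLin := LinearMap.snd K M.space N.space
  map_parity _ := rfl
  equivariant _ _ x := snd_sumEnd _ _ x

lemma sumEnd_inl {M N : Type u} [AddCommGroup M] [Module K M] [AddCommGroup N] [Module K N]
    {A : SuperCommAlg K} (f : Module.End K (M ⊗[K] A)) (h : Module.End K (N ⊗[K] A)) (x) :
    LinearMap.rTensor A (LinearMap.inl K M N) (f x) =
      sumEnd f h (LinearMap.rTensor A (LinearMap.inl K M N) x) := by
  have h1 : ∀ y, LinearMap.rTensor A (LinearMap.fst K M N) (LinearMap.rTensor A (LinearMap.inl K M N) y)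
      = y := fun y => by
    rw [← LinearMap.comp_apply, ← LinearMap.rTensor_comp, LinearMap.fst_comp_inl,
      LinearMap.rTensor_id]; rfl
  have h2 : ∀ y, LinearMap.rTensor A (LinearMap.snd K M N) (LinearMap.rTensor A (LinearMap.inl K M N) y)
      = 0 := fun y => by
    rw [← LinearMap.comp_apply, ← LinearMap.rTensor_comp, LinearMap.snd_comp_inl,
      LinearMap.rTensor_zero]; rfl
  refine prod_tensor_ext ?_ ?_
  · rw [fst_sumEnd, h1, h1]
  · rw [snd_sumEnd, h2, h2, map_zero]

/-- The first inclusion in a direct sum. -/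
def Rep.inl (M N : Rep H) : M.Hom (M.prod N) where
  toLin := LinearMap.inl K M.space N.space
  map_parity v := by
    change (M.space.parity v, (0 : N.space)) = (M.space.parity v, N.space.parity 0)
    rw [map_zero]
  equivariant A g x := sumEnd_inl _ _ x

lemma Rep.shortExact_prod (M N : Rep H) : Rep.ShortExact M (M.prod N) N :=
  ⟨Rep.inl M N, Rep.snd M N, LinearMap.inl_injective, LinearMap.snd_surjective, fun x => by
    change x.2 = 0 ↔ x ∈ Set.range (LinearMap.inl K M.space N.space)
    constructor
    · intro h
      exact ⟨x.1, Prod.ext rfl h.symm⟩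
    · rintro ⟨y, rfl⟩
      rfl⟩

end Constr


/-! ### Characters and supercharacters as ring homomorphisms on the Grothendieck ring. -/

noncomputable section Traces

/-- Split the sequence by `s : Z → Y` and the corresponding `r : Y → X`. Then `b = f a r + b s g`,
and cyclicity of the trace turns the two terms into the traces of `a r f = a` and `g b s = c`. -/
lemma trace_of_exact {K : Type u} [Field K] {X Y Z : Type u} [AddCommGroup X] [Module K X]
    [Module.Finite K X] [AddCommGroup Y] [Module K Y] [Module.Finite K Y] [AddCommGroup Z]
    [Module K Z] [Module.Finite K Z] {f : X →ₗ[K] Y} {g : Y →ₗ[K] Z} (hf : Function.Injective f)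
    (hg : Function.Surjective g) (hfg : Function.Exact f g) {a : Module.End K X}
    {b : Module.End K Y} {c : Module.End K Z} (hab : ∀ x, f (a x) = b (f x))
    (hbc : ∀ y, g (b y) = c (g y)) :
    LinearMap.trace K Y b = LinearMap.trace K X a + LinearMap.trace K Z c := by
  obtain ⟨s, hs⟩ := LinearMap.exists_rightInverse_of_surjective g (LinearMap.range_eq_top.2 hg)
  have hs' : ∀ z, g (s z) = z := fun z => LinearMap.congr_fun hs z
  have hr0 : ∀ y, ∃ x, f x = y - s (g y) := fun y =>
    (hfg _).1 (by rw [map_sub, hs', sub_self])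
  choose r hr using hr0
  let r' : Y →ₗ[K] X :=
    { toFun := r
      map_add' := fun y z => hf (by rw [map_add, hr, hr, hr, map_add, map_add]; abel)
      map_smul' := fun t y => hf (by
        rw [RingHom.id_apply, map_smul, hr, hr, map_smul, map_smul, smul_sub]) }
  have hr' : ∀ y, f (r' y) = y - s (g y) := hr
  have h1 : b = f ∘ₗ (a ∘ₗ r') + (b ∘ₗ s) ∘ₗ g := by
    ext y
    simp only [LinearMap.add_apply, LinearMap.comp_apply, hab, hr', map_sub, sub_add_cancel]
  have hrf : ∀ x, r' (f x) = x := fun x => hf (by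
    rw [hr', (hfg (f x)).2 ⟨x, rfl⟩, map_zero, sub_zero])
  have h2 : (a ∘ₗ r') ∘ₗ f = a := LinearMap.ext fun x => congrArg a (hrf x)
  have h3 : g ∘ₗ b ∘ₗ s = c := LinearMap.ext fun z => (hbc _).trans (congrArg c (hs' z))
  rw [h1, map_add, LinearMap.trace_comp_comm' (a ∘ₗ r') f, LinearMap.trace_comp_comm' g (b ∘ₗ s), h2,
    h3]

variable {K : Type u} [Field K] [CharZero K] {V : SuperSpace K} {p q : ℕ} {e : HomBasis V p q}
  {H : SubgroupFunctor V} (hH : Reductive e H)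

/-- The action of a torus point over the ground field, composed with a power of the parity
involution. -/
def Rep.opS (M : Rep H) (ε : ℕ) (t : Fin p ⊕ Fin q → Kˣ) : Module.End K M.space :=
  M.space.parity ^ ε * M.opT hH t

lemma Rep.Hom.map_opK {M N : Rep H} (f : M.Hom N) {g : SGL V (KAlg K)} (hg : g ∈ H _)
    (m : M.space) : f.toLin (M.opK hg m) = N.opK hg (f.toLin m) := by
  apply tmul_one_injective K
  rw [N.opK_tmul, ← f.map_gact, ← M.opK_tmul, LinearMap.rTensor_tmul]

lemma Rep.Hom.map_opS {M N : Rep H} (f : M.Hom N) (ε : ℕ) (t : Fin p ⊕ Fin q → Kˣ)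
    (m : M.space) : f.toLin (M.opS hH ε t m) = N.opS hH ε t (f.toLin m) := by
  have h1 : ∀ (n : ℕ) (v : M.space), f.toLin ((M.space.parity ^ n) v) =
      (N.space.parity ^ n) (f.toLin v) := by
    intro n
    induction n with
    | zero => intro v; rfl
    | succ n ih => intro v; rw [pow_succ, pow_succ, Module.End.mul_apply, Module.End.mul_apply, ih,
        f.map_parity]
  rw [Rep.opS, Module.End.mul_apply, h1, Rep.opT, f.map_opK]
  rfl

/-- The super character of a representation. -/
def Rep.char (M : Rep H) (ε : ℕ) (t : Fin p ⊕ Fin q → Kˣ) : K :=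
  LinearMap.trace K M.space (M.opS hH ε t)

lemma Rep.ShortExact.char {M' M M'' : Rep H} (h : Rep.ShortExact M' M M'') (ε : ℕ)
    (t : Fin p ⊕ Fin q → Kˣ) : M.char hH ε t = M'.char hH ε t + M''.char hH ε t := by
  obtain ⟨f, g, h1, h2, h3⟩ := h
  exact trace_of_exact h1 h2 h3 (f.map_opS hH ε t) (g.map_opS hH ε t)

lemma Rep.opK_unit {g : SGL V (KAlg K)} (hg : g ∈ H _) : (Rep.unit H).opK hg = 1 := by
  refine LinearMap.ext fun m => ?_
  apply tmul_one_injective K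
  exact (Rep.unit H).opK_tmul hg m

lemma Rep.char_unit (ε : ℕ) (t : Fin p ⊕ Fin q → Kˣ) : (Rep.unit H).char hH ε t = 1 := by
  have h1 : (Rep.unit H).opS hH ε t = 1 := by
    rw [Rep.opS, Rep.opT, Rep.opK_unit, mul_one]
    exact one_pow ε
  rw [Rep.char, h1]
  exact (LinearMap.trace_one K K).trans (by simp)

lemma Rep.opK_tensor (M N : Rep H) {g : SGL V (KAlg K)} (hg : g ∈ H _) :
    (M.tensor N).opK hg = TensorProduct.map (M.opK hg) (N.opK hg) := by
  refine TensorProduct.ext' fun m n => ?_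
  apply tmul_one_injective K
  change _ = (M.opK hg m ⊗ₜ[K] N.opK hg n) ⊗ₜ[K] (1 : KAlg K)
  refine ((M.tensor N).opK_tmul hg _).trans ?_
  refine (tensorEnd_tmul N.space.parity (KAlg K) (M.gact hg) (N.gact hg) m n 1).trans ?_
  rw [rmul_one, ← M.opK_tmul, ← N.opK_tmul, sprod_tmul, (KAlg K).od_of_even rfl,
    (KAlg K).ev_of_even rfl, zero_mul, TensorProduct.tmul_zero, add_zero, one_mul]

lemma Rep.opS_tensor (M N : Rep H) (ε : ℕ) (t : Fin p ⊕ Fin q → Kˣ) :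
    (M.tensor N).opS hH ε t = TensorProduct.map (M.opS hH ε t) (N.opS hH ε t) := by
  have h1 : (TensorProduct.map M.space.parity N.space.parity) ^ ε =
    TensorProduct.map (M.space.parity ^ ε) (N.space.parity ^ ε) := (TensorProduct.map_pow _ _ _)
  rw [Rep.opS, Rep.opS, Rep.opS, TensorProduct.map_mul, ← h1]
  exact congrArg _ (M.opK_tensor N _)

lemma Rep.char_tensor (M N : Rep H) (ε : ℕ) (t : Fin p ⊕ Fin q → Kˣ) :
    (M.tensor N).char hH ε t = M.char hH ε t * N.char hH ε t := by
  rw [Rep.char, Rep.opS_tensor hH M N]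
  exact LinearMap.trace_tensorProduct' (R := K) _ _

/-- The super characters as ring homomorphisms. -/
def K0.char (ε : ℕ) (t : Fin p ⊕ Fin q → Kˣ) : K0 H →+* K :=
  Ideal.Quotient.lift (K0Rel H)
    (MvPolynomial.eval₂Hom (Int.castRingHom K) fun M : Rep H => M.char hH ε t) (by
    have key : K0Rel H ≤ RingHom.ker
        (MvPolynomial.eval₂Hom (Int.castRingHom K) fun M : Rep H => M.char hH ε t) := by
      refine Ideal.span_le.2 ?_
      rintro _ ((⟨M', M, M'', hs, rfl⟩ | ⟨M, N, rfl⟩) | rfl)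
      · simp only [SetLike.mem_coe, RingHom.mem_ker, map_sub, MvPolynomial.eval₂Hom_X', hs.char]
        ring
      · simp only [SetLike.mem_coe, RingHom.mem_ker, map_sub, map_mul, MvPolynomial.eval₂Hom_X',
          Rep.char_tensor, sub_self]
      · simp only [SetLike.mem_coe, RingHom.mem_ker, map_sub, map_one, MvPolynomial.eval₂Hom_X',
          Rep.char_unit, sub_self]
    exact fun a ha => RingHom.mem_ker.1 (key ha))

lemma K0.char_cls (M : Rep H) (ε : ℕ) (t : Fin p ⊕ Fin q → Kˣ) :
    K0.char hH ε t M.cls = M.char hH ε t := by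
  exact (Ideal.Quotient.lift_mk _ _ _).trans (MvPolynomial.eval₂Hom_X' _ _ _)

lemma Rep.ShortExact.cls {M' M M'' : Rep H} (h : Rep.ShortExact M' M M'') :
    M.cls = M'.cls + M''.cls := by
  rw [← sub_eq_zero, ← sub_sub]
  exact Ideal.Quotient.eq_zero_iff_mem.2 (Ideal.subset_span (.inl (.inl ⟨M', M, M'', h, rfl⟩)))

lemma Rep.cls_tensor (M N : Rep H) : (M.tensor N).cls = M.cls * N.cls := by
  rw [← sub_eq_zero]
  exact Ideal.Quotient.eq_zero_iff_mem.2 (Ideal.subset_span (.inl (.inr ⟨M, N, rfl⟩)))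

lemma Rep.cls_unit : (Rep.unit H).cls = 1 := by
  rw [← sub_eq_zero]
  exact Ideal.Quotient.eq_zero_iff_mem.2 (Ideal.subset_span (.inr rfl))

lemma Rep.cls_prod (M N : Rep H) : (M.prod N).cls = M.cls + N.cls := (M.shortExact_prod N).cls

/-- For a zero space the identity maps form an exact sequence `0 → M → M → M → 0`, whence `[M] = 2
[M]`. -/
lemma Rep.cls_eq_zero (M : Rep H) [Subsingleton M.space] : M.cls = 0 := by
  let i : M.Hom M := ⟨LinearMap.id, fun _ => rfl, fun A g x => by simp⟩
  have h : Rep.ShortExact M M M := ⟨i, i, fun _ _ h => h, fun x => ⟨x, rfl⟩, fun x =>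
    ⟨fun _ => ⟨x, rfl⟩, fun _ => Subsingleton.elim _ _⟩⟩
  simpa using h.cls

variable (H) in
/-- The zero representation. -/
def Rep.zero : Rep H := (Rep.unit H).quot
  ⟨⊤, le_top.trans (by simp), fun A g x _ => by
    refine mem_baseSub_of_co (M := K) A fun φ hφ => ?_
    have h0 : φ = 0 := LinearMap.ext fun x => hφ x trivial
    subst h0
    have h1 : co (M := K) A (0 : K →ₗ[K] K) = 0 := by simp [co]
    rw [h1]; rfl⟩

/-- Every element of the Grothendieck ring is a difference of classes. -/
lemma K0.exists_sub (x : K0 H) : ∃ M N : Rep H, x = M.cls - N.cls := by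
  obtain ⟨P, rfl⟩ := Ideal.Quotient.mk_surjective x
  have hz : (Rep.zero H).cls = 0 := by
    have : Subsingleton (Rep.zero H).space :=
      (inferInstance : Subsingleton (K ⧸ (⊤ : Submodule K K)))
    exact Rep.cls_eq_zero _
  induction P using MvPolynomial.induction_on with
  | C n =>
    have hn : ∀ n : ℕ, ∃ M : Rep H, M.cls = n := by
      intro n
      induction n with
      | zero => exact ⟨_, by rw [hz, Nat.cast_zero]⟩
      | succ n ih =>
        obtain ⟨M, hM⟩ := ih
        exact ⟨M.prod (Rep.unit H), by rw [Rep.cls_prod, hM, Rep.cls_unit, Nat.cast_succ]⟩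
    have hC : Ideal.Quotient.mk (K0Rel H) (MvPolynomial.C n) = (n : K0 H) :=
      map_intCast ((Ideal.Quotient.mk (K0Rel H)).comp MvPolynomial.C) n
    rw [hC]
    obtain ⟨m, rfl | rfl⟩ := n.eq_nat_or_neg
    · obtain ⟨M, hM⟩ := hn m
      exact ⟨M, Rep.zero H, by rw [hM, hz]; simp⟩
    · obtain ⟨M, hM⟩ := hn m
      exact ⟨Rep.zero H, M, by rw [hM, hz]; simp⟩
  | add P Q hP hQ =>
    obtain ⟨M, N, h1⟩ := hP
    obtain ⟨M', N', h2⟩ := hQ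
    exact ⟨M.prod M', N.prod N', by rw [map_add, h1, h2, Rep.cls_prod, Rep.cls_prod]; ring⟩
  | mul_X P R hP =>
    obtain ⟨M, N, h1⟩ := hP
    refine ⟨M.tensor R, N.tensor R, ?_⟩
    rw [map_mul, h1, Rep.cls_tensor, Rep.cls_tensor, sub_mul]
    rfl

end Traces


/-! ### Classes are determined by characters; restriction is injective. -/

noncomputable section Injectivity

variable {K : Type u} [Field K] [CharZero K] {V : SuperSpace K} {p q : ℕ} {e : HomBasis V p q}
  {H : SubgroupFunctor V} (hH : Reductive e H) (M N : Rep H)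

lemma Rep.char_eq_sum {F : Finset (Fin p ⊕ Fin q → ℤ)} (hF : M.wts hH ⊆ F) (ε : ℕ)
    (t : Fin p ⊕ Fin q → Kˣ) : M.char hH ε t = ∑ l ∈ F, chi t (Multiplicative.ofAdd l) •
      LinearMap.trace K M.space (M.space.parity ^ ε * M.wproj hH l) := by
  rw [← Finset.sum_subset hF fun l _ hl => by rw [M.wproj_eq_zero hH hl, mul_zero, map_zero, smul_zero],
    Rep.char, Rep.opS, M.opT_eq, Finset.mul_sum, map_sum]
  exact Finset.sum_congr rfl fun l _ => by rw [mul_smul_comm, map_smul]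

variable {M N} in
-- Independence of the torus characters lets the weight multiplicities be read off; the values for
-- `ε = 0` and `ε = 1` together separate even from odd vectors.
lemma Rep.trace_wproj_eq (h : ∀ ε t, M.char hH ε t = N.char hH ε t) (ε : ℕ)
    (l : Fin p ⊕ Fin q → ℤ) :
    LinearMap.trace K M.space (M.space.parity ^ ε * M.wproj hH l) =
      LinearMap.trace K N.space (N.space.parity ^ ε * N.wproj hH l) := by
  classical
  refine eq_of_chi K (M.wts hH ∪ N.wts hH)
    (v := fun l => LinearMap.trace K M.space (M.space.parity ^ ε * M.wproj hH l))
    (w := fun l => LinearMap.trace K N.space (N.space.parity ^ ε * N.wproj hH l))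
    (fun l hl => ?_) (fun l hl => ?_) (fun t => ?_) l
  · rw [Finset.mem_union, not_or] at hl
    simp only [M.wproj_eq_zero hH hl.1, mul_zero, map_zero]
  · rw [Finset.mem_union, not_or] at hl
    simp only [N.wproj_eq_zero hH hl.2, mul_zero, map_zero]
  · rw [← M.char_eq_sum hH Finset.subset_union_left, ← N.char_eq_sum hH Finset.subset_union_right, h]

/-- The projection to the vectors of weight `l` and parity `s`. -/
def Rep.hproj (l : Fin p ⊕ Fin q → ℤ) (s : K) : Module.End K M.space :=
  (2⁻¹ : K) • (M.wproj hH l + s • (M.space.parity * M.wproj hH l))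

lemma Rep.trace_hproj (l : Fin p ⊕ Fin q → ℤ) (s : K) :
    LinearMap.trace K M.space (M.hproj hH l s) =
      2⁻¹ * (LinearMap.trace K M.space (M.space.parity ^ 0 * M.wproj hH l) +
        s * LinearMap.trace K M.space (M.space.parity ^ 1 * M.wproj hH l)) := by
  rw [Rep.hproj, map_smul, map_add, map_smul, pow_zero, one_mul, pow_one, smul_eq_mul, smul_eq_mul]

lemma Rep.hproj_apply (l : Fin p ⊕ Fin q → ℤ) (s : K) (x : M.space) : M.hproj hH l s x =
    (2⁻¹ : K) • (M.wproj hH l x + s • M.space.parity (M.wproj hH l x)) := rfl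

lemma Rep.wproj_hproj (l : Fin p ⊕ Fin q → ℤ) (s : K) (x : M.space) :
    M.wproj hH l (M.hproj hH l s x) = M.hproj hH l s x := by
  rw [M.hproj_apply, map_smul, map_add, map_smul, M.wproj_parity, M.wproj_wproj_self]

lemma Rep.parity_hproj (l : Fin p ⊕ Fin q → ℤ) {s : K} (hs : s * s = 1) (x : M.space) :
    M.space.parity (M.hproj hH l s x) = s • M.hproj hH l s x := by
  rw [M.hproj_apply, map_smul, map_add, map_smul, M.space.parity_parity,
    smul_comm s (2⁻¹ : K), smul_add s, smul_smul s s, hs, one_smul, add_comm]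

lemma Rep.hproj_idem (l : Fin p ⊕ Fin q → ℤ) {s : K} (hs : s * s = 1) :
    IsIdempotentElem (M.hproj hH l s) := by
  refine LinearMap.ext fun x => ?_
  rw [Module.End.mul_apply, M.hproj_apply hH l s (M.hproj hH l s x), M.wproj_hproj,
    M.parity_hproj hH l hs, smul_smul, hs, one_smul, ← two_smul K, smul_smul,
    inv_mul_cancel₀ two_ne_zero, one_smul]

lemma Rep.exists_hproj_ne {l : Fin p ⊕ Fin q → ℤ} (h : M.wproj hH l ≠ 0) :
    ∃ s : K, s * s = 1 ∧ M.hproj hH l s ≠ 0 := by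
  by_contra! h0
  refine h ?_
  have h1 : M.wproj hH l = M.hproj hH l 1 + M.hproj hH l (-1) := by
    rw [Rep.hproj, Rep.hproj, ← smul_add, neg_smul, one_smul, add_add_add_comm, add_neg_cancel,
      add_zero, ← two_smul K, smul_smul, inv_mul_cancel₀ two_ne_zero, one_smul]
  rw [h1, h0 1 (by simp), h0 (-1) (by simp), add_zero]

variable {M N}

/-- In characteristic zero an idempotent vanishes exactly when its trace does, and the traces are
given by the characters. -/
lemma Rep.hproj_ne_iff (h : ∀ ε t, M.char hH ε t = N.char hH ε t) (l : Fin p ⊕ Fin q → ℤ) {s : K}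
    (hs : s * s = 1) : M.hproj hH l s ≠ 0 ↔ N.hproj hH l s ≠ 0 := by
  have key : LinearMap.trace K M.space (M.hproj hH l s) = LinearMap.trace K N.space (N.hproj hH l s) := by
    rw [Rep.trace_hproj, Rep.trace_hproj, Rep.trace_wproj_eq hH h, Rep.trace_wproj_eq hH h]
  rw [ne_eq, ne_eq, ← LinearMap.IsIdempotentElem.trace_eq_zero_iff (M.hproj_idem hH l hs),
    ← LinearMap.IsIdempotentElem.trace_eq_zero_iff (N.hproj_idem hH l hs), key]

/-- A common highest weight vector of two representations with the same characters. -/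
lemma Rep.exists_top (h : ∀ ε t, M.char hH ε t = N.char hH ε t)
    (hne : 0 < Module.finrank K M.space + Module.finrank K N.space) :
    ∃ (k : Fin p ⊕ Fin q → ℤ) (s : K) (w₁ : M.space) (w₂ : N.space),
      (∀ l, ht hgt k < ht hgt l → M.wproj hH l = 0 ∧ N.wproj hH l = 0) ∧
      M.wproj hH k w₁ = w₁ ∧ N.wproj hH k w₂ = w₂ ∧ M.space.parity w₁ = s • w₁ ∧
      N.space.parity w₂ = s • w₂ ∧ w₁ ≠ 0 ∧ w₂ ≠ 0 := by
  classical
  have hz : ∀ R : Rep H, (∀ l, R.wproj hH l = 0) → Module.finrank K R.space = 0 := by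
    intro R hR
    have h1 : (1 : Module.End K R.space) = 0 := by
      rw [← R.sum_wproj hH]; exact Finset.sum_eq_zero fun l _ => hR l
    have : Subsingleton R.space := ⟨fun x y => by
      rw [← Module.End.one_apply (R := K) x, ← Module.End.one_apply (R := K) y, h1]; rfl⟩
    exact Module.finrank_zero_of_subsingleton
  let F := (M.wts hH ∪ N.wts hH).filter fun l => M.wproj hH l ≠ 0 ∨ N.wproj hH l ≠ 0
  have hF : ∀ l, l ∉ F → M.wproj hH l = 0 ∧ N.wproj hH l = 0 := by
    intro l hl
    by_contra h0
    have h1 : M.wproj hH l ≠ 0 ∨ N.wproj hH l ≠ 0 := by tauto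
    refine hl (Finset.mem_filter.2 ⟨?_, h1⟩)
    by_contra h2
    rw [Finset.mem_union, not_or] at h2
    exact h0 ⟨M.wproj_eq_zero hH h2.1, N.wproj_eq_zero hH h2.2⟩
  have hFne : F.Nonempty := by
    by_contra h0
    rw [Finset.not_nonempty_iff_eq_empty] at h0
    rw [hz M fun l => (hF l (by rw [h0]; simp)).1, hz N fun l => (hF l (by rw [h0]; simp)).2] at hne
    exact lt_irrefl _ hne
  -- The height is maximized over the weights of both representations; by equality of characters,
  -- weight `k` then occurs in both with a common parity.
  obtain ⟨k, hk, hmax⟩ := F.exists_max_image (ht hgt) hFne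
  obtain ⟨s, hs, h1⟩ : ∃ s : K, s * s = 1 ∧ M.hproj hH k s ≠ 0 := by
    rcases (Finset.mem_filter.1 hk).2 with h1 | h1
    · exact M.exists_hproj_ne hH h1
    · obtain ⟨s, hs, h2⟩ := N.exists_hproj_ne hH h1
      exact ⟨s, hs, (Rep.hproj_ne_iff hH h k hs).2 h2⟩
  have h2 := (Rep.hproj_ne_iff hH h k hs).1 h1
  obtain ⟨x, hx⟩ : ∃ x, M.hproj hH k s x ≠ 0 := by
    by_contra! h0; exact h1 (LinearMap.ext h0)
  obtain ⟨y, hy⟩ : ∃ x, N.hproj hH k s x ≠ 0 := by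
    by_contra! h0; exact h2 (LinearMap.ext h0)
  refine ⟨k, s, _, _, fun l hl => hF l fun h0 => ?_, M.wproj_hproj hH k s x, N.wproj_hproj hH k s y,
    M.parity_hproj hH k hs x, N.parity_hproj hH k hs y, hx, hy⟩
  exact absurd (hmax l h0) (not_le.2 hl)

lemma Rep.wproj_prod (l : Fin p ⊕ Fin q → ℤ) (x : M.space) (y : N.space) :
    (M.prod N).wproj hH l (x, y) = (M.wproj hH l x, N.wproj hH l y) :=
  Prod.ext ((M.fst N).map_wproj hH l (x, y)) ((M.snd N).map_wproj hH l (x, y))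

/-- The difference of two classes in terms of a correspondence. -/
lemma Rep.cls_sub_cls {D : Rep H} (f : D.Hom M) (g : D.Hom N) : M.cls - N.cls =
    ((M.quot f.range).prod g.ker.toRep).cls - ((N.quot g.range).prod f.ker.toRep).cls := by
  have h1 := f.range.shortExact.cls
  have h2 := g.range.shortExact.cls
  have h3 := f.shortExact.cls
  have h4 := g.shortExact.cls
  rw [Rep.cls_prod, Rep.cls_prod, h1, h2]
  rw [h3] at h4
  linear_combination h4

/-- By rank–nullity the total dimension drops by `2 (dim D - dim ker f - dim ker g)`. The two
kernels meet in zero, and by `hw` their sum is not all of `D`. -/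
lemma Rep.finrank_correspondence {D : Rep H} (f : D.Hom M) (g : D.Hom N)
    (hinf : ∀ x, f.toLin x = 0 → g.toLin x = 0 → x = 0) {w : D.space}
    (hw : w ∉ LinearMap.ker f.toLin ⊔ LinearMap.ker g.toLin) :
    Module.finrank K ((M.quot f.range).prod g.ker.toRep).space +
      Module.finrank K ((N.quot g.range).prod f.ker.toRep).space <
        Module.finrank K M.space + Module.finrank K N.space := by
  have h1 : Module.finrank K ((M.quot f.range).prod g.ker.toRep).space =
      Module.finrank K (M.space ⧸ LinearMap.range f.toLin) + Module.finrank K (LinearMap.ker g.toLin) :=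
    Module.finrank_prod
  have h2 : Module.finrank K ((N.quot g.range).prod f.ker.toRep).space =
      Module.finrank K (N.space ⧸ LinearMap.range g.toLin) + Module.finrank K (LinearMap.ker f.toLin) :=
    Module.finrank_prod
  have h3 := (LinearMap.range f.toLin).finrank_quotient_add_finrank
  have h4 := (LinearMap.range g.toLin).finrank_quotient_add_finrank
  have h5 := LinearMap.finrank_range_add_finrank_ker f.toLin
  have h6 := LinearMap.finrank_range_add_finrank_ker g.toLin
  have h7 := Submodule.finrank_sup_add_finrank_inf_eq (LinearMap.ker f.toLin) (LinearMap.ker g.toLin)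
  have h8 : LinearMap.ker f.toLin ⊓ LinearMap.ker g.toLin = ⊥ :=
    (Submodule.eq_bot_iff _).2 fun x hx => hinf x hx.1 hx.2
  have h9 := Submodule.finrank_lt (s := LinearMap.ker f.toLin ⊔ LinearMap.ker g.toLin)
    (fun h => hw (h ▸ Submodule.mem_top))
  rw [h8, finrank_bot] at h7
  rw [h1, h2]
  omega

/-- Representations with the same characters have the same class. -/
theorem Rep.cls_eq_of_char (n : ℕ) : ∀ M N : Rep H,
    Module.finrank K M.space + Module.finrank K N.space ≤ n →
    (∀ ε t, M.char hH ε t = N.char hH ε t) → M.cls = N.cls := by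
  induction n with
  | zero =>
    intro M N hn _
    have h1 : Subsingleton M.space := Module.finrank_zero_iff.1 (by omega : Module.finrank K M.space = 0)
    have h2 : Subsingleton N.space := Module.finrank_zero_iff.1 (by omega : Module.finrank K N.space = 0)
    rw [M.cls_eq_zero, N.cls_eq_zero]
  | succ n ih =>
    intro M N hn h
    by_cases hpos : Module.finrank K M.space + Module.finrank K N.space ≤ n
    · exact ih M N hpos h
    obtain ⟨k, s, w₁, w₂, hc, hw₁, hw₂, hs₁, hs₂, hne₁, hne₂⟩ := Rep.exists_top hH h (by omega)
    let L := M.prod N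
    let w : L.space := (w₁, w₂)
    have hw : L.wproj hH k w = w := by
      refine (Rep.wproj_prod hH k w₁ w₂).trans ?_
      rw [hw₁, hw₂]
    have hLc : ∀ l, ht hgt k < ht hgt l → L.wproj hH l = 0 := fun l hl =>
      LinearMap.ext fun x => by
        refine (Rep.wproj_prod hH l x.1 x.2).trans ?_
        rw [(hc l hl).1, (hc l hl).2]
        rfl
    -- `D` plays the role of the graph of an isomorphism between the parts of `M` and `N` generated
    -- by `w₁` and `w₂`.
    let D := L.topSub hH (ht hgt k) w s (Prod.ext hs₁ hs₂)
    have hwD : w ∈ D.carrier := Rep.mem_topSpace_self hH hLc rfl hw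
    let f := (M.fst N).comp D.incl
    let g := (M.snd N).comp D.incl
    have hf : ∀ x : D.carrier, f.toLin x = x.1.1 := fun _ => rfl
    have hg : ∀ x : D.carrier, g.toLin x = x.1.2 := fun _ => rfl
    have hlt := Rep.finrank_correspondence f g (fun x h1 h2 => Subtype.ext (Prod.ext h1 h2))
      (w := (⟨w, hwD⟩ : D.carrier)) (fun h0 => by
        -- If `w` were a sum from the two kernels, `(w₁, 0)` would lie in `D`. It has weight `k`, so
        -- it would be a multiple of `(w₁, w₂)`, which is impossible with both components nonzero.
        obtain ⟨a, ha, b, hb, hab⟩ := Submodule.mem_sup.1 h0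
        have ha' : (a : D.carrier).1.1 = 0 := ha
        have hb' : (b : D.carrier).1.2 = 0 := hb
        have hab' : (a : D.carrier).1 + (b : D.carrier).1 = w := congrArg Subtype.val hab
        have hb1 : (b : D.carrier).1.1 = w₁ := by
          have : (a : D.carrier).1.1 + (b : D.carrier).1.1 = w₁ := congrArg Prod.fst hab'
          rwa [ha', zero_add] at this
        have hbw : (b : D.carrier).1 = (w₁, (0 : N.space)) := Prod.ext hb1 hb'
        have hmem : ((w₁, (0 : N.space)) : L.space) ∈ L.topSpace hH (ht hgt k) w := by
          rw [← hbw]; exact (b : D.carrier).2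
        have hspan := Rep.mem_span_of_mem_topSpace hH rfl hw hmem (by
          refine (Rep.wproj_prod hH k w₁ 0).trans ?_
          rw [hw₁, map_zero])
        obtain ⟨r, hr⟩ := Submodule.mem_span_singleton.1 hspan
        have hr1 : r • w₁ = w₁ := congrArg Prod.fst hr
        have hr2 : r • w₂ = 0 := congrArg Prod.snd hr
        rcases smul_eq_zero.1 hr2 with h0 | h0
        · rw [h0, zero_smul] at hr1
          exact hne₁ hr1.symm
        · exact hne₂ h0)
    have hsub := Rep.cls_sub_cls f g
    rw [← sub_eq_zero, hsub, sub_eq_zero]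
    refine ih _ _ (by omega) fun ε t => ?_
    -- The new pair has the same difference of classes as `M` and `N`, hence again equal characters.
    rw [← K0.char_cls, ← K0.char_cls, ← sub_eq_zero, ← map_sub, ← hsub, map_sub, K0.char_cls,
      K0.char_cls, h, sub_self]

/-- Elements of the Grothendieck ring are determined by their characters. -/
theorem K0.eq_of_char {x y : K0 H} (h : ∀ ε t, K0.char hH ε t x = K0.char hH ε t y) : x = y := by
  rw [← sub_eq_zero]
  obtain ⟨M, N, hMN⟩ := K0.exists_sub (x - y)
  rw [hMN, sub_eq_zero]
  refine Rep.cls_eq_of_char hH _ M N le_rfl fun ε t => ?_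
  rw [← K0.char_cls, ← K0.char_cls, ← sub_eq_zero, ← map_sub, ← hMN, map_sub, h, sub_self]

/-- Characters involve only the parity and points of the torus, which lies in the block-diagonal
subgroup. -/
lemma K0.char_resBlock (e : HomBasis V p q) (ε : ℕ) (t : Fin p ⊕ Fin q → Kˣ) (x : K0 (fullGL V)) :
    K0.char (reductive_blockDiag e) ε t (resBlock V x) = K0.char (reductive_fullGL e) ε t x := by
  have key : (K0.char (reductive_blockDiag e) ε t).comp (resBlock V) =
      K0.char (reductive_fullGL e) ε t := by
    refine Ideal.Quotient.ringHom_ext (MvPolynomial.ringHom_ext (fun n => ?_) fun M => ?_)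
    · simp
    · have h1 : resBlock V M.cls = (M.restrict fun _ => le_top).cls := by
        change Ideal.Quotient.mk _ (MvPolynomial.rename _ (MvPolynomial.X M)) = _
        rw [MvPolynomial.rename_X]
        rfl
      change K0.char (reductive_blockDiag e) ε t (resBlock V M.cls) =
        K0.char (reductive_fullGL e) ε t M.cls
      rw [h1, K0.char_cls, K0.char_cls]
      rfl
  exact RingHom.congr_fun key x

theorem resBlock_injective (e : HomBasis V p q) : Function.Injective (resBlock V) := fun x y h =>
  K0.eq_of_char (reductive_fullGL e) fun ε t => by
    rw [← K0.char_resBlock, ← K0.char_resBlock, h]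

end Injectivity


/-! ### Words in a homogeneous basis modulo the exterior relations. -/

noncomputable section ExteriorWords

variable {K : Type u} [Field K] [CharZero K] {V : SuperSpace K} {H : SubgroupFunctor V} (R : Rep H)

/-- The multiplication `T^k R × R → T^{k+1} R`. -/
def Rep.tm (k : ℕ) : (R.tpow k).space →ₗ[K] R.space →ₗ[K] (R.tpow (k + 1)).space :=
  TensorProduct.mk K (R.tpow k).space R.space

variable {R}

lemma Rep.tpow_induction {k : ℕ} {S : Submodule K (R.tpow (k + 1)).space}
    (h : ∀ x v, R.tm k x v ∈ S) (y : (R.tpow (k + 1)).space) : y ∈ S :=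
  TensorProduct.induction_on (motive := fun y => y ∈ S) (y : (R.tpow k).space ⊗[K] R.space)
    S.zero_mem h fun _ _ => S.add_mem

lemma Rep.Sub.step_eq {T : Rep H} (S : (T.tensor R).Sub) :
    (S.step.carrier : Submodule K ((T.space ⊗[K] R.space) ⊗[K] R.space)) =
      Submodule.map₂ (TensorProduct.mk K (T.space ⊗[K] R.space) R.space) S.carrier ⊤ ⊔
        LinearMap.range (symm T.space R.space.parity) := rfl

lemma Rep.Sub.tmul_mem_step {T : Rep H} (S : (T.tensor R).Sub) {x : T.space ⊗[K] R.space}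
    (hx : x ∈ (S.carrier : Submodule K (T.space ⊗[K] R.space))) (v : R.space) :
    x ⊗ₜ[K] v ∈ (S.step.carrier : Submodule K ((T.space ⊗[K] R.space) ⊗[K] R.space)) := by
  rw [S.step_eq]
  exact Submodule.mem_sup_left (Submodule.apply_mem_map₂ _ hx Submodule.mem_top)

lemma Rep.tm_mem_extRel {k : ℕ} {x : (R.tpow k).space} (hx : x ∈ (R.extRel k).carrier)
    (v : R.space) : R.tm k x v ∈ (R.extRel (k + 1)).carrier := by
  cases k with
  | zero =>
    have h0 : x = 0 := hx
    rw [h0, map_zero]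
    exact Submodule.zero_mem _
  | succ k => exact Rep.Sub.tmul_mem_step (T := R.tpow k) (R.extRel (k + 1)) hx v

variable [DecidableEq K]

/-- The sign of the exchange of two homogeneous vectors. -/
def swapSign (s s' : K) : K := if s' = 1 then 1 else s

lemma symm_homogeneous {T : Type u} [AddCommGroup T] [Module K T] {σ : Module.End K R.space}
    {v w : R.space} {s s' : K} (hv : σ v = s • v)
    (hw : σ w = s' • w) (hs' : s' = 1 ∨ s' = -1) (x : T) :
    symm T σ ((x ⊗ₜ v) ⊗ₜ w) = (x ⊗ₜ v) ⊗ₜ w + swapSign s s' • ((x ⊗ₜ w) ⊗ₜ[K] v) := by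
  have h1 : (1 : K) ≠ -1 := by norm_num
  rw [symm_tmul]
  rcases hs' with rfl | rfl
  · rw [one_smul] at hw
    rw [evPart_of_even σ hw, odPart_of_even σ hw, swapSign, if_pos rfl, one_smul]
    simp
  · rw [neg_one_smul] at hw
    rw [evPart_of_odd σ hw, odPart_of_odd σ hw, swapSign, if_neg h1.symm, hv]
    simp [TensorProduct.tmul_smul]

/-- A basis of homogeneous vectors, `s` being their parities. -/
structure IsHom {ι : Type} (b : Module.Basis ι K R.space) (s : ι → K) : Prop where
  parity : ∀ i, R.space.parity (b i) = s i • b i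
  sign : ∀ i, s i = 1 ∨ s i = -1

variable {ι : Type} {b : Module.Basis ι K R.space} {s : ι → K}

lemma IsHom.symm_mem_step (hb : IsHom b s) {T : Rep H} (S : (T.tensor R).Sub) (x : T.space)
    (i j : ι) : (x ⊗ₜ b i) ⊗ₜ b j + swapSign (s i) (s j) • ((x ⊗ₜ[K] b j) ⊗ₜ[K] b i) ∈
      (S.step.carrier : Submodule K ((T.space ⊗[K] R.space) ⊗[K] R.space)) := by
  have h : (x ⊗ₜ b i) ⊗ₜ b j + swapSign (s i) (s j) • ((x ⊗ₜ[K] b j) ⊗ₜ[K] b i) ∈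
      LinearMap.range (symm T.space R.space.parity) :=
    ⟨_, symm_homogeneous (hb.parity i) (hb.parity j) (hb.sign j) x⟩
  have h' : LinearMap.range (symm T.space R.space.parity) ≤
      (S.step.carrier : Submodule K ((T.space ⊗[K] R.space) ⊗[K] R.space)) := by
    rw [S.step_eq]
    exact le_sup_right
  exact h' h

lemma IsHom.step_le (hb : IsHom b s) {T : Rep H} (S : (T.tensor R).Sub)
    {U : Submodule K ((T.space ⊗[K] R.space) ⊗[K] R.space)}
    (h1 : ∀ x ∈ (S.carrier : Submodule K (T.space ⊗[K] R.space)), ∀ v : R.space, x ⊗ₜ[K] v ∈ U)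
    (h2 : ∀ (x : T.space) i j,
      (x ⊗ₜ b i) ⊗ₜ b j + swapSign (s i) (s j) • ((x ⊗ₜ[K] b j) ⊗ₜ[K] b i) ∈ U) :
    (S.step.carrier : Submodule K ((T.space ⊗[K] R.space) ⊗[K] R.space)) ≤ U := by
  rw [S.step_eq]
  refine sup_le (Submodule.map₂_le.2 fun x hx v _ => h1 x hx v) ?_
  have h3 : ∀ x (v w : R.space), symm T.space R.space.parity ((x ⊗ₜ v) ⊗ₜ w) ∈ U := by
    intro x v w
    have h4 : ∀ i, symm T.space R.space.parity ((x ⊗ₜ b i) ⊗ₜ w) ∈ U := by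
      intro i
      induction b.mem_span w using Submodule.span_induction with
      | mem w hw =>
        obtain ⟨j, rfl⟩ := hw
        rw [symm_homogeneous (hb.parity i) (hb.parity j) (hb.sign j)]
        exact h2 x i j
      | zero => rw [TensorProduct.tmul_zero, map_zero]; exact U.zero_mem
      | add y z _ _ hy hz => rw [TensorProduct.tmul_add, map_add]; exact U.add_mem hy hz
      | smul c y _ hy => rw [TensorProduct.tmul_smul, map_smul]; exact U.smul_mem c hy
    induction b.mem_span v using Submodule.span_induction with
    | mem v hv =>
      obtain ⟨i, rfl⟩ := hv
      exact h4 i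
    | zero => rw [TensorProduct.tmul_zero, TensorProduct.zero_tmul, map_zero]; exact U.zero_mem
    | add y z _ _ hy hz =>
      rw [TensorProduct.tmul_add, TensorProduct.add_tmul, map_add]; exact U.add_mem hy hz
    | smul c y _ hy =>
      rw [TensorProduct.tmul_smul, ← TensorProduct.smul_tmul', map_smul]
      exact U.smul_mem c hy
  rintro _ ⟨y, rfl⟩
  induction y with
  | zero => rw [map_zero]; exact U.zero_mem
  | add y z hy hz => rw [map_add]; exact U.add_mem hy hz
  | tmul y w =>
    induction y with
    | zero => rw [TensorProduct.zero_tmul, map_zero]; exact U.zero_mem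
    | add y z hy hz => rw [TensorProduct.add_tmul, map_add]; exact U.add_mem hy hz
    | tmul x v => exact h3 x v w

lemma IsHom.swap_mem (hb : IsHom b s) {k : ℕ} (x : (R.tpow k).space) (i j : ι) :
    R.tm (k + 1) (R.tm k x (b i)) (b j) +
      swapSign (s i) (s j) • R.tm (k + 1) (R.tm k x (b j)) (b i) ∈ (R.extRel (k + 2)).carrier :=
  hb.symm_mem_step (T := R.tpow k) (R.extRel (k + 1)) x i j

lemma IsHom.extRel_le (hb : IsHom b s) {k : ℕ} {S : Submodule K (R.tpow (k + 2)).space}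
    (h1 : ∀ x ∈ (R.extRel (k + 1)).carrier, ∀ v, R.tm (k + 1) x v ∈ S)
    (h2 : ∀ x i j, R.tm (k + 1) (R.tm k x (b i)) (b j) +
      swapSign (s i) (s j) • R.tm (k + 1) (R.tm k x (b j)) (b i) ∈ S) :
    (R.extRel (k + 2)).carrier ≤ S :=
  hb.step_le (T := R.tpow k) (R.extRel (k + 1)) h1 h2

/-- Products of basis vectors; the head of the list is the last factor. -/
def Rep.word (b : Module.Basis ι K R.space) : ∀ k : ℕ, List ι → (R.tpow k).space
  | 0, _ => (1 : K)
  | _ + 1, [] => 0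
  | k + 1, i :: l => R.tm k (Rep.word b k l) (b i)

lemma Rep.mem_span_word (k : ℕ) (x : (R.tpow k).space) :
    x ∈ Submodule.span K (Rep.word b k '' {l | l.length = k}) := by
  induction k with
  | zero =>
    have h1 : (Rep.word b 0 [] : (R.tpow 0).space) ∈ Submodule.span K (Rep.word b 0 '' {l | l.length = 0}) :=
      Submodule.subset_span ⟨[], rfl, rfl⟩
    have h2 : x = (show K from x) • Rep.word b 0 [] := (mul_one (show K from x)).symm
    rw [h2]
    exact Submodule.smul_mem _ _ h1
  | succ k ih =>
    refine Rep.tpow_induction (fun y v => ?_) x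
    have h1 : Submodule.span K (Rep.word b k '' {l | l.length = k}) ≤
        (Submodule.span K (Rep.word b (k + 1) '' {l | l.length = k + 1})).comap ((R.tm k).flip v) := by
      refine Submodule.span_le.2 ?_
      rintro _ ⟨l, hl, rfl⟩
      change R.tm k (Rep.word b k l) v ∈
        Submodule.span K (Rep.word b (k + 1) '' {l | l.length = k + 1})
      rw [← b.linearCombination_repr v, Finsupp.linearCombination_apply, Finsupp.sum, map_sum]
      refine Submodule.sum_mem _ fun i _ => ?_
      rw [map_smul]
      refine Submodule.smul_mem _ _ (Submodule.subset_span ⟨i :: l, ?_, rfl⟩)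
      exact congrArg (· + 1) hl
    exact h1 (ih y)

/-- Adjacent letters commute up to a scalar modulo the relations, at the end of a word and hence
everywhere, since appending letters preserves the relations. -/
lemma IsHom.word_perm (hb : IsHom b s) {l l' : List ι} (h : l.Perm l') : ∀ k, l.length = k →
    ∃ c : K, Rep.word b k l - c • Rep.word b k l' ∈ (R.extRel k).carrier := by
  induction h with
  | nil => exact fun k _ => ⟨1, by rw [one_smul, sub_self]; exact Submodule.zero_mem _⟩
  | cons i h ih =>
    rintro k rfl
    obtain ⟨c, hc⟩ := ih _ rfl
    refine ⟨c, ?_⟩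
    have := Rep.tm_mem_extRel hc (b i)
    rwa [map_sub, map_smul, LinearMap.sub_apply, LinearMap.smul_apply] at this
  | swap i j l =>
    rintro k rfl
    refine ⟨-swapSign (s i) (s j), ?_⟩
    rw [neg_smul, sub_neg_eq_add]
    exact hb.swap_mem (Rep.word b l.length l) i j
  | trans h1 _ ih1 ih2 =>
    rintro k rfl
    obtain ⟨c, hc⟩ := ih1 _ rfl
    obtain ⟨c', hc'⟩ := ih2 _ h1.length_eq.symm
    refine ⟨c * c', ?_⟩
    have := Submodule.add_mem _ hc (Submodule.smul_mem _ c hc')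
    rwa [smul_sub, smul_smul, sub_add_sub_cancel] at this

/-- The exchange relation of an even letter with itself is twice the word, and `2` is invertible. -/
lemma IsHom.word_square (hb : IsHom b s) {i : ι} (hi : s i = 1) (l : List ι) :
    Rep.word b (l.length + 2) (i :: i :: l) ∈ (R.extRel (l.length + 2)).carrier := by
  have := hb.swap_mem (Rep.word b l.length l) i i
  rw [swapSign, if_pos hi, one_smul, ← two_smul K] at this
  exact (Submodule.smul_mem_iff _ two_ne_zero).1 this

end ExteriorWords


/-! ### A model of the exterior algebra on monomials. -/

noncomputable section ExteriorModel

variable {K : Type u} [Field K] [CharZero K] [DecidableEq K] {ι : Type} [Fintype ι] [LinearOrder ι]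

/-- The exponent of a word. -/
def expo : List ι → ι →₀ ℕ
  | [] => 0
  | i :: l => Finsupp.single i 1 + expo l

lemma expo_apply (l : List ι) (i : ι) : expo l i = l.count i := by
  induction l with
  | nil => simp [expo]
  | cons j l ih =>
    rw [expo, Finsupp.add_apply, ih, List.count_cons, Finsupp.single_apply, add_comm]
    by_cases h : j = i <;> simp [h]

lemma perm_of_expo_eq {l l' : List ι} (h : expo l = expo l') : l.Perm l' :=
  List.perm_iff_count.2 fun i => by rw [← expo_apply, ← expo_apply, h]

lemma sum_expo (l : List ι) : ∑ i, expo l i = l.length := by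
  induction l with
  | nil => simp [expo]
  | cons j l ih =>
    simp only [expo, Finsupp.add_apply, Finset.sum_add_distrib, ih]
    rw [Finset.sum_eq_single j (fun i _ hi => Finsupp.single_eq_of_ne hi)
      (fun h => absurd (Finset.mem_univ j) h), Finsupp.single_eq_same, List.length_cons, add_comm]

lemma exists_expo (a : ι →₀ ℕ) : ∃ l : List ι, expo l = a := by
  refine ⟨(Finsupp.toMultiset a).toList, Finsupp.ext fun i => ?_⟩
  rw [expo_apply, ← Multiset.coe_count, Multiset.coe_toList, Finsupp.count_toMultiset]

/-- Exponents which are at most one in the even variables. -/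
def IsValid (s : ι → K) (a : ι →₀ ℕ) : Prop := ∀ i, s i = 1 → a i ≤ 1

/-- The sign of the product of the monomial `a` and of the variable `i`. -/
def crSign (s : ι → K) (a : ι →₀ ℕ) (i : ι) : K :=
  (if s i = 1 ∧ a i ≠ 0 then 0 else 1) *
    ∏ j ∈ Finset.univ.filter (i < ·), (-swapSign (s i) (s j)) ^ a j

/-- The operator of multiplication by a variable on the exterior algebra model. -/
def crOp (s : ι → K) (i : ι) : Module.End K ((ι →₀ ℕ) →₀ K) :=
  Finsupp.lift _ K _ fun a => crSign s a i • Finsupp.single (Finsupp.single i 1 + a) 1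

lemma crOp_single (s : ι → K) (i : ι) (a : ι →₀ ℕ) :
    crOp s i (Finsupp.single a 1) = crSign s a i • Finsupp.single (Finsupp.single i 1 + a) 1 := by
  rw [crOp, Finsupp.lift_apply]
  exact (Finsupp.sum_single_index (by rw [zero_smul])).trans (one_smul K _)

/-- Monomials are written in increasing order and a new variable enters at the right end. To reach
its place, `i` has to cross the additional `j`. -/
lemma crSign_of_lt {s : ι → K} (a : ι →₀ ℕ) {i j : ι} (h : i < j) :
    crSign s (Finsupp.single j 1 + a) i = -swapSign (s i) (s j) * crSign s a i := by
  have h1 : (Finsupp.single j 1 + a : ι →₀ ℕ) i = a i := by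
    rw [Finsupp.add_apply, Finsupp.single_eq_of_ne h.ne, zero_add]
  rw [crSign, crSign, h1, mul_left_comm]
  congr 1
  have h2 : ∀ m, (-swapSign (s i) (s m)) ^ ((Finsupp.single j 1 + a : ι →₀ ℕ) m) =
      (if m = j then -swapSign (s i) (s j) else 1) * (-swapSign (s i) (s m)) ^ a m := by
    intro m
    rw [Finsupp.add_apply, pow_add]
    congr 1
    by_cases hm : m = j
    · subst hm; rw [Finsupp.single_eq_same, if_pos rfl, pow_one]
    · rw [Finsupp.single_eq_of_ne hm, if_neg hm, pow_zero]
  rw [Finset.prod_congr rfl fun m _ => h2 m, Finset.prod_mul_distrib, Finset.prod_ite_eq',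
    if_pos (Finset.mem_filter.2 ⟨Finset.mem_univ _, h⟩)]

/-- Smaller variables are not crossed, so an additional one costs no sign. -/
lemma crSign_of_gt {s : ι → K} (a : ι →₀ ℕ) {i j : ι} (h : j < i) :
    crSign s (Finsupp.single j 1 + a) i = crSign s a i := by
  have h1 : ∀ m, m ≠ j → (Finsupp.single j 1 + a : ι →₀ ℕ) m = a m := fun m hm => by
    rw [Finsupp.add_apply, Finsupp.single_eq_of_ne hm, zero_add]
  rw [crSign, crSign, h1 i h.ne']
  congr 1
  refine Finset.prod_congr rfl fun m hm => ?_
  rw [h1 m ((Finset.mem_filter.1 hm).2.trans' h).ne']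

lemma crSign_ne_zero {s : ι → K} (hs : ∀ i, s i = 1 ∨ s i = -1) {a : ι →₀ ℕ} {i : ι}
    (h : s i = 1 → a i = 0) : crSign s a i ≠ 0 := by
  refine mul_ne_zero ?_ (Finset.prod_ne_zero_iff.2 fun j _ => pow_ne_zero _ (neg_ne_zero.2 ?_))
  · rw [if_neg fun h1 => h1.2 (h h1.1)]; exact one_ne_zero
  · rw [swapSign]
    split_ifs
    · exact one_ne_zero
    · rcases hs i with h1 | h1 <;> rw [h1] <;> norm_num

lemma swapSign_comm {s s' : K} (h : s = 1 ∨ s = -1) (h' : s' = 1 ∨ s' = -1) :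
    swapSign s s' = swapSign s' s := by
  rcases h with rfl | rfl <;> rcases h' with rfl | rfl <;> simp [swapSign]

lemma swapSign_mul_self {s s' : K} (h : s = 1 ∨ s = -1) : swapSign s s' * swapSign s s' = 1 := by
  rw [swapSign]
  split_ifs
  · rw [one_mul]
  · rcases h with rfl | rfl <;> norm_num

/-- The operators satisfy the exterior relations. For `i ≠ j` exactly one of the two orders of
multiplication involves an additional crossing. For `i = j` even the operator squares to zero, and
for `i = j` odd the relation is trivial. -/
lemma crOp_comm {s : ι → K} (hs : ∀ i, s i = 1 ∨ s i = -1) (i j : ι) (x : (ι →₀ ℕ) →₀ K) :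
    crOp s j (crOp s i x) + swapSign (s i) (s j) • crOp s i (crOp s j x) = 0 := by
  have key : crOp s j * crOp s i + swapSign (s i) (s j) • (crOp s i * crOp s j) = 0 := by
    refine Finsupp.lhom_ext' fun a => LinearMap.ext_ring ?_
    change crOp s j (crOp s i (Finsupp.single a 1)) +
      swapSign (s i) (s j) • crOp s i (crOp s j (Finsupp.single a 1)) = 0
    simp only [crOp_single, map_smul, smul_smul]
    rcases lt_trichotomy i j with h | rfl | h
    · rw [crSign_of_lt a h, crSign_of_gt a h, add_left_comm, ← add_smul]
      convert zero_smul K _ using 2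
      linear_combination (-crSign s a i * crSign s a j) * swapSign_mul_self (s' := s j) (hs i)
    · rw [← add_smul]
      convert zero_smul K _ using 2
      have h1 : (1 : K) ≠ -1 := by norm_num
      rcases hs i with h | h
      · have : crSign s (Finsupp.single i 1 + a) i = 0 := by
          rw [crSign, if_pos ⟨h, by simp⟩, zero_mul]
        rw [this]; ring
      · rw [swapSign, h, if_neg h1.symm]; ring
    · rw [crSign_of_gt a h, crSign_of_lt a h, add_left_comm, ← add_smul,
        swapSign_comm (hs j) (hs i)]
      convert zero_smul K _ using 2
      ring
  exact LinearMap.congr_fun key x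

end ExteriorModel

/-! ### The monomial basis of the exterior powers. -/

noncomputable section ExteriorBasis

variable {K : Type u} [Field K] [CharZero K] [DecidableEq K] {V : SuperSpace K}
  {H : SubgroupFunctor V} {R : Rep H} {ι : Type} [Fintype ι] [LinearOrder ι]
  (b : Module.Basis ι K R.space) (s : ι → K)

/-- The map from the tensor powers to the exterior algebra model. -/
def Rep.model : ∀ k : ℕ, (R.tpow k).space →ₗ[K] (ι →₀ ℕ) →₀ K
  | 0 => (Finsupp.lsingle 0 : K →ₗ[K] (ι →₀ ℕ) →₀ K)
  | k + 1 => (TensorProduct.lift ((b.constr K (crOp s)).flip ∘ₗ Rep.model k) :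
      (R.tpow k).space ⊗[K] R.space →ₗ[K] (ι →₀ ℕ) →₀ K)

lemma Rep.model_tm (k : ℕ) (x : (R.tpow k).space) (v : R.space) :
    Rep.model b s (k + 1) (R.tm k x v) = b.constr K (crOp s) v (Rep.model b s k x) := rfl

lemma Rep.model_tm_basis (k : ℕ) (x : (R.tpow k).space) (i : ι) :
    Rep.model b s (k + 1) (R.tm k x (b i)) = crOp s i (Rep.model b s k x) := by
  rw [Rep.model_tm, Module.Basis.constr_basis]

variable {b s}

/-- The model therefore receives a map from the exterior power, which is what detects linear
independence there. -/
lemma IsHom.extRel_le_ker (hb : IsHom b s) (k : ℕ) :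
    (R.extRel k).carrier ≤ LinearMap.ker (Rep.model b s k) := by
  induction k with
  | zero => exact bot_le
  | succ k ih =>
    cases k with
    | zero => exact bot_le
    | succ k =>
      refine hb.extRel_le (fun x hx v => ?_) fun x i j => ?_
      · rw [LinearMap.mem_ker, Rep.model_tm, LinearMap.mem_ker.1 (ih hx), map_zero]
      · rw [LinearMap.mem_ker, map_add, map_smul, Rep.model_tm_basis, Rep.model_tm_basis,
          Rep.model_tm_basis, Rep.model_tm_basis, crOp_comm hb.sign]

lemma IsHom.exists_model_word (hb : IsHom b s) (l : List ι) : ∀ k, l.length = k →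
    ∃ c : K, Rep.model b s k (Rep.word b k l) = c • Finsupp.single (expo l) 1 ∧
      (IsValid s (expo l) → c ≠ 0) := by
  induction l with
  | nil =>
    rintro k rfl
    exact ⟨1, (one_smul K _).symm, fun _ => one_ne_zero⟩
  | cons i l ih =>
    rintro k rfl
    obtain ⟨c, hc, hc'⟩ := ih _ rfl
    refine ⟨c * crSign s (expo l) i, ?_, fun h => mul_ne_zero (hc' fun j hj => ?_)
      (crSign_ne_zero hb.sign fun hi => ?_)⟩
    · refine (Rep.model_tm_basis b s _ _ i).trans ?_
      rw [hc, map_smul, crOp_single, smul_smul]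
      rfl
    · have := h j hj
      rw [expo, Finsupp.add_apply] at this
      omega
    · have := h i hi
      rw [expo, Finsupp.add_apply, Finsupp.single_eq_same] at this
      omega

/-- The exponents of degree `k` of the exterior algebra. -/
def validExpo (s : ι → K) (k : ℕ) : Finset (ι →₀ ℕ) :=
  (Finset.finsuppAntidiag Finset.univ k).filter fun a => ∀ i, s i = 1 → a i ≤ 1

lemma mem_validExpo {k : ℕ} {a : ι →₀ ℕ} : a ∈ validExpo s k ↔ ∑ i, a i = k ∧ IsValid s a := by
  rw [validExpo, Finset.mem_filter, Finset.mem_finsuppAntidiag]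
  simp [IsValid]

/-- A word with a given exponent. -/
def canon (a : ι →₀ ℕ) : List ι := (exists_expo a).choose

lemma expo_canon (a : ι →₀ ℕ) : expo (canon a) = a := (exists_expo a).choose_spec

variable (R) in
/-- The projection of the tensor power to the exterior power. -/
def Rep.extMk (k : ℕ) : (R.tpow k).space →ₗ[K] (R.ext k).space := (R.extRel k).carrier.mkQ

lemma Rep.extMk_surjective (k : ℕ) : Function.Surjective (R.extMk k) :=
  (R.extRel k).carrier.mkQ_surjective

lemma Rep.extMk_eq_zero {k : ℕ} {x : (R.tpow k).space} :
    R.extMk k x = 0 ↔ x ∈ (R.extRel k).carrier :=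
  Submodule.Quotient.mk_eq_zero _

variable (b s) in
/-- The map from the exterior power to the exterior algebra model. -/
def IsHom.extModel (hb : IsHom b s) (k : ℕ) : (R.ext k).space →ₗ[K] (ι →₀ ℕ) →₀ K :=
  (R.extRel k).carrier.liftQ (Rep.model b s k) (hb.extRel_le_ker k)

lemma IsHom.extModel_extMk (hb : IsHom b s) (k : ℕ) (x : (R.tpow k).space) :
    hb.extModel b s k (R.extMk k x) = Rep.model b s k x := rfl

variable (b s) in
/-- The basis vectors of the exterior power. -/
def extVec (k : ℕ) (a : validExpo s k) : (R.ext k).space :=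
  R.extMk k (Rep.word b k (canon a.1))

lemma length_canon {k : ℕ} (a : validExpo s k) : (canon a.1).length = k := by
  rw [← sum_expo, expo_canon]
  exact (mem_validExpo.1 a.2).1

/-- Some even letter occurs twice; bring two copies of it to the head of the list, where
`IsHom.word_square` applies. -/
lemma IsHom.word_mem_of_not_valid (hb : IsHom b s) {l : List ι} (h : ¬ IsValid s (expo l)) :
    Rep.word b l.length l ∈ (R.extRel l.length).carrier := by
  simp only [IsValid, not_forall, not_le] at h
  obtain ⟨i, hi, h2⟩ := h
  rw [expo_apply] at h2
  have h3 : l.Perm (i :: i :: (l.erase i).erase i) := by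
    have h4 : i ∈ l := List.count_pos_iff.1 (by omega)
    have h5 : i ∈ l.erase i := List.count_pos_iff.1 (by rw [List.count_erase_self]; omega)
    exact (List.perm_cons_erase h4).trans ((List.perm_cons_erase h5).cons i)
  obtain ⟨c, hc⟩ := hb.word_perm h3 _ rfl
  have h6 := hb.word_square hi ((l.erase i).erase i)
  have h7 : l.length = ((l.erase i).erase i).length + 2 := h3.length_eq
  rw [h7] at hc ⊢
  have := Submodule.add_mem _ hc (Submodule.smul_mem _ c h6)
  rwa [sub_add_cancel] at this

/-- The images in the model are nonzero multiples of distinct monomials. -/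
lemma IsHom.linearIndependent_extVec (hb : IsHom b s) (k : ℕ) :
    LinearIndependent K (extVec (R := R) b s k) := by
  choose c hc hc' using fun a : validExpo s k => hb.exists_model_word _ _ (length_canon a)
  have h1 : ∀ a : validExpo s k, IsUnit (c a) := fun a =>
    (hc' a (by rw [expo_canon]; exact (mem_validExpo.1 a.2).2)).isUnit
  refine LinearIndependent.of_comp (hb.extModel b s k) ?_
  have h2 : hb.extModel b s k ∘ extVec b s k = (fun a => (h1 a).unit) •
      fun a : validExpo s k => (Finsupp.single a.1 1 : (ι →₀ ℕ) →₀ K) := by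
    funext a
    refine (hb.extModel_extMk k _).trans ?_
    rw [hc, expo_canon]
    rfl
  rw [h2]
  refine LinearIndependent.units_smul ?_ _
  exact (Finsupp.linearIndependent_single_one K (ι →₀ ℕ)).comp _ Subtype.val_injective

/-- Words span the tensor power. Modulo the relations each is zero or a multiple of the chosen word
with the same exponent. -/
lemma IsHom.span_extVec (hb : IsHom b s) (k : ℕ) :
    ⊤ ≤ Submodule.span K (Set.range (extVec (R := R) b s k)) := by
  intro y _
  obtain ⟨x, rfl⟩ := Rep.extMk_surjective k y
  have h1 : Submodule.span K (Rep.word b k '' {l | l.length = k}) ≤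
      (Submodule.span K (Set.range (extVec (R := R) b s k))).comap (R.extMk k) := by
    refine Submodule.span_le.2 ?_
    rintro _ ⟨l, rfl, rfl⟩
    change R.extMk _ _ ∈ Submodule.span K (Set.range (extVec (R := R) b s _))
    by_cases hv : IsValid s (expo l)
    · have ha : expo l ∈ validExpo s l.length := mem_validExpo.2 ⟨sum_expo l, hv⟩
      obtain ⟨c, hc⟩ := hb.word_perm (perm_of_expo_eq (expo_canon (expo l)).symm) _ rfl
      rw [← Rep.extMk_eq_zero, map_sub, map_smul, sub_eq_zero] at hc
      rw [hc]
      exact Submodule.smul_mem _ _ (Submodule.subset_span ⟨⟨expo l, ha⟩, rfl⟩)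
    · have h2 : R.extMk l.length (Rep.word b l.length l) = 0 :=
        Rep.extMk_eq_zero.2 (hb.word_mem_of_not_valid hv)
      rw [h2]
      exact Submodule.zero_mem _
  exact h1 (Rep.mem_span_word k x)

/-- The basis of the exterior power. -/
def IsHom.extBasis (hb : IsHom b s) (k : ℕ) : Module.Basis (validExpo s k) K (R.ext k).space :=
  Module.Basis.mk (hb.linearIndependent_extVec k) (hb.span_extVec k)

end ExteriorBasis


/-! ### Characters of exterior powers as coefficients of generating functions. -/

noncomputable section ExteriorCharacter

variable {K : Type u} [Field K] [CharZero K] {V : SuperSpace K} {p q : ℕ} {e : HomBasis V p q}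
  {H : SubgroupFunctor V} (hH : Reductive e H)

lemma trace_eq_sum {X : Type u} [AddCommGroup X] [Module K X] {ι : Type} [Fintype ι]
    (b : Module.Basis ι K X) {f : Module.End K X} {c : ι → K} (h : ∀ i, f (b i) = c i • b i) :
    LinearMap.trace K X f = ∑ i, c i := by
  classical
  rw [LinearMap.trace_eq_matrix_trace K b, Matrix.trace]
  refine Finset.sum_congr rfl fun i _ => ?_
  rw [Matrix.diag_apply, LinearMap.toMatrix_apply, h, map_smul, Finsupp.smul_apply, b.repr_self,
    Finsupp.single_eq_same, smul_eq_mul, mul_one]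

lemma Rep.char_eq_sum_basis {M : Rep H} {ε : ℕ} {t : Fin p ⊕ Fin q → Kˣ} {ι : Type} [Fintype ι]
    (b : Module.Basis ι K M.space) {c : ι → K} (h : ∀ i, M.opS hH ε t (b i) = c i • b i) :
    M.char hH ε t = ∑ i, c i := trace_eq_sum b h

lemma Rep.opS_tm {R : Rep H} (ε : ℕ) (t : Fin p ⊕ Fin q → Kˣ) (k : ℕ) (x : (R.tpow k).space)
    (v : R.space) : (R.tpow (k + 1)).opS hH ε t (R.tm k x v) =
      R.tm k ((R.tpow k).opS hH ε t x) (R.opS hH ε t v) :=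
  LinearMap.congr_fun (Rep.opS_tensor hH (R.tpow k) R ε t)
    (x ⊗ₜ v : (R.tpow k).space ⊗[K] R.space)

lemma Rep.opS_unit (ε : ℕ) (t : Fin p ⊕ Fin q → Kˣ) : (Rep.unit H).opS hH ε t = 1 := by
  have h : (Rep.unit H).space.parity = 1 := rfl
  rw [Rep.opS, Rep.opT, Rep.opK_unit, h, one_pow, one_mul]

variable {R : Rep H} {ι : Type} {b : Module.Basis ι K R.space} {s c : ι → K} {ε : ℕ}
  {t : Fin p ⊕ Fin q → Kˣ}

lemma Rep.opS_word (h : ∀ i, R.opS hH ε t (b i) = c i • b i) (l : List ι) : ∀ k, l.length = k →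
    (R.tpow k).opS hH ε t (Rep.word b k l) = (l.map c).prod • Rep.word b k l := by
  induction l with
  | nil =>
    rintro k rfl
    rw [List.map_nil, List.prod_nil, one_smul]
    exact LinearMap.congr_fun (Rep.opS_unit hH ε t) _
  | cons i l ih =>
    rintro k rfl
    refine (Rep.opS_tm hH ε t l.length (Rep.word b l.length l) (b i)).trans ?_
    rw [ih _ rfl, h, map_smul, map_smul, LinearMap.smul_apply, smul_smul]
    rfl

variable [DecidableEq K] [Fintype ι] [LinearOrder ι]

lemma prod_map_canon (c : ι → K) (a : ι →₀ ℕ) : ((canon a).map c).prod = ∏ i, c i ^ a i := by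
  rw [Finset.prod_list_map_count]
  refine (Finset.prod_subset (Finset.subset_univ _) fun i _ hi => ?_).trans
    (Finset.prod_congr rfl fun i _ => ?_)
  · rw [List.count_eq_zero_of_not_mem (mt List.mem_toFinset.2 hi), pow_zero]
  · rw [← expo_apply, expo_canon]

lemma IsHom.opS_extBasis (hb : IsHom b s) (h : ∀ i, R.opS hH ε t (b i) = c i • b i) (k : ℕ)
    (a : validExpo s k) :
    (R.ext k).opS hH ε t (hb.extBasis k a) = (∏ i, c i ^ a.1 i) • hb.extBasis k a := by
  have h1 : hb.extBasis k a = R.extMk k (Rep.word b k (canon a.1)) := by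
    rw [IsHom.extBasis, Module.Basis.mk_apply, extVec]
  have h2 := Rep.Hom.map_opS hH (R.extRel k).proj ε t (Rep.word b k (canon a.1))
  rw [h1, ← prod_map_canon, ← map_smul, ← Rep.opS_word hH h _ _ (length_canon a)]
  exact h2.symm

lemma IsHom.char_ext (hb : IsHom b s) (h : ∀ i, R.opS hH ε t (b i) = c i • b i) (k : ℕ) :
    (R.ext k).char hH ε t = ∑ a ∈ validExpo s k, ∏ i, c i ^ a i := by
  rw [Rep.char_eq_sum_basis hH (hb.extBasis k) (hb.opS_extBasis hH h k)]
  exact Finset.sum_coe_sort (validExpo s k) fun a => ∏ i, c i ^ a i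

/-- The generating function of the exterior powers of a homogeneous line. -/
def extSeries (s c : K) : PowerSeries K := PowerSeries.mk fun n => if s = 1 ∧ 1 < n then 0 else c ^ n

/-- An even line contributes `1 + c z` and an odd line the full geometric series, so the bound on
even exponents is encoded in vanishing coefficients. -/
lemma sum_validExpo (s c : ι → K) (k : ℕ) : ∑ a ∈ validExpo s k, ∏ i, c i ^ a i =
    PowerSeries.coeff k (∏ i, extSeries (s i) (c i)) := by
  rw [PowerSeries.coeff_prod, validExpo, Finset.sum_filter]
  refine Finset.sum_congr rfl fun a _ => ?_
  simp only [extSeries, PowerSeries.coeff_mk]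
  split_ifs with ha
  · refine Finset.prod_congr rfl fun i _ => ?_
    rw [if_neg fun h => (ha i h.1).not_gt h.2]
  · push Not at ha
    obtain ⟨i, hi⟩ := ha
    symm
    exact Finset.prod_eq_zero (Finset.mem_univ i) (if_pos hi)

end ExteriorCharacter

lemma IsHom.char_ext_eq_coeff {K : Type u} [Field K] [CharZero K] [DecidableEq K]
    {V : SuperSpace K} {p q : ℕ} {e : HomBasis V p q} {H : SubgroupFunctor V}
    (hH : Reductive e H) {R : Rep H} {ι : Type} [Fintype ι] {b : Module.Basis ι K R.space}
    {s c : ι → K} {ε : ℕ} {t : Fin p ⊕ Fin q → Kˣ} (hb : IsHom b s)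
    (h : ∀ i, R.opS hH ε t (b i) = c i • b i) (k : ℕ) :
    (R.ext k).char hH ε t = PowerSeries.coeff k (∏ i, extSeries (s i) (c i)) := by
  -- The order only serves to construct the monomial basis; any one will do, as the generating
  -- function is symmetric.
  let : LinearOrder ι := LinearOrder.lift' (Fintype.equivFin ι) (Fintype.equivFin ι).injective
  rw [hb.char_ext hH h, sum_validExpo]



/-! ### Characters of `V`, its dual, `Π` and `Ber V`. -/

noncomputable section StandardCharacters

variable {K : Type u} [Field K] [CharZero K] {V : SuperSpace K} {p q : ℕ} {e : HomBasis V p q}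
  {H : SubgroupFunctor V} (hH : Reductive e H) (ε : ℕ) (t : Fin p ⊕ Fin q → Kˣ)

variable {ε t} in
lemma Rep.opS_of_eigenvector {M : Rep H} {m : M.space} {s c : K}
    (hs : M.space.parity m = s • m) (hc : M.opT hH t m = c • m) :
    M.opS hH ε t m = (s ^ ε * c) • m := by
  have h : ∀ n : ℕ, (M.space.parity ^ n) m = s ^ n • m := by
    intro n
    induction n with
    | zero => rw [pow_zero, pow_zero, one_smul]; rfl
    | succ n ih => rw [pow_succ, Module.End.mul_apply, hs, map_smul, ih, smul_smul, pow_succ']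
  rw [Rep.opS, Module.End.mul_apply, hc, map_smul, h, smul_smul, mul_comm]

lemma torusPt_apply (i : Fin p ⊕ Fin q) :
    (torusPt e t).1.1 (e.basis i ⊗ₜ 1) = ((t i : K) • e.basis i) ⊗ₜ[K] (1 : KAlg K) := by
  rw [apply_basis e]
  change ∑ j, e.basis j ⊗ₜ[K] pmat e (torusPt e t) j i = _
  rw [pmat_torusPt, Finset.sum_eq_single i]
  · rw [Matrix.diagonal_apply_eq, TensorProduct.smul_tmul]
    congr 1
    exact (mul_one (t i : K)).symm
  · intro j _ hj
    rw [Matrix.diagonal_apply_ne _ hj, TensorProduct.tmul_zero]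
  · exact fun h => absurd (Finset.mem_univ i) h

lemma Rep.opT_taut (i : Fin p ⊕ Fin q) :
    (Rep.taut H).opT hH t (e.basis i) = (t i : K) • e.basis i := by
  apply tmul_one_injective K
  exact ((Rep.taut H).opK_tmul _ _).trans (torusPt_apply t i)

lemma Rep.opS_taut (i : Fin p ⊕ Fin q) :
    (Rep.taut H).opS hH ε t (e.basis i) = (sgn K i ^ ε * t i) • e.basis i :=
  Rep.opS_of_eigenvector (M := Rep.taut H) hH (e.parity_basis i) (Rep.opT_taut hH t i)

/-- Over the ground field all scalars are even, so the signs in `dualEquiv` disappear and the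
ordinary contragredient action remains. -/
lemma Rep.opK_dual (R : Rep H) {g : SGL V (KAlg K)} (hg : g ∈ H _) (φ : Module.Dual K R.space)
    (m : R.space) : (show Module.Dual K R.space from R.dual.opK hg φ) m =
      φ (R.opK (inv_mem hg) m) := by
  have h1 := R.dual.opK_tmul hg φ
  have h2 : R.dual.gact hg (φ ⊗ₜ 1) = dualEnd R.space.parity R.space.parity_parity (KAlg K)
      (R.gact (inv_mem hg)) (φ ⊗ₜ 1) := rfl
  have h3 := LinearMap.congr_fun (congrArg (dualEquiv R.space.parity R.space.parity_parity (KAlg K))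
    (h1.trans h2)) m
  have h4 : ∀ (ψ : Module.Dual K R.space) (n : R.space),
      dualEquiv R.space.parity R.space.parity_parity (KAlg K) (ψ ⊗ₜ 1) n = ψ n := by
    intro ψ n
    rw [dualEquiv_tmul, (KAlg K).od_of_even rfl, (KAlg K).ev_of_even rfl, smul_zero, add_zero]
    exact mul_one (ψ n)
  refine (h4 _ m).symm.trans (h3.trans ?_)
  rw [dualEquiv_dualEnd, precomp_apply, ← R.opK_tmul, evalExt_tmul, mul_one, h4]

lemma Rep.opT_dual (R : Rep H) (φ : Module.Dual K R.space) (m : R.space) :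
    (show Module.Dual K R.space from R.dual.opT hH t φ) m = φ (R.opT hH t⁻¹ m) := by
  have h : torusPt e t⁻¹ = (torusPt e t)⁻¹ := by
    rw [eq_inv_iff_mul_eq_one, ← torusPt_mul, inv_mul_cancel, torusPt_one]
  refine (R.opK_dual _ φ m).trans (congrArg (fun f : Module.End K R.space => φ (f m)) ?_)
  rw [Rep.opT]
  congr 1
  exact h.symm

lemma dual_parity_basis (i : Fin p ⊕ Fin q) :
    V.parity.dualMap (e.basis.dualBasis i) = sgn K i • e.basis.dualBasis i := by
  refine e.basis.ext fun j => ?_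
  rw [LinearMap.dualMap_apply, e.parity_basis, map_smul, LinearMap.smul_apply,
    Module.Basis.dualBasis_apply_self]
  split_ifs with h
  · rw [h]
  · simp

lemma Rep.opS_dual_taut (i : Fin p ⊕ Fin q) :
    (Rep.taut H).dual.opS hH ε t (e.basis.dualBasis i) =
      (sgn K i ^ ε * (t i : K)⁻¹) • e.basis.dualBasis i := by
  refine Rep.opS_of_eigenvector (M := (Rep.taut H).dual) hH (dual_parity_basis i) ?_
  refine e.basis.ext fun j => ?_
  refine (Rep.opT_dual hH t (Rep.taut H) (e.basis.dualBasis i) (e.basis j)).trans ?_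
  refine (congrArg (e.basis.dualBasis i) (Rep.opT_taut hH t⁻¹ j)).trans ?_
  change _ = (t i : K)⁻¹ • e.basis.dualBasis i (e.basis j)
  rw [map_smul, Module.Basis.dualBasis_apply_self, Pi.inv_apply, Units.val_inv_eq_inv_val]
  split_ifs with h
  · rw [h]
  · simp

lemma Rep.opS_shift (R : Rep H) (m : R.space) :
    (show R.space from R.shift.opS hH ε t m) = (-1 : K) ^ ε • R.opS hH ε t m := by
  have h : (-R.space.parity) ^ ε = ((-1 : K) ^ ε) • R.space.parity ^ ε := by
    rw [← neg_one_smul K, smul_pow]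
  change ((-R.space.parity) ^ ε) (R.opT hH t m) = _
  rw [h]
  rfl

lemma K0.char_Pi : K0.char hH ε t (Pi H) = (-1) ^ ε := by
  rw [Pi, K0.char_cls]
  have h : ∀ i : Unit, (Rep.unit H).shift.opS hH ε t (Module.Basis.singleton Unit K i) =
      (-1 : K) ^ ε • Module.Basis.singleton Unit K i := by
    intro i
    refine (Rep.opS_shift hH ε t (Rep.unit H) _).trans ?_
    rw [Rep.opS_unit]
    rfl
  exact (Rep.char_eq_sum_basis hH (M := (Rep.unit H).shift) (Module.Basis.singleton Unit K) h).trans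
    (by simp)

lemma edet_diagonal {A : SuperCommAlg K} {n : Type} [Fintype n] [DecidableEq n] (d : n → K) :
    edet A (Matrix.diagonal fun i => algebraMap K A (d i)) = algebraMap K A (∏ i, d i) := by
  have h : Matrix.diagonal (fun i => algebraMap K A (d i)) =
      (Matrix.diagonal fun i => algebraMap K A.even (d i)).map Subtype.val := by
    rw [Matrix.diagonal_map rfl]
    rfl
  rw [h, edet_map, Matrix.det_diagonal, ← map_prod]
  rfl

lemma ber_diagonal {A : SuperCommAlg K} {m n : Type} [Fintype m] [DecidableEq m] [Fintype n]
    [DecidableEq n] (c : m → K) (d : n → K) (hd : ∀ j, d j ≠ 0) :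
    ber A (Matrix.diagonal fun i => algebraMap K A (c i)) 0 0
      (Matrix.diagonal fun i => algebraMap K A (d i)) =
      algebraMap K A ((∏ i, c i) * ∏ j, (d j)⁻¹) := by
  have hev : ∀ d : n → K, IsEv A (Matrix.diagonal fun i => algebraMap K A (d i)) := by
    intro d i j
    rw [Matrix.diagonal_apply]
    split_ifs
    · exact A.parity.commutes _
    · exact map_zero _
  have h1 : EvInv (Matrix.diagonal fun j => algebraMap K A (d j))
      (Matrix.diagonal fun j => algebraMap K A (d j)⁻¹) := by
    refine ⟨hev _, hev fun j => (d j)⁻¹, ?_, ?_⟩ <;>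
      rw [Matrix.diagonal_mul_diagonal, ← Matrix.diagonal_one] <;>
      congr 1 <;> funext j <;> rw [← map_mul]
    · rw [mul_inv_cancel₀ (hd j), map_one]
    · rw [inv_mul_cancel₀ (hd j), map_one]
  rw [ber_eq h1, Matrix.zero_mul, Matrix.zero_mul, sub_zero, edet_diagonal, edet_diagonal, map_mul]

lemma berEnd_torusPt : berEnd e (KAlg K) (torusPt e t).1.1 =
    algebraMap K (KAlg K) ((∏ i, (t (.inl i) : K)) * ∏ j, (t (.inr j) : K)⁻¹) := by
  have h : mat e.basis (KAlg K) (torusPt e t).1.1 =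
    Matrix.diagonal fun i => algebraMap K (KAlg K) (t i) := pmat_torusPt e t
  rw [berEnd, h, Matrix.toBlocks₁₁_diagonal, Matrix.toBlocks₂₂_diagonal,
    Matrix.toBlocks₁₂_diagonal, Matrix.toBlocks₂₁_diagonal]
  exact ber_diagonal _ _ fun j => (t (.inr j)).ne_zero

lemma tmul_algebraMap {A : SuperCommAlg K} {M : Type u} [AddCommGroup M] [Module K M] (m : M)
    (c : K) : m ⊗ₜ[K] algebraMap K A c = (c • m) ⊗ₜ 1 := by
  rw [Algebra.algebraMap_eq_smul_one, TensorProduct.smul_tmul]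

lemma Rep.char_ber : (Rep.ber e H).char hH ε t =
    (∏ i, (t (.inl i) : K)) * ∏ j, (t (.inr j) : K)⁻¹ := by
  have h : ∀ i : Unit, (Rep.ber e H).opS hH ε t (Module.Basis.singleton Unit K i) =
      (1 ^ ε * ((∏ i, (t (.inl i) : K)) * ∏ j, (t (.inr j) : K)⁻¹)) •
        Module.Basis.singleton Unit K i := by
    intro i
    refine Rep.opS_of_eigenvector (M := Rep.ber e H) hH (one_smul K _).symm ?_
    apply tmul_one_injective K
    refine ((Rep.ber e H).opK_tmul _ _).trans ?_
    refine (scalarEnd_apply (A := KAlg K) _ (berEnd_even e _) _).trans ?_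
    refine (LinearMap.lTensor_tmul K _ _ _).trans ?_
    refine (congrArg (fun a => Module.Basis.singleton Unit K i ⊗ₜ[K] a)
      ((mul_one _).trans (berEnd_torusPt t))).trans ?_
    exact tmul_algebraMap (K := K) (M := K) _ _
  exact (Rep.char_eq_sum_basis hH (M := Rep.ber e H) (Module.Basis.singleton Unit K) h).trans
    (by simp)

end StandardCharacters

/-! ### The weights of `W`. -/

noncomputable section OddPart

variable {K : Type u} [Field K] [CharZero K] {V : SuperSpace K} {p q : ℕ} (e : HomBasis V p q)

/-- The odd coordinates of a vector. -/
def oddCoord : V →ₗ[K] Fin q → K := LinearMap.pi fun j => e.basis.coord (.inr j)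

lemma oddCoord_apply (v : V) (j : Fin q) : oddCoord e v j = e.basis.repr v (.inr j) := rfl

lemma oddCoord_surjective : Function.Surjective (oddCoord e) := by
  intro c
  refine ⟨∑ j, c j • e.basis (.inr j), ?_⟩
  funext j
  rw [oddCoord_apply, map_sum]
  simp [Finsupp.single_apply]

lemma repr_parity (v : V) (i : Fin p ⊕ Fin q) :
    e.basis.repr (V.parity v) i = sgn K i * e.basis.repr v i := by
  have : e.basis.coord i ∘ₗ V.parity = sgn K i • e.basis.coord i := by
    refine e.basis.ext fun j => ?_
    rw [LinearMap.comp_apply, e.parity_basis, map_smul, LinearMap.smul_apply,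
      Module.Basis.coord_apply, Module.Basis.repr_self, Finsupp.single_apply]
    split_ifs with h
    · rw [h]
    · simp
  exact LinearMap.congr_fun this v

/-- This identifies the quotient of `V` by its even part with `K^q` by means of the odd coordinates,
and so gives a basis of `W`. -/
lemma range_evPart_eq_ker : LinearMap.range (evPart V.parity) = LinearMap.ker (oddCoord e) := by
  ext v
  constructor
  · rintro ⟨v, rfl⟩
    rw [LinearMap.mem_ker]
    funext j
    have h := repr_parity e v (.inr j)
    have h1 : oddCoord e (evPart V.parity v) j =
      2⁻¹ * (e.basis.repr v (.inr j) + e.basis.repr (V.parity v) (.inr j)) := by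
      rw [oddCoord_apply, evPart, LinearMap.smul_apply, map_smul, LinearMap.add_apply, map_add]
      rfl
    rw [h1, h, sgn, Sum.elim_inr]
    simp
  · intro h
    have h1 : V.parity v = v := by
      refine e.basis.repr.injective (Finsupp.ext fun i => ?_)
      rw [repr_parity]
      rcases i with i | j
      · rw [sgn, Sum.elim_inl, one_mul]
      · have : e.basis.repr v (.inr j) = 0 := congrFun (LinearMap.mem_ker.1 h) j
        rw [this, mul_zero]
    exact ⟨v, evPart_of_even V.parity h1⟩

/-- The basis of `W` given by the odd vectors of a homogeneous basis of `V`. -/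
def oddBasis : Module.Basis (Fin q) K (oddPartW V).space :=
  .ofEquivFun ((Submodule.quotEquivOfEq _ _ (range_evPart_eq_ker e)).trans
    ((oddCoord e).quotKerEquivOfSurjective (oddCoord_surjective e)) :
      (V ⧸ LinearMap.range (evPart V.parity)) ≃ₗ[K] (Fin q → K))

lemma oddBasis_apply (j : Fin q) :
    oddBasis e j = (evenSub V).proj.toLin (e.basis (.inr j)) := by
  let E : (V ⧸ LinearMap.range (evPart V.parity)) ≃ₗ[K] (Fin q → K) :=
    (Submodule.quotEquivOfEq _ _ (range_evPart_eq_ker e)).trans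
    ((oddCoord e).quotKerEquivOfSurjective (oddCoord_surjective e))
  have h1 : oddBasis e j = E.symm (Pi.single j 1) := by
    exact congrFun (Module.Basis.coe_ofEquivFun E) j
  have h2 : E ((LinearMap.range (evPart V.parity)).mkQ (e.basis (.inr j))) = Pi.single j 1 := by
    change oddCoord e (e.basis (.inr j)) = _
    funext i
    rw [oddCoord_apply, Module.Basis.repr_self, Finsupp.single_apply, Pi.single_apply]
    simp [eq_comm]
  rw [h1, ← h2]
  exact E.symm_apply_apply _

lemma isHom_oddBasis : IsHom (oddBasis e) fun _ => (1 : K) where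
  parity j := by
    rw [one_smul, oddBasis_apply]
    change -((evenSub V).proj.toLin (V.parity (e.basis (.inr j)))) = _
    refine (congrArg (fun v => -(evenSub V).proj.toLin v) (e.odd j)).trans ?_
    exact (congrArg (- ·) (map_neg (evenSub V).proj.toLin (e.basis (.inr j)))).trans (neg_neg _)
  sign _ := .inl rfl

/-- The sign `(-1) ^ ε` of the parity shift cancels that of the odd vectors, so the eigenvalues do
not depend on `ε`. -/
lemma Rep.opS_oddPartW (ε : ℕ) (t : Fin p ⊕ Fin q → Kˣ) (j : Fin q) :
    (oddPartW V).opS (reductive_blockDiag e) ε t (oddBasis e j) =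
      (t (.inr j) : K) • oddBasis e j := by
  refine (Rep.opS_shift (reductive_blockDiag e) ε t ((Rep.taut (blockDiag V)).quot (evenSub V))
    (oddBasis e j)).trans ?_
  rw [oddBasis_apply]
  have h := (evenSub V).proj.map_opS (reductive_blockDiag e) ε t (e.basis (.inr j))
  rw [← h]
  refine (congrArg (fun v => (-1 : K) ^ ε • (evenSub V).proj.toLin v)
    (Rep.opS_taut (reductive_blockDiag e) ε t (.inr j))).trans ?_
  refine (congrArg ((-1 : K) ^ ε • ·) (map_smul (evenSub V).proj.toLin _ (e.basis (.inr j)))).trans ?_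
  refine (smul_smul _ _ _).trans ?_
  rw [sgn, Sum.elim_inr, ← mul_assoc, ← mul_pow, neg_one_mul, neg_neg, one_pow, one_mul]
  rfl

end OddPart


/-! ### The identity of generating functions. -/

noncomputable section Recurrence

variable {K : Type u} [Field K]

/-- The coefficients of a power series, extended by zero to negative degrees. -/
def zcoeff (L : PowerSeries K) (n : ℤ) : K := if 0 ≤ n then PowerSeries.coeff n.toNat L else 0

lemma zcoeff_natCast (L : PowerSeries K) (n : ℕ) : zcoeff L n = PowerSeries.coeff n L := by
  rw [zcoeff, if_pos (Int.natCast_nonneg n), Int.toNat_natCast]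

lemma zcoeff_of_neg (L : PowerSeries K) {n : ℤ} (h : n < 0) : zcoeff L n = 0 := if_neg h.not_ge

/-- A Cauchy product. The ranges `i ≤ q` and `i ≤ n` are both enlarged to `i ≤ max q n`; the added
terms vanish by the degree of `P` in the first case and by negativity of `n - i` in the second. -/
lemma sum_coeff_mul_zcoeff {P : Polynomial K} {q : ℕ} (hP : P.natDegree ≤ q) (L : PowerSeries K)
    (n : ℤ) : ∑ i ∈ Finset.range (q + 1), P.coeff i * zcoeff L (n - i) =
      zcoeff ((P : PowerSeries K) * L) n := by
  rcases lt_or_ge n 0 with h | h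
  · rw [zcoeff_of_neg _ h]
    exact Finset.sum_eq_zero fun i _ => by rw [zcoeff_of_neg _ (by omega), mul_zero]
  · lift n to ℕ using h
    rw [zcoeff_natCast, PowerSeries.coeff_mul, Finset.Nat.sum_antidiagonal_eq_sum_range_succ
      fun i j => PowerSeries.coeff i (P : PowerSeries K) * PowerSeries.coeff j L]
    have h1 : ∀ N, q ≤ N → n ≤ N → ∑ i ∈ Finset.range (q + 1), P.coeff i * zcoeff L (n - i) =
        ∑ i ∈ Finset.range (N + 1), P.coeff i * zcoeff L (n - i) := fun N hN _ =>
      Finset.sum_subset (Finset.range_subset_range.2 (by omega)) fun i _ hi => by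
        rw [Polynomial.coeff_eq_zero_of_natDegree_lt
          (hP.trans_lt (by rw [Finset.mem_range] at hi; omega)), zero_mul]
    rw [h1 (max q n) (le_max_left _ _) (le_max_right _ _)]
    symm
    refine Eq.trans ?_ (Finset.sum_subset (Finset.range_subset_range.2
      (Nat.succ_le_succ (le_max_right q n))) fun i _ hi => ?_)
    · refine Finset.sum_congr rfl fun i hi => ?_
      rw [Finset.mem_range] at hi
      rw [Polynomial.coeff_coe, ← zcoeff_natCast L, Nat.cast_sub (by omega)]
    · rw [Finset.mem_range] at hi
      rw [zcoeff_of_neg _ (by omega), mul_zero]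

variable {ι : Type} [Fintype ι]

/-- The generating polynomial of the elementary symmetric polynomials. -/
def eGen (c : ι → K) : Polynomial K := ∏ i, (1 + Polynomial.C (c i) * Polynomial.X)

lemma natDegree_linear_le (c : K) : (1 + Polynomial.C c * Polynomial.X).natDegree ≤ 1 := by
  rw [add_comm, ← Polynomial.C_1]
  exact Polynomial.natDegree_linear_le

lemma natDegree_eGen_le (c : ι → K) : (eGen c).natDegree ≤ Fintype.card ι :=
  (Polynomial.natDegree_prod_le _ _).trans
    ((Finset.sum_le_card_nsmul _ _ 1 fun i _ => natDegree_linear_le (c i)).trans (by simp))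

/-- Reversal of coefficients is multiplicative, and it turns `1 + c X` into `c (1 + c⁻¹ X)`. -/
lemma reflect_eGen {c : ι → K} (hc : ∀ i, c i ≠ 0) :
    (eGen c).reflect (Fintype.card ι) =
      Polynomial.C (∏ i, c i) * eGen fun i => (c i)⁻¹ := by
  classical
  have h : ∀ s : Finset ι, Polynomial.reflect s.card
      (∏ i ∈ s, (1 + Polynomial.C (c i) * Polynomial.X)) =
      Polynomial.C (∏ i ∈ s, c i) * ∏ i ∈ s, (1 + Polynomial.C (c i)⁻¹ * Polynomial.X) := by
    intro s
    induction s using Finset.induction_on with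
    | empty => simp
    | insert i s hi ih =>
      have h1 : (∏ i ∈ s, (1 + Polynomial.C (c i) * Polynomial.X)).natDegree ≤ s.card :=
        (Polynomial.natDegree_prod_le _ _).trans
          ((Finset.sum_le_card_nsmul _ _ 1 fun i _ => natDegree_linear_le (c i)).trans (by simp))
      have h2 : Polynomial.reflect 1 (1 + Polynomial.C (c i) * Polynomial.X) =
          Polynomial.C (c i) * (1 + Polynomial.C (c i)⁻¹ * Polynomial.X) := by
        rw [Polynomial.reflect_add, mul_add, ← mul_assoc, ← Polynomial.C_mul,
          mul_inv_cancel₀ (hc i), ← Polynomial.C_1, Polynomial.reflect_C, Polynomial.reflect_C_mul,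
          Polynomial.reflect_one_X]
        simp [add_comm]
      rw [Finset.card_insert_of_notMem hi, Finset.prod_insert hi, Finset.prod_insert hi,
        Finset.prod_insert hi, add_comm s.card,
        Polynomial.reflect_mul _ _ (natDegree_linear_le (c i)) h1, h2, ih, Polynomial.C_mul]
      ring
  exact h Finset.univ

lemma coeff_eGen_inv {c : ι → K} (hc : ∀ i, c i ≠ 0) {m n : ℕ} (h : m + n = Fintype.card ι) :
    (eGen c).coeff m = (∏ i, c i) * (eGen fun i => (c i)⁻¹).coeff n := by
  rw [← Polynomial.coeff_C_mul, ← reflect_eGen hc, Polynomial.coeff_reflect,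
    Polynomial.revAt_le (by omega)]
  congr 1
  omega

/-- The case `q = 0` of the theorem on characters: the `n`-th exterior power against the determinant
times the complementary exterior power of the dual, in all integral degrees. -/
lemma zcoeff_eGen_inv {c : ι → K} (hc : ∀ i, c i ≠ 0) (n : ℤ) :
    zcoeff (eGen c : PowerSeries K) n =
      (∏ i, c i) * zcoeff (eGen fun i => (c i)⁻¹ : Polynomial K) (Fintype.card ι - n) := by
  have h1 : ∀ (c : ι → K) (m : ℤ), Fintype.card ι < m →
      zcoeff (eGen c : PowerSeries K) m = 0 := by
    intro c m hm
    lift m to ℕ using by omega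
    rw [zcoeff_natCast, Polynomial.coeff_coe, Polynomial.coeff_eq_zero_of_natDegree_lt
      ((natDegree_eGen_le c).trans_lt (by exact_mod_cast hm))]
  rcases lt_or_ge n 0 with h | h
  · rw [zcoeff_of_neg _ h, h1 _ _ (by omega), mul_zero]
  · rcases lt_or_ge (Fintype.card ι : ℤ) n with h' | h'
    · rw [h1 _ _ h', zcoeff_of_neg _ (by omega), mul_zero]
    · lift n to ℕ using h
      have h2 : (Fintype.card ι : ℤ) - n = ((Fintype.card ι - n : ℕ) : ℤ) := by omega
      rw [h2, zcoeff_natCast, zcoeff_natCast, Polynomial.coeff_coe, Polynomial.coeff_coe]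
      exact coeff_eGen_inv hc (by omega)

/-- `L` is the expansion of `eGen x / eGen y` at zero. Up to the factor `∏ x / ∏ y` and a shift of
degree, `M` is its expansion at infinity, the variable being inverted. Convolution with the
coefficients of `eGen y` gives the `n`-th coefficient of `eGen x` for either one. -/
lemma sum_recurrence {p q : ℕ} {x : Fin p → K} {y : Fin q → K} (hx : ∀ i, x i ≠ 0)
    (hy : ∀ j, y j ≠ 0) {L M : PowerSeries K}
    (hL : (eGen y : Polynomial K) * L = (eGen x : Polynomial K))
    (hM : (eGen fun j => (y j)⁻¹ : Polynomial K) * M = (eGen fun i => (x i)⁻¹ : Polynomial K))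
    (n : ℤ) :
    ∑ i ∈ Finset.range (q + 1), (eGen y).coeff i * (zcoeff L (n - i) -
      (∏ i, x i) * (∏ j, y j)⁻¹ * zcoeff M (p - (n + q - i))) = 0 := by
  have h1 : ∑ i ∈ Finset.range (q + 1), (eGen y).coeff i * zcoeff L (n - i) =
      zcoeff (eGen x : PowerSeries K) n := by
    rw [sum_coeff_mul_zcoeff ((natDegree_eGen_le y).trans_eq (Fintype.card_fin q)), hL]
  have h2 : ∑ i ∈ Finset.range (q + 1), (eGen fun j => (y j)⁻¹).coeff i *
      zcoeff M ((p - n : ℤ) - i) = zcoeff (eGen fun i => (x i)⁻¹ : Polynomial K) (p - n) := by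
    rw [sum_coeff_mul_zcoeff ((natDegree_eGen_le _).trans_eq (Fintype.card_fin q)), hM]
  have h3 := zcoeff_eGen_inv hx n
  rw [Fintype.card_fin, ← h2, ← Finset.sum_range_reflect, Finset.mul_sum] at h3
  simp only [mul_sub, Finset.sum_sub_distrib]
  rw [h1, h3, sub_eq_zero]
  refine Finset.sum_congr rfl fun i hi => ?_
  rw [Finset.mem_range] at hi
  have h4 := coeff_eGen_inv hy (m := i) (n := q - i) (by rw [Fintype.card_fin]; omega)
  -- Inverting the variable reverses the coefficients of `eGen y`, so the second sum is matched with
  -- the first by `i ↦ q - i`.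
  have h5 : (p : ℤ) - (n + q - i) = p - n - ((q + 1 - 1 - i : ℕ) : ℤ) := by omega
  have h6 : (∏ j, y j) ≠ 0 := Finset.prod_ne_zero_iff.2 fun j _ => hy j
  rw [h4, h5, Nat.add_sub_cancel]
  field_simp

lemma coe_eGen (c : ι → K) : (eGen c : PowerSeries K) =
    ∏ i, ((1 + Polynomial.C (c i) * Polynomial.X : Polynomial K) : PowerSeries K) :=
  map_prod Polynomial.coeToPowerSeries.ringHom
    (fun i => 1 + Polynomial.C (c i) * Polynomial.X) Finset.univ

lemma prod_extSeries_one [DecidableEq K] (c : ι → K) :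
    ∏ i, extSeries 1 (c i) = (eGen c : PowerSeries K) := by
  rw [coe_eGen]
  refine Finset.prod_congr rfl fun i _ => ?_
  ext n
  rw [extSeries, PowerSeries.coeff_mk, Polynomial.coeff_coe]
  rcases n with _ | _ | n <;> simp [Polynomial.coeff_one, Polynomial.coeff_X]

lemma coeff_eGen_mul (a : K) (c : ι → K) (n : ℕ) :
    (eGen fun i => a * c i).coeff n = a ^ n * (eGen c).coeff n := by
  have h : (eGen fun i => a * c i) = (eGen c).comp (Polynomial.C a * Polynomial.X) := by
    rw [eGen, eGen, Polynomial.prod_comp]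
    refine Finset.prod_congr rfl fun i _ => ?_
    simp only [Polynomial.add_comp, Polynomial.one_comp, Polynomial.mul_comp, Polynomial.C_comp,
      Polynomial.X_comp, Polynomial.C_mul]
    ring
  rw [h, Polynomial.comp_C_mul_X_coeff, mul_comm]

/-- Each factor `1 - y z` cancels the geometric series of an odd line, leaving the factors `1 + x z`
of the even lines. -/
lemma eGen_mul_extSeries [CharZero K] [DecidableEq K] {p q : ℕ} (x : Fin p → K) (y : Fin q → K) :
    (eGen fun j => -y j : Polynomial K) * ∏ i, extSeries (sgn K i) (Sum.elim x y i) =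
      (eGen x : Polynomial K) := by
  have h2 : ∀ c : K, (1 + Polynomial.C (-c) * Polynomial.X : Polynomial K) * extSeries (-1) c = 1 := by
    intro c
    have h3 : (-1 : K) ≠ 1 := by norm_num
    ext n
    rw [Polynomial.coe_add, Polynomial.coe_one, Polynomial.coe_mul, Polynomial.coe_C,
      Polynomial.coe_X, add_mul, one_mul, map_add, mul_assoc, PowerSeries.coeff_C_mul]
    rcases n with _ | n
    · simp [extSeries, h3]
    · rw [PowerSeries.coeff_succ_X_mul, extSeries, PowerSeries.coeff_mk, PowerSeries.coeff_mk,
        if_neg fun h => h3 h.1, if_neg fun h => h3 h.1, PowerSeries.coeff_one,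
        if_neg n.succ_ne_zero, pow_succ']
      ring
  rw [Fintype.prod_sum_type, mul_left_comm, coe_eGen fun j => -y j]
  simp only [sgn, Sum.elim_inl, Sum.elim_inr]
  rw [prod_extSeries_one, ← Finset.prod_mul_distrib]
  simp only [h2, Finset.prod_const_one, mul_one]

end Recurrence


/-! ### The recurrence and the Hankel determinants. -/

noncomputable section MainResult

variable {K : Type u} [Field K] [CharZero K] {V : SuperSpace K} {p q : ℕ} {e : HomBasis V p q}
  {H : SubgroupFunctor V} (hH : Reductive e H) (ε : ℕ) (t : Fin p ⊕ Fin q → Kˣ)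

variable {ε t} in
lemma IsHom.char_extCls [DecidableEq K] {R : Rep H} {ι : Type} [Fintype ι]
    {b : Module.Basis ι K R.space} {s c : ι → K} (hb : IsHom b s)
    (h : ∀ i, R.opS hH ε t (b i) = c i • b i) (k : ℤ) :
    K0.char hH ε t (extCls R k) = zcoeff (∏ i, extSeries (s i) (c i)) k := by
  rw [extCls, zcoeff]
  split_ifs
  · rw [K0.char_cls, hb.char_ext_eq_coeff hH h]
  · exact map_zero _

lemma sgn_pow_mul (y : Fin p ⊕ Fin q → K) : (fun i => sgn K i ^ ε * y i) =
    Sum.elim (fun i => y (.inl i)) (fun j => (-1) ^ ε * y (.inr j)) := by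
  funext i
  rcases i with i | j <;> simp [sgn]

lemma sgn_eq (i : Fin p ⊕ Fin q) : sgn K i = 1 ∨ sgn K i = -1 := by
  rcases i with i | i
  · exact .inl rfl
  · exact .inr rfl

lemma K0.char_extCls_taut [DecidableEq K] (k : ℤ) :
    K0.char hH ε t (extCls (Rep.taut H) k) = zcoeff (∏ i, extSeries (sgn K i)
      (Sum.elim (fun i => (t (.inl i) : K)) (fun j => (-1) ^ ε * (t (.inr j) : K)) i)) k := by
  have hb : IsHom (R := Rep.taut H) e.basis (sgn K) := ⟨e.parity_basis, sgn_eq⟩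
  rw [hb.char_extCls hH (Rep.opS_taut hH ε t), ← sgn_pow_mul ε fun i => (t i : K)]

lemma K0.char_sigmaCls [DecidableEq K] (k : ℤ) : K0.char hH ε t (sigmaCls e H k) =
    ((∏ i, (t (.inl i) : K)) * ∏ j, (t (.inr j) : K)⁻¹) * zcoeff (∏ i, extSeries (sgn K i)
      (Sum.elim (fun i => (t (.inl i) : K)⁻¹) (fun j => (-1) ^ ε * (t (.inr j) : K)⁻¹) i))
        (p - k) := by
  have hb : IsHom (R := (Rep.taut H).dual) e.basis.dualBasis (sgn K) :=
    ⟨dual_parity_basis, sgn_eq⟩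
  rw [sigmaCls]
  split_ifs with h
  · rw [Rep.cls_tensor, map_mul, K0.char_cls, Rep.char_ber, K0.char_cls,
      hb.char_ext_eq_coeff hH (Rep.opS_dual_taut hH ε t), zcoeff, if_pos (by omega),
      ← sgn_pow_mul ε fun i => (t i : K)⁻¹]
  · rw [map_zero, zcoeff_of_neg _ (by omega), mul_zero]

variable (e) in
-- The factor `(-Π)^i` rescales the variable of the generating function `∏ (1 + y_j z)` of the `Λ^i
-- W`, so that the `b_i` become the coefficients of the denominator in the series for `Λ^k V`.
lemma K0.char_coeffB (i : ℕ) : K0.char (reductive_blockDiag e) ε t (coeffB V i) =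
    (eGen fun j => -((-1) ^ ε * (t (.inr j) : K))).coeff i := by
  classical
  have h : (fun j => -((-1) ^ ε * (t (.inr j) : K))) = fun j => -(-1) ^ ε * (t (.inr j) : K) := by
    funext j
    rw [neg_mul]
  rw [coeffB, map_mul, map_pow, map_neg, K0.char_Pi,
    (isHom_oddBasis e).char_extCls (reductive_blockDiag e) (Rep.opS_oddPartW e ε t),
    prod_extSeries_one, zcoeff_natCast, Polynomial.coeff_coe, h, coeff_eGen_mul]

lemma coeffB_zero (e : HomBasis V p q) : coeffB V 0 = 1 := by
  refine K0.eq_of_char (reductive_blockDiag e) fun ε t => ?_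
  rw [K0.char_coeffB, map_one, eGen, Polynomial.coeff_zero_prod]
  simp

lemma sum_coeffB_mul_Gam (e : HomBasis V p q) (k : ℤ) : ∑ i ∈ Finset.range (q + 1),
    coeffB V i * resBlock V (Gam e (k + q - i)) = 0 := by
  classical
  refine K0.eq_of_char (reductive_blockDiag e) fun ε t => ?_
  have hπ : ((-1 : K) ^ ε) * (-1) ^ ε = 1 := by rw [← mul_pow]; simp
  have hπ' : (((-1 : K)) ^ ε)⁻¹ = (-1) ^ ε := inv_eq_of_mul_eq_one_left hπ
  have hM := eGen_mul_extSeries (fun i : Fin p => (t (.inl i) : K)⁻¹)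
    (fun j : Fin q => (-1) ^ ε * (t (.inr j) : K)⁻¹)
  have h1 : (fun j : Fin q => -((-1) ^ ε * (t (.inr j) : K)⁻¹)) =
      fun j => (-((-1) ^ ε * (t (.inr j) : K)))⁻¹ := by
    funext j
    rw [inv_neg, mul_inv, hπ']
  rw [h1] at hM
  -- This is where `(-Π)^q` comes from: inverting the leading coefficient of the denominator gives
  -- `(-π)^q` times the odd factor `∏ y_j⁻¹` of the Berezinian.
  have h2 : (∏ j : Fin q, -((-1) ^ ε * (t (.inr j) : K)))⁻¹ =
      (-(-1) ^ ε) ^ q * ∏ j, (t (.inr j) : K)⁻¹ := by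
    rw [← Finset.prod_inv_distrib, Finset.prod_congr rfl fun j _ => (congrFun h1 j).symm]
    simp only [← neg_mul, Finset.prod_mul_distrib, Finset.prod_const, Finset.card_univ,
      Fintype.card_fin]
  rw [map_sum, map_zero, ← sum_recurrence (x := fun i : Fin p => (t (.inl i) : K))
    (fun i => (t (.inl i)).ne_zero)
    (fun j => neg_ne_zero.2 (mul_ne_zero (pow_ne_zero _ (by simp)) (t (.inr j)).ne_zero))
    (eGen_mul_extSeries _ _) hM (k + q)]
  refine Finset.sum_congr rfl fun i _ => ?_
  rw [map_mul, K0.char_coeffB, K0.char_resBlock, Gam, map_sub, map_mul, map_pow, map_neg, K0.char_Pi,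
    K0.char_extCls_taut, K0.char_sigmaCls, h2]
  -- The degree of the exterior power of the dual inside `Σ^{m+q}`, with `m = k + q - i` the index
  -- of `Γ`.
  have h3 : (p : ℤ) - (k + q + q - i) = p - (k + q - i + q) := by ring
  rw [h3]
  ring

/-- Multiplying by the adjugate gives `det M • v = 0`, and the entry equal to `1` isolates the
determinant. No absence of zero divisors is used. -/
lemma det_eq_zero_of_mulVec {R : Type*} [CommRing R] {n : Type*} [Fintype n] [DecidableEq n]
    {M : Matrix n n R} {v : n → R} (h : M.mulVec v = 0) {i : n} (hi : v i = 1) : M.det = 0 := by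
  have h1 := congrFun (congrArg M.adjugate.mulVec h) i
  rw [Matrix.mulVec_mulVec, Matrix.adjugate_mul, Matrix.smul_mulVec, Matrix.one_mulVec,
    Pi.smul_apply, hi, Matrix.mulVec_zero, smul_eq_mul, mul_one] at h1
  exact h1

/-- After restriction to the block-diagonal subgroup the recurrence says that the Hankel matrix
kills `(b_q, …, b_0)`, whose last entry is `1`. Injectivity of restriction brings the vanishing back
to the ring of `GL(V)`, which need not contain the `b_i`. -/
lemma det_Gam (e : HomBasis V p q) (k : ℤ) : Matrix.det (Matrix.of fun i j : Fin (q + 1) =>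
    Gam e (k + (i : ℕ) + (j : ℕ))) = 0 := by
  refine resBlock_injective e ?_
  rw [RingHom.map_det, map_zero]
  refine det_eq_zero_of_mulVec (v := fun j => coeffB V (q - j)) (i := Fin.last q) ?_ ?_
  · funext i
    rw [Matrix.mulVec, dotProduct, Pi.zero_apply, ← sum_coeffB_mul_Gam e (k + i), ← Finset.sum_range_reflect
      (fun i' : ℕ => coeffB V i' * resBlock V (Gam e (k + i + q - i'))),
      ← Fin.sum_univ_eq_sum_range fun j : ℕ => coeffB V (q + 1 - 1 - j) *
        resBlock V (Gam e (k + i + q - ((q + 1 - 1 - j : ℕ) : ℤ)))]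
    refine Finset.sum_congr rfl fun j _ => ?_
    have h1 : k + (i : ℕ) + q - ((q + 1 - 1 - j : ℕ) : ℤ) = k + (i : ℕ) + (j : ℕ) := by omega
    rw [h1, mul_comm]
    rfl
  · rw [Fin.val_last, Nat.sub_self, coeffB_zero e]

end MainResult

end Super

theorem mainTheorem3 {K : Type*} [Field K] [CharZero K] (V : Super.SuperSpace K) (p q : ℕ)
    (e : Super.HomBasis V p q) :
    Function.Injective (Super.resBlock V) ∧
    (Super.coeffB V 0 = 1 ∧
      ∀ k : ℤ, ∑ i ∈ Finset.range (q + 1),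
        Super.coeffB V i * Super.resBlock V (Super.Gam e (k + q - i)) = 0) ∧
    ∀ k : ℤ, Matrix.det (Matrix.of fun i j : Fin (q + 1) =>
      Super.Gam e (k + (i : ℕ) + (j : ℕ))) = 0 := by
  exact ⟨Super.resBlock_injective e,
    ⟨Super.coeffB_zero e, Super.sum_coeffB_mul_Gam e⟩, Super.det_Gam e⟩
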